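/- Consider Minkowski spacetime of dimension $d\ge 4$ with inertial coordinates $(t,x^i)$, metric $\eta=\mathrm{diag}(-1,1,\dots,1)$, $r=|x|$, $u=t-r$, and $\theta=x/r\in S^{d-2}$. A neighborhood of null infinity is an open set $U$ such that for every bounded interval $I$ there is $R$ with $\{u\in I,\ r>R\}\subset U$. We write $f\sim\sum_{j\ge0} r^{-(a+j)}f^{(a+j)}(u,\theta)$, with smooth $f^{(a+j)}$ on $\mathbb R\times S^{d-2}$, if for every $N$ the remainder $f-\sum_{j<N}r^{-(a+j)}f^{(a+j)}$ and all its derivatives in $u$ and the angles are $O(r^{-(a+N)})$ as $r\to\infty$, each additional $r$-derivative improving the order by $r^{-1}$, locally uniformly in $u$ and uniformly in $\theta$; similarly for a sum of two such series. Tensors are expanded by their inertial components (equivalently, by components in the normalized frame $\partial_u,\partial_r,r^{-1}\partial_A$). A tensor field $h_{ab}$ satisfies the ansatz if $$h_{ab}\sim\sum_{n=d/2-1}^{\infty}\frac{h^{(n)}_{ab}(u,\theta)}{r^n}\ (d\text{ even}),\qquad h_{ab}\sim\sum_{n=d/2-1}^{\infty}\frac{h^{(n)}_{ab}(u,\theta)}{r^n}+\sum_{p=d-3}^{\infty}\frac{\tilde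 h^{(p)}_{ab}(u,\theta)}{r^p}\ (d\text{ odd}),$$ where $n$ and $p$ increase in integer steps. Let $h_{ab}$ be a smooth symmetric tensor field on a neighborhood $U$ of null infinity that satisfies the ansatz and the linearized Einstein equation $\delta G_{ab}=8\pi T_{ab}$ on $U$, where $-2\,\delta G_{ab}=\Box\bar h_{ab}-2\partial_{(a}\partial^c\bar h_{b)c}+\eta_{ab}\partial^c\partial^d\bar h_{cd}$ and $\bar h_{ab}=h_{ab}-\tfrac12\eta_{ab}\eta^{cd}h_{cd}$. Suppose that $T_{ab}\sim\sum_{n=d-2}^\infty r^{-n}T^{(n)}_{ab}(u,\theta)$ ($n$ integer), that $T_{ab}$ satisfies the dominant energy condition on $U$, and that $T^{(d-2)}_{ab}(u,\theta)\to0$ as $u\to-\infty$ for each $\theta$. Say that $h_{ab}$ can be put in Lorenz gauge within the ansatz if there are a neighborhood of null infinity $V\subset U$ and a smooth covector field $\xi_a$ on $V$ such that $h'_{ab}=h_{ab}-\partial_{(a}\xi_{b)}$ satisfies $\partial^b\bar h'_{ab}=0$ on $V$ and again satisfies the ansatz. Then: 1. If $d>4$, $h_{ab}$ can be put in Lorenz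 gauge within the ansatz. 2. If $d=4$, $h_{ab}$ can be put in Lorenz gauge within the ansatz if and only if $T^{(2)}_{uu}(u,\theta)=0$ for all $(u,\theta)$, i.e. there is no stress-energy flux to null infinity. -/

import Mathlib

open scoped ContDiff

namespace LinGrav

noncomputable section

/-- Minkowski spacetime of dimension `d = n + 1` in global inertial coordinates
`(t, x¹, …, xⁿ)`; index `0` is the time coordinate. -/
abbrev Spacetime (n : ℕ) : Type := Fin (n + 1) → ℝ

/-- Euclidean space, whose unit sphere is the `(d - 2)`-sphere of directions. -/
abbrev Space (n : ℕ) : Type := EuclideanSpace ℝ (Fin n)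

/-- Covector (or vector) fields, by inertial components. -/
abbrev CovectorField (n : ℕ) : Type := Spacetime n → Fin (n + 1) → ℝ

/-- Covariant two-tensor fields, by inertial components. -/
abbrev TensorField (n : ℕ) : Type := Spacetime n → Fin (n + 1) → Fin (n + 1) → ℝ

/-- The Minkowski metric `diag(-1, 1, …, 1)`. -/
def eta (n : ℕ) : Matrix (Fin (n + 1)) (Fin (n + 1)) ℝ :=
  Matrix.diagonal fun μ => if μ = 0 then -1 else 1

/-- The matrix `eta` is its own inverse, so it also gives the components of the inverse metric
and is used below to raise indices. -/
theorem eta_mul_eta (n : ℕ) : eta n * eta n = 1 := by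
  unfold eta
  rw [Matrix.diagonal_mul_diagonal, ← Matrix.diagonal_one]
  congr 1
  funext μ
  split_ifs <;> norm_num

variable {n : ℕ}

/-! ### Differential operators -/

/-- The coordinate partial derivative `∂_μ f`. -/
def pd (μ : Fin (n + 1)) (f : Spacetime n → ℝ) (x : Spacetime n) : ℝ :=
  fderiv ℝ f x (Pi.single μ 1)

/-- The wave operator `η^{μν} ∂_μ ∂_ν`. -/
def box (f : Spacetime n → ℝ) (x : Spacetime n) : ℝ :=
  ∑ μ, ∑ ν, eta n μ ν * pd μ (pd ν f) x

/-- The divergence `∂^μ w_μ` of a covector field. -/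
def div (w : CovectorField n) (x : Spacetime n) : ℝ :=
  ∑ μ, ∑ ν, eta n μ ν * pd μ (fun y => w y ν) x

/-- The trace reversal `h_{μν} - (1/2) h η_{μν}`, where `h = η^{αβ} h_{αβ}`. -/
def traceRev (h : TensorField n) : TensorField n := fun x μ ν =>
  h x μ ν - 1 / 2 * (∑ α, ∑ β, eta n α β * h x α β) * eta n μ ν

/-- `χ_μ = ∂^ν (traceRev h)_{μν}`. -/
def chi (h : TensorField n) : CovectorField n := fun x μ =>
  div (fun y ν => traceRev h y μ ν) x

/-- The linearized Einstein tensor: `-2 δG_{μν}` is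
`□ h̄_{μν} - 2 ∂_{(μ} ∂^ρ h̄_{ν)ρ} + η_{μν} ∂^ρ ∂^σ h̄_{ρσ}`, `h̄` being the trace reversal. -/
def linEinstein (h : TensorField n) : TensorField n := fun x μ ν =>
  -(1 / 2) * (box (fun y => traceRev h y μ ν) x
    - (pd μ (fun y => chi h y ν) x + pd ν (fun y => chi h y μ) x)
    + eta n μ ν * div (chi h) x)

/-- The gauge transformation `h_{μν} ↦ h_{μν} - ∂_{(μ} ξ_{ν)}`. -/
def gaugeTransform (h : TensorField n) (ξ : CovectorField n) : TensorField n := fun x μ ν =>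
  h x μ ν - 1 / 2 * (pd μ (fun y => ξ y ν) x + pd ν (fun y => ξ y μ) x)

/-! ### Null infinity and asymptotic expansions -/

/-- The direction `y / |y|` of `y`. Functions on the sphere are given as functions on `Space n` of
which only the values at unit vectors are used, and are extended by means of `dir` so that
derivatives can be taken. -/
def dir (y : Space n) : Space n := ‖y‖⁻¹ • y

/-- The point with retarded time `u = t - r`, radius `r` and direction `θ` (a unit vector). -/
def nullPoint (u r : ℝ) (θ : Space n) : Spacetime n :=
  Matrix.vecCons (u + r) fun i => r * θ i

/-- `U` is an open neighborhood of future null infinity: for `u` in any bounded interval it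
contains all points of sufficiently large `r`. -/
def IsNhdNullInfinity (U : Set (Spacetime n)) : Prop :=
  IsOpen U ∧ ∀ a b : ℝ, ∃ R : ℝ, ∀ u ∈ Set.Icc a b, ∀ r > R, ∀ θ : Space n, ‖θ‖ = 1 →
    nullPoint u r θ ∈ U

/-- `F(u, r, y)`, a function of `u`, `r` and the direction of `y`, is `O(r^(-β))` as `r → ∞`,
locally uniformly in `u` and the direction, as are all its derivatives with respect to `u` and the
direction, whereas `k` additional derivatives with respect to `r` are `O(r^(-β-k))`. -/
def IsBigOInfinity (F : ℝ → ℝ → Space n → ℝ) (β : ℝ) : Prop :=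
  ∀ (k m : ℕ) (a b : ℝ), ∃ C : ℝ, ∃ R > (0 : ℝ), ∀ r > R, ∀ u ∈ Set.Icc a b,
    ∀ θ : Space n, ‖θ‖ = 1 →
      ‖iteratedFDeriv ℝ m
          (fun p : ℝ × Space n => iteratedDeriv k (fun r' => F p.1 r' p.2) r) (u, θ)‖
        ≤ C * r ^ (-(β + k))

/-- Smoothness of a function of `u` and the direction. -/
def IsSmoothCoeff (c : ℝ → Space n → ℝ) : Prop :=
  ContDiffOn ℝ ∞ (fun p : ℝ × Space n => c p.1 (dir p.2)) {p | p.2 ≠ 0}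

/-- The asymptotic expansion `f ∼ ∑_{j ≥ 0} r^(-(a+j)) c_j(u, direction)`. -/
def HasExpansion (f : Spacetime n → ℝ) (a : ℝ) (c : ℕ → ℝ → Space n → ℝ) : Prop :=
  (∀ j, IsSmoothCoeff (c j)) ∧
  ∀ N : ℕ, IsBigOInfinity
    (fun u r y => f (nullPoint u r (dir y))
      - ∑ j ∈ Finset.range N, r ^ (-(a + j)) * c j u (dir y))
    (a + N)

/-- The asymptotic expansion
`f ∼ ∑_{j ≥ 0} r^(-(a+j)) c_j(u, direction) + ∑_{j ≥ 0} r^(-(b+j)) c'_j(u, direction)`. -/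
def HasDoubleExpansion (f : Spacetime n → ℝ) (a : ℝ) (c : ℕ → ℝ → Space n → ℝ)
    (b : ℝ) (c' : ℕ → ℝ → Space n → ℝ) : Prop :=
  (∀ j, IsSmoothCoeff (c j)) ∧ (∀ j, IsSmoothCoeff (c' j)) ∧
  ∀ N : ℕ, IsBigOInfinity
    (fun u r y => f (nullPoint u r (dir y))
      - ∑ j ∈ Finset.range N, r ^ (-(a + j)) * c j u (dir y)
      - ∑ j ∈ Finset.range N, r ^ (-(b + j)) * c' j u (dir y))
    (min a b + N)

/-- The ansatz for the metric perturbation in dimension `d = n + 1`: powers `d/2 - 1 + j` of `1/r`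
if `d` is even; powers `d/2 - 1 + j` and `d - 3 + j` if `d` is odd. The transformation from the
inertial frame to the normalized frame `∂/∂u`, `∂/∂r`, `(1/r) ∂/∂x^A` depends smoothly on the
direction only, so orders in the two frames agree. -/
def MetricAnsatz (h : TensorField n) : Prop :=
  (Even (n + 1) → ∃ c : ℕ → ℝ → Space n → Fin (n + 1) → Fin (n + 1) → ℝ, ∀ μ ν,
    HasExpansion (fun x => h x μ ν) (((n + 1 : ℕ) : ℝ) / 2 - 1) (fun j u θ => c j u θ μ ν)) ∧
  (Odd (n + 1) → ∃ c c' : ℕ → ℝ → Space n → Fin (n + 1) → Fin (n + 1) → ℝ, ∀ μ ν,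
    HasDoubleExpansion (fun x => h x μ ν)
      (((n + 1 : ℕ) : ℝ) / 2 - 1) (fun j u θ => c j u θ μ ν)
      (((n + 1 : ℕ) : ℝ) - 3) (fun j u θ => c' j u θ μ ν))

/-! ### Stress-energy -/

/-- Future-directed timelike vectors. -/
def IsFutureTimelike (v : Fin (n + 1) → ℝ) : Prop :=
  0 < v 0 ∧ ∑ μ, ∑ ν, eta n μ ν * v μ * v ν < 0

/-- Vectors that are future-directed timelike, future-directed null, or zero. -/
def IsFutureCausal (v : Fin (n + 1) → ℝ) : Prop :=
  0 ≤ v 0 ∧ ∑ μ, ∑ ν, eta n μ ν * v μ * v ν ≤ 0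

/-- The dominant energy condition on `U`: `-T^μ_ν v^ν` is future-directed causal (or zero) for
every future-directed timelike `v`. -/
def DominantEnergy (U : Set (Spacetime n)) (T : TensorField n) : Prop :=
  ∀ x ∈ U, ∀ v : Fin (n + 1) → ℝ, IsFutureTimelike v →
    IsFutureCausal fun μ => -∑ ρ, ∑ ν, eta n μ ρ * T x ρ ν * v ν

/-- The assumptions on the stress-energy tensor near null infinity. The coefficient of
`r^(-(d-2+j))` is `Tc j`, so `Tc 0` is the tensor `T^{(d-2)}`. -/
structure StressEnergyAnsatz (U : Set (Spacetime n)) (T : TensorField n)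
    (Tc : ℕ → ℝ → Space n → Fin (n + 1) → Fin (n + 1) → ℝ) : Prop where
  expansion : ∀ μ ν,
    HasExpansion (fun x => T x μ ν) (((n + 1 : ℕ) : ℝ) - 2) (fun j u θ => Tc j u θ μ ν)
  dominantEnergy : DominantEnergy U T
  noEarlyFlux : ∀ θ : Space n, ‖θ‖ = 1 → ∀ μ ν,
    Filter.Tendsto (fun u => Tc 0 u θ μ ν) Filter.atBot (nhds 0)

/-- The `uu` component of a tensor; `∂/∂u` at fixed `r` and direction is `∂/∂t`. -/
def uuComp (A : Fin (n + 1) → Fin (n + 1) → ℝ) : ℝ := A 0 0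

/-- Near null infinity, `h` can be put in the Lorenz gauge `∂^ν h̄_{μν} = 0` by a gauge
transformation in such a way that the transformed perturbation satisfies the metric ansatz. -/
def CanImposeLorenzGauge (U : Set (Spacetime n)) (h : TensorField n) : Prop :=
  ∃ V ⊆ U, IsNhdNullInfinity V ∧ ∃ ξ : CovectorField n, ContDiffOn ℝ ∞ ξ V ∧
    MetricAnsatz (gaugeTransform h ξ) ∧ ∀ x ∈ V, ∀ μ, chi (gaugeTransform h ξ) x μ = 0

end

end LinGrav

open LinGrav

open LinGrav

noncomputable section

open scoped ContDiff
open Filter Topology Set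

/-! ### Weighted jets in the coordinates u, r, y -/

variable {n : ℕ}

/-! A gauge change by ξ alters χ_a = ∂^b h̄_ab by −½ □ξ_a, so imposing the Lorenz gauge within the
ansatz means solving □ξ_a = 2χ_a near null infinity with ∂ξ in the ansatz. The theorem is thus about
one scalar wave equation and about the first coefficients of χ.

On series, □ sends r^(-p) c(u,θ) to (2p − d + 2) r^(-p-1) ∂_u c plus r^(-p-2) times an angular
operator applied to c (`boxCoef`). Comparing orders determines each ∂_u c, hence c by integration in
u, except at the radiative order p = d/2 − 1, where the factor vanishes. A source term at r^(-d/2)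
therefore has to come from the angular operator. If it does not depend on u, a stationary term
r^(-(d/2-2)) k(θ) produces it, where k solves an elliptic equation on the sphere (`exists_poisson`).
For d > 4 this is always solvable. For d = 4 the operator is the Laplacian of the sphere and a
constant is left over; it is matched by a multiple of log r, whose gradient still fits the ansatz
(`exists_box_log`). Borel summation (`exists_borel`) turns the formal solution into a function with
an error smaller than every power of 1/r. This error extends to a Schwartz function on Minkowski
space (`exists_rapid_extension`), and the solution of the wave equation that vanishes in the distant
future removes it without affecting the expansion (`exists_wave_solution`). The result is
`exists_box_eq`.

It remains to see that 2χ is such a source. A priori χ starts at r^(-(d/2-1)). The Einstein equation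
one order further, contracted with the null covector ∂u, is a system that forces this coefficient to
vanish (`divCoef_eq_zero_of_leading`). The same argument removes the term r^(-(d-3)) when d is odd;
there the contraction of T^(d-2) vanishes because conservation makes it constant in u and it tends
to 0 as u → −∞ (`lc_stressCoef_eq_zero`). If T has no r^(-d/2) term, the full Einstein equation at
that order makes the next coefficient of χ stationary (`dU_divCoef_four_eq_zero`).

For d > 4 the expansion of T starts at r^(-(d-2)), which is beyond r^(-d/2), so nothing obstructs.
For d = 4 the term in question is T^(2). It satisfies the dominant energy condition as a limit, so
T^(2)_uu = 0 forces T^(2) = 0 (`eq_zero_of_dominantEnergy`). Conversely, in Lorenz gauge δG = −½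
□h̄, and the r^(-2) coefficient of □h̄ vanishes for every h̄ in the ansatz, since this is where the
transport factor is zero; hence T^(2) = 0. -/

/-- Retarded time, radius and direction. -/
abbrev NullChart (n : ℕ) : Type := ℝ × ℝ × Space n

/-- The coordinate directions `u`, `r`, `yᵢ`, in this order. -/
abbrev Slot (n : ℕ) : Type := Option (Option (Fin n))

def Slot.vec : Slot n → NullChart n
  | none => (1, 0, 0)
  | some none => (0, 1, 0)
  | some (some i) => (0, 0, EuclideanSpace.single i 1)

/-- The number of powers of `1 / r` gained by a derivative. -/
def Slot.wt : Slot n → ℝ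
  | some none => 1
  | _ => 0

/-- Partial derivatives in the coordinates `u`, `r`, `yᵢ`. -/
def dd (v : Slot n) (F : NullChart n → ℝ) (p : NullChart n) : ℝ := fderiv ℝ F p v.vec

/-- The weighted `C^m` norm at a point for the decay rate `r^(-β)`, every derivative in `r`
improving the rate by one power. -/
def jet : ℕ → ℝ → (NullChart n → ℝ) → NullChart n → ℝ
  | 0, β, F, p => |F p| * p.2.1 ^ β
  | m + 1, β, F, p => |F p| * p.2.1 ^ β + ∑ v, jet m (β + v.wt) (dd v F) p

theorem jet_nonneg {p : NullChart n} (hp : 0 < p.2.1) (m : ℕ) (β : ℝ) (F : NullChart n → ℝ) :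
    0 ≤ jet m β F p := by
  induction m generalizing β F with
  | zero => exact mul_nonneg (abs_nonneg _) (Real.rpow_nonneg hp.le _)
  | succ m ih =>
    exact add_nonneg (mul_nonneg (abs_nonneg _) (Real.rpow_nonneg hp.le _))
      (Finset.sum_nonneg fun v _ => ih _ _)

theorem abs_mul_le_jet {p : NullChart n} (hp : 0 < p.2.1) (m : ℕ) (β : ℝ)
    (F : NullChart n → ℝ) : |F p| * p.2.1 ^ β ≤ jet m β F p := by
  cases m with
  | zero => exact le_rfl
  | succ m => exact le_add_of_nonneg_right (Finset.sum_nonneg fun v _ => jet_nonneg hp _ _ _)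

theorem jet_dd_le {p : NullChart n} (hp : 0 < p.2.1) (m : ℕ) (β : ℝ)
    (F : NullChart n → ℝ) (v : Slot n) : jet m (β + v.wt) (dd v F) p ≤ jet (m + 1) β F p := by
  have h1 := Finset.single_le_sum (f := fun v : Slot n => jet m (β + v.wt) (dd v F) p)
    (fun v _ => jet_nonneg hp _ _ _) (Finset.mem_univ v)
  have h2 : 0 ≤ |F p| * p.2.1 ^ β := mul_nonneg (abs_nonneg _) (Real.rpow_nonneg hp.le _)
  simp only [jet] at *
  linarith

theorem jet_mono {p : NullChart n} (hp : 0 < p.2.1) {m m' : ℕ} (h : m ≤ m') (β : ℝ)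
    (F : NullChart n → ℝ) : jet m β F p ≤ jet m' β F p := by
  induction m generalizing m' β F with
  | zero => exact abs_mul_le_jet hp _ _ _
  | succ m ih =>
    obtain ⟨k, rfl⟩ : ∃ k, m' = k + 1 := ⟨m' - 1, by omega⟩
    exact add_le_add le_rfl (Finset.sum_le_sum fun v _ => ih (by omega) _ _)

theorem dd_eventuallyEq {F G : NullChart n → ℝ} {p : NullChart n} (h : F =ᶠ[𝓝 p] G)
    (v : Slot n) : dd v F =ᶠ[𝓝 p] dd v G := by
  filter_upwards [h.fderiv (𝕜 := ℝ)] with q hq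
  simp only [dd, hq]

theorem jet_congr {F G : NullChart n → ℝ} {p : NullChart n} (h : F =ᶠ[𝓝 p] G) (m : ℕ) (β : ℝ) :
    jet m β F p = jet m β G p := by
  induction m generalizing β F G with
  | zero => simp only [jet, h.self_of_nhds]
  | succ m ih =>
    simp only [jet, h.self_of_nhds]
    congr 1
    exact Finset.sum_congr rfl fun v _ => ih (dd_eventuallyEq h v) _

/-- The weight is evaluated at the point and never differentiated, so every term of the jet acquires
the same factor. -/
theorem jet_weight {p : NullChart n} (hp : 0 < p.2.1) (m : ℕ) (β γ : ℝ) (F : NullChart n → ℝ) :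
    jet m (γ + β) F p = p.2.1 ^ γ * jet m β F p := by
  induction m generalizing β F with
  | zero => simp only [jet, Real.rpow_add hp]; ring
  | succ m ih =>
    simp only [jet, mul_add, Finset.mul_sum, ← ih, add_assoc]
    congr 1
    rw [Real.rpow_add hp]; ring

theorem dd_zero (v : Slot n) : dd v (0 : NullChart n → ℝ) = 0 := by
  funext p; simp [dd]

theorem jet_zero (m : ℕ) (β : ℝ) (p : NullChart n) : jet m β 0 p = 0 := by
  induction m generalizing β with
  | zero => simp [jet]
  | succ m ih => simp [jet, dd_zero, ih]

theorem ContDiffAt.dd {F : NullChart n → ℝ} {p : NullChart n} (h : ContDiffAt ℝ ∞ F p)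
    (v : Slot n) : ContDiffAt ℝ ∞ (dd v F) p :=
  (h.fderiv_right (m := ∞) (by simp)).clm_apply contDiffAt_const

theorem ContDiffAt.eventually_differentiableAt {E : Type*} [NormedAddCommGroup E]
    [NormedSpace ℝ E] {F : E → ℝ} {p : E} (h : ContDiffAt ℝ ∞ F p) :
    ∀ᶠ q in 𝓝 p, DifferentiableAt ℝ F q := by
  have h1 : ContDiffAt ℝ 1 F p := h.of_le (by exact_mod_cast le_top)
  filter_upwards [h1.eventually (by simp)] with q hq
  exact hq.differentiableAt (by simp)

theorem dd_add {F G : NullChart n → ℝ} {p : NullChart n} (hF : ContDiffAt ℝ ∞ F p)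
    (hG : ContDiffAt ℝ ∞ G p) (v : Slot n) : dd v (F + G) =ᶠ[𝓝 p] dd v F + dd v G := by
  filter_upwards [hF.eventually_differentiableAt, hG.eventually_differentiableAt] with q h1 h2
  simp [dd, fderiv_add h1 h2]

theorem dd_const_mul (c : ℝ) (F : NullChart n → ℝ) (v : Slot n) :
    dd v (fun p => c * F p) = fun p => c * dd v F p := by
  funext p
  have h2 : (fun p => c * F p) = c • F := rfl
  rw [dd, h2, fderiv_const_smul_field]
  rfl

theorem dd_mul {F G : NullChart n → ℝ} {p : NullChart n} (hF : ContDiffAt ℝ ∞ F p)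
    (hG : ContDiffAt ℝ ∞ G p) (v : Slot n) :
    dd v (F * G) =ᶠ[𝓝 p] dd v F * G + F * dd v G := by
  filter_upwards [hF.eventually_differentiableAt, hG.eventually_differentiableAt] with q h1 h2
  simp [dd, fderiv_mul h1 h2]
  ring

theorem jet_add_le {F G : NullChart n → ℝ} {p : NullChart n} (hp : 0 < p.2.1)
    (hF : ContDiffAt ℝ ∞ F p) (hG : ContDiffAt ℝ ∞ G p) (m : ℕ) (β : ℝ) :
    jet m β (F + G) p ≤ jet m β F p + jet m β G p := by
  have key : ∀ (F G : NullChart n → ℝ) (β : ℝ),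
      |(F + G) p| * p.2.1 ^ β ≤ |F p| * p.2.1 ^ β + |G p| * p.2.1 ^ β := fun F G β => by
    rw [← add_mul]
    exact mul_le_mul_of_nonneg_right (abs_add_le _ _) (Real.rpow_nonneg hp.le _)
  induction m generalizing β F G with
  | zero => exact key F G β
  | succ m ih =>
    have h1 : ∑ v, jet m (β + v.wt) (dd v (F + G)) p
        ≤ ∑ v, (jet m (β + v.wt) (dd v F) p + jet m (β + v.wt) (dd v G) p) :=
      Finset.sum_le_sum fun v _ => by
        rw [jet_congr (dd_add hF hG v)]
        exact ih (hF.dd v) (hG.dd v) _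
    rw [Finset.sum_add_distrib] at h1
    have := key F G β
    simp only [jet] at *
    linarith

theorem jet_const_mul (c : ℝ) (F : NullChart n → ℝ) (p : NullChart n) (m : ℕ) (β : ℝ) :
    jet m β (fun q => c * F q) p = |c| * jet m β F p := by
  induction m generalizing β F with
  | zero => simp [jet, abs_mul, mul_assoc]
  | succ m ih => simp only [jet, dd_const_mul, ih, abs_mul, mul_add, Finset.mul_sum, mul_assoc]

theorem jet_sum_le {ι : Type*} (s : Finset ι) {F : ι → NullChart n → ℝ} {p : NullChart n}
    (hp : 0 < p.2.1) (hF : ∀ i ∈ s, ContDiffAt ℝ ∞ (F i) p) (m : ℕ) (β : ℝ) :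
    jet m β (fun q => ∑ i ∈ s, F i q) p ≤ ∑ i ∈ s, jet m β (F i) p := by
  classical
  induction s using Finset.induction_on with
  | empty => exact (jet_zero m β p).le
  | insert a s ha ih =>
    simp only [Finset.sum_insert ha]
    have h1 := jet_add_le hp (hF a (by simp))
      (ContDiffAt.sum (s := s) (f := F) fun i hi => hF i (by simp [hi])) m β
    have h2 := ih fun i hi => hF i (by simp [hi])
    exact h1.trans (add_le_add le_rfl h2)

/-- Leibniz rule. Passing from m to m + 1 adds the undifferentiated product and two sums, one for
each factor differentiated; each is bounded by the product of the jets, whence a factor 3 per order.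
-/
theorem jet_mul_le {F G : NullChart n → ℝ} {p : NullChart n} (hp : 0 < p.2.1)
    (hF : ContDiffAt ℝ ∞ F p) (hG : ContDiffAt ℝ ∞ G p) (m : ℕ) (β γ : ℝ) :
    jet m (β + γ) (F * G) p ≤ 3 ^ m * (jet m β F p * jet m γ G p) := by
  have key : ∀ (F G : NullChart n → ℝ) (β γ : ℝ),
      |(F * G) p| * p.2.1 ^ (β + γ) = (|F p| * p.2.1 ^ β) * (|G p| * p.2.1 ^ γ) :=
    fun F G β γ => by rw [Pi.mul_apply, abs_mul, Real.rpow_add hp]; ring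
  induction m generalizing β γ F G with
  | zero => exact ((key F G β γ).trans (by simp [jet])).le
  | succ m ih =>
    have h1 : ∀ v : Slot n, jet m (β + γ + v.wt) (dd v (F * G)) p
        ≤ 3 ^ m * (jet m (β + v.wt) (dd v F) p * jet (m + 1) γ G p)
          + 3 ^ m * (jet (m + 1) β F p * jet m (γ + v.wt) (dd v G) p) := fun v => by
      rw [jet_congr (dd_mul hF hG v)]
      refine (jet_add_le hp ((hF.dd v).mul hG) (hF.mul (hG.dd v)) _ _).trans ?_
      have e1 : β + γ + v.wt = (β + v.wt) + γ := by ring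
      have e2 : β + γ + v.wt = β + (γ + v.wt) := by ring
      refine add_le_add ?_ ?_
      · rw [e1]
        refine (ih (hF.dd v) hG _ _).trans ?_
        gcongr
        · exact jet_nonneg hp _ _ _
        · exact jet_mono hp (Nat.le_succ m) _ _
      · rw [e2]
        refine (ih hF (hG.dd v) _ _).trans ?_
        gcongr
        · exact jet_nonneg hp _ _ _
        · exact jet_mono hp (Nat.le_succ m) _ _
    have h2 := Finset.sum_le_sum fun v (_ : v ∈ Finset.univ) => h1 v
    rw [Finset.sum_add_distrib, ← Finset.mul_sum, ← Finset.mul_sum, ← Finset.sum_mul,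
      ← Finset.mul_sum] at h2
    have hFn := jet_nonneg hp (m + 1) β F
    have hGn := jet_nonneg hp (m + 1) γ G
    have hS1 : ∑ v, jet m (β + v.wt) (dd v F) p ≤ jet (m + 1) β F p :=
      le_add_of_nonneg_left (mul_nonneg (abs_nonneg _) (Real.rpow_nonneg hp.le _))
    have hS2 : ∑ v, jet m (γ + v.wt) (dd v G) p ≤ jet (m + 1) γ G p :=
      le_add_of_nonneg_left (mul_nonneg (abs_nonneg _) (Real.rpow_nonneg hp.le _))
    have h3 : |(F * G) p| * p.2.1 ^ (β + γ) ≤ jet (m + 1) β F p * jet (m + 1) γ G p := by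
      rw [key]
      exact mul_le_mul (abs_mul_le_jet hp _ _ _) (abs_mul_le_jet hp _ _ _)
        (mul_nonneg (abs_nonneg _) (Real.rpow_nonneg hp.le _)) hFn
    have h4 := mul_le_mul_of_nonneg_right hS1 hGn
    have h5 := mul_le_mul_of_nonneg_left hS2 hFn
    have h6 : (1 : ℝ) ≤ 3 ^ m := one_le_pow₀ (by norm_num)
    have hP : 0 ≤ jet (m + 1) β F p * jet (m + 1) γ G p := mul_nonneg hFn hGn
    have h7 : (jet (m + 1) (β + γ) (F * G) p)
      = |(F * G) p| * p.2.1 ^ (β + γ) + ∑ v, jet m (β + γ + v.wt) (dd v (F * G)) p := rfl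
    rw [h7, pow_succ]
    have h8 : (0:ℝ) ≤ 3 ^ m := by positivity
    have h9 := mul_le_mul_of_nonneg_left h4 h8
    have h10 := mul_le_mul_of_nonneg_left h5 h8
    have h11 := mul_le_mul_of_nonneg_right h6 hP
    linarith

/-! ### Iterated Fréchet derivatives and partial derivatives -/

section Coordinates

variable {E ι : Type*} [NormedAddCommGroup E] [NormedSpace ℝ E] [Fintype ι]

theorem ContDiffAt.contDiffAt_fderiv_apply {f : E → ℝ} {p : E} (hf : ContDiffAt ℝ ∞ f p) (v : E) :
    ContDiffAt ℝ ∞ (fun q => fderiv ℝ f q v) p :=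
  (hf.fderiv_right (m := ∞) (by simp)).clm_apply contDiffAt_const

/-- Resolving the identity by a basis and its dual writes the Fréchet derivative as a sum of partial
derivatives times fixed covectors, so that induction can run over partial derivatives. -/
theorem norm_iteratedFDeriv_succ_le_sum (e : ι → E) (ε : ι → E →L[ℝ] ℝ)
    (he : ∀ x, ∑ i, ε i x • e i = x) {f : E → ℝ} {p : E} (hf : ContDiffAt ℝ ∞ f p) (m : ℕ) :
    ‖iteratedFDeriv ℝ (m + 1) f p‖
      ≤ ∑ i, ‖ε i‖ * ‖iteratedFDeriv ℝ m (fun q => fderiv ℝ f q (e i)) p‖ := by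
  rw [← norm_iteratedFDeriv_fderiv]
  have h1 : fderiv ℝ f = fun q => ∑ i, ContinuousLinearMap.toSpanSingleton ℝ (ε i)
      (fderiv ℝ f q (e i)) := by
    funext q
    ext x
    conv_lhs => rw [← he x]
    simp [mul_comm]
  have h2 : ∀ i, ContDiffAt ℝ ∞ (fun q => fderiv ℝ f q (e i)) p :=
    fun i => hf.contDiffAt_fderiv_apply _
  have hm : (m : ℕ∞ω) ≤ ∞ := by exact_mod_cast le_top
  have h3 : iteratedFDeriv ℝ m (fderiv ℝ f) p = iteratedFDeriv ℝ m (fun q => ∑ i,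
      ContinuousLinearMap.toSpanSingleton ℝ (ε i) (fderiv ℝ f q (e i))) p := by rw [← h1]
  rw [h3, iteratedFDeriv_fun_sum_apply]
  · refine (norm_sum_le _ _).trans (Finset.sum_le_sum fun i _ => ?_)
    refine ((ContinuousLinearMap.toSpanSingleton ℝ (ε i)).norm_iteratedFDeriv_comp_left
      (h2 i) hm).trans ?_
    rw [ContinuousLinearMap.norm_toSpanSingleton]
  · intro i _
    exact ((ContinuousLinearMap.toSpanSingleton ℝ (ε i)).contDiff.contDiffAt.comp p (h2 i)).of_le hm

theorem norm_iteratedFDeriv_fderiv_apply_le {f : E → ℝ} {p : E} (hf : ContDiffAt ℝ ∞ f p) (m : ℕ)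
    (v : E) :
    ‖iteratedFDeriv ℝ m (fun q => fderiv ℝ f q v) p‖ ≤ ‖v‖ * ‖iteratedFDeriv ℝ (m + 1) f p‖ := by
  rw [← norm_iteratedFDeriv_fderiv]
  have hm : (m : ℕ∞ω) ≤ ∞ := by exact_mod_cast le_top
  refine ((ContinuousLinearMap.apply ℝ ℝ v).norm_iteratedFDeriv_comp_left
    (hf.fderiv_right (m := ∞) (by simp)) hm).trans ?_
  gcongr
  refine ContinuousLinearMap.opNorm_le_bound _ (norm_nonneg _) fun L => ?_
  rw [mul_comm]
  exact L.le_opNorm v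

theorem ContDiffAt.eventually_nat {f : E → ℝ} {p : E} (hf : ContDiffAt ℝ ∞ f p) (k : ℕ) :
    ∀ᶠ q in 𝓝 p, ContDiffAt ℝ k f q :=
  (hf.of_le (by exact_mod_cast le_top)).eventually (by simp)

theorem ContDiffAt.fderiv_fderiv_comm {f : E → ℝ} {p : E} (hf : ContDiffAt ℝ ∞ f p) (v w : E) :
    (fun q => fderiv ℝ (fun x => fderiv ℝ f x w) q v)
      =ᶠ[𝓝 p] fun q => fderiv ℝ (fun x => fderiv ℝ f x v) q w := by
  filter_upwards [hf.eventually_nat 2] with q hq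
  have h1 : DifferentiableAt ℝ (fderiv ℝ f) q :=
    (hq.fderiv_right (m := 1) (by norm_num)).differentiableAt (by simp)
  have h2 : ∀ w, fderiv ℝ (fun x => fderiv ℝ f x w) q = (fderiv ℝ (fderiv ℝ f) q).flip w := by
    intro w
    rw [fderiv_clm_apply h1 (differentiableAt_const w)]
    simp
  rw [h2, h2]
  exact (hq.isSymmSndFDerivAt (by simp)) v w

end Coordinates

theorem dd_comm {F : NullChart n → ℝ} {p : NullChart n} (hF : ContDiffAt ℝ ∞ F p)
    (v w : Slot n) : dd v (dd w F) =ᶠ[𝓝 p] dd w (dd v F) :=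
  hF.fderiv_fderiv_comm _ _

theorem ContDiffAt.iterate_dd {F : NullChart n → ℝ} {p : NullChart n} (h : ContDiffAt ℝ ∞ F p)
    (v : Slot n) (k : ℕ) : ContDiffAt ℝ ∞ ((_root_.dd v)^[k] F) p := by
  induction k with
  | zero => exact h
  | succ k ih => rw [Function.iterate_succ_apply']; exact ih.dd v

theorem iterate_dd_comm {F : NullChart n → ℝ} {p : NullChart n} (hF : ContDiffAt ℝ ∞ F p)
    (v w : Slot n) (k : ℕ) : (dd v)^[k] (dd w F) =ᶠ[𝓝 p] dd w ((dd v)^[k] F) := by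
  induction k with
  | zero => rfl
  | succ k ih =>
    simp only [Function.iterate_succ_apply']
    exact (dd_eventuallyEq ih v).trans (dd_comm (hF.iterate_dd v k) v w)

/-- Finite smoothness is assumed because the identity is used on a neighborhood of a point:
smoothness of infinite order at a point gives, for each k separately, a neighborhood where the
function is C^k. -/
theorem iteratedDeriv_radial {G : NullChart n → ℝ} {p : NullChart n} (k : ℕ)
    (hG : ContDiffAt ℝ k G p) :
    iteratedDeriv k (fun r => G (p.1, r, p.2.2)) p.2.1 = ((dd (some none))^[k] G) p := by
  induction k generalizing G with
  | zero => rfl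
  | succ k ih =>
    rw [iteratedDeriv_succ', Function.iterate_succ_apply]
    have hk : ContDiffAt ℝ k (dd (some none) G) p :=
      (hG.fderiv_right (m := k) (by norm_cast)).clm_apply contDiffAt_const
    rw [← ih hk]
    apply Filter.EventuallyEq.iteratedDeriv_eq
    have hc : ContinuousAt (fun r : ℝ => ((p.1, r, p.2.2) : NullChart n)) p.2.1 := by fun_prop
    have hd : ∀ᶠ q in 𝓝 p, DifferentiableAt ℝ G q := by
      filter_upwards [hG.eventually (by simp)] with q hq
      exact hq.differentiableAt (by simp)
    filter_upwards [hc.eventually hd] with r hr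
    have h1 : HasDerivAt (fun r : ℝ => ((p.1, r, p.2.2) : NullChart n)) (0, 1, 0) r :=
      (hasDerivAt_const _ _).prodMk ((hasDerivAt_id r).prodMk (hasDerivAt_const _ _))
    exact (hr.hasFDerivAt.comp_hasDerivAt r h1).deriv

/-- Restriction to a fixed radius. -/
def slice (r : ℝ) (K : NullChart n → ℝ) (q : ℝ × Space n) : ℝ := K (q.1, r, q.2)

def sliceVec : Option (Fin n) → ℝ × Space n
  | none => (1, 0)
  | some i => (0, EuclideanSpace.single i 1)

def sliceCoord : Option (Fin n) → ℝ × Space n →L[ℝ] ℝ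
  | none => ContinuousLinearMap.fst ℝ _ _
  | some i => (EuclideanSpace.proj i).comp (ContinuousLinearMap.snd ℝ _ _)

/-- The slot of a coordinate on a slice. -/
def sliceSlot : Option (Fin n) → Slot n
  | none => none
  | some i => some (some i)

theorem sliceSlot_wt (i : Option (Fin n)) : (sliceSlot i).wt = 0 := by
  cases i <;> rfl

theorem sum_sliceCoord (x : ℝ × Space n) : ∑ i, sliceCoord i x • sliceVec i = x := by
  rw [Fintype.sum_option]
  refine Prod.ext ?_ ?_
  · simp [sliceCoord, sliceVec, Prod.fst_sum]
  · ext j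
    simp [sliceCoord, sliceVec, Prod.snd_sum, Finset.sum_apply, Pi.single_apply]

theorem contDiffAt_slice {K : NullChart n → ℝ} {p : NullChart n} {m : ℕ∞ω}
    (hK : ContDiffAt ℝ m K p) : ContDiffAt ℝ m (slice p.2.1 K) (p.1, p.2.2) := by
  have : ContDiffAt ℝ m (fun q : ℝ × Space n => ((q.1, p.2.1, q.2) : NullChart n))
      (p.1, p.2.2) := by fun_prop
  exact ContDiffAt.comp (p.1, p.2.2) (by exact hK) this

theorem fderiv_slice {K : NullChart n → ℝ} {p : NullChart n} (hK : ContDiffAt ℝ ∞ K p)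
    (i : Option (Fin n)) :
    (fun q => fderiv ℝ (slice p.2.1 K) q (sliceVec i))
      =ᶠ[𝓝 (p.1, p.2.2)] slice p.2.1 (dd (sliceSlot i) K) := by
  have hc : ContinuousAt (fun q : ℝ × Space n => ((q.1, p.2.1, q.2) : NullChart n))
      (p.1, p.2.2) := by fun_prop
  have hd : ∀ᶠ q in 𝓝 ((p.1, p.2.1, p.2.2) : NullChart n), DifferentiableAt ℝ K q :=
    hK.eventually_differentiableAt
  filter_upwards [hc.eventually hd] with q hq
  have h1 : HasFDerivAt (fun q : ℝ × Space n => ((q.1, p.2.1, q.2) : NullChart n))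
      ((ContinuousLinearMap.fst ℝ ℝ (Space n)).prod
        ((0 : ℝ × Space n →L[ℝ] ℝ).prod (ContinuousLinearMap.snd ℝ ℝ (Space n)))) q :=
    hasFDerivAt_fst.prodMk ((hasFDerivAt_const _ _).prodMk hasFDerivAt_snd)
  have h2 := (hq.hasFDerivAt.comp q h1).fderiv
  have h3 : (K ∘ fun q : ℝ × Space n => ((q.1, p.2.1, q.2) : NullChart n)) = slice p.2.1 K := rfl
  rw [h3] at h2
  rw [h2]
  cases i <;> simp [slice, dd, sliceSlot, sliceVec, Slot.vec]

/-- Directions tangent to a slice of constant r have weight zero, so differentiating in them does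
not change the exponent. The constant depends on m alone. -/
theorem exists_norm_iteratedFDeriv_slice_le (m : ℕ) : ∃ C : ℝ, 0 ≤ C ∧ ∀ (β : ℝ)
    (K : NullChart n → ℝ) (p : NullChart n), 0 < p.2.1 → ContDiffAt ℝ ∞ K p →
    ‖iteratedFDeriv ℝ m (slice p.2.1 K) (p.1, p.2.2)‖ * p.2.1 ^ β ≤ C * jet m β K p := by
  induction m with
  | zero =>
    refine ⟨1, zero_le_one, fun β K p hp hK => ?_⟩
    simp [slice, jet]
  | succ m ih =>
    obtain ⟨C, hC, h⟩ := ih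
    refine ⟨∑ i : Option (Fin n), ‖(sliceCoord i : ℝ × Space n →L[ℝ] ℝ)‖ * C,
      Finset.sum_nonneg fun i _ => by positivity, fun β K p hp hK => ?_⟩
    have h1 := norm_iteratedFDeriv_succ_le_sum sliceVec sliceCoord sum_sliceCoord
      (contDiffAt_slice hK) m
    have hr : 0 ≤ p.2.1 ^ β := Real.rpow_nonneg hp.le _
    refine (mul_le_mul_of_nonneg_right h1 hr).trans ?_
    rw [Finset.sum_mul, Finset.sum_mul]
    refine Finset.sum_le_sum fun i _ => ?_
    rw [((fderiv_slice hK i).iteratedFDeriv ℝ m).self_of_nhds, mul_assoc, mul_assoc]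
    refine mul_le_mul_of_nonneg_left ?_ (norm_nonneg _)
    refine (h β (dd (sliceSlot i) K) p hp (hK.dd _)).trans ?_
    refine mul_le_mul_of_nonneg_left ?_ hC
    have := jet_dd_le hp m β K (sliceSlot i)
    rwa [sliceSlot_wt, add_zero] at this

/-! ### The filter of points approaching null infinity -/

/-- `r → ∞` with `u ∈ [a, b]`, uniformly in the direction. -/
def scriOn (n : ℕ) (a b : ℝ) : Filter (NullChart n) :=
  comap (fun p => p.2.1) atTop ⊓ 𝓟 {p | p.1 ∈ Icc a b ∧ ‖p.2.2‖ = 1}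

theorem eventually_scriOn {a b : ℝ} {P : NullChart n → Prop} :
    (∀ᶠ p in scriOn n a b, P p) ↔
      ∃ R : ℝ, ∀ r > R, ∀ u ∈ Icc a b, ∀ θ : Space n, ‖θ‖ = 1 → P (u, r, θ) := by
  rw [scriOn, eventually_inf_principal, eventually_comap, ]
  constructor
  · intro h
    obtain ⟨R, hR⟩ := eventually_atTop.1 h
    exact ⟨R, fun r hr u hu θ hθ => hR r (le_of_lt hr) (u, r, θ) rfl ⟨hu, hθ⟩⟩
  · rintro ⟨R, hR⟩
    filter_upwards [eventually_gt_atTop R] with r hr p hp hq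
    subst hp
    exact hR _ hr _ hq.1 _ hq.2

theorem eventually_scriOn_gt (a b R : ℝ) : ∀ᶠ p in scriOn n a b, R < p.2.1 :=
  eventually_scriOn.2 ⟨R, fun _ hr _ _ _ _ => hr⟩

theorem eventually_scriOn_mem (a b : ℝ) :
    ∀ᶠ p in scriOn n a b, p.1 ∈ Icc a b ∧ ‖p.2.2‖ = 1 :=
  eventually_scriOn.2 ⟨0, fun _ _ _ hu _ hθ => ⟨hu, hθ⟩⟩

/-- `F = O(r^(-β))` near null infinity with all derivatives, derivatives in `r` gaining powers. -/
structure IsOScri (F : NullChart n → ℝ) (β : ℝ) : Prop where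
  smooth : ∀ a b, ∀ᶠ p in scriOn n a b, ContDiffAt ℝ ∞ F p
  bound : ∀ m a b, ∃ C, ∀ᶠ p in scriOn n a b, jet m β F p ≤ C

/-- Equality near null infinity. -/
def EqScri (F G : NullChart n → ℝ) : Prop := ∀ a b, ∀ᶠ p in scriOn n a b, F =ᶠ[𝓝 p] G

namespace IsOScri

variable {F G : NullChart n → ℝ} {β γ : ℝ}

theorem congr (hF : IsOScri F β) (h : EqScri F G) : IsOScri G β where
  smooth a b := by
    filter_upwards [hF.smooth a b, h a b] with p h1 h2
    exact h1.congr_of_eventuallyEq h2.symm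
  bound m a b := by
    obtain ⟨C, hC⟩ := hF.bound m a b
    refine ⟨C, ?_⟩
    filter_upwards [hC, h a b] with p h1 h2
    rwa [← jet_congr h2]

theorem add (hF : IsOScri F β) (hG : IsOScri G β) : IsOScri (F + G) β where
  smooth a b := by
    filter_upwards [hF.smooth a b, hG.smooth a b] with p h1 h2 using h1.add h2
  bound m a b := by
    obtain ⟨C, hC⟩ := hF.bound m a b
    obtain ⟨D, hD⟩ := hG.bound m a b
    refine ⟨C + D, ?_⟩
    filter_upwards [hC, hD, hF.smooth a b, hG.smooth a b, eventually_scriOn_gt a b 0]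
      with p h1 h2 h3 h4 h5
    exact (jet_add_le h5 h3 h4 m β).trans (add_le_add h1 h2)

theorem const_mul (c : ℝ) (hF : IsOScri F β) : IsOScri (fun p => c * F p) β where
  smooth a b := by
    filter_upwards [hF.smooth a b] with p h1 using contDiffAt_const.mul h1
  bound m a b := by
    obtain ⟨C, hC⟩ := hF.bound m a b
    refine ⟨|c| * C, ?_⟩
    filter_upwards [hC] with p h1
    rw [jet_const_mul]
    gcongr

theorem zero (β : ℝ) : IsOScri (0 : NullChart n → ℝ) β where
  smooth _ _ := Eventually.of_forall fun _ => contDiffAt_const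
  bound m _ _ := ⟨0, Eventually.of_forall fun p => (jet_zero m β p).le⟩

theorem neg (hF : IsOScri F β) : IsOScri (-F) β := by
  convert hF.const_mul (-1) using 1
  funext p; simp

theorem sub (hF : IsOScri F β) (hG : IsOScri G β) : IsOScri (F - G) β := by
  rw [sub_eq_add_neg]; exact hF.add hG.neg

theorem sum {ι : Type*} (s : Finset ι) {F : ι → NullChart n → ℝ}
    (hF : ∀ i ∈ s, IsOScri (F i) β) : IsOScri (fun p => ∑ i ∈ s, F i p) β := by
  classical
  induction s using Finset.induction_on with
  | empty => exact zero β
  | insert a s ha ih =>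
    simp only [Finset.sum_insert ha]
    exact (hF a (by simp)).add (ih fun i hi => hF i (by simp [hi]))

theorem mul (hF : IsOScri F β) (hG : IsOScri G γ) : IsOScri (F * G) (β + γ) where
  smooth a b := by
    filter_upwards [hF.smooth a b, hG.smooth a b] with p h1 h2 using h1.mul h2
  bound m a b := by
    obtain ⟨C, hC⟩ := hF.bound m a b
    obtain ⟨D, hD⟩ := hG.bound m a b
    refine ⟨3 ^ m * (|C| * |D|), ?_⟩
    filter_upwards [hC, hD, hF.smooth a b, hG.smooth a b, eventually_scriOn_gt a b 0]
      with p h1 h2 h3 h4 h5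
    refine (jet_mul_le h5 h3 h4 m β γ).trans ?_
    gcongr
    · exact jet_nonneg h5 _ _ _
    · exact h1.trans (le_abs_self C)
    · exact h2.trans (le_abs_self D)

theorem dd (hF : IsOScri F β) (v : Slot n) : IsOScri (dd v F) (β + v.wt) where
  smooth a b := by filter_upwards [hF.smooth a b] with p h1 using h1.dd v
  bound m a b := by
    obtain ⟨C, hC⟩ := hF.bound (m + 1) a b
    refine ⟨C, ?_⟩
    filter_upwards [hC, eventually_scriOn_gt a b 0] with p h1 h2
    exact (jet_dd_le h2 m β F v).trans h1

theorem mono (hF : IsOScri F β) (h : γ ≤ β) : IsOScri F γ where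
  smooth := hF.smooth
  bound m a b := by
    obtain ⟨C, hC⟩ := hF.bound m a b
    refine ⟨C, ?_⟩
    filter_upwards [hC, eventually_scriOn_gt a b 1] with p h1 h2
    have h3 : γ = (γ - β) + β := by ring
    have h4 : (0 : ℝ) < p.2.1 := by linarith
    rw [h3, jet_weight h4]
    have h5 := jet_nonneg h4 m β F
    have h6 : p.2.1 ^ (γ - β) ≤ 1 := Real.rpow_le_one_of_one_le_of_nonpos h2.le (by linarith)
    nlinarith

end IsOScri

/-! ### Equivalence of jet bounds with the decay condition of the statement -/

theorem IsOScri.isBigOInfinity {G : NullChart n → ℝ} {β : ℝ} (h : IsOScri G β) :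
    IsBigOInfinity (fun u r y => G (u, r, y)) β := by
  intro k m a b
  have h1 : IsOScri ((_root_.dd (some none))^[k] G) (β + k) := by
    clear m a b
    induction k with
    | zero => simpa using h
    | succ k ih =>
      rw [Function.iterate_succ_apply']
      have := ih.dd (some none)
      push_cast
      rwa [← add_assoc]
  obtain ⟨C, hC⟩ := h1.bound m a b
  obtain ⟨D, hD, hD2⟩ := exists_norm_iteratedFDeriv_slice_le (n := n) m
  have h2 : ∀ᶠ p in scriOn n a b, 0 < p.2.1 ∧ ‖iteratedFDeriv ℝ m (fun q : ℝ × Space n =>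
      iteratedDeriv k (fun r' => G (q.1, r', q.2)) p.2.1) (p.1, p.2.2)‖
        ≤ D * C * p.2.1 ^ (-(β + k)) := by
    filter_upwards [hC, h1.smooth a b, h.smooth a b, eventually_scriOn_gt a b 0] with p h1 h2 h3 h4
    refine ⟨h4, ?_⟩
    have h5 : (fun q : ℝ × Space n => iteratedDeriv k (fun r' => G (q.1, r', q.2)) p.2.1)
        =ᶠ[𝓝 (p.1, p.2.2)] slice p.2.1 ((_root_.dd (some none))^[k] G) := by
      have hc : ContinuousAt (fun q : ℝ × Space n => ((q.1, p.2.1, q.2) : NullChart n))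
        (p.1, p.2.2) := by fun_prop
      have hd : ∀ᶠ q in 𝓝 ((p.1, p.2.1, p.2.2) : NullChart n), ContDiffAt ℝ k G q :=
        h3.eventually_nat k
      filter_upwards [hc.eventually hd] with q hq
      exact iteratedDeriv_radial k hq
    rw [(h5.iteratedFDeriv ℝ m).self_of_nhds]
    have h6 := (hD2 (β + k) _ p h4 h2).trans (mul_le_mul_of_nonneg_left h1 hD)
    rw [Real.rpow_neg h4.le, ← div_eq_mul_inv, le_div_iff₀ (Real.rpow_pos_of_pos h4 _)]
    exact h6
  obtain ⟨R, hR⟩ := eventually_scriOn.1 h2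
  refine ⟨D * C, max R 1, by positivity, fun r hr u hu θ hθ => ?_⟩
  exact (hR r (lt_of_le_of_lt (le_max_left _ _) hr) u hu θ hθ).2

/-- The bounds in `IsBigOInfinity`, by means of iterated partial derivatives in `r`. -/
def SliceBound (G : NullChart n → ℝ) (β : ℝ) : Prop :=
  ∀ (k m : ℕ) (a b : ℝ), ∃ C : ℝ, ∀ᶠ p in scriOn n a b,
    ‖iteratedFDeriv ℝ m (slice p.2.1 ((dd (some none))^[k] G)) (p.1, p.2.2)‖ * p.2.1 ^ (β + k) ≤ C

/-- An r-derivative raises k and brings its own power of r; a u- or y-derivative raises m, after it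
has been commuted past the radial derivatives. -/
theorem SliceBound.dd {G : NullChart n → ℝ} {β : ℝ}
    (hG : ∀ a b, ∀ᶠ p in scriOn n a b, ContDiffAt ℝ ∞ G p) (h : SliceBound G β) (v : Slot n) :
    SliceBound (dd v G) (β + v.wt) := by
  intro k m a b
  rcases v with _ | _ | i
  case some.none =>
    obtain ⟨C, hC⟩ := h (k + 1) m a b
    refine ⟨C, ?_⟩
    filter_upwards [hC] with p h1
    rw [Function.iterate_succ_apply] at h1
    have : β + ((k + 1 : ℕ) : ℝ) = β + Slot.wt (n := n) (some none) + k := by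
      simp [Slot.wt]; ring
    rwa [this] at h1
  all_goals
    obtain ⟨C, hC⟩ := h k (m + 1) a b
    refine ⟨C, ?_⟩
    filter_upwards [hC, hG a b, eventually_scriOn_gt a b 0] with p h1 h2 h3
    refine le_trans ?_ h1
    simp only [Slot.wt, add_zero]
    refine mul_le_mul_of_nonneg_right ?_ (Real.rpow_nonneg h3.le _)
  · have h4 := norm_iteratedFDeriv_fderiv_apply_le
      (contDiffAt_slice (h2.iterate_dd (some none) k)) m (sliceVec none)
    rw [((fderiv_slice (h2.iterate_dd (some none) k) none).iteratedFDeriv ℝ m).self_of_nhds] at h4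
    have h5 : slice p.2.1 ((_root_.dd (some none))^[k] (_root_.dd none G)) =ᶠ[𝓝 (p.1, p.2.2)]
        slice p.2.1 (_root_.dd none ((_root_.dd (some none))^[k] G)) := by
      have hc : ContinuousAt (fun q : ℝ × Space n => ((q.1, p.2.1, q.2) : NullChart n))
        (p.1, p.2.2) := by fun_prop
      exact hc.eventually (iterate_dd_comm h2 (some none) none k)
    rw [(h5.iteratedFDeriv ℝ m).self_of_nhds]
    have h6 : ‖(sliceVec none : ℝ × Space n)‖ = 1 := by simp [sliceVec, Prod.norm_def]
    rw [h6, one_mul] at h4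
    exact h4
  · have h4 := norm_iteratedFDeriv_fderiv_apply_le
      (contDiffAt_slice (h2.iterate_dd (some none) k)) m (sliceVec (some i))
    rw [((fderiv_slice (h2.iterate_dd (some none) k) (some i)).iteratedFDeriv ℝ m).self_of_nhds]
      at h4
    have h5 : slice p.2.1 ((_root_.dd (some none))^[k] (_root_.dd (some (some i)) G))
        =ᶠ[𝓝 (p.1, p.2.2)]
        slice p.2.1 (_root_.dd (some (some i)) ((_root_.dd (some none))^[k] G)) := by
      have hc : ContinuousAt (fun q : ℝ × Space n => ((q.1, p.2.1, q.2) : NullChart n))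
        (p.1, p.2.2) := by fun_prop
      exact hc.eventually (iterate_dd_comm h2 (some none) (some (some i)) k)
    rw [(h5.iteratedFDeriv ℝ m).self_of_nhds]
    have h6 : ‖(sliceVec (some i) : ℝ × Space n)‖ = 1 := by simp [sliceVec, Prod.norm_def]
    rw [h6, one_mul] at h4
    exact h4

/-- The class of slice bounds is stable under partial derivatives, hence the bound on values,
applied to every iterated derivative, bounds the jet. -/
theorem SliceBound.isOScri {G : NullChart n → ℝ} {β : ℝ}
    (hG : ∀ a b, ∀ᶠ p in scriOn n a b, ContDiffAt ℝ ∞ G p) (h : SliceBound G β) :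
    IsOScri G β := by
  refine ⟨hG, fun m => ?_⟩
  have base : ∀ (G : NullChart n → ℝ) (β : ℝ), SliceBound G β → ∀ a b, ∃ C,
      ∀ᶠ p in scriOn n a b, |G p| * p.2.1 ^ β ≤ C := fun G β h a b => by
    obtain ⟨C, hC⟩ := h 0 0 a b
    refine ⟨C, ?_⟩
    filter_upwards [hC] with p h1
    simpa [slice] using h1
  induction m generalizing G β with
  | zero => exact base G β h
  | succ m ih =>
    intro a b
    obtain ⟨C, hC⟩ := base G β h a b
    have h1 : ∀ v : Slot n, ∃ C, ∀ᶠ p in scriOn n a b, jet m (β + v.wt) (_root_.dd v G) p ≤ C :=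
      fun v => ih (fun a b => (hG a b).mono fun p hp => hp.dd v) (h.dd hG v) a b
    choose D hD using h1
    refine ⟨C + ∑ v, D v, ?_⟩
    filter_upwards [hC, eventually_all.2 hD] with p h1 h2
    exact add_le_add h1 (Finset.sum_le_sum fun v _ => h2 v)

theorem isOScri_of_isBigOInfinity {G : NullChart n → ℝ} {β : ℝ}
    (hG : ∀ a b, ∀ᶠ p in scriOn n a b, ContDiffAt ℝ ∞ G p)
    (h : IsBigOInfinity (fun u r y => G (u, r, y)) β) : IsOScri G β := by
  refine SliceBound.isOScri hG fun k m a b => ?_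
  obtain ⟨C, R, hR, hC⟩ := h k m a b
  refine ⟨C, ?_⟩
  have h2 : ∀ᶠ p in scriOn n a b, ‖iteratedFDeriv ℝ m (fun q : ℝ × Space n =>
      iteratedDeriv k (fun r' => G (q.1, r', q.2)) p.2.1) (p.1, p.2.2)‖
        ≤ C * p.2.1 ^ (-(β + k)) :=
    eventually_scriOn.2 ⟨R, hC⟩
  filter_upwards [h2, hG a b, eventually_scriOn_gt a b 0] with p h1 h3 h4
  have h5 : (fun q : ℝ × Space n => iteratedDeriv k (fun r' => G (q.1, r', q.2)) p.2.1)
      =ᶠ[𝓝 (p.1, p.2.2)] slice p.2.1 ((dd (some none))^[k] G) := by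
    have hc : ContinuousAt (fun q : ℝ × Space n => ((q.1, p.2.1, q.2) : NullChart n))
      (p.1, p.2.2) := by fun_prop
    have hd : ∀ᶠ q in 𝓝 ((p.1, p.2.1, p.2.2) : NullChart n), ContDiffAt ℝ k G q :=
      h3.eventually_nat k
    filter_upwards [hc.eventually hd] with q hq
    exact iteratedDeriv_radial k hq
  rw [(h5.iteratedFDeriv ℝ m).self_of_nhds, Real.rpow_neg h4.le, ← div_eq_mul_inv,
    le_div_iff₀ (Real.rpow_pos_of_pos h4 _)] at h1
  exact h1

/-! ### The radial direction field -/

theorem norm_dir {y : Space n} (hy : y ≠ 0) : ‖dir y‖ = 1 := by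
  rw [dir, norm_smul, norm_inv, norm_norm, inv_mul_cancel₀ (norm_ne_zero_iff.2 hy)]

theorem dir_of_norm_eq_one {y : Space n} (hy : ‖y‖ = 1) : dir y = y := by
  rw [dir, hy, inv_one, one_smul]

theorem dir_smul {t : ℝ} (ht : 0 < t) (y : Space n) : dir (t • y) = dir y := by
  rw [dir, dir, norm_smul, Real.norm_eq_abs, abs_of_pos ht, smul_smul, mul_inv_rev, mul_assoc,
    inv_mul_cancel₀ ht.ne', mul_one]

theorem norm_smul_dir (y : Space n) : ‖y‖ • dir y = y := by
  rcases eq_or_ne y 0 with rfl | hy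
  · simp
  · rw [dir, smul_smul, mul_inv_cancel₀ (norm_ne_zero_iff.2 hy), one_smul]

theorem ne_zero_of_norm_eq_one {y : Space n} (hy : ‖y‖ = 1) : y ≠ 0 := by
  rintro rfl; simp at hy

theorem sum_dir_mul_dir {y : Space n} (hy : y ≠ 0) : ∑ i, dir y i * dir y i = 1 := by
  have := norm_dir hy
  rw [EuclideanSpace.norm_eq, Real.sqrt_eq_one] at this
  rw [← this]
  exact Finset.sum_congr rfl fun i _ => by rw [Real.norm_eq_abs, sq_abs, sq]

theorem contDiffAt_norm_space {y : Space n} (hy : y ≠ 0) {m : ℕ∞ω} :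
    ContDiffAt ℝ m (fun y : Space n => ‖y‖) y := contDiffAt_norm ℝ hy

theorem contDiffAt_dir {y : Space n} (hy : y ≠ 0) {m : ℕ∞ω} :
    ContDiffAt ℝ m (dir : Space n → Space n) y :=
  ((contDiffAt_norm_space hy).inv (norm_ne_zero_iff.2 hy)).smul contDiffAt_id

theorem contDiffAt_dir_apply {y : Space n} (hy : y ≠ 0) (i : Fin n) {m : ℕ∞ω} :
    ContDiffAt ℝ m (fun y : Space n => dir y i) y :=
  (EuclideanSpace.proj (𝕜 := ℝ) i).contDiff.contDiffAt.comp y (contDiffAt_dir hy)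

/-- Compare the two ways of differentiating the square of the norm. -/
theorem fderiv_norm_single {y : Space n} (hy : y ≠ 0) (i : Fin n) :
    fderiv ℝ (fun y : Space n => ‖y‖) y (EuclideanSpace.single i 1) = dir y i := by
  have h1 : HasFDerivAt (fun y : Space n => ‖y‖ ^ 2) (2 • innerSL ℝ y) y :=
    (hasStrictFDerivAt_norm_sq y).hasFDerivAt
  have h2 : HasFDerivAt (fun y : Space n => ‖y‖) (fderiv ℝ (fun y : Space n => ‖y‖) y) y :=
    ((contDiffAt_norm_space (m := 1) hy).differentiableAt (by simp)).hasFDerivAt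
  have h3 := congrArg (fun L => L (EuclideanSpace.single i 1)) (h1.unique (h2.pow 2))
  have hn := norm_ne_zero_iff.2 hy
  simp [EuclideanSpace.inner_single_right] at h3
  rw [dir]
  simp only [PiLp.smul_apply, smul_eq_mul]
  field_simp
  linarith

/-- Differentiate the identity ‖y‖ • `dir y` = y and solve for the derivative of `dir`. -/
theorem fderiv_dir_single {y : Space n} (hy : y ≠ 0) (i : Fin n) :
    fderiv ℝ (dir : Space n → Space n) y (EuclideanSpace.single i 1)
      = ‖y‖⁻¹ • (EuclideanSpace.single i 1 - dir y i • dir y) := by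
  have hn := norm_ne_zero_iff.2 hy
  have h2 : HasFDerivAt (fun y : Space n => ‖y‖) (fderiv ℝ (fun y : Space n => ‖y‖) y) y :=
    ((contDiffAt_norm_space (m := 1) hy).differentiableAt (by simp)).hasFDerivAt
  have h3 : HasFDerivAt (dir : Space n → Space n) (fderiv ℝ (dir : Space n → Space n) y) y :=
    ((contDiffAt_dir (m := 1) hy).differentiableAt (by simp)).hasFDerivAt
  have h4 := (h2.smul h3).unique ((hasFDerivAt_id y).congr_of_eventuallyEq
    (Eventually.of_forall fun z => norm_smul_dir z))
  have h5 := congrArg (fun L => L (EuclideanSpace.single i 1)) h4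
  simp only [add_apply, smul_apply,
    ContinuousLinearMap.smulRight_apply, fderiv_norm_single hy, ContinuousLinearMap.id_apply] at h5
  conv_rhs => rw [← h5]
  rw [add_sub_cancel_right, smul_smul, inv_mul_cancel₀ hn, one_smul]

/-! ### Passing between spacetime and the null chart -/

def spatial (x : Spacetime n) : Space n := WithLp.toLp 2 fun i => x i.succ

def chartPoint (p : NullChart n) : Spacetime n := nullPoint p.1 p.2.1 (dir p.2.2)

/-- A function on spacetime in the null chart. -/
def toNull (f : Spacetime n → ℝ) (p : NullChart n) : ℝ := f (chartPoint p)

/-- A function in the null chart as a function on spacetime. -/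
def ofNull (F : NullChart n → ℝ) (x : Spacetime n) : ℝ :=
  F (x 0 - ‖spatial x‖, ‖spatial x‖, dir (spatial x))

theorem spatial_nullPoint (u r : ℝ) (θ : Space n) : spatial (nullPoint u r θ) = r • θ := by
  ext i; simp [spatial, nullPoint]

theorem nullPoint_zero (u r : ℝ) (θ : Space n) : nullPoint u r θ 0 = u + r := rfl

theorem nullPoint_succ (u r : ℝ) (θ : Space n) (i : Fin n) : nullPoint u r θ i.succ = r * θ i := rfl

theorem nullPoint_spatial (x : Spacetime n) :
    nullPoint (x 0 - ‖spatial x‖) ‖spatial x‖ (dir (spatial x)) = x := by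
  funext μ
  refine Fin.cases ?_ (fun i => ?_) μ
  · simp [nullPoint_zero]
  · have := congrArg (fun z : Space n => z i) (norm_smul_dir (spatial x))
    simpa [nullPoint_succ, spatial] using this

theorem ofNull_nullPoint (F : NullChart n → ℝ) {u r : ℝ} (hr : 0 < r) {θ : Space n}
    (hθ : ‖θ‖ = 1) : ofNull F (nullPoint u r θ) = F (u, r, θ) := by
  have h1 : ‖r • θ‖ = r := by rw [norm_smul, hθ, mul_one, Real.norm_eq_abs, abs_of_pos hr]
  rw [ofNull, spatial_nullPoint, nullPoint_zero, h1, dir_smul hr, dir_of_norm_eq_one hθ,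
    add_sub_cancel_right]

theorem toNull_ofNull (F : NullChart n → ℝ) {p : NullChart n} (hr : 0 < p.2.1)
    (hy : p.2.2 ≠ 0) : toNull (ofNull F) p = F (p.1, p.2.1, dir p.2.2) :=
  ofNull_nullPoint F hr (norm_dir hy)

theorem contDiff_spatial {m : ℕ∞ω} : ContDiff ℝ m (spatial : Spacetime n → Space n) := by
  unfold spatial
  have : ContDiff ℝ m (fun x : Spacetime n => fun i : Fin n => x i.succ) := by fun_prop
  exact (PiLp.contDiff_toLp (p := 2)).comp this

theorem contDiffAt_chartPoint {p : NullChart n} (hy : p.2.2 ≠ 0) {m : ℕ∞ω} :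
    ContDiffAt ℝ m (chartPoint : NullChart n → Spacetime n) p := by
  rw [contDiffAt_pi]
  have h1 : ContDiffAt ℝ m (fun p : NullChart n => p.2.1) p := by fun_prop
  have h2 : ContDiffAt ℝ m (fun p : NullChart n => p.2.2) p := by fun_prop
  intro μ
  refine Fin.cases ?_ (fun i => ?_) μ
  · exact contDiffAt_fst.add h1
  · exact h1.mul (ContDiffAt.comp p (g := fun y : Space n => dir y i)
      (contDiffAt_dir_apply (m := m) hy i) h2)

theorem ContDiffAt.toNull {f : Spacetime n → ℝ} {p : NullChart n} {m : ℕ∞ω}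
    (hf : ContDiffAt ℝ m f (chartPoint p)) (hy : p.2.2 ≠ 0) : ContDiffAt ℝ m (toNull f) p :=
  ContDiffAt.comp p hf (contDiffAt_chartPoint hy)

theorem ContDiffAt.ofNull {F : NullChart n → ℝ} {x : Spacetime n} {m : ℕ∞ω}
    (hF : ContDiffAt ℝ m F (x 0 - ‖spatial x‖, ‖spatial x‖, dir (spatial x)))
    (hx : spatial x ≠ 0) : ContDiffAt ℝ m (ofNull F) x := by
  have h1 : ContDiffAt ℝ m (fun x : Spacetime n => ‖spatial x‖) x :=
    ContDiffAt.comp x (contDiffAt_norm_space hx) contDiff_spatial.contDiffAt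
  have h2 : ContDiffAt ℝ m (fun x : Spacetime n => dir (spatial x)) x :=
    ContDiffAt.comp x (g := dir) (contDiffAt_dir hx) contDiff_spatial.contDiffAt
  have h3 : ContDiffAt ℝ m (fun x : Spacetime n => x 0) x := by fun_prop
  exact ContDiffAt.comp x (f := fun x : Spacetime n =>
    ((x 0 - ‖spatial x‖, ‖spatial x‖, dir (spatial x)) : NullChart n)) hF
    ((h3.sub h1).prodMk (h1.prodMk h2))

/-- The inertial partial derivatives in the null chart. -/
def npd (μ : Fin (n + 1)) (F : NullChart n → ℝ) (p : NullChart n) : ℝ :=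
  Fin.cases (dd none F p) (fun i => dir p.2.2 i * (dd (some none) F p - dd none F p)
    + p.2.1⁻¹ * ‖p.2.2‖ * dd (some (some i)) F p) μ

theorem npd_zero (F : NullChart n → ℝ) : npd 0 F = dd none F := rfl

theorem npd_succ (i : Fin n) (F : NullChart n → ℝ) :
    npd i.succ F = fun p => dir p.2.2 i * (dd (some none) F p - dd none F p)
    + p.2.1⁻¹ * ‖p.2.2‖ * dd (some (some i)) F p := rfl

theorem fderiv_chartPoint {p : NullChart n} (hy : p.2.2 ≠ 0) (v : NullChart n) :
    fderiv ℝ chartPoint p v = Matrix.vecCons (v.1 + v.2.1) fun i =>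
      v.2.1 * dir p.2.2 i + p.2.1 * fderiv ℝ (dir : Space n → Space n) p.2.2 v.2.2 i := by
  have hd : DifferentiableAt ℝ (chartPoint : NullChart n → Spacetime n) p :=
    (contDiffAt_chartPoint (m := 1) hy).differentiableAt (by simp)
  have h1 : HasFDerivAt (fun p : NullChart n => p.2.1)
      ((ContinuousLinearMap.fst ℝ ℝ (Space n)).comp (ContinuousLinearMap.snd ℝ ℝ _)) p :=
    hasFDerivAt_fst.comp p hasFDerivAt_snd
  have h2 : HasFDerivAt (fun p : NullChart n => p.2.2)
      ((ContinuousLinearMap.snd ℝ ℝ (Space n)).comp (ContinuousLinearMap.snd ℝ ℝ _)) p :=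
    hasFDerivAt_snd.comp p hasFDerivAt_snd
  have h3 : HasFDerivAt (dir : Space n → Space n) (fderiv ℝ (dir : Space n → Space n) p.2.2) p.2.2 :=
    ((contDiffAt_dir (m := 1) hy).differentiableAt (by simp)).hasFDerivAt
  funext μ
  rw [show fderiv ℝ chartPoint p v μ = fderiv ℝ (fun x => chartPoint x μ) p v from
    (congrArg (fun L => L v) (hasFDerivAt_pi'.1 hd.hasFDerivAt μ).fderiv).symm]
  refine Fin.cases ?_ (fun i => ?_) μ
  · have : (fun x : NullChart n => chartPoint x 0) = fun p => p.1 + p.2.1 := rfl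
    rw [this, (hasFDerivAt_fst.fun_add h1).fderiv]
    rfl
  · have h4 : HasFDerivAt (fun x : NullChart n => dir x.2.2 i) _ p :=
      (EuclideanSpace.proj (𝕜 := ℝ) i).hasFDerivAt.comp p (HasFDerivAt.comp p (g := dir) h3 h2)
    have : (fun x : NullChart n => chartPoint x i.succ) = fun p => p.2.1 * dir p.2.2 i := rfl
    rw [this, (h1.fun_mul h4).fderiv]
    simp
    ring

/-- By the chain rule it suffices that the combination of u-, r- and y-vectors occurring in `npd` is
mapped by the derivative of `chartPoint` to the inertial basis vector. -/
theorem toNull_pd {f : Spacetime n → ℝ} {p : NullChart n} (hr : 0 < p.2.1) (hy : p.2.2 ≠ 0)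
    (hf : DifferentiableAt ℝ f (chartPoint p)) (μ : Fin (n + 1)) :
    toNull (pd μ f) p = npd μ (toNull f) p := by
  have hd : DifferentiableAt ℝ (chartPoint : NullChart n → Spacetime n) p :=
    (contDiffAt_chartPoint (m := 1) hy).differentiableAt (by simp)
  have hn := norm_ne_zero_iff.2 hy
  have h1 : ∀ v : Slot n, dd v (toNull f) p = fderiv ℝ f (chartPoint p)
      (fderiv ℝ chartPoint p v.vec) := fun v => by
    have : toNull f = f ∘ chartPoint := rfl
    rw [dd, this, fderiv_comp p hf hd]
    rfl
  refine Fin.cases ?_ (fun i => ?_) μ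
  · rw [npd_zero, h1, fderiv_chartPoint hy]
    simp only [toNull, pd, Slot.vec]
    congr 1
    funext ν
    refine Fin.cases ?_ (fun j => ?_) ν <;> simp
  · rw [npd_succ]
    simp only [h1, fderiv_chartPoint hy]
    rw [← map_sub, ← smul_eq_mul, ← smul_eq_mul (p.2.1⁻¹ * ‖p.2.2‖), ← map_smul, ← map_smul,
      ← map_add]
    simp only [toNull, pd]
    congr 1
    funext ν
    refine Fin.cases ?_ (fun j => ?_) ν
    · simp [Slot.vec]
    · simp only [Slot.vec, Pi.add_apply, Pi.smul_apply, Pi.sub_apply, smul_eq_mul,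
        Matrix.cons_val_succ, fderiv_dir_single hy]
      simp [Pi.single_apply]
      field_simp
      simp

theorem eventually_ne_of_pos {p : NullChart n} (hr : 0 < p.2.1) (hy : p.2.2 ≠ 0) :
    ∀ᶠ q in 𝓝 p, 0 < q.2.1 ∧ q.2.2 ≠ 0 := by
  have h1 : ContinuousAt (fun q : NullChart n => q.2.1) p := by fun_prop
  have h2 : ContinuousAt (fun q : NullChart n => q.2.2) p := by fun_prop
  exact (h1.eventually (lt_mem_nhds hr)).and (h2.eventually_ne hy)

theorem toNull_pd_eventuallyEq {f : Spacetime n → ℝ} {p : NullChart n} (hr : 0 < p.2.1)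
    (hy : p.2.2 ≠ 0) (hf : ContDiffAt ℝ ∞ f (chartPoint p)) (μ : Fin (n + 1)) :
    toNull (pd μ f) =ᶠ[𝓝 p] npd μ (toNull f) := by
  have hc : ContinuousAt (chartPoint : NullChart n → Spacetime n) p :=
    (contDiffAt_chartPoint (m := 0) hy).continuousAt
  filter_upwards [eventually_ne_of_pos hr hy, hc.eventually hf.eventually_differentiableAt]
    with q h1 h2
  exact toNull_pd h1.1 h1.2 h2 μ

theorem ContDiffAt.pd {f : Spacetime n → ℝ} {x : Spacetime n} (hf : ContDiffAt ℝ ∞ f x)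
    (μ : Fin (n + 1)) : ContDiffAt ℝ ∞ (pd μ f) x :=
  hf.contDiffAt_fderiv_apply _

/-! ### Coefficients: functions of `u` and the direction -/

/-- Smooth functions of `u` and the direction, extended homogeneously. -/
structure IsCoef (c : ℝ × Space n → ℝ) : Prop where
  smooth : ∀ q, q.2 ≠ 0 → ContDiffAt ℝ ∞ c q
  homog : ∀ q, q.2 ≠ 0 → ∀ t : ℝ, 0 < t → c (q.1, t • q.2) = c q

/-- The `u` derivative of a coefficient. -/
def dU (c : ℝ × Space n → ℝ) (q : ℝ × Space n) : ℝ := fderiv ℝ c q (1, 0)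

/-- The angular derivatives of a coefficient, in inertial components. -/
def dY (i : Fin n) (c : ℝ × Space n → ℝ) (q : ℝ × Space n) : ℝ :=
  ‖q.2‖ * fderiv ℝ c q (0, EuclideanSpace.single i 1)

def hatY (i : Fin n) (q : ℝ × Space n) : ℝ := dir q.2 i

theorem isOpen_snd_ne : IsOpen {q : ℝ × Space n | q.2 ≠ 0} :=
  isOpen_ne.preimage continuous_snd

theorem eventually_snd_ne {q : ℝ × Space n} (hq : q.2 ≠ 0) : ∀ᶠ x in 𝓝 q, x.2 ≠ 0 :=
  isOpen_snd_ne.mem_nhds hq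

theorem dU_congr {c c' : ℝ × Space n → ℝ} (h : ∀ q, q.2 ≠ 0 → c q = c' q) {q : ℝ × Space n}
    (hq : q.2 ≠ 0) : dU c q = dU c' q := by
  rw [dU, dU, Filter.EventuallyEq.fderiv_eq ((eventually_snd_ne hq).mono h)]

theorem dY_congr {c c' : ℝ × Space n → ℝ} (h : ∀ q, q.2 ≠ 0 → c q = c' q) (i : Fin n)
    {q : ℝ × Space n} (hq : q.2 ≠ 0) : dY i c q = dY i c' q := by
  rw [dY, dY, Filter.EventuallyEq.fderiv_eq ((eventually_snd_ne hq).mono h)]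

def dilation (n : ℕ) (t : ℝ) : ℝ × Space n →L[ℝ] ℝ × Space n :=
  (ContinuousLinearMap.fst ℝ ℝ (Space n)).prod (t • ContinuousLinearMap.snd ℝ ℝ (Space n))

namespace IsCoef

variable {c c' : ℝ × Space n → ℝ}

theorem differentiableAt (hc : IsCoef c) {q : ℝ × Space n} (hq : q.2 ≠ 0) :
    DifferentiableAt ℝ c q := (hc.smooth q hq).differentiableAt (by simp)

/-- Invariance under dilations of y, differentiated. It is what makes derivatives of coefficients,
rescaled by ‖y‖, coefficients again. -/
theorem fderiv_dilation (hc : IsCoef c) {q : ℝ × Space n} (hq : q.2 ≠ 0) {t : ℝ} (ht : 0 < t) :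
    (fderiv ℝ c (q.1, t • q.2)).comp (dilation n t) = fderiv ℝ c q := by
  have h1 : (c ∘ dilation n t) =ᶠ[𝓝 q] c :=
    (eventually_snd_ne hq).mono fun x hx => hc.homog x hx t ht
  have h2 : DifferentiableAt ℝ c (dilation n t q) :=
    hc.differentiableAt (q := (q.1, t • q.2)) (smul_ne_zero ht.ne' hq)
  rw [← h1.fderiv_eq, fderiv_comp q h2 (dilation n t).differentiableAt,
    (dilation n t).fderiv]
  rfl

/-- Euler's relation in degree zero. -/
theorem fderiv_radial (hc : IsCoef c) {q : ℝ × Space n} (hq : q.2 ≠ 0) :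
    fderiv ℝ c q (0, q.2) = 0 := by
  have h1 : HasDerivAt (fun t : ℝ => (q.1, t • q.2)) ((0, q.2) : ℝ × Space n) 1 := by
    have := (hasDerivAt_id (1 : ℝ)).smul_const q.2
    simp only [one_smul] at this
    exact (hasDerivAt_const _ _).prodMk this
  have h3 : HasFDerivAt c (fderiv ℝ c q) ((1 : ℝ) • q) := by
    rw [one_smul]; exact (hc.differentiableAt hq).hasFDerivAt
  have h2 : HasDerivAt (fun t : ℝ => c (q.1, t • q.2)) (fderiv ℝ c q (0, q.2)) 1 := by
    refine HasFDerivAt.comp_hasDerivAt (1 : ℝ) ?_ h1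
    simpa using h3
  have h4 : (fun t : ℝ => c (q.1, t • q.2)) =ᶠ[𝓝 1] fun _ => c q :=
    (lt_mem_nhds (by norm_num : (0:ℝ) < 1)).mono fun t ht => hc.homog q hq t ht
  exact h2.unique ((hasDerivAt_const _ _).congr_of_eventuallyEq h4)

theorem sum_dir_mul_dY (hc : IsCoef c) {q : ℝ × Space n} (hq : q.2 ≠ 0) :
    ∑ i, hatY i q * dY i c q = 0 := by
  have hn := norm_ne_zero_iff.2 hq
  have h1 : ∑ i, (q.2 i) • ((0 : ℝ), (EuclideanSpace.single i 1 : Space n)) = (0, q.2) := by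
    refine Prod.ext (by simp [Prod.fst_sum]) ?_
    ext j
    simp [Prod.snd_sum, Pi.single_apply]
  have h2 := hc.fderiv_radial hq
  rw [← h1, map_sum] at h2
  rw [← h2]
  refine Finset.sum_congr rfl fun i _ => ?_
  rw [map_smul, hatY, dY, dir]
  simp only [PiLp.smul_apply, smul_eq_mul]
  field_simp

theorem const (a : ℝ) : IsCoef (fun _ : ℝ × Space n => a) :=
  ⟨fun _ _ => contDiffAt_const, fun _ _ _ _ => rfl⟩

theorem add (hc : IsCoef c) (hc' : IsCoef c') : IsCoef (fun q => c q + c' q) :=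
  ⟨fun q hq => (hc.smooth q hq).add (hc'.smooth q hq), fun q hq t ht => by
    simp only [hc.homog q hq t ht, hc'.homog q hq t ht]⟩

theorem mul (hc : IsCoef c) (hc' : IsCoef c') : IsCoef (fun q => c q * c' q) :=
  ⟨fun q hq => (hc.smooth q hq).mul (hc'.smooth q hq), fun q hq t ht => by
    simp only [hc.homog q hq t ht, hc'.homog q hq t ht]⟩

theorem const_mul (a : ℝ) (hc : IsCoef c) : IsCoef (fun q => a * c q) := (const a).mul hc

theorem neg (hc : IsCoef c) : IsCoef (fun q => -c q) := by
  simpa using hc.const_mul (-1)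

theorem sub (hc : IsCoef c) (hc' : IsCoef c') : IsCoef (fun q => c q - c' q) := by
  simpa [sub_eq_add_neg] using hc.add hc'.neg

theorem sum {ι : Type*} (s : Finset ι) {c : ι → ℝ × Space n → ℝ} (hc : ∀ i ∈ s, IsCoef (c i)) :
    IsCoef (fun q => ∑ i ∈ s, c i q) :=
  ⟨fun q hq => ContDiffAt.sum fun i hi => (hc i hi).smooth q hq, fun q hq t ht =>
    Finset.sum_congr rfl fun i hi => (hc i hi).homog q hq t ht⟩

theorem congr (hc : IsCoef c) (h : ∀ q, q.2 ≠ 0 → c q = c' q) : IsCoef c' :=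
  ⟨fun q hq => (hc.smooth q hq).congr_of_eventuallyEq
    ((eventually_snd_ne hq).mono fun x hx => (h x hx).symm), fun q hq t ht => by
    rw [← h q hq, ← hc.homog q hq t ht, h (q.1, t • q.2) (smul_ne_zero ht.ne' hq)]⟩

theorem hatY (i : Fin n) : IsCoef (hatY i) :=
  ⟨fun q hq => ContDiffAt.comp q (g := fun y : Space n => dir y i) (contDiffAt_dir_apply hq i)
    contDiffAt_snd, fun q _ t ht => by simp only [_root_.hatY, dir_smul ht]⟩

theorem dU (hc : IsCoef c) : IsCoef (dU c) :=
  ⟨fun q hq => (hc.smooth q hq).contDiffAt_fderiv_apply _, fun q hq t ht => by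
    rw [_root_.dU, _root_.dU, ← hc.fderiv_dilation hq ht]
    simp [dilation]⟩

theorem dY (hc : IsCoef c) (i : Fin n) : IsCoef (dY i c) :=
  ⟨fun q hq => (ContDiffAt.comp q (g := fun y : Space n => ‖y‖) (contDiffAt_norm_space hq)
    contDiffAt_snd).mul ((hc.smooth q hq).contDiffAt_fderiv_apply _), fun q hq t ht => by
    rw [_root_.dY, _root_.dY, ← hc.fderiv_dilation hq ht]
    simp only [dilation, ContinuousLinearMap.comp_apply, ContinuousLinearMap.prod_apply,
      smul_apply, ContinuousLinearMap.coe_fst', ContinuousLinearMap.coe_snd',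
      norm_smul, Real.norm_eq_abs, abs_of_pos ht]
    rw [show ((0 : ℝ), t • (EuclideanSpace.single i 1 : Space n)) = t • ((0 : ℝ),
      (EuclideanSpace.single i 1 : Space n)) by simp, map_smul, smul_eq_mul]
    ring⟩

theorem dU_dY (hc : IsCoef c) (i : Fin n) {q : ℝ × Space n} (hq : q.2 ≠ 0) :
    _root_.dU (_root_.dY i c) q = _root_.dY i (_root_.dU c) q := by
  have h1 : DifferentiableAt ℝ (fun q : ℝ × Space n => ‖q.2‖) q :=
    (ContDiffAt.comp q (g := fun y : Space n => ‖y‖) (contDiffAt_norm_space (m := 1) hq)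
      contDiffAt_snd).differentiableAt (by simp)
  have h2 := ((hc.smooth q hq).contDiffAt_fderiv_apply
    (0, EuclideanSpace.single i 1)).differentiableAt (by simp)
  have h3 := ((hc.smooth q hq).fderiv_fderiv_comm (1, 0)
    (0, EuclideanSpace.single i 1)).self_of_nhds
  have h4 : fderiv ℝ (fun q : ℝ × Space n => ‖q.2‖) q (1, 0) = 0 := by
    have h5 : HasFDerivAt (fun q : ℝ × Space n => ‖q.2‖) _ q :=
      HasFDerivAt.comp q (g := fun y : Space n => ‖y‖) (((contDiffAt_norm_space
        (m := 1) hq).differentiableAt (by simp)).hasFDerivAt) hasFDerivAt_snd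
    rw [h5.fderiv]; simp
  unfold _root_.dU _root_.dY
  rw [fderiv_fun_mul h1 h2]
  simp only [add_apply, smul_apply, smul_eq_mul, h4, mul_zero, add_zero]
  exact congrArg _ h3

end IsCoef

/-! ### Sum and product rules for derivatives of coefficients -/

section CoefRules

variable {c c' : ℝ × Space n → ℝ} {q : ℝ × Space n}

theorem dU_add (hc : IsCoef c) (hc' : IsCoef c') (hq : q.2 ≠ 0) :
    dU (fun q => c q + c' q) q = dU c q + dU c' q := by
  rw [dU, fderiv_fun_add (hc.differentiableAt hq) (hc'.differentiableAt hq)]; rfl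

theorem dY_add (i : Fin n) (hc : IsCoef c) (hc' : IsCoef c') (hq : q.2 ≠ 0) :
    dY i (fun q => c q + c' q) q = dY i c q + dY i c' q := by
  rw [dY, fderiv_fun_add (hc.differentiableAt hq) (hc'.differentiableAt hq), dY, dY, ← mul_add]
  rfl

theorem dU_mul (hc : IsCoef c) (hc' : IsCoef c') (hq : q.2 ≠ 0) :
    dU (fun q => c q * c' q) q = c q * dU c' q + c' q * dU c q := by
  rw [dU, fderiv_fun_mul (hc.differentiableAt hq) (hc'.differentiableAt hq)]; rfl

theorem dY_mul (i : Fin n) (hc : IsCoef c) (hc' : IsCoef c') (hq : q.2 ≠ 0) :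
    dY i (fun q => c q * c' q) q = c q * dY i c' q + c' q * dY i c q := by
  rw [dY, fderiv_fun_mul (hc.differentiableAt hq) (hc'.differentiableAt hq), dY, dY]
  simp
  ring

theorem dU_const (a : ℝ) : dU (fun _ : ℝ × Space n => a) q = 0 := by simp [dU]

theorem dY_const (i : Fin n) (a : ℝ) : dY i (fun _ : ℝ × Space n => a) q = 0 := by simp [dY]

theorem dU_const_mul (a : ℝ) (hc : IsCoef c) (hq : q.2 ≠ 0) :
    dU (fun q => a * c q) q = a * dU c q := by
  rw [dU_mul (IsCoef.const a) hc hq, dU_const, mul_zero, add_zero]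

theorem dY_const_mul (i : Fin n) (a : ℝ) (hc : IsCoef c) (hq : q.2 ≠ 0) :
    dY i (fun q => a * c q) q = a * dY i c q := by
  rw [dY_mul i (IsCoef.const a) hc hq, dY_const, mul_zero, add_zero]

theorem dU_sum {ι : Type*} (s : Finset ι) {c : ι → ℝ × Space n → ℝ}
    (hc : ∀ i ∈ s, IsCoef (c i)) (hq : q.2 ≠ 0) :
    dU (fun q => ∑ i ∈ s, c i q) q = ∑ i ∈ s, dU (c i) q := by
  rw [dU, fderiv_fun_sum fun i hi => (hc i hi).differentiableAt hq]
  simp [dU]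

theorem dY_sum (j : Fin n) {ι : Type*} (s : Finset ι) {c : ι → ℝ × Space n → ℝ}
    (hc : ∀ i ∈ s, IsCoef (c i)) (hq : q.2 ≠ 0) :
    dY j (fun q => ∑ i ∈ s, c i q) q = ∑ i ∈ s, dY j (c i) q := by
  rw [dY, fderiv_fun_sum fun i hi => (hc i hi).differentiableAt hq]
  simp [dY, Finset.mul_sum]

theorem fderiv_hatY (i : Fin n) (hq : q.2 ≠ 0) (v : ℝ × Space n) :
    fderiv ℝ (hatY i) q v = fderiv ℝ (dir : Space n → Space n) q.2 v.2 i := by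
  have h3 : HasFDerivAt (dir : Space n → Space n) (fderiv ℝ (dir : Space n → Space n) q.2) q.2 :=
    ((contDiffAt_dir (m := 1) hq).differentiableAt (by simp)).hasFDerivAt
  have h4 : HasFDerivAt (fun x : ℝ × Space n => dir x.2 i) _ q :=
    (EuclideanSpace.proj (𝕜 := ℝ) i).hasFDerivAt.comp q
      (HasFDerivAt.comp q (g := dir) h3 hasFDerivAt_snd)
  have : (hatY i : ℝ × Space n → ℝ) = fun x => dir x.2 i := rfl
  rw [this, h4.fderiv]
  rfl

theorem dU_hatY (i : Fin n) (hq : q.2 ≠ 0) : dU (hatY i) q = 0 := by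
  rw [dU, fderiv_hatY i hq]; simp

/-- This is the orthogonal projection onto the tangent space of the sphere, the derivative of its
inclusion. -/
theorem dY_hatY (i j : Fin n) (hq : q.2 ≠ 0) :
    dY i (hatY j) q = (if i = j then 1 else 0) - hatY i q * hatY j q := by
  rw [dY, fderiv_hatY j hq, fderiv_dir_single hq]
  have hn := norm_ne_zero_iff.2 hq
  simp only [PiLp.smul_apply, PiLp.sub_apply, smul_eq_mul, hatY]
  rw [← mul_assoc, mul_inv_cancel₀ hn, one_mul]
  simp [eq_comm]

end CoefRules

/-! ### Lifts of coefficients and powers of the radius -/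

def lift (c : ℝ × Space n → ℝ) (p : NullChart n) : ℝ := c (p.1, p.2.2)

theorem contDiffAt_lift {c : ℝ × Space n → ℝ} {p : NullChart n} {m : ℕ∞ω}
    (hc : ContDiffAt ℝ m c (p.1, p.2.2)) : ContDiffAt ℝ m (lift c) p :=
  ContDiffAt.comp p (f := fun p : NullChart n => ((p.1, p.2.2) : ℝ × Space n)) hc (by fun_prop)

theorem fderiv_lift {c : ℝ × Space n → ℝ} {p : NullChart n}
    (hc : DifferentiableAt ℝ c (p.1, p.2.2)) (v : NullChart n) :
    fderiv ℝ (lift c) p v = fderiv ℝ c (p.1, p.2.2) (v.1, v.2.2) := by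
  have h2 : HasFDerivAt (fun p : NullChart n => ((p.1, p.2.2) : ℝ × Space n))
      ((ContinuousLinearMap.fst ℝ ℝ (ℝ × Space n)).prod
        ((ContinuousLinearMap.snd ℝ ℝ (Space n)).comp (ContinuousLinearMap.snd ℝ ℝ _))) p :=
    hasFDerivAt_fst.prodMk (hasFDerivAt_snd.comp p hasFDerivAt_snd)
  have h3 : HasFDerivAt (lift c) _ p := HasFDerivAt.comp p (g := c) hc.hasFDerivAt h2
  rw [h3.fderiv]
  rfl

theorem eventually_dd_lift {c : ℝ × Space n → ℝ} (hc : ∀ q, q.2 ≠ 0 → ContDiffAt ℝ ∞ c q)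
    {p : NullChart n} (hy : p.2.2 ≠ 0) (v : Slot n) :
    dd v (lift c) =ᶠ[𝓝 p] lift fun q => fderiv ℝ c q (v.vec.1, v.vec.2.2) := by
  have h2 : ContinuousAt (fun q : NullChart n => q.2.2) p := by fun_prop
  filter_upwards [h2.eventually_ne hy] with x hx
  exact fderiv_lift ((hc (x.1, x.2.2) hx).differentiableAt (by simp)) _

/-- A lift has no radial derivative and the other derivatives have weight zero, so the jet is
controlled by a function of u and y alone. Continuity of that function is recorded for compactness
arguments. -/
theorem exists_jet_lift_le (m : ℕ) {c : ℝ × Space n → ℝ}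
    (hc : ∀ q, q.2 ≠ 0 → ContDiffAt ℝ ∞ c q) :
    ∃ K : ℝ × Space n → ℝ, (∀ q, q.2 ≠ 0 → ContinuousAt K q) ∧
      ∀ p : NullChart n, 0 < p.2.1 → p.2.2 ≠ 0 → jet m 0 (lift c) p ≤ K (p.1, p.2.2) := by
  induction m generalizing c with
  | zero =>
    refine ⟨fun q => |c q|, fun q hq => (hc q hq).continuousAt.abs, fun p _ _ => ?_⟩
    simp [jet, lift]
  | succ m ih =>
    have h1 : ∀ v : Slot n, ∃ K : ℝ × Space n → ℝ, (∀ q, q.2 ≠ 0 → ContinuousAt K q) ∧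
        ∀ p : NullChart n, 0 < p.2.1 → p.2.2 ≠ 0 →
          jet m (0 + v.wt) (dd v (lift c)) p ≤ K (p.1, p.2.2) := fun v => by
      rcases v with _ | _ | i
      case some.none =>
        refine ⟨0, fun _ _ => continuousAt_const, fun p hp hy => ?_⟩
        rw [jet_congr (eventually_dd_lift hc hy _)]
        have : (lift fun q => fderiv ℝ c q ((Slot.vec (n := n) (some none)).1,
            (Slot.vec (n := n) (some none)).2.2)) = 0 := by
          funext p
          simp only [lift, Slot.vec, Pi.zero_apply]
          exact map_zero _
        rw [this, jet_zero]
        rfl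
      all_goals
        obtain ⟨K, hK, hK2⟩ := ih (fun q hq => (hc q hq).contDiffAt_fderiv_apply
          ((Slot.vec (n := n) _).1, (Slot.vec (n := n) _).2.2))
        refine ⟨K, hK, fun p hp hy => ?_⟩
        rw [jet_congr (eventually_dd_lift hc hy _)]
        simp only [Slot.wt, add_zero]
        exact hK2 p hp hy
    choose K hK hK2 using h1
    refine ⟨fun q => |c q| + ∑ v, K v q, fun q hq => ?_, fun p hp hy => ?_⟩
    · exact (hc q hq).continuousAt.abs.add (tendsto_finsetSum _ fun v _ => hK v q hq)
    · have h2 : |lift c p| * p.2.1 ^ (0:ℝ) = |c (p.1, p.2.2)| := by simp [lift]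
      simp only [jet, h2]
      exact add_le_add le_rfl (Finset.sum_le_sum fun v _ => hK2 v p hp hy)

/-- The product of a bounded interval in u and the unit sphere is compact. -/
theorem exists_jet_lift_bound (m : ℕ) {c : ℝ × Space n → ℝ}
    (hc : ∀ q, q.2 ≠ 0 → ContDiffAt ℝ ∞ c q) (a b : ℝ) : ∃ C : ℝ, ∀ p : NullChart n,
      0 < p.2.1 → p.1 ∈ Icc a b → ‖p.2.2‖ = 1 → jet m 0 (lift c) p ≤ C := by
  obtain ⟨K, hK, hK2⟩ := exists_jet_lift_le m hc
  have h1 : IsCompact (Icc a b ×ˢ Metric.sphere (0 : Space n) 1) :=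
    isCompact_Icc.prod (isCompact_sphere _ _)
  obtain ⟨C, hC⟩ := h1.bddAbove_image (f := K) fun q hq => (hK q (ne_zero_of_norm_eq_one
    (by simpa using hq.2))).continuousWithinAt
  refine ⟨C, fun p hp hu hy => (hK2 p hp (ne_zero_of_norm_eq_one hy)).trans ?_⟩
  exact hC ⟨(p.1, p.2.2), ⟨hu, by simpa using hy⟩, rfl⟩

theorem isOScri_lift {c : ℝ × Space n → ℝ} (hc : ∀ q, q.2 ≠ 0 → ContDiffAt ℝ ∞ c q) :
    IsOScri (lift c) 0 where
  smooth a b := by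
    filter_upwards [eventually_scriOn_mem a b] with p hp
    exact contDiffAt_lift (hc _ (ne_zero_of_norm_eq_one hp.2))
  bound m a b := by
    obtain ⟨C, hC⟩ := exists_jet_lift_bound m hc a b
    refine ⟨C, ?_⟩
    filter_upwards [eventually_scriOn_mem a b, eventually_scriOn_gt a b 0] with p hp hp'
    exact hC p hp' hp.1 hp.2

/-- Powers of the radius. -/
def rpowR (n : ℕ) (β : ℝ) (p : NullChart n) : ℝ := p.2.1 ^ β

theorem contDiffAt_rpowR (β : ℝ) {p : NullChart n} (hp : 0 < p.2.1) {m : ℕ∞ω} :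
    ContDiffAt ℝ m (rpowR n β) p := by
  have h1 : ContDiffAt ℝ m (fun q : NullChart n => q.2.1) p := by fun_prop
  exact h1.rpow_const_of_ne hp.ne'

theorem eventually_dd_rpowR (β : ℝ) {p : NullChart n} (hp : 0 < p.2.1) (v : Slot n) :
    dd v (rpowR n β) =ᶠ[𝓝 p] fun q => (v.wt * β) * rpowR n (β - 1) q := by
  have h1 : ContinuousAt (fun q : NullChart n => q.2.1) p := by fun_prop
  filter_upwards [h1.eventually (lt_mem_nhds hp)] with q hq
  have h2 : HasFDerivAt (fun p : NullChart n => p.2.1)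
      ((ContinuousLinearMap.fst ℝ ℝ (Space n)).comp (ContinuousLinearMap.snd ℝ ℝ _)) q :=
    hasFDerivAt_fst.comp q hasFDerivAt_snd
  have h3 : HasFDerivAt (rpowR n β) _ q := h2.rpow_const (Or.inl hq.ne')
  rw [dd, h3.fderiv]
  rcases v with _ | _ | i <;> simp [Slot.vec, Slot.wt, rpowR]

theorem exists_jet_rpowR_le (m : ℕ) (β : ℝ) : ∃ C : ℝ, ∀ p : NullChart n, 0 < p.2.1 →
    jet m (-β) (rpowR n β) p ≤ C := by
  induction m generalizing β with
  | zero =>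
    refine ⟨1, fun p hp => ?_⟩
    rw [jet, rpowR, abs_of_pos (Real.rpow_pos_of_pos hp _), ← Real.rpow_add hp]
    simp
  | succ m ih =>
    obtain ⟨C, hC⟩ := ih (β - 1)
    refine ⟨1 + ∑ v : Slot n, |v.wt * β| * C, fun p hp => ?_⟩
    rw [jet]
    refine add_le_add ?_ (Finset.sum_le_sum fun v _ => ?_)
    · rw [rpowR, abs_of_pos (Real.rpow_pos_of_pos hp _), ← Real.rpow_add hp]
      simp
    · rw [jet_congr (eventually_dd_rpowR β hp v), jet_const_mul]
      rcases v with _ | _ | i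
      · simp [Slot.wt]
      · have : -β + Slot.wt (n := n) (some none) = -(β - 1) := by simp [Slot.wt]; ring
        rw [this]
        gcongr
        exact hC p hp
      · simp [Slot.wt]

theorem isOScri_rpowR (β : ℝ) : IsOScri (rpowR n β) (-β) where
  smooth a b := (eventually_scriOn_gt a b 0).mono fun p hp => contDiffAt_rpowR β hp
  bound m a b := by
    obtain ⟨C, hC⟩ := exists_jet_rpowR_le (n := n) m β
    exact ⟨C, (eventually_scriOn_gt a b 0).mono fun p hp => hC p hp⟩

theorem eventually_scriOn_pos_ne (a b : ℝ) :
    ∀ᶠ p in scriOn n a b, 0 < p.2.1 ∧ p.2.2 ≠ 0 := by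
  filter_upwards [eventually_scriOn_gt a b 0, eventually_scriOn_mem a b] with p h1 h2
  exact ⟨h1, ne_zero_of_norm_eq_one h2.2⟩

theorem eqScri_of_forall {F G : NullChart n → ℝ}
    (h : ∀ p : NullChart n, 0 < p.2.1 → p.2.2 ≠ 0 → F p = G p) : EqScri F G := fun a b => by
  filter_upwards [eventually_scriOn_pos_ne a b] with p hp
  exact (eventually_ne_of_pos hp.1 hp.2).mono fun q hq => h q hq.1 hq.2

/-- The monomial `r^(-β) c(u, direction)`. -/
def mono (β : ℝ) (c : ℝ × Space n → ℝ) (p : NullChart n) : ℝ := p.2.1 ^ (-β) * c (p.1, p.2.2)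

theorem isOScri_mono (β : ℝ) {c : ℝ × Space n → ℝ} (hc : IsCoef c) : IsOScri (mono β c) β := by
  have := (isOScri_rpowR (n := n) (-β)).mul (isOScri_lift hc.smooth)
  rw [neg_neg, add_zero] at this
  exact this

theorem IsCoef.contDiffAt_mono (β : ℝ) {c : ℝ × Space n → ℝ} (hc : IsCoef c) {p : NullChart n}
    (hp : 0 < p.2.1) (hy : p.2.2 ≠ 0) : ContDiffAt ℝ ∞ (mono β c) p :=
  (contDiffAt_rpowR (-β) hp).mul (contDiffAt_lift (hc.smooth _ hy))

/-- No power is gained, because every inertial derivative contains the u-derivative in general. -/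
theorem IsOScri.npd {F : NullChart n → ℝ} {β : ℝ} (hF : IsOScri F β) (μ : Fin (n + 1)) :
    IsOScri (npd μ F) β := by
  have h0 : IsOScri (_root_.dd none F) β := by simpa [Slot.wt] using hF.dd none
  refine Fin.cases ?_ (fun i => ?_) μ
  · exact h0
  · have h1 : IsOScri (_root_.dd (some none) F) β :=
      (hF.dd (some none)).mono (by simp [Slot.wt])
    have h2 : IsOScri (_root_.dd (some (some i)) F) β := by
      simpa [Slot.wt] using hF.dd (some (some i))
    have h3 := (isOScri_lift (IsCoef.hatY i).smooth).mul (h1.sub h0)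
    have h5 : IsOScri (lift fun q : ℝ × Space n => ‖q.2‖) 0 := isOScri_lift fun q hq =>
      ContDiffAt.comp q (g := fun y : Space n => ‖y‖) (contDiffAt_norm_space hq) contDiffAt_snd
    have h4 := ((isOScri_rpowR (n := n) (-1)).mul h5).mul h2
    refine (h3.add (h4.mono (by simp) : IsOScri _ (0 + β))).congr ?_ |>.mono (by simp)
    refine eqScri_of_forall fun p hp hy => ?_
    simp [npd_succ, lift, _root_.hatY, rpowR, Real.rpow_neg_one]

theorem npd_add {F G : NullChart n → ℝ} {p : NullChart n} (hF : DifferentiableAt ℝ F p)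
    (hG : DifferentiableAt ℝ G p) (μ : Fin (n + 1)) :
    npd μ (fun p => F p + G p) p = npd μ F p + npd μ G p := by
  have h : ∀ v : Slot n, dd v (fun p => F p + G p) p = dd v F p + dd v G p := fun v => by
    rw [dd, fderiv_fun_add hF hG]; rfl
  refine Fin.cases ?_ (fun i => ?_) μ
  · exact h none
  · simp only [npd_succ, h]; ring

theorem npd_const_mul {F : NullChart n → ℝ} (a : ℝ) (μ : Fin (n + 1)) :
    npd μ (fun p => a * F p) = fun p => a * npd μ F p := by
  funext p
  refine Fin.cases ?_ (fun i => ?_) μ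
  · simp only [npd_zero, dd_const_mul]
  · simp only [npd_succ, dd_const_mul]; ring

theorem npd_sum {ι : Type*} (s : Finset ι) {F : ι → NullChart n → ℝ} {p : NullChart n}
    (hF : ∀ i ∈ s, DifferentiableAt ℝ (F i) p) (μ : Fin (n + 1)) :
    npd μ (fun p => ∑ i ∈ s, F i p) p = ∑ i ∈ s, npd μ (F i) p := by
  have h : ∀ v : Slot n, dd v (fun p => ∑ i ∈ s, F i p) p = ∑ i ∈ s, dd v (F i) p := fun v => by
    rw [dd, fderiv_fun_sum hF]; simp [dd]
  refine Fin.cases ?_ (fun i => ?_) μ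
  · exact h none
  · simp only [npd_succ, h, Finset.mul_sum, Finset.sum_add_distrib, ← Finset.sum_sub_distrib]

/-- The components of `du`. -/
def ell (μ : Fin (n + 1)) (q : ℝ × Space n) : ℝ := Fin.cases 1 (fun i => -hatY i q) μ

/-- The action of the inertial derivatives on the coefficient of `r^(-β)`, in the direction of
the cone and relative to `r^(-β-1)`. -/
def dC (β : ℝ) (μ : Fin (n + 1)) (c : ℝ × Space n → ℝ) (q : ℝ × Space n) : ℝ :=
  Fin.cases 0 (fun i => -β * (hatY i q * c q) + dY i c q) μ

@[simp] theorem ell_zero (q : ℝ × Space n) : ell 0 q = 1 := rfl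

@[simp] theorem ell_succ (i : Fin n) (q : ℝ × Space n) : ell i.succ q = -hatY i q := rfl

@[simp] theorem dC_zero (β : ℝ) (c : ℝ × Space n → ℝ) (q : ℝ × Space n) : dC β 0 c q = 0 := rfl

@[simp] theorem dC_succ (β : ℝ) (i : Fin n) (c : ℝ × Space n → ℝ) (q : ℝ × Space n) :
    dC β i.succ c q = -β * (hatY i q * c q) + dY i c q := rfl

theorem isCoef_ell (μ : Fin (n + 1)) : IsCoef (ell μ : ℝ × Space n → ℝ) := by
  refine Fin.cases ?_ (fun i => ?_) μ
  · exact IsCoef.const 1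
  · exact (IsCoef.hatY i).neg

theorem IsCoef.dC {c : ℝ × Space n → ℝ} (hc : IsCoef c) (β : ℝ) (μ : Fin (n + 1)) :
    IsCoef (dC β μ c) := by
  refine Fin.cases ?_ (fun i => ?_) μ
  · exact IsCoef.const 0
  · exact (((IsCoef.hatY i).mul hc).const_mul (-β)).add (hc.dY i)

/-- Differentiation along du keeps the power of r; the radial and angular parts lower it by one. The
two terms are the only ones, which makes the action on series a two-term recursion. -/
theorem npd_mono (β : ℝ) {c : ℝ × Space n → ℝ} (hc : IsCoef c) (μ : Fin (n + 1))
    {p : NullChart n} (hp : 0 < p.2.1) (hy : p.2.2 ≠ 0) :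
    npd μ (mono β c) p = mono β (fun q => ell μ q * dU c q) p + mono (β + 1) (dC β μ c) p := by
  have h1 : ∀ v : Slot n, dd v (mono β c) p = p.2.1 ^ (-β) * dd v (lift c) p
      + c (p.1, p.2.2) * (v.wt * -β * p.2.1 ^ (-β - 1)) := fun v => by
    have e : mono β c = fun p => rpowR n (-β) p * lift c p := rfl
    rw [dd, e, fderiv_fun_mul ((contDiffAt_rpowR (m := 1) (-β) hp).differentiableAt (by simp))
      ((contDiffAt_lift (hc.smooth _ hy)).differentiableAt (by simp))]
    have := (eventually_dd_rpowR (-β) hp v).self_of_nhds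
    simp only [dd, rpowR] at this
    simp [this, dd, lift, rpowR]
  have h2 := fderiv_lift (p := p) (hc.differentiableAt (q := (p.1, p.2.2)) hy)
  refine Fin.cases ?_ (fun i => ?_) μ
  · rw [npd_zero, h1, dd, h2]
    simp [mono, Slot.vec, Slot.wt, dU]
  · have e1 : p.2.1 ^ (-(β + 1)) = p.2.1⁻¹ * p.2.1 ^ (-β) := by
      rw [show -(β + 1) = -1 + -β by ring, Real.rpow_add hp, Real.rpow_neg_one]
    have e2 : p.2.1 ^ (-β - 1) = p.2.1⁻¹ * p.2.1 ^ (-β) := by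
      rw [show -β - 1 = -1 + -β by ring, Real.rpow_add hp, Real.rpow_neg_one]
    have h0 : fderiv ℝ c (p.1, p.2.2) (0, 0) = 0 := map_zero _
    rw [npd_succ]
    simp only [h1, mono, e1, e2]
    simp only [dd, h2]
    simp [h0, Slot.vec, Slot.wt, dU, dY, hatY]
    ring

/-! ### Asymptotic series in half-integer steps -/

/-- The exponents `(d - 4 + j) / 2`; the ansatz for the metric starts at `j = 2`. -/
def pw (n j : ℕ) : ℝ := ((n : ℝ) - 3 + j) / 2

theorem pw_add_two (n j : ℕ) : pw n (j + 2) = pw n j + 1 := by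
  simp only [pw]; push_cast; ring

theorem pw_mono {i j : ℕ} (h : i ≤ j) : pw n i ≤ pw n j := by
  have : (i : ℝ) ≤ j := by exact_mod_cast h
  simp only [pw]; linarith

/-- The function `F` has the expansion `∑ⱼ r^(-pw n j) cⱼ(u, direction)`. -/
structure HasAsymp (F : NullChart n → ℝ) (c : ℕ → ℝ × Space n → ℝ) : Prop where
  coef : ∀ j, IsCoef (c j)
  rem : ∀ N, IsOScri (fun p => F p - ∑ j ∈ Finset.range N, mono (pw n j) (c j) p) (pw n N)

theorem isOScri_mono_of_vanish (β γ : ℝ) {c : ℝ × Space n → ℝ} (hc : ∀ q, q.2 ≠ 0 → c q = 0) :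
    IsOScri (mono β c) γ :=
  (IsOScri.zero γ).congr (eqScri_of_forall fun p _ hy => by
    simp [mono, hc (p.1, p.2.2) hy])

/-- Indices at least K contribute terms of the order of the remainder, and omitted indices below K
have vanishing coefficients. This permits sparse index sets in place of initial segments. -/
theorem isOScri_sum_sub_sum {c : ℕ → ℝ × Space n → ℝ} (hc : ∀ j, IsCoef (c j)) {K : ℕ}
    {s : Finset ℕ} (hs : ∀ i < K, i ∉ s → ∀ q, q.2 ≠ 0 → c i q = 0) :
    IsOScri (fun p => ∑ j ∈ s, mono (pw n j) (c j) p
      - ∑ j ∈ Finset.range K, mono (pw n j) (c j) p) (pw n K) := by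
  have h1 : IsOScri (fun p => ∑ j ∈ s \ Finset.range K, mono (pw n j) (c j) p) (pw n K) :=
    IsOScri.sum _ fun j hj => (isOScri_mono _ (hc j)).mono (pw_mono (by simp at hj; exact hj.2))
  have h2 : IsOScri (fun p => ∑ j ∈ Finset.range K \ s, mono (pw n j) (c j) p) (pw n K) :=
    IsOScri.sum _ fun j hj => isOScri_mono_of_vanish _ _ (by
      simp at hj; exact hs j hj.1 hj.2)
  convert h1.sub h2 using 1
  funext p
  exact (Finset.sum_sdiff_sub_sum_sdiff ..).symm

namespace HasAsymp

variable {F G : NullChart n → ℝ} {c c' : ℕ → ℝ × Space n → ℝ}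

/-- Truncations may be made over any convenient finite index set for each order of the remainder, as
long as no nonzero coefficient below that order is left out. -/
theorem of_finset (hc : ∀ j, IsCoef (c j)) (h : ∀ K, ∃ s : Finset ℕ,
    (∀ i < K, i ∉ s → ∀ q, q.2 ≠ 0 → c i q = 0) ∧
      IsOScri (fun p => F p - ∑ j ∈ s, mono (pw n j) (c j) p) (pw n K)) : HasAsymp F c := by
  refine ⟨hc, fun K => ?_⟩
  obtain ⟨s, hs, h1⟩ := h K
  convert h1.add (isOScri_sum_sub_sum hc hs) using 1
  funext p
  simp

theorem rem_finset (h : HasAsymp F c) {K : ℕ} {s : Finset ℕ}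
    (hs : ∀ i < K, i ∉ s → ∀ q, q.2 ≠ 0 → c i q = 0) :
    IsOScri (fun p => F p - ∑ j ∈ s, mono (pw n j) (c j) p) (pw n K) := by
  convert (h.rem K).sub (isOScri_sum_sub_sum h.coef hs) using 1
  funext p
  simp

theorem smooth (h : HasAsymp F c) (a b : ℝ) : ∀ᶠ p in scriOn n a b, ContDiffAt ℝ ∞ F p := by
  have := (h.rem 0).smooth a b
  simpa using this

theorem congr (h : HasAsymp F c) (hFG : EqScri F G) : HasAsymp G c :=
  ⟨h.coef, fun N => (h.rem N).congr fun a b => (hFG a b).mono fun _ hp =>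
    hp.mono fun _ hq => by simp only [hq]⟩

theorem congr_coef (h : HasAsymp F c) (hcc : ∀ j q, q.2 ≠ 0 → c j q = c' j q) : HasAsymp F c' :=
  ⟨fun j => (h.coef j).congr (hcc j), fun N => (h.rem N).congr (eqScri_of_forall fun p _ hy => by
    simp only [mono]
    congr 1
    exact Finset.sum_congr rfl fun j _ => by rw [hcc j (p.1, p.2.2) hy])⟩

theorem add (hF : HasAsymp F c) (hG : HasAsymp G c') :
    HasAsymp (fun p => F p + G p) fun j q => c j q + c' j q := by
  refine ⟨fun j => (hF.coef j).add (hG.coef j), fun N => ?_⟩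
  convert (hF.rem N).add (hG.rem N) using 1
  funext p
  simp only [mono, mul_add, Finset.sum_add_distrib, Pi.add_apply]
  ring

theorem const_mul (a : ℝ) (hF : HasAsymp F c) :
    HasAsymp (fun p => a * F p) fun j q => a * c j q := by
  refine ⟨fun j => (hF.coef j).const_mul a, fun N => ?_⟩
  convert (hF.rem N).const_mul a using 1
  funext p
  simp only [mono, mul_sub, Finset.mul_sum]
  congr 1
  exact Finset.sum_congr rfl fun j _ => by ring

theorem sub (hF : HasAsymp F c) (hG : HasAsymp G c') :
    HasAsymp (fun p => F p - G p) fun j q => c j q - c' j q := by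
  have := hF.add (hG.const_mul (-1))
  simpa [sub_eq_add_neg] using this

theorem zero : HasAsymp (fun _ : NullChart n => 0) fun _ _ => 0 :=
  ⟨fun _ => IsCoef.const 0, fun N => (IsOScri.zero (pw n N)).congr
    (eqScri_of_forall fun p _ _ => by simp [mono])⟩

theorem sum {ι : Type*} (s : Finset ι) {F : ι → NullChart n → ℝ}
    {c : ι → ℕ → ℝ × Space n → ℝ} (h : ∀ i ∈ s, HasAsymp (F i) (c i)) :
    HasAsymp (fun p => ∑ i ∈ s, F i p) fun j q => ∑ i ∈ s, c i j q := by
  classical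
  induction s using Finset.induction_on with
  | empty => simpa using zero
  | insert a s ha ih =>
    simp only [Finset.sum_insert ha]
    exact (h a (by simp)).add (ih fun i hi => h i (by simp [hi]))

theorem of_isOScri (h : ∀ β, IsOScri F β) : HasAsymp F fun _ _ => 0 :=
  ⟨fun _ => IsCoef.const 0, fun N => (h (pw n N)).congr
    (eqScri_of_forall fun p _ _ => by simp [mono])⟩

theorem isOScri_of_vanish (h : HasAsymp F c) (hc : ∀ j q, q.2 ≠ 0 → c j q = 0) (β : ℝ) :
    IsOScri F β := by
  obtain ⟨N, hN⟩ := exists_nat_ge (2 * β - n + 3)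
  have h1 := h.rem_finset (K := N) (s := ∅) fun i _ _ => hc i
  simp only [Finset.sum_empty, sub_zero] at h1
  refine h1.mono ?_
  simp only [pw]
  linarith

theorem of_mono {k : ℕ} {c : ℝ × Space n → ℝ} (hc : IsCoef c) :
    HasAsymp (mono (pw n k) c) fun j q => if j = k then c q else 0 := by
  have h1 : ∀ j, IsCoef fun q => if j = k then c q else 0 := fun j => by
    split_ifs
    · exact hc
    · exact IsCoef.const 0
  refine of_finset h1 fun K => ⟨{k}, fun i _ hi q _ => ?_, ?_⟩
  · simp at hi; simp [hi]
  · convert IsOScri.zero (pw n K) using 1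
    funext p; simp

/-- If all earlier coefficients vanish, the next term is its own remainder and so must decay faster
than its power of r allows unless its coefficient is zero. -/
theorem coef_eq_zero (h : HasAsymp (fun _ => 0) c) (j : ℕ) (q : ℝ × Space n) (hq : q.2 ≠ 0) :
    c j q = 0 := by
  induction j using Nat.strong_induction_on generalizing q with
  | _ j ih =>
    have h1 := h.rem_finset (K := j + 1) (s := {j}) fun i hi hij q hq => ih i (by
      simp at hij; omega) q hq
    simp only [Finset.sum_singleton, zero_sub] at h1
    obtain ⟨C, hC⟩ := h1.bound 0 q.1 q.1
    obtain ⟨R, hR⟩ := eventually_scriOn.1 (hC.and (eventually_scriOn_gt _ _ 0))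
    have h2 : c j q = c j (q.1, dir q.2) := by
      have := (h.coef j).homog q hq ‖q.2‖⁻¹ (inv_pos.2 (norm_pos_iff.2 hq))
      rw [← this]; rfl
    rw [h2]
    -- The half power is the gap between consecutive exponents; letting r → ∞ rules out a nonzero
    -- coefficient.
    have h3 : ∀ r > R, |c j (q.1, dir q.2)| * r ^ (1 / 2 : ℝ) ≤ C := fun r hr => by
      obtain ⟨h4, h5⟩ := hR r hr q.1 (by simp) (dir q.2) (norm_dir hq)
      have h5' : 0 < r := h5
      simp only [jet, mono, abs_neg, abs_mul] at h4
      rw [abs_of_pos (Real.rpow_pos_of_pos h5' _)] at h4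
      have e : r ^ pw n (j + 1) = r ^ (1 / 2 : ℝ) * r ^ pw n j := by
        rw [← Real.rpow_add h5']; congr 1; simp only [pw]; push_cast; ring
      have e2 : r ^ (-pw n j) * r ^ pw n j = 1 := by
        rw [← Real.rpow_add h5']; simp
      rw [e] at h4
      calc _ = r ^ (-pw n j) * |c j (q.1, dir q.2)| * (r ^ (1 / 2 : ℝ) * r ^ pw n j) := by
            linear_combination (-(|c j (q.1, dir q.2)| * r ^ (1 / 2 : ℝ))) * e2
        _ ≤ C := h4
    by_contra hne
    have h6 : Tendsto (fun r : ℝ => |c j (q.1, dir q.2)| * r ^ (1 / 2 : ℝ)) atTop atTop :=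
      (tendsto_rpow_atTop (by norm_num)).const_mul_atTop (abs_pos.2 hne)
    obtain ⟨r, hr1, hr2⟩ := ((h6.eventually_gt_atTop C).and (eventually_gt_atTop R)).exists
    exact absurd (h3 r hr2) (not_le.2 hr1)

theorem coef_unique (h : HasAsymp F c) (h' : HasAsymp F c') (j : ℕ) (q : ℝ × Space n)
    (hq : q.2 ≠ 0) : c j q = c' j q := by
  have := h.sub h'
  simp only [sub_self] at this
  linarith [this.coef_eq_zero j q hq]

end HasAsymp

/-- The coefficients of the derivative `∂_μ` of a series. -/
def pdCoef (μ : Fin (n + 1)) (c : ℕ → ℝ × Space n → ℝ) : ℕ → ℝ × Space n → ℝ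
  | 0 => fun q => ell μ q * dU (c 0) q
  | 1 => fun q => ell μ q * dU (c 1) q
  | j + 2 => fun q => ell μ q * dU (c (j + 2)) q + dC (pw n j) μ (c j) q

theorem isCoef_pdCoef {c : ℕ → ℝ × Space n → ℝ} (hc : ∀ j, IsCoef (c j)) (μ : Fin (n + 1))
    (j : ℕ) : IsCoef (pdCoef μ c j) := by
  rcases j with _ | _ | j
  · exact (isCoef_ell μ).mul (hc 0).dU
  · exact (isCoef_ell μ).mul (hc 1).dU
  · exact ((isCoef_ell μ).mul (hc _).dU).add ((hc j).dC _ μ)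

/-- The remainder is differentiated as a whole and the finite sum term by term. The terms that reach
past the truncation order are absorbed by `isOScri_sum_sub_sum`. -/
theorem HasAsymp.npd {F : NullChart n → ℝ} {c : ℕ → ℝ × Space n → ℝ} (h : HasAsymp F c)
    (μ : Fin (n + 1)) : HasAsymp (npd μ F) (pdCoef μ c) := by
  refine ⟨isCoef_pdCoef h.coef μ, fun N => ?_⟩
  have h1 := (h.rem N).npd μ
  have hA : ∀ j, IsCoef fun q => ell μ q * dU (c j) q := fun j => (isCoef_ell μ).mul (h.coef j).dU
  have hD : ∀ j, IsCoef (dC (pw n j) μ (c j)) := fun j => (h.coef j).dC _ μ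
  have h2 : EqScri (_root_.npd μ fun p => F p - ∑ j ∈ Finset.range N, mono (pw n j) (c j) p)
      (fun p => _root_.npd μ F p - ∑ j ∈ Finset.range N,
        (mono (pw n j) (fun q => ell μ q * dU (c j) q) p
          + mono (pw n (j + 2)) (dC (pw n j) μ (c j)) p)) := fun a b => by
    filter_upwards [h.smooth a b, eventually_scriOn_pos_ne a b] with p hp hp2
    filter_upwards [hp.eventually_differentiableAt, eventually_ne_of_pos hp2.1 hp2.2] with x h3 h4
    have hd : ∀ j, DifferentiableAt ℝ (mono (pw n j) (c j)) x := fun j =>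
      ((h.coef j).contDiffAt_mono _ h4.1 h4.2).differentiableAt (by simp)
    have h5 : (fun p => F p - ∑ j ∈ Finset.range N, mono (pw n j) (c j) p)
        = fun p => F p + (-1) * ∑ j ∈ Finset.range N, mono (pw n j) (c j) p := by
      funext p; ring
    have h6 : DifferentiableAt ℝ (fun p => ∑ j ∈ Finset.range N, mono (pw n j) (c j) p) x :=
      DifferentiableAt.fun_sum fun j _ => hd j
    rw [h5, npd_add h3 (h6.const_mul _), npd_const_mul]
    beta_reduce
    rw [npd_sum _ fun j _ => hd j]
    rw [Finset.sum_congr rfl fun j _ => npd_mono (pw n j) (h.coef j) μ h4.1 h4.2]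
    simp only [pw_add_two]
    ring
  -- One full power of 1/r is two half-integer steps, so the terms with a lowered power are shifted
  -- by two indices.
  have key : ∀ p, ∑ j ∈ Finset.range (N + 2), mono (pw n j) (pdCoef μ c j) p
      = ∑ j ∈ Finset.range (N + 2), mono (pw n j) (fun q => ell μ q * dU (c j) q) p
        + ∑ j ∈ Finset.range N, mono (pw n (j + 2)) (dC (pw n j) μ (c j)) p := fun p => by
    rw [Finset.sum_range_succ', Finset.sum_range_succ', Finset.sum_range_succ' _ (N + 1),
      Finset.sum_range_succ' _ N]
    simp only [pdCoef, mono, mul_add, Finset.sum_add_distrib]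
    ring
  have h3 : IsOScri (fun p => _root_.npd μ F p
      - ∑ j ∈ Finset.range (N + 2), mono (pw n j) (pdCoef μ c j) p) (pw n N) := by
    have h4 : IsOScri (fun p => ∑ j ∈ Finset.range (N + 2),
        mono (pw n j) (fun q => ell μ q * dU (c j) q) p
        - ∑ j ∈ Finset.range N, mono (pw n j) (fun q => ell μ q * dU (c j) q) p) (pw n N) :=
      isOScri_sum_sub_sum hA fun i hi hi2 => absurd (by simp; omega) hi2
    refine ((h1.congr h2).sub h4).congr (eqScri_of_forall fun p _ _ => ?_)
    simp only [Pi.sub_apply, key, Finset.sum_add_distrib]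
    ring
  have h4 : IsOScri (fun p => ∑ j ∈ Finset.range (N + 2), mono (pw n j) (pdCoef μ c j) p
        - ∑ j ∈ Finset.range N, mono (pw n j) (pdCoef μ c j) p) (pw n N) :=
      isOScri_sum_sub_sum (isCoef_pdCoef h.coef μ) fun i hi hi2 => absurd (by simp; omega) hi2
  convert h3.add h4 using 1
  funext p
  simp

/-! ### The wave equation with rapidly decreasing source -/

section Wave

open MeasureTheory FourierTransform LineDeriv
open scoped SchwartzMap

def slabInc (n : ℕ) : Space n →L[ℝ] Spacetime n :=
  ContinuousLinearMap.pi fun μ => Fin.cases 0 (fun i => EuclideanSpace.proj i) μ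

/-- The point with time `s` and position `y`. -/
def consPt (s : ℝ) (y : Space n) : Spacetime n := Pi.single 0 s + slabInc n y

@[simp] theorem consPt_zero (s : ℝ) (y : Space n) : consPt s y 0 = s := by
  simp [consPt, slabInc]

@[simp] theorem consPt_succ (s : ℝ) (y : Space n) (i : Fin n) : consPt s y i.succ = y i := by
  simp [consPt, slabInc]

theorem spatial_consPt (s : ℝ) (y : Space n) : spatial (consPt s y) = y := by
  ext i; simp [spatial]

theorem consPt_spatial (x : Spacetime n) : consPt (x 0) (spatial x) = x := by
  funext μ
  refine Fin.cases ?_ (fun i => ?_) μ <;> simp [spatial]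

def spatialCLM (n : ℕ) : Spacetime n →L[ℝ] Space n :=
  LinearMap.toContinuousLinearMap
    { toFun := spatial
      map_add' := fun _ _ => rfl
      map_smul' := fun _ _ => rfl }

theorem spatialCLM_apply (x : Spacetime n) : spatialCLM n x = spatial x := rfl

theorem exists_norm_spatial_le (n : ℕ) : ∃ A : ℝ, 1 ≤ A ∧ ∀ x : Spacetime n,
    ‖spatial x‖ ≤ A * ‖x‖ := by
  refine ⟨max 1 ‖spatialCLM n‖, le_max_left _ _, fun x => ?_⟩
  refine ((spatialCLM n).le_opNorm x).trans ?_
  gcongr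
  exact le_max_right _ _

theorem abs_le_norm_consPt (s : ℝ) (y : Space n) : |s| ≤ ‖consPt s y‖ := by
  have := norm_le_pi_norm (consPt s y) 0
  simpa using this

theorem consPt_hasTemperateGrowth (s : ℝ) :
    (consPt s : Space n → Spacetime n).HasTemperateGrowth :=
  (Function.HasTemperateGrowth.const _).add (slabInc n).hasTemperateGrowth

theorem consPt_upper (s : ℝ) : ∃ (k : ℕ) (C : ℝ), ∀ y : Space n,
    ‖y‖ ≤ C * (1 + ‖consPt s y‖) ^ k := by
  obtain ⟨A, hA, h⟩ := exists_norm_spatial_le n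
  refine ⟨1, A, fun y => ?_⟩
  have := h (consPt s y)
  rw [spatial_consPt] at this
  rw [pow_one]
  nlinarith

/-- Restriction to the hyperplane of constant time `s`. -/
def timeSlice (G : 𝓢(Spacetime n, ℂ)) (s : ℝ) : 𝓢(Space n, ℂ) :=
  SchwartzMap.compCLM ℂ (consPt_hasTemperateGrowth s) (consPt_upper s) G

theorem timeSlice_apply (G : 𝓢(Spacetime n, ℂ)) (s : ℝ) (y : Space n) :
    timeSlice G s y = G (consPt s y) := rfl

def pdS (μ : Fin (n + 1)) (G : 𝓢(Spacetime n, ℂ)) : 𝓢(Spacetime n, ℂ) := ∂_{(Pi.single μ 1 : Spacetime n)} G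

theorem pdS_apply (μ : Fin (n + 1)) (G : 𝓢(Spacetime n, ℂ)) (x : Spacetime n) :
    pdS μ G x = fderiv ℝ G x (Pi.single μ 1) := SchwartzMap.lineDerivOp_apply_eq_fderiv _ _ _

/-- The Fourier transform in space. -/
def fh (G : 𝓢(Spacetime n, ℂ)) (s : ℝ) (k : Space n) : ℂ := 𝓕 (timeSlice G s) k

theorem fh_eq (G : 𝓢(Spacetime n, ℂ)) (s : ℝ) (k : Space n) :
    fh G s k = ∫ y : Space n, Real.fourierChar (-inner ℝ y k) • G (consPt s y) := by
  rw [fh, SchwartzMap.fourier_coe, Real.fourier_eq]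
  rfl

/-- Schwartz decay in spacetime is split between time and space: arbitrary decay in time, and enough
in space for integrability over the slice, uniformly in the time. -/
theorem exists_norm_consPt_bound (G : 𝓢(Spacetime n, ℂ)) (N : ℕ) : ∃ C : ℝ, 0 ≤ C ∧
    ∀ s (y : Space n), ‖G (consPt s y)‖ * (1 + |s|) ^ N ≤ C * (1 + ‖y‖) ^ (-((n : ℝ) + 1)) := by
  obtain ⟨A, hA, h⟩ := exists_norm_spatial_le n
  -- N powers are spent on time; n + 1 exceed the dimension of space and make the remaining weight
  -- integrable.
  set K := N + (n + 1)
  have h1 := fun x => SchwartzMap.one_add_le_sup_seminorm_apply (𝕜 := ℂ) (m := (K, 0)) le_rfl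
    le_rfl G x
  set D := 2 ^ K * (Finset.Iic (K, 0)).sup (fun m => SchwartzMap.seminorm ℂ (E := Spacetime n)
    (F := ℂ) m.1 m.2) G
  have hD : 0 ≤ D := le_trans (by positivity) (h1 0)
  refine ⟨D * A ^ (n + 1), by positivity, fun s y => ?_⟩
  have h2 := h1 (consPt s y)
  simp only [norm_iteratedFDeriv_zero] at h2
  have h3 := h (consPt s y)
  rw [spatial_consPt] at h3
  have h4 := abs_le_norm_consPt s y
  have h5 : (1 + ‖y‖) ≤ A * (1 + ‖consPt s y‖) := by nlinarith
  have h6 : (1 + ‖y‖) ^ (-((n : ℝ) + 1)) = ((1 + ‖y‖) ^ (n + 1))⁻¹ := by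
    rw [Real.rpow_neg (by positivity)]
    norm_cast
  rw [h6, ← div_eq_mul_inv, le_div_iff₀ (by positivity)]
  calc ‖G (consPt s y)‖ * (1 + |s|) ^ N * (1 + ‖y‖) ^ (n + 1)
      ≤ ‖G (consPt s y)‖ * (1 + ‖consPt s y‖) ^ N * (A * (1 + ‖consPt s y‖)) ^ (n + 1) := by
        gcongr
    _ = ((1 + ‖consPt s y‖) ^ K * ‖G (consPt s y)‖) * A ^ (n + 1) := by
        rw [mul_pow, pow_add]; ring
    _ ≤ D * A ^ (n + 1) := by gcongr

theorem integrable_weight (n : ℕ) :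
    Integrable (fun y : Space n => (1 + ‖y‖) ^ (-((n : ℝ) + 1))) :=
  integrable_one_add_norm (by simp)

theorem norm_consPt_le (G : 𝓢(Spacetime n, ℂ)) : ∃ C : ℝ, 0 ≤ C ∧
    ∀ s (y : Space n), ‖G (consPt s y)‖ ≤ C * (1 + ‖y‖) ^ (-((n : ℝ) + 1)) := by
  obtain ⟨C, hC, h⟩ := exists_norm_consPt_bound G 0
  exact ⟨C, hC, fun s y => by simpa using h s y⟩

theorem exists_norm_fh_bound (G : 𝓢(Spacetime n, ℂ)) (N : ℕ) : ∃ C : ℝ, 0 ≤ C ∧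
    ∀ s (k : Space n), ‖fh G s k‖ * (1 + |s|) ^ N ≤ C := by
  obtain ⟨C, hC, h⟩ := exists_norm_consPt_bound G N
  have hI : 0 ≤ ∫ y : Space n, (1 + ‖y‖) ^ (-((n : ℝ) + 1)) :=
    integral_nonneg fun y => by positivity
  refine ⟨C * ∫ y : Space n, (1 + ‖y‖) ^ (-((n : ℝ) + 1)), by positivity, fun s k => ?_⟩
  have hs : (0 : ℝ) < (1 + |s|) ^ N := by positivity
  rw [← le_div_iff₀ hs, fh_eq, mul_comm C, mul_div_assoc, mul_comm, ← integral_const_mul]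
  refine norm_integral_le_of_norm_le ((integrable_weight n).const_mul _) ?_
  refine Eventually.of_forall fun y => ?_
  rw [Circle.norm_smul, div_mul_eq_mul_div, le_div_iff₀ hs]
  exact h s y

theorem continuous_consPt : Continuous fun z : ℝ × Space n => consPt z.1 z.2 := by
  refine continuous_pi fun μ => ?_
  refine Fin.cases ?_ (fun i => ?_) μ
  · simpa using continuous_fst
  · simp only [consPt_succ]; fun_prop

theorem continuous_consPt_right (s : ℝ) : Continuous (consPt s : Space n → Spacetime n) :=
  continuous_consPt.comp (f := fun y : Space n => (s, y)) (by fun_prop)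

theorem continuous_fh (G : 𝓢(Spacetime n, ℂ)) : Continuous fun z : ℝ × Space n => fh G z.1 z.2 := by
  obtain ⟨C, hC, h⟩ := norm_consPt_le G
  simp only [fh_eq]
  refine continuous_of_dominated (bound := fun y => C * (1 + ‖y‖) ^ (-((n : ℝ) + 1)))
    (fun z => ?_) (fun z => ?_) ((integrable_weight n).const_mul _) ?_
  · refine Continuous.aestronglyMeasurable ?_
    have h1 : Continuous fun y : Space n => G (consPt z.1 y) :=
      G.continuous.comp (continuous_consPt_right _)
    exact (Real.continuous_fourierChar.comp (by fun_prop)).smul h1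
  · refine Eventually.of_forall fun y => ?_
    rw [Circle.norm_smul]; exact h _ _
  · refine Eventually.of_forall fun y => ?_
    have h1 : Continuous fun z : ℝ × Space n => G (consPt z.1 y) :=
      G.continuous.comp (continuous_consPt.comp (f := fun z : ℝ × Space n => (z.1, y))
        (by fun_prop))
    exact (Real.continuous_fourierChar.comp (by fun_prop)).smul h1

theorem hasDerivAt_fh (G : 𝓢(Spacetime n, ℂ)) (s : ℝ) (k : Space n) :
    HasDerivAt (fun s => fh G s k) (fh (pdS 0 G) s k) s := by
  obtain ⟨C, hC, h⟩ := norm_consPt_le (pdS 0 G)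
  obtain ⟨C', hC', h'⟩ := norm_consPt_le G
  simp only [fh_eq]
  have hcont : ∀ (G : 𝓢(Spacetime n, ℂ)) (s : ℝ),
      Continuous fun y => Real.fourierChar (-inner ℝ y k) • G (consPt s y) := fun G s => by
    have h1 : Continuous fun y : Space n => G (consPt s y) :=
      G.continuous.comp (continuous_consPt_right _)
    exact (Real.continuous_fourierChar.comp (by fun_prop)).smul h1
  refine (hasDerivAt_integral_of_dominated_loc_of_deriv_le
    (F' := fun s y => Real.fourierChar (-inner ℝ y k) • pdS 0 G (consPt s y))
    (bound := fun y => C * (1 + ‖y‖) ^ (-((n : ℝ) + 1))) univ_mem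
    (Eventually.of_forall fun s => (hcont G s).aestronglyMeasurable)
    (((integrable_weight n).const_mul C').mono' (hcont G s).aestronglyMeasurable
      (Eventually.of_forall fun y => ?_)) (hcont _ s).aestronglyMeasurable
    (Eventually.of_forall fun y x _ => ?_) ((integrable_weight n).const_mul _)
    (Eventually.of_forall fun y x _ => ?_)).2
  · rw [Circle.norm_smul]; exact h' _ _
  · rw [Circle.norm_smul]; exact h _ _
  · have h1 : HasDerivAt (fun s : ℝ => consPt s y) (Pi.single 0 1) x := by
      have : HasDerivAt (fun s : ℝ => (Pi.single 0 s : Spacetime n)) (Pi.single 0 1) x := by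
        have := (ContinuousLinearMap.single ℝ (fun _ : Fin (n + 1) => ℝ) 0).hasFDerivAt
          (x := x) |>.hasDerivAt
        simpa using this
      exact this.add_const _
    have h2 := ((G.differentiableAt (x := consPt x y)).hasFDerivAt.comp_hasDerivAt x h1)
    rw [pdS_apply]
    exact h2.const_smul (Real.fourierChar (-inner ℝ y k))

theorem timeSlice_pdS_succ (G : 𝓢(Spacetime n, ℂ)) (s : ℝ) (i : Fin n) :
    timeSlice (pdS i.succ G) s = ∂_{(EuclideanSpace.single i (1 : ℝ) : Space n)} (timeSlice G s) := by
  ext y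
  rw [SchwartzMap.lineDerivOp_apply_eq_fderiv, timeSlice_apply, pdS_apply]
  have h1 : HasFDerivAt (consPt s : Space n → Spacetime n) (slabInc n) y :=
    (slabInc n).hasFDerivAt.const_add _
  have h2 : HasFDerivAt (timeSlice G s) _ y :=
    (G.differentiableAt (x := consPt s y)).hasFDerivAt.comp y h1
  rw [h2.fderiv, ContinuousLinearMap.comp_apply]
  congr 1
  funext μ
  refine Fin.cases ?_ (fun j => ?_) μ
  · simp [slabInc]
  · simp [slabInc, Pi.single_apply]

theorem fh_pdS_succ (G : 𝓢(Spacetime n, ℂ)) (s : ℝ) (i : Fin n) (k : Space n) :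
    fh (pdS i.succ G) s k = 2 * Real.pi * Complex.I * k i * fh G s k := by
  rw [fh, timeSlice_pdS_succ, SchwartzMap.fourier_lineDerivOp_eq]
  have : (fun k : Space n => inner ℝ k (EuclideanSpace.single i (1 : ℝ))).HasTemperateGrowth :=
    ((innerSL ℝ).flip (EuclideanSpace.single i (1 : ℝ) : Space n)).hasTemperateGrowth
  rw [smul_apply, SchwartzMap.smulLeftCLM_apply_apply this]
  simp [fh, EuclideanSpace.inner_single_right]
  ring

theorem fh_add (G H : 𝓢(Spacetime n, ℂ)) (s : ℝ) (k : Space n) :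
    fh (G + H) s k = fh G s k + fh H s k := by
  have : timeSlice (G + H) s = timeSlice G s + timeSlice H s := rfl
  rw [fh, this, FourierTransform.fourier_add]; rfl

theorem fh_smul (a : ℂ) (G : 𝓢(Spacetime n, ℂ)) (s : ℝ) (k : Space n) :
    fh (a • G) s k = a * fh G s k := by
  have : timeSlice (a • G) s = a • timeSlice G s := rfl
  rw [fh, this, FourierTransform.fourier_smul]; rfl

theorem fh_sum {ι : Type*} (t : Finset ι) (G : ι → 𝓢(Spacetime n, ℂ)) (s : ℝ) (k : Space n) :
    fh (∑ i ∈ t, G i) s k = ∑ i ∈ t, fh (G i) s k := by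
  classical
  induction t using Finset.induction_on with
  | empty =>
    have := fh_smul 0 (0 : 𝓢(Spacetime n, ℂ)) s k
    simpa using this
  | insert a t ha ih => rw [Finset.sum_insert ha, Finset.sum_insert ha, fh_add, ih]

/-- The operator `1 - Δ` in space. -/
def oneSubLap (G : 𝓢(Spacetime n, ℂ)) : 𝓢(Spacetime n, ℂ) :=
  G + (-1 : ℂ) • ∑ i : Fin n, pdS i.succ (pdS i.succ G)

theorem sum_sq_eq (k : Space n) : ∑ i, (k i : ℂ) ^ 2 = (‖k‖ : ℂ) ^ 2 := by
  rw [← Complex.ofReal_pow, EuclideanSpace.norm_sq_eq]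
  push_cast
  refine Finset.sum_congr rfl fun i _ => ?_
  rw [← Complex.ofReal_pow, ← Complex.ofReal_pow, Real.norm_eq_abs, sq_abs]

theorem fh_oneSubLap (G : 𝓢(Spacetime n, ℂ)) (s : ℝ) (k : Space n) :
    fh (oneSubLap G) s k = (1 + 4 * Real.pi ^ 2 * ‖k‖ ^ 2 : ℝ) * fh G s k := by
  rw [oneSubLap, fh_add, fh_smul, fh_sum]
  simp only [fh_pdS_succ]
  have h1 : ∑ i : Fin n, 2 * (Real.pi : ℂ) * Complex.I * (k i : ℂ) *
      (2 * Real.pi * Complex.I * (k i : ℂ) * fh G s k)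
      = -(4 * Real.pi ^ 2 * ∑ i, (k i : ℂ) ^ 2) * fh G s k := by
    rw [Finset.mul_sum, ← Finset.sum_neg_distrib, Finset.sum_mul]
    refine Finset.sum_congr rfl fun i _ => ?_
    linear_combination (4 * (Real.pi : ℂ) ^ 2 * (k i : ℂ) ^ 2 * fh G s k) * Complex.I_sq
  rw [h1, sum_sq_eq]
  push_cast
  ring

/-- Powers of 1 + |k|² are traded for applications of 1 − Δ to the source, whose spatial transform
is bounded by the case without frequency weight. -/
theorem exists_norm_fh_bound' (G : 𝓢(Spacetime n, ℂ)) (N M : ℕ) : ∃ C : ℝ, 0 ≤ C ∧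
    ∀ s (k : Space n), ‖fh G s k‖ * (1 + |s|) ^ N * (1 + ‖k‖ ^ 2) ^ M ≤ C := by
  induction M generalizing G with
  | zero => simpa using exists_norm_fh_bound G N
  | succ M ih =>
    obtain ⟨C, hC, h⟩ := ih (oneSubLap G)
    refine ⟨C, hC, fun s k => le_trans ?_ (h s k)⟩
    rw [fh_oneSubLap, norm_mul, Complex.norm_real, Real.norm_eq_abs,
      abs_of_nonneg (show 0 ≤ 1 + 4 * Real.pi ^ 2 * ‖k‖ ^ 2 by positivity), pow_succ]
    have h1 : (1 + ‖k‖ ^ 2) ≤ 1 + 4 * Real.pi ^ 2 * ‖k‖ ^ 2 := by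
      have : 1 ≤ 4 * Real.pi ^ 2 := by nlinarith [Real.pi_gt_three]
      nlinarith [sq_nonneg ‖k‖]
    calc _ = (1 + ‖k‖ ^ 2) * (‖fh G s k‖ * (1 + |s|) ^ N * (1 + ‖k‖ ^ 2) ^ M) := by ring
      _ ≤ (1 + 4 * Real.pi ^ 2 * ‖k‖ ^ 2) * (‖fh G s k‖ * (1 + |s|) ^ N * (1 + ‖k‖ ^ 2) ^ M) := by
        gcongr
      _ = _ := by ring

end Wave

/-- The `C^m` norm at a point, by inertial partial derivatives. -/
def pdjet : ℕ → (Spacetime n → ℝ) → Spacetime n → ℝ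
  | 0, f, x => |f x|
  | m + 1, f, x => |f x| + ∑ μ, pdjet m (pd μ f) x

section Wave

open MeasureTheory FourierTransform LineDeriv
open scoped SchwartzMap

/-- The integrand of the solution: `z = (σ, k)` consists of a time difference and a frequency. -/
def waveKer (G : 𝓢(Spacetime n, ℂ)) (x : Spacetime n) (z : ℝ × Space n) : ℂ :=
  ((z.1 * Real.sinc (2 * Real.pi * ‖z.2‖ * z.1) : ℝ) : ℂ) *
    ((Real.fourierChar (inner ℝ z.2 (spatial x)) : ℂ) * fh G (x 0 + z.1) z.2)

def waveMeasure (n : ℕ) : Measure (ℝ × Space n) :=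
  (volume.restrict (Ioi 0)).prod volume

def waveWeight (z : ℝ × Space n) : ℝ := (1 + ‖z.1‖) ^ (-2 : ℝ) * (1 + ‖z.2‖ ^ 2) ^ (-((n : ℝ) + 1))

theorem integrable_waveWeight : Integrable (waveWeight (n := n)) (waveMeasure n) := by
  have h1 : Integrable (fun σ : ℝ => (1 + ‖σ‖) ^ (-2 : ℝ)) (volume.restrict (Ioi 0)) :=
    (integrable_one_add_norm (by simp)).restrict
  have h2 : Integrable (fun k : Space n => (1 + ‖k‖ ^ 2) ^ (-((n : ℝ) + 1))) := by
    have := integrable_rpow_neg_one_add_norm_sq (E := Space n) (μ := volume)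
      (r := 2 * ((n : ℝ) + 1)) (by simp; linarith)
    convert this using 3
    ring
  exact h1.mul_prod h2

theorem continuous_waveKer (G : 𝓢(Spacetime n, ℂ)) (x : Spacetime n) :
    Continuous (waveKer G x) := by
  have h1 : Continuous fun z : ℝ × Space n => fh G (x 0 + z.1) z.2 :=
    (continuous_fh G).comp (f := fun z : ℝ × Space n => (x 0 + z.1, z.2)) (by fun_prop)
  have h2 : Continuous fun z : ℝ × Space n =>
      (Real.fourierChar (inner ℝ z.2 (spatial x)) : ℂ) :=
    continuous_subtype_val.comp (Real.continuous_fourierChar.comp (by fun_prop))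
  have h3 : Continuous fun z : ℝ × Space n =>
      z.1 * Real.sinc (2 * Real.pi * ‖z.2‖ * z.1) :=
    continuous_fst.mul (Real.continuous_sinc.comp (by fun_prop))
  exact (Complex.continuous_ofReal.comp h3).mul (h2.mul h1)

/-- The factor σ `sinc` grows at most linearly in the time difference, and integrability in it needs
two more powers. All three come from the decay of the source in its time t + σ, at the cost of (1 +
a)³ if t ≥ −a. -/
theorem exists_norm_waveKer_le (G : 𝓢(Spacetime n, ℂ)) (N : ℕ) : ∃ C : ℝ, 0 ≤ C ∧
    ∀ a : ℝ, 0 ≤ a → ∀ x : Spacetime n, -a ≤ x 0 → ∀ z : ℝ × Space n, 0 ≤ z.1 →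
      ‖waveKer G x z‖ * (1 + |x 0 + z.1|) ^ N ≤ C * (1 + a) ^ 3 * waveWeight z := by
  obtain ⟨C, hC, h⟩ := exists_norm_fh_bound' G (N + 3) (n + 1)
  refine ⟨C, hC, fun a ha x hx z hz => ?_⟩
  have h1 := h (x 0 + z.1) z.2
  have h2 : ‖waveKer G x z‖ ≤ (1 + z.1) * ‖fh G (x 0 + z.1) z.2‖ := by
    rw [waveKer, norm_mul, norm_mul, Circle.norm_coe, one_mul, Complex.norm_real,
      Real.norm_eq_abs, abs_mul, abs_of_nonneg hz]
    refine mul_le_mul_of_nonneg_right ?_ (norm_nonneg _)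
    have := Real.abs_sinc_le_one (2 * Real.pi * ‖z.2‖ * z.1)
    nlinarith
  -- Since t ≥ −a, the time difference is at most the source time plus a.
  have h3 : 1 + z.1 ≤ (1 + a) * (1 + |x 0 + z.1|) := by
    have := le_abs_self (x 0 + z.1)
    nlinarith [abs_nonneg (x 0 + z.1)]
  have e1 : (1 + ‖z.1‖) ^ (-2 : ℝ) = ((1 + z.1) ^ 2)⁻¹ := by
    rw [Real.norm_eq_abs, abs_of_nonneg hz, Real.rpow_neg (by positivity)]
    norm_cast
  have e2 : (1 + ‖z.2‖ ^ 2) ^ (-((n : ℝ) + 1)) = ((1 + ‖z.2‖ ^ 2) ^ (n + 1))⁻¹ := by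
    rw [Real.rpow_neg (by positivity)]
    norm_cast
  rw [waveWeight, e1, e2, ← mul_inv, ← div_eq_mul_inv, le_div_iff₀ (by positivity)]
  set w := 1 + |x 0 + z.1|
  have hw : 0 < w := by positivity
  set f := ‖fh G (x 0 + z.1) z.2‖
  have h4 : (1 + z.1) ^ 3 ≤ ((1 + a) * w) ^ 3 := pow_le_pow_left₀ (by positivity) h3 3
  calc ‖waveKer G x z‖ * w ^ N * ((1 + z.1) ^ 2 * (1 + ‖z.2‖ ^ 2) ^ (n + 1))
      ≤ (1 + z.1) * f * w ^ N * ((1 + z.1) ^ 2 * (1 + ‖z.2‖ ^ 2) ^ (n + 1)) := by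
        refine mul_le_mul_of_nonneg_right (mul_le_mul_of_nonneg_right h2 ?_) ?_ <;> positivity
    _ = (1 + z.1) ^ 3 * (f * w ^ N * (1 + ‖z.2‖ ^ 2) ^ (n + 1)) := by ring
    _ ≤ ((1 + a) * w) ^ 3 * (f * w ^ N * (1 + ‖z.2‖ ^ 2) ^ (n + 1)) := by
        refine mul_le_mul_of_nonneg_right h4 ?_; positivity
    _ = (1 + a) ^ 3 * (f * w ^ (N + 3) * (1 + ‖z.2‖ ^ 2) ^ (n + 1)) := by ring
    _ ≤ (1 + a) ^ 3 * C := mul_le_mul_of_nonneg_left h1 (by positivity)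
    _ = _ := by ring

theorem ae_waveMeasure : ∀ᵐ z ∂(waveMeasure n), 0 ≤ z.1 := by
  have h : ∀ᵐ s : ℝ ∂(volume.restrict (Ioi (0:ℝ))), 0 ≤ s :=
    (ae_restrict_mem measurableSet_Ioi).mono fun s hs => le_of_lt hs
  exact Measure.quasiMeasurePreserving_fst.ae h

theorem integrable_waveKer (G : 𝓢(Spacetime n, ℂ)) (x : Spacetime n) :
    Integrable (waveKer G x) (waveMeasure n) := by
  obtain ⟨C, hC, h⟩ := exists_norm_waveKer_le G 0
  refine ((integrable_waveWeight (n := n)).const_mul (C * (1 + |x 0|) ^ 3)).mono'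
    (continuous_waveKer G x).aestronglyMeasurable (ae_waveMeasure.mono fun z hz => ?_)
  simpa using h |x 0| (abs_nonneg _) x (neg_abs_le _) z hz

def waveKer' (G : 𝓢(Spacetime n, ℂ)) (x : Spacetime n) (z : ℝ × Space n) :
    Spacetime n →L[ℝ] ℂ :=
  ∑ μ, (ContinuousLinearMap.proj (R := ℝ) (φ := fun _ : Fin (n + 1) => ℝ) μ).smulRight
    (waveKer (pdS μ G) x z)

theorem hasFDerivAt_waveKer (G : 𝓢(Spacetime n, ℂ)) (x : Spacetime n) (z : ℝ × Space n) :
    HasFDerivAt (fun x => waveKer G x z) (waveKer' G x z) x := by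
  have h1 : HasFDerivAt (fun x : Spacetime n => inner ℝ z.2 (spatial x))
      ((innerSL ℝ z.2).comp (spatialCLM n)) x :=
    (innerSL ℝ z.2).hasFDerivAt.comp x (spatialCLM n).hasFDerivAt
  have h2 := (Real.hasDerivAt_fourierChar (inner ℝ z.2 (spatial x))).hasFDerivAt.comp x h1
  have h3 : HasFDerivAt (fun x : Spacetime n => x 0 + z.1)
      (ContinuousLinearMap.proj (R := ℝ) (φ := fun _ : Fin (n + 1) => ℝ) 0) x :=
    (ContinuousLinearMap.proj (R := ℝ) (φ := fun _ : Fin (n + 1) => ℝ) 0).hasFDerivAt.add_const _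
  have h4 := (hasDerivAt_fh G (x 0 + z.1) z.2).hasFDerivAt.comp x h3
  have h5 := (h2.mul h4).const_mul ((z.1 * Real.sinc (2 * Real.pi * ‖z.2‖ * z.1) : ℝ) : ℂ)
  refine h5.congr_fderiv ?_
  ext v
  have h6 : inner ℝ z.2 (spatial v) = ∑ i : Fin n, z.2 i * v i.succ := by
    simp [PiLp.inner_apply, spatial, mul_comm]
  simp [waveKer', waveKer, fh_pdS_succ, Fin.sum_univ_succ, spatialCLM_apply, h6,
    Function.comp_apply]
  simp only [Finset.mul_sum]
  ring_nf
  congr 1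
  refine Finset.sum_congr rfl fun i _ => ?_
  ring

/-- The solution of `□ ψ = G` that vanishes in the distant future. -/
def wavePsi (G : 𝓢(Spacetime n, ℂ)) (x : Spacetime n) : ℂ := -∫ z, waveKer G x z ∂(waveMeasure n)

/-- The kernel of a differentiated source is the derivative of the kernel, so every derivative of a
potential is again a potential and the bounds need proof only in order zero. -/
theorem hasFDerivAt_wavePsi (G : 𝓢(Spacetime n, ℂ)) (x : Spacetime n) :
    HasFDerivAt (wavePsi G) (∑ μ, (ContinuousLinearMap.proj (R := ℝ)
      (φ := fun _ : Fin (n + 1) => ℝ) μ).smulRight (wavePsi (pdS μ G) x)) x := by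
  have hb : ∀ μ : Fin (n + 1), ∃ C : ℝ, 0 ≤ C ∧ ∀ y ∈ Metric.ball x 1, ∀ z : ℝ × Space n,
      0 ≤ z.1 → ‖waveKer (pdS μ G) y z‖ ≤ C * waveWeight z := fun μ => by
    obtain ⟨C, hC, h⟩ := exists_norm_waveKer_le (pdS μ G) 0
    refine ⟨C * (1 + (|x 0| + 1)) ^ 3, by positivity, fun y hy z hz => ?_⟩
    have h1 : |y 0 - x 0| ≤ 1 := by
      have := norm_le_pi_norm (y - x) 0
      rw [mem_ball_iff_norm] at hy
      simpa using this.trans hy.le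
    have := abs_le.1 h1
    have h2 := neg_abs_le (x 0)
    simpa using h (|x 0| + 1) (by positivity) y (by linarith) z hz
  choose C hC h using hb
  have hmeas : ∀ y, AEStronglyMeasurable (waveKer' G y) (waveMeasure n) := fun y => by
    refine Continuous.aestronglyMeasurable ?_
    refine continuous_finsetSum _ fun μ _ => ?_
    exact (ContinuousLinearMap.smulRightL ℝ (Spacetime n) ℂ _).continuous.comp
      (continuous_waveKer (pdS μ G) y)
  have key := hasFDerivAt_integral_of_dominated_of_fderiv_le (μ := waveMeasure n)
    (F := waveKer G) (F' := waveKer' G) (x₀ := x)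
    (s := Metric.ball x 1) (bound := fun z => ∑ μ, ‖ContinuousLinearMap.proj (R := ℝ)
      (φ := fun _ : Fin (n + 1) => ℝ) μ‖ * (C μ * waveWeight z)) (Metric.ball_mem_nhds x one_pos)
    (Eventually.of_forall fun y => (continuous_waveKer G y).aestronglyMeasurable)
    (integrable_waveKer G x) (hmeas x)
    (ae_waveMeasure.mono fun z hz y hy => ?_)
    (integrable_finsetSum _ fun μ _ => ((integrable_waveWeight (n := n)).const_mul _).const_mul _)
    (Eventually.of_forall fun z y _ => hasFDerivAt_waveKer G y z)
  · refine key.neg.congr_fderiv ?_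
    simp only [waveKer']
    rw [integral_finsetSum]
    · rw [← Finset.sum_neg_distrib]
      refine Finset.sum_congr rfl fun μ _ => ?_
      have h1 := ((ContinuousLinearMap.smulRightL ℝ (Spacetime n) ℂ
        (ContinuousLinearMap.proj (R := ℝ) (φ := fun _ : Fin (n + 1) => ℝ) μ))).integral_comp_comm
        (integrable_waveKer (pdS μ G) x)
      have h2 : ∀ w : ℂ, (ContinuousLinearMap.smulRightL ℝ (Spacetime n) ℂ
        (ContinuousLinearMap.proj (R := ℝ) (φ := fun _ : Fin (n + 1) => ℝ) μ)) w
        = (ContinuousLinearMap.proj (R := ℝ) (φ := fun _ : Fin (n + 1) => ℝ) μ).smulRight w :=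
        fun w => rfl
      simp only [h2] at h1
      rw [h1, wavePsi]
      ext v
      simp
    · intro μ _
      exact (ContinuousLinearMap.smulRightL ℝ (Spacetime n) ℂ _).integrable_comp
        (integrable_waveKer (pdS μ G) x)
  · refine (norm_sum_le _ _).trans (Finset.sum_le_sum fun μ _ => ?_)
    rw [ContinuousLinearMap.norm_smulRight_apply]
    exact mul_le_mul_of_nonneg_left (h μ y hy z hz) (norm_nonneg _)

/-- Only source times t + σ ≥ t enter the integral, and there the source is already rapidly small.
This is why the advanced rather than the retarded solution is used. -/
theorem exists_norm_wavePsi_le (G : 𝓢(Spacetime n, ℂ)) (N : ℕ) : ∃ C : ℝ,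
    ∀ x : Spacetime n, 1 ≤ x 0 → ‖wavePsi G x‖ * (x 0) ^ N ≤ C := by
  obtain ⟨C, hC, h⟩ := exists_norm_waveKer_le G N
  refine ⟨∫ z, C * waveWeight z ∂(waveMeasure n), fun x hx => ?_⟩
  have hx0 : 0 < x 0 ^ N := by positivity
  rw [wavePsi, norm_neg, ← le_div_iff₀ hx0, ← integral_div]
  refine norm_integral_le_of_norm_le (((integrable_waveWeight (n := n)).const_mul _).div_const _)
    (ae_waveMeasure.mono fun z hz => ?_)
  rw [le_div_iff₀ hx0]
  have h1 := h 0 le_rfl x (by linarith) z hz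
  simp only [add_zero, one_pow, mul_one] at h1
  refine le_trans ?_ h1
  refine mul_le_mul_of_nonneg_left (pow_le_pow_left₀ (by linarith) ?_ N) (norm_nonneg _)
  have := le_abs_self (x 0 + z.1)
  linarith

theorem tendsto_fh (G : 𝓢(Spacetime n, ℂ)) (t : ℝ) (k : Space n) :
    Tendsto (fun σ => fh G (t + σ) k) atTop (𝓝 0) := by
  obtain ⟨C, hC, h⟩ := exists_norm_fh_bound G 1
  have h1 : Tendsto (fun σ : ℝ => C / (1 + |t + σ|)) atTop (𝓝 0) :=
    tendsto_const_nhds.div_atTop (tendsto_atTop_add_const_left _ _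
      (tendsto_abs_atTop_atTop.comp (tendsto_atTop_add_const_left _ _ tendsto_id)))
  refine squeeze_zero_norm (fun σ => ?_) h1
  rw [le_div_iff₀ (by positivity)]
  simpa using h (t + σ) k

/-- For each nonzero frequency sin(wσ)/w is the fundamental solution of the oscillator, and two
integrations by parts move ∂_t² + w² from the source onto it. -/
theorem integral_duhamel (G : 𝓢(Spacetime n, ℂ)) (t : ℝ) {k : Space n} (hk : k ≠ 0)
    (hInt : IntegrableOn (fun σ : ℝ => ((σ * Real.sinc (2 * Real.pi * ‖k‖ * σ) : ℝ) : ℂ) *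
      (fh (pdS 0 (pdS 0 G)) (t + σ) k + (2 * Real.pi * ‖k‖) ^ 2 * fh G (t + σ) k)) (Ioi 0)) :
    ∫ σ in Ioi (0:ℝ), ((σ * Real.sinc (2 * Real.pi * ‖k‖ * σ) : ℝ) : ℂ) *
      (fh (pdS 0 (pdS 0 G)) (t + σ) k + (2 * Real.pi * ‖k‖) ^ 2 * fh G (t + σ) k) = fh G t k := by
  set w : ℝ := 2 * Real.pi * ‖k‖ with hw
  have hw0 : w ≠ 0 := by have := norm_ne_zero_iff.2 hk; positivity
  have e : ∀ σ, σ * Real.sinc (w * σ) = Real.sin (w * σ) / w := fun σ => by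
    rcases eq_or_ne σ 0 with rfl | hσ
    · simp
    · rw [Real.sinc_of_ne_zero (mul_ne_zero hw0 hσ)]; field_simp
  have hc : ((2 * Real.pi * ‖k‖ : ℂ)) = (w : ℂ) := by rw [hw]; push_cast; ring
  simp only [e, hc] at hInt ⊢
  have hd : ∀ (G : 𝓢(Spacetime n, ℂ)) (σ : ℝ),
      HasDerivAt (fun σ => fh G (t + σ) k) (fh (pdS 0 G) (t + σ) k) σ := fun G σ => by
    have := (hasDerivAt_fh G (t + σ) k).scomp σ ((hasDerivAt_id σ).const_add t)
    simpa [Function.comp_def] using this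
  have hsin : ∀ σ : ℝ, HasDerivAt (fun σ : ℝ => ((Real.sin (w * σ) / w : ℝ) : ℂ))
      ((Real.cos (w * σ) : ℝ) : ℂ) σ := fun σ => by
    have h1 := (((Real.hasDerivAt_sin (w * σ)).comp σ ((hasDerivAt_id σ).const_mul w)).div_const w)
    convert h1.ofReal_comp using 1
    norm_cast
    field_simp
  have hcos : ∀ σ : ℝ, HasDerivAt (fun σ : ℝ => ((Real.cos (w * σ) : ℝ) : ℂ))
      ((-Real.sin (w * σ) * w : ℝ) : ℂ) σ := fun σ => by
    have h1 := ((Real.hasDerivAt_cos (w * σ)).comp σ ((hasDerivAt_id σ).const_mul w))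
    convert h1.ofReal_comp using 1
    norm_cast
    ring_nf
  -- The two integrations by parts are made at once by an explicit primitive, which tends to 0 at
  -- infinity and equals minus the transform of the source at σ = 0.
  have key := integral_Ioi_of_hasDerivAt_of_tendsto' (a := (0:ℝ)) (m := (0:ℂ))
    (f := fun σ : ℝ => ((Real.sin (w * σ) / w : ℝ) : ℂ) * fh (pdS 0 G) (t + σ) k
      - ((Real.cos (w * σ) : ℝ) : ℂ) * fh G (t + σ) k)
    (f' := fun σ : ℝ => ((Real.sin (w * σ) / w : ℝ) : ℂ) *
      (fh (pdS 0 (pdS 0 G)) (t + σ) k + (w : ℂ) ^ 2 * fh G (t + σ) k))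
    (fun σ _ => ?_) hInt ?_
  · rw [key]; simp
  · refine (((hsin σ).mul (hd (pdS 0 G) σ)).sub ((hcos σ).mul (hd G σ))).congr_deriv ?_
    have hw1 : (w : ℂ) ≠ 0 := by exact_mod_cast hw0
    push_cast
    field_simp
    ring
  · have b1 : Tendsto (fun σ : ℝ => ((Real.sin (w * σ) / w : ℝ) : ℂ) * fh (pdS 0 G) (t + σ) k)
        atTop (𝓝 0) := by
      refine squeeze_zero_norm (a := fun σ => |w|⁻¹ * ‖fh (pdS 0 G) (t + σ) k‖) (fun σ => ?_) ?_
      · rw [norm_mul, Complex.norm_real, Real.norm_eq_abs, abs_div, div_eq_mul_inv]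
        refine mul_le_mul_of_nonneg_right ?_ (norm_nonneg _)
        exact mul_le_of_le_one_left (by positivity) (Real.abs_sin_le_one _)
      · simpa using ((tendsto_fh (pdS 0 G) t k).norm).const_mul |w|⁻¹
    have b2 : Tendsto (fun σ : ℝ => ((Real.cos (w * σ) : ℝ) : ℂ) * fh G (t + σ) k)
        atTop (𝓝 0) := by
      refine squeeze_zero_norm (a := fun σ => ‖fh G (t + σ) k‖) (fun σ => ?_) ?_
      · rw [norm_mul, Complex.norm_real, Real.norm_eq_abs]
        exact mul_le_of_le_one_left (norm_nonneg _) (Real.abs_cos_le_one _)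
      · simpa using (tendsto_fh G t k).norm
    simpa using b1.sub b2

/-- On the Fourier side □ becomes −(∂_t² + w²) and `integral_duhamel` evaluates the time integral;
Fourier inversion on the slice then returns the source. -/
theorem wavePsi_box (hn : 0 < n) (G : 𝓢(Spacetime n, ℂ)) (x : Spacetime n) :
    -wavePsi (pdS 0 (pdS 0 G)) x + ∑ i : Fin n, wavePsi (pdS i.succ (pdS i.succ G)) x = G x := by
  have h0 := integrable_waveKer (pdS 0 (pdS 0 G)) x
  have h1 : ∀ i : Fin n, Integrable (waveKer (pdS i.succ (pdS i.succ G)) x) (waveMeasure n) :=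
    fun i => integrable_waveKer _ x
  simp only [wavePsi, neg_neg]
  rw [Finset.sum_neg_distrib, ← integral_finsetSum _ fun i _ => h1 i, ← sub_eq_add_neg,
    ← integral_sub h0 (integrable_finsetSum _ fun i _ => h1 i)]
  have e1 : ∀ z : ℝ × Space n, waveKer (pdS 0 (pdS 0 G)) x z
      - ∑ i : Fin n, waveKer (pdS i.succ (pdS i.succ G)) x z
      = (Real.fourierChar (inner ℝ z.2 (spatial x)) : ℂ) *
        (((z.1 * Real.sinc (2 * Real.pi * ‖z.2‖ * z.1) : ℝ) : ℂ) *
        (fh (pdS 0 (pdS 0 G)) (x 0 + z.1) z.2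
          + (2 * Real.pi * ‖z.2‖) ^ 2 * fh G (x 0 + z.1) z.2)) := fun z => by
    have h2 : ∑ i : Fin n, waveKer (pdS i.succ (pdS i.succ G)) x z
        = ((z.1 * Real.sinc (2 * Real.pi * ‖z.2‖ * z.1) : ℝ) : ℂ) *
          ((Real.fourierChar (inner ℝ z.2 (spatial x)) : ℂ) *
          (-(4 * Real.pi ^ 2 * ∑ i, (z.2 i : ℂ) ^ 2) * fh G (x 0 + z.1) z.2)) := by
      simp only [waveKer, fh_pdS_succ]
      rw [← Finset.mul_sum, ← Finset.mul_sum, Finset.mul_sum _ _ (4 * (Real.pi : ℂ) ^ 2),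
        ← Finset.sum_neg_distrib, Finset.sum_mul]
      congr 2
      refine Finset.sum_congr rfl fun i _ => ?_
      linear_combination (4 * (Real.pi : ℂ) ^ 2 * (z.2 i : ℂ) ^ 2 *
        fh G (x 0 + z.1) z.2) * Complex.I_sq
    rw [h2, sum_sq_eq, waveKer]
    ring
  have hInt : Integrable (fun z => waveKer (pdS 0 (pdS 0 G)) x z
      - ∑ i : Fin n, waveKer (pdS i.succ (pdS i.succ G)) x z) (waveMeasure n) :=
    h0.sub (integrable_finsetSum _ fun i _ => h1 i)
  simp only [e1] at hInt ⊢
  have hInt2 := hInt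
  unfold waveMeasure at hInt2 ⊢
  rw [integral_prod_symm _ hInt2]
  -- The frequency zero, where sin(wσ)/w is not available, is a null set since n > 0.
  have hne : ∀ᵐ k : Space n, k ≠ 0 := by
    have : Nonempty (Fin n) := ⟨⟨0, hn⟩⟩
    exact (Measure.ae_ne volume (0 : Space n))
  have h3 : ∀ᵐ k : Space n, (∫ σ in Ioi (0:ℝ), (Real.fourierChar (inner ℝ k (spatial x)) : ℂ) *
        (((σ * Real.sinc (2 * Real.pi * ‖k‖ * σ) : ℝ) : ℂ) *
        (fh (pdS 0 (pdS 0 G)) (x 0 + σ) k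
          + (2 * Real.pi * ‖k‖) ^ 2 * fh G (x 0 + σ) k)))
      = Real.fourierChar (inner ℝ k (spatial x)) • fh G (x 0) k := by
    filter_upwards [hInt2.prod_left_ae, hne] with k hk1 hk2
    rw [integral_const_mul, integral_duhamel G (x 0) hk2]
    · rfl
    · have := hk1.const_mul (Real.fourierChar (inner ℝ k (spatial x)) : ℂ)⁻¹
      refine this.congr (Eventually.of_forall fun σ => ?_)
      simp only
      rw [← mul_assoc, inv_mul_cancel₀ (Circle.coe_ne_zero _), one_mul]
  rw [integral_congr_ae h3, ← Real.fourierInv_eq]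
  have h4 : (fun k => fh G (x 0) k) = 𝓕 (timeSlice G (x 0) : Space n → ℂ) := by
    rw [← SchwartzMap.fourier_coe]; rfl
  have h5 : fh G (x 0) = 𝓕 (timeSlice G (x 0) : Space n → ℂ) := h4
  rw [h5, (timeSlice G (x 0)).continuous.fourierInv_fourier_eq (timeSlice G (x 0)).integrable,
    timeSlice_apply, consPt_spatial]
  rw [← SchwartzMap.fourier_coe]
  exact SchwartzMap.integrable _

theorem box_eq (f : Spacetime n → ℝ) (x : Spacetime n) :
    box f x = -pd 0 (pd 0 f) x + ∑ i : Fin n, pd i.succ (pd i.succ f) x := by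
  have h1 : ∀ μ ν : Fin (n + 1), eta n μ ν = if μ = ν then (if μ = 0 then -1 else 1) else 0 :=
    fun μ ν => Matrix.diagonal_apply ..
  simp [box, h1, Fin.sum_univ_succ]

/-- The wave equation with rapidly decreasing source has a smooth solution all derivatives of which
decrease rapidly in time. -/
theorem exists_wave_solution (hn : 0 < n) {G : Spacetime n → ℝ} (hG : ContDiff ℝ ∞ G)
    (hdec : ∀ k m : ℕ, ∃ C : ℝ, ∀ x, ‖x‖ ^ k * ‖iteratedFDeriv ℝ m G x‖ ≤ C) :
    ∃ ψ : Spacetime n → ℝ, ContDiff ℝ ∞ ψ ∧ (∀ x, box ψ x = G x) ∧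
      ∀ m N : ℕ, ∃ C : ℝ, ∀ x : Spacetime n, 1 ≤ x 0 → pdjet m ψ x * (x 0) ^ N ≤ C := by
  let S : 𝓢(Spacetime n, ℂ) :=
    { toFun := fun x => (G x : ℂ)
      smooth' := Complex.ofRealCLM.contDiff.comp hG
      decay' := fun k m => by
        obtain ⟨C, hC⟩ := hdec k m
        refine ⟨C, fun x => ?_⟩
        have := Complex.ofRealLI.norm_iteratedFDeriv_comp_left (x := x) (i := m) (n := ∞)
          hG.contDiffAt (by exact_mod_cast le_top)
        have h2 : iteratedFDeriv ℝ m (fun x => (G x : ℂ)) x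
          = iteratedFDeriv ℝ m (Complex.ofRealLI ∘ G) x := rfl
        rw [h2, this]
        exact hC x }
  have hfd : ∀ (H : 𝓢(Spacetime n, ℂ)) (x : Spacetime n),
      HasFDerivAt (fun x => (wavePsi H x).re) (∑ μ, (ContinuousLinearMap.proj (R := ℝ)
      (φ := fun _ : Fin (n + 1) => ℝ) μ).smulRight (wavePsi (pdS μ H) x).re) x := fun H x => by
    refine (Complex.reCLM.hasFDerivAt.comp x (hasFDerivAt_wavePsi H x)).congr_fderiv ?_
    ext v
    simp
  have hpd : ∀ (H : 𝓢(Spacetime n, ℂ)) (μ : Fin (n + 1)),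
      pd μ (fun x => (wavePsi H x).re) = fun x => (wavePsi (pdS μ H) x).re := fun H μ => by
    funext x
    rw [pd, (hfd H x).fderiv]
    simp [Pi.single_apply]
  have hsm : ∀ (m : ℕ) (H : 𝓢(Spacetime n, ℂ)), ContDiff ℝ m fun x => (wavePsi H x).re := by
    intro m
    induction m with
    | zero =>
      intro H
      exact contDiff_zero.2 (continuous_iff_continuousAt.2 fun x => (hfd H x).continuousAt)
    | succ m ih =>
      intro H
      push_cast
      rw [contDiff_succ_iff_fderiv]
      refine ⟨fun x => (hfd H x).differentiableAt, by simp, ?_⟩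
      rw [show fderiv ℝ (fun x => (wavePsi H x).re) = _ from funext fun x => (hfd H x).fderiv]
      refine ContDiff.sum fun μ _ => ?_
      exact contDiff_const.smulRight (ih (pdS μ H))
  refine ⟨fun x => (wavePsi S x).re, contDiff_infty.2 fun m => hsm m S, fun x => ?_, ?_⟩
  · rw [box_eq]
    simp only [hpd]
    have := congrArg Complex.re (wavePsi_box hn S x)
    have h2 : S x = (G x : ℂ) := rfl
    rw [h2] at this
    simpa using this
  · intro m N
    have base : ∀ H : 𝓢(Spacetime n, ℂ), ∃ C : ℝ, ∀ x : Spacetime n, 1 ≤ x 0 →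
        |(wavePsi H x).re| * (x 0) ^ N ≤ C := fun H => by
      obtain ⟨C, hC⟩ := exists_norm_wavePsi_le H N
      refine ⟨C, fun x hx => le_trans ?_ (hC x hx)⟩
      exact mul_le_mul_of_nonneg_right (Complex.abs_re_le_norm _) (by positivity)
    -- The induction on the number of derivatives passes to derivatives of the source.
    generalize S = H
    induction m generalizing H with
    | zero => exact base H
    | succ m ih =>
      obtain ⟨C, hC⟩ := base H
      have h1 : ∀ μ : Fin (n + 1), ∃ C : ℝ, ∀ x : Spacetime n, 1 ≤ x 0 →
          pdjet m (pd μ fun x => (wavePsi H x).re) x * (x 0) ^ N ≤ C := fun μ => by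
        rw [hpd]; exact ih (pdS μ H)
      choose D hD using h1
      refine ⟨C + ∑ μ, D μ, fun x hx => ?_⟩
      rw [pdjet, add_mul, Finset.sum_mul]
      exact add_le_add (hC x hx) (Finset.sum_le_sum fun μ _ => hD μ x hx)

end Wave

/-! ### Radial cutoffs and locally finite sums -/

/-- A cutoff that vanishes for `r ≤ R` and is `1` for `r ≥ 2 R`. -/
def cut (n : ℕ) (R : ℝ) (p : NullChart n) : ℝ := Real.smoothTransition (p.2.1 / R - 1)

theorem contDiff_smoothTransition_sub_one {m : ℕ∞} :
    ContDiff ℝ m fun x : ℝ => Real.smoothTransition (x - 1) :=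
  Real.smoothTransition.contDiff.comp (contDiff_id.sub contDiff_const)

theorem contDiff_cut (R : ℝ) : ContDiff ℝ ∞ (cut n R) := by
  have h : ContDiff ℝ ∞ fun p : NullChart n => p.2.1 / R := by fun_prop
  exact (contDiff_smoothTransition_sub_one (m := ⊤)).comp h

theorem cut_eq_zero {R : ℝ} (hR : 0 < R) {p : NullChart n} (h : p.2.1 ≤ R) : cut n R p = 0 :=
  Real.smoothTransition.zero_of_nonpos (by
    have : p.2.1 / R ≤ 1 := (div_le_one hR).2 h
    linarith)

theorem cut_eq_one {R : ℝ} (hR : 0 < R) {p : NullChart n} (h : 2 * R ≤ p.2.1) : cut n R p = 1 :=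
  Real.smoothTransition.one_of_one_le (by
    have : 2 ≤ p.2.1 / R := (le_div_iff₀ hR).2 h
    linarith)

theorem cut_eventuallyEq_zero {R : ℝ} (hR : 0 < R) {p : NullChart n} (h : p.2.1 < R) :
    cut n R =ᶠ[𝓝 p] fun _ => 0 := by
  have h1 : ContinuousAt (fun q : NullChart n => q.2.1) p := by fun_prop
  exact (h1.eventually (gt_mem_nhds h)).mono fun q hq => cut_eq_zero hR (le_of_lt hq)

theorem cut_eventuallyEq_one {R : ℝ} (hR : 0 < R) {p : NullChart n} (h : 2 * R < p.2.1) :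
    cut n R =ᶠ[𝓝 p] fun _ => 1 := by
  have h1 : ContinuousAt (fun q : NullChart n => q.2.1) p := by fun_prop
  exact (h1.eventually (lt_mem_nhds h)).mono fun q hq => cut_eq_one hR (le_of_lt hq)

/-- Rescaling r by R produces a factor 1/R for each radial derivative, exactly compensated by the
weight. The power R^(-i) in front makes the family stable under differentiation, so the bound is
uniform in R. -/
theorem exists_jet_radial_le (m i : ℕ) {h : ℝ → ℝ} (hh : ContDiff ℝ ∞ h)
    (hb : ∀ k, ∃ C, ∀ x, 0 ≤ x → |iteratedDeriv k h x| * x ^ (i + k) ≤ C) :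
    ∃ A : ℝ, ∀ R : ℝ, 0 < R → ∀ p : NullChart n, 0 < p.2.1 →
      jet m i (fun p => (R ^ i)⁻¹ * h (p.2.1 / R)) p ≤ A := by
  have base : ∀ (h : ℝ → ℝ) (i : ℕ) (C : ℝ), (∀ x, 0 ≤ x → |h x| * x ^ i ≤ C) → ∀ R : ℝ, 0 < R →
      ∀ p : NullChart n, 0 < p.2.1 → |(R ^ i)⁻¹ * h (p.2.1 / R)| * p.2.1 ^ (i : ℝ) ≤ C := by
    intro h i C hC R hR p hp
    have := hC (p.2.1 / R) (by positivity)
    rw [abs_mul, abs_of_nonneg (by positivity), Real.rpow_natCast]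
    rw [div_pow] at this
    calc _ = |h (p.2.1 / R)| * (p.2.1 ^ i / R ^ i) := by ring
      _ ≤ C := this
  induction m generalizing i h with
  | zero =>
    obtain ⟨C, hC⟩ := hb 0
    exact ⟨C, base h i C (by simpa using hC)⟩
  | succ m ih =>
    obtain ⟨C, hC⟩ := hb 0
    obtain ⟨A, hA⟩ := ih (i + 1) (h := deriv h) (contDiff_infty_iff_deriv.1 hh).2
      (fun k => by
        obtain ⟨D, hD⟩ := hb (k + 1)
        refine ⟨D, fun x hx => ?_⟩
        rw [← iteratedDeriv_succ']
        have := hD x hx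
        rwa [show i + (k + 1) = i + 1 + k by ring] at this)
    refine ⟨C + A, fun R hR p hp => ?_⟩
    rw [jet]
    refine add_le_add (base h i C (by simpa using hC) R hR p hp) ?_
    have hd : ∀ v : Slot n, dd v (fun p : NullChart n => (R ^ i)⁻¹ * h (p.2.1 / R))
        = fun q => v.wt * ((R ^ (i + 1))⁻¹ * deriv h (q.2.1 / R)) := fun v => by
      funext q
      have h2 : HasFDerivAt (fun p : NullChart n => p.2.1)
        ((ContinuousLinearMap.fst ℝ ℝ (Space n)).comp (ContinuousLinearMap.snd ℝ ℝ _)) q :=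
        hasFDerivAt_fst.comp q hasFDerivAt_snd
      have h3 : HasDerivAt h (deriv h (q.2.1 * R⁻¹)) (q.2.1 * R⁻¹) :=
        ((hh.differentiable (by simp)) _).hasDerivAt
      have h4 := (h3.comp_hasFDerivAt q (h2.mul_const R⁻¹)).const_mul (R ^ i)⁻¹
      simp only [div_eq_mul_inv]
      rw [dd]
      have h5 := h4.fderiv
      simp only [Function.comp_def] at h5
      rw [h5]
      rcases v with _ | _ | j <;> simp [Slot.vec, Slot.wt, pow_succ]
      ring
    simp only [hd, jet_const_mul]
    rw [Fintype.sum_option, Fintype.sum_option]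
    simp only [Slot.wt, abs_zero, zero_mul, abs_one, one_mul, zero_add, Finset.sum_const_zero,
      add_zero]
    have := hA R hR p hp
    push_cast at this
    rwa [jet_const_mul] at this

/-- Uniformity in R is the point: cutoffs are inserted at arbitrarily large radii without loss in
the weighted norms. -/
theorem exists_jet_cut_le (m : ℕ) : ∃ A : ℝ, 0 ≤ A ∧ ∀ R : ℝ, 0 < R → ∀ p : NullChart n,
    0 < p.2.1 → jet m 0 (cut n R) p ≤ A := by
  have hs : ContDiff ℝ ∞ fun x : ℝ => Real.smoothTransition (x - 1) :=
    contDiff_smoothTransition_sub_one (m := ⊤)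
  obtain ⟨A, hA⟩ := exists_jet_radial_le (n := n) m 0 hs fun k => by
    have hc : Continuous (iteratedDeriv k fun x : ℝ => Real.smoothTransition (x - 1)) :=
      hs.continuous_iteratedDeriv k (by exact_mod_cast le_top)
    obtain ⟨C, hC⟩ := (isCompact_Icc (a := (0:ℝ)) (b := 3)).bddAbove_image
      (f := fun x => |iteratedDeriv k (fun x : ℝ => Real.smoothTransition (x - 1)) x| * x ^ (0 + k))
      (Continuous.continuousOn (by fun_prop))
    refine ⟨max C 1, fun x hx => ?_⟩
    rcases le_or_gt x 3 with h | h
    · exact le_max_of_le_left (hC ⟨x, ⟨hx, h⟩, rfl⟩)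
    · refine le_max_of_le_right ?_
      have h1 : (fun x : ℝ => Real.smoothTransition (x - 1)) =ᶠ[𝓝 x] fun _ => 1 :=
        (lt_mem_nhds h).mono fun z hz => Real.smoothTransition.one_of_one_le (by linarith)
      rw [h1.iteratedDeriv_eq k, iteratedDeriv_const]
      split_ifs with h0
      · subst h0; simp
      · simp
  refine ⟨max A 0, le_max_right _ _, fun R hR p hp => le_max_of_le_left ?_⟩
  have := hA R hR p hp
  simp only [pow_zero, inv_one, one_mul, Nat.cast_zero] at this
  exact this

/-- On the support of the cutoff r ≥ R, so giving up β − γ powers of decay gains the factor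
R^(-(β-γ)), which is as small as desired for large R. -/
theorem exists_cut_jet_le {e : NullChart n → ℝ} {m : ℕ} {β γ R₀ C : ℝ} {I : Set ℝ} (hγ : γ < β)
    (he : ∀ p : NullChart n, R₀ < p.2.1 → p.1 ∈ I → ‖p.2.2‖ = 1 →
      ContDiffAt ℝ ∞ e p ∧ jet m β e p ≤ C) (L : ℝ) {ε : ℝ} (hε : 0 < ε) :
    ∃ R : ℝ, L ≤ R ∧ 1 ≤ R ∧ ∀ p : NullChart n, 0 < p.2.1 → p.1 ∈ I → ‖p.2.2‖ = 1 →
      jet m γ (fun p => cut n R p * e p) p ≤ ε := by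
  obtain ⟨A, hA0, hA⟩ := exists_jet_cut_le (n := n) m
  have h1 : Tendsto (fun r : ℝ => r ^ (-(β - γ)) * (3 ^ m * (A * |C|))) atTop (𝓝 0) := by
    simpa using (tendsto_rpow_neg_atTop (sub_pos.2 hγ)).mul_const (3 ^ m * (A * |C|))
  obtain ⟨R₁, hR₁⟩ := eventually_atTop.1 (h1.eventually (gt_mem_nhds hε))
  set R := max (max L 1) (max (R₀ + 1) R₁) with hR
  have hR1 : 1 ≤ R := (le_max_right _ _).trans (le_max_left _ _)
  have hR2 : R₀ + 1 ≤ R := (le_max_left _ _).trans (le_max_right _ _)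
  have hR3 : R₁ ≤ R := (le_max_right _ _).trans (le_max_right _ _)
  refine ⟨R, (le_max_left _ _).trans (le_max_left _ _), hR1, fun p hp hu hy => ?_⟩
  have hR0 : 0 < R := by linarith
  rcases lt_or_ge p.2.1 R with h | h
  · have h2 : (fun p => cut n R p * e p) =ᶠ[𝓝 p] 0 := by
      filter_upwards [cut_eventuallyEq_zero hR0 h] with q hq
      simp [hq]
    rw [jet_congr h2, jet_zero]
    exact hε.le
  · obtain ⟨h2, h3⟩ := he p (by linarith) hu hy
    have h4 := jet_mul_le hp ((contDiff_cut R).contDiffAt) h2 m 0 β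
    rw [zero_add] at h4
    have h5 : jet m γ (fun p => cut n R p * e p) p = p.2.1 ^ (-(β - γ)) * jet m β (cut n R * e) p := by
      rw [← jet_weight hp]
      congr 1
      ring
    rw [h5]
    refine le_trans ?_ (hR₁ p.2.1 (hR3.trans h)).le
    refine mul_le_mul_of_nonneg_left (h4.trans ?_) (Real.rpow_nonneg hp.le _)
    gcongr
    · exact jet_nonneg hp _ _ _
    · exact hA R hR0 p hp
    · exact h3.trans (le_abs_self C)

/-- The sum of a sequence whose `k`-th term vanishes for `r ≤ k`. -/
def locSum (T : ℕ → NullChart n → ℝ) (p : NullChart n) : ℝ :=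
  ∑ k ∈ Finset.range ⌈p.2.1⌉₊, T k p

theorem locSum_eq {T : ℕ → NullChart n → ℝ} (hT : ∀ (k : ℕ) (p : NullChart n), p.2.1 ≤ k → T k p = 0) {K : ℕ}
    {p : NullChart n} (hp : p.2.1 ≤ K) : locSum T p = ∑ k ∈ Finset.range K, T k p := by
  rw [locSum]
  refine Finset.sum_subset (fun k hk => ?_) fun k _ hk => hT k p ?_
  · simp only [Finset.mem_range] at hk ⊢
    exact lt_of_lt_of_le hk (Nat.ceil_le.2 hp)
  · simp only [Finset.mem_range, not_lt] at hk
    exact Nat.ceil_le.1 hk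

theorem locSum_eventuallyEq {T : ℕ → NullChart n → ℝ} (hT : ∀ (k : ℕ) (p : NullChart n), p.2.1 ≤ k → T k p = 0) {K : ℕ}
    {p : NullChart n} (hp : p.2.1 < K) :
    locSum T =ᶠ[𝓝 p] fun q => ∑ k ∈ Finset.range K, T k q := by
  have h1 : ContinuousAt (fun q : NullChart n => q.2.1) p := by fun_prop
  exact (h1.eventually (gt_mem_nhds hp)).mono fun q hq => locSum_eq hT (le_of_lt hq)

theorem sum_two_inv_pow_le (s : Finset ℕ) : ∑ k ∈ s, (2⁻¹ : ℝ) ^ k ≤ 2 := by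
  have h := summable_geometric_of_lt_one (r := (2⁻¹ : ℝ)) (by norm_num) (by norm_num)
  refine (h.sum_le_tsum s fun _ _ => by positivity).trans ?_
  rw [tsum_geometric_of_lt_one (by norm_num) (by norm_num)]
  norm_num

/-! ### Borel's lemma -/

theorem exists_jet_mono_bound (m : ℕ) (β : ℝ) {c : ℝ × Space n → ℝ} (hc : IsCoef c) (a b : ℝ) :
    ∃ C : ℝ, ∀ p : NullChart n, 0 < p.2.1 → p.1 ∈ Icc a b → ‖p.2.2‖ = 1 →
      jet m β (mono β c) p ≤ C := by
  obtain ⟨C, hC⟩ := exists_jet_lift_bound m hc.smooth a b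
  obtain ⟨A, hA⟩ := exists_jet_rpowR_le (n := n) m (-β)
  refine ⟨3 ^ m * (|A| * |C|), fun p hp hu hy => ?_⟩
  have h1 := jet_mul_le hp (contDiffAt_rpowR (n := n) (-β) hp)
    (contDiffAt_lift (hc.smooth (p.1, p.2.2) (ne_zero_of_norm_eq_one hy))) m β 0
  rw [add_zero] at h1
  refine (show jet m β (mono β c) p ≤ _ from h1).trans ?_
  have h2 := hA p hp
  rw [neg_neg] at h2
  gcongr
  · exact jet_nonneg hp _ _ _
  · exact h2.trans (le_abs_self A)
  · exact (hC p hp hu hy).trans (le_abs_self C)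

/-- Borel summation: the j-th term is cut off at a radius so large that the sum is locally finite
and its tail converges in every weighted norm. Homogeneity in y is preserved since the cutoffs are
radial. -/
theorem exists_borel {c : ℕ → ℝ × Space n → ℝ} (hc : ∀ j, IsCoef (c j)) :
    ∃ B : NullChart n → ℝ, (∀ p, 0 < p.2.1 → p.2.2 ≠ 0 → ContDiffAt ℝ ∞ B p) ∧
      (∀ p, p.2.2 ≠ 0 → B (p.1, p.2.1, dir p.2.2) = B p) ∧ HasAsymp B c := by
  -- Half a power is sacrificed to make the j-th term at most 2⁻ʲ, in j derivatives and for |u| ≤ j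
  -- at the same time, so that each fixed order and bounded interval is covered by almost all j.
  have h1 : ∀ j : ℕ, ∃ R : ℝ, (j : ℝ) ≤ R ∧ 1 ≤ R ∧ ∀ p : NullChart n, 0 < p.2.1 →
      p.1 ∈ Icc (-(j : ℝ)) j → ‖p.2.2‖ = 1 →
      jet j (pw n j - 1 / 2) (fun p => cut n R p * mono (pw n j) (c j) p) p ≤ 2⁻¹ ^ j := fun j => by
    obtain ⟨C, hC⟩ := exists_jet_mono_bound j (pw n j) (hc j) (-(j : ℝ)) j
    exact exists_cut_jet_le (by linarith) (R₀ := 0) (fun p hp hu hy =>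
      ⟨(hc j).contDiffAt_mono _ hp (ne_zero_of_norm_eq_one hy), hC p hp hu hy⟩) _ (by positivity)
  choose R hRj hR1 hR using h1
  have hR0 : ∀ j, 0 < R j := fun j => zero_lt_one.trans_le (hR1 j)
  set T : ℕ → NullChart n → ℝ := fun j p => cut n (R j) p * mono (pw n j) (c j) p with hTdef
  have hT : ∀ (k : ℕ) (p : NullChart n), p.2.1 ≤ k → T k p = 0 := fun k p hp => by
    simp only [hTdef, cut_eq_zero (hR0 k) (hp.trans (hRj k)), zero_mul]
  have hTs : ∀ j p, 0 < p.2.1 → p.2.2 ≠ 0 → ContDiffAt ℝ ∞ (T j) p := fun j p hp hy =>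
    (contDiff_cut (R j)).contDiffAt.mul ((hc j).contDiffAt_mono _ hp hy)
  have hTm : ∀ j, IsOScri (fun p => T j p - mono (pw n j) (c j) p) (pw n j + 1) := fun j =>
    (IsOScri.zero _).congr fun a b => by
      filter_upwards [eventually_scriOn_gt a b (2 * R j)] with p hp
      filter_upwards [cut_eventuallyEq_one (hR0 j) hp] with q hq
      simp [hTdef, hq]
  have hTO : ∀ j, IsOScri (T j) (pw n j) := fun j => by
    convert ((hTm j).mono (γ := pw n j) (by linarith)).add (isOScri_mono (pw n j) (hc j)) using 1
    funext p; simp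
  have hBs : ∀ p, 0 < p.2.1 → p.2.2 ≠ 0 → ContDiffAt ℝ ∞ (locSum T) p := fun p hp hy => by
    obtain ⟨K, hK⟩ := exists_nat_gt p.2.1
    exact (ContDiffAt.sum fun j _ => hTs j p hp hy).congr_of_eventuallyEq
      (locSum_eventuallyEq hT hK)
  refine ⟨locSum T, hBs, fun p hy => ?_, hc, fun N => ?_⟩
  · simp only [locSum, hTdef, mono, cut]
    refine Finset.sum_congr rfl fun j _ => ?_
    congr 2
    exact (hc j).homog (p.1, p.2.2) hy ‖p.2.2‖⁻¹ (inv_pos.2 (norm_pos_iff.2 hy))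
  · have key : IsOScri (fun p => locSum T p - ∑ j ∈ Finset.range N, T j p) (pw n N) := by
      refine ⟨fun a b => ?_, fun m a b => ?_⟩
      · filter_upwards [eventually_scriOn_pos_ne a b] with p hp
        exact (hBs p hp.1 hp.2).sub (ContDiffAt.sum fun j _ => hTs j p hp.1 hp.2)
      · obtain ⟨J, hJ⟩ := exists_nat_ge (max (max (m : ℝ) (N + 1)) (max |a| |b|))
        have hJm : m ≤ J := by
          exact_mod_cast ((le_max_left _ _).trans (le_max_left _ _)).trans hJ
        have hJN : N + 1 ≤ J := by
          exact_mod_cast ((le_max_right _ _).trans (le_max_left _ _)).trans hJ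
        have hJa : |a| ≤ J := ((le_max_left _ _).trans (le_max_right _ _)).trans hJ
        have hJb : |b| ≤ J := ((le_max_right _ _).trans (le_max_right _ _)).trans hJ
        have hfin : IsOScri (fun p => ∑ j ∈ Finset.Ico N J, T j p) (pw n N) :=
          IsOScri.sum _ fun j hj => (hTO j).mono (pw_mono (Finset.mem_Ico.1 hj).1)
        obtain ⟨C, hC⟩ := hfin.bound m a b
        refine ⟨C + 2, ?_⟩
        filter_upwards [hC, eventually_scriOn_gt a b 1, eventually_scriOn_mem a b] with p h1 h2 h3
        have hp : 0 < p.2.1 := zero_lt_one.trans h2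
        have hy := ne_zero_of_norm_eq_one h3.2
        obtain ⟨K, hK⟩ := exists_nat_gt (max p.2.1 J)
        have hKp : p.2.1 < K := (le_max_left _ _).trans_lt hK
        have hKJ : J ≤ K := by exact_mod_cast ((le_max_right _ _).trans_lt hK).le
        have e1 : (fun p => locSum T p - ∑ j ∈ Finset.range N, T j p) =ᶠ[𝓝 p]
            (fun p => ∑ j ∈ Finset.Ico N J, T j p) + fun p => ∑ j ∈ Finset.Ico J K, T j p := by
          filter_upwards [locSum_eventuallyEq hT hKp] with q hq
          rw [hq, Pi.add_apply, Finset.sum_Ico_consecutive _ (by omega) hKJ,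
            Finset.sum_Ico_eq_sub _ (by omega)]
        rw [jet_congr e1]
        refine (jet_add_le hp (ContDiffAt.sum fun j _ => hTs j p hp hy)
          (ContDiffAt.sum fun j _ => hTs j p hp hy) m _).trans (add_le_add h1 ?_)
        refine (jet_sum_le _ hp (fun j _ => hTs j p hp hy) m _).trans ?_
        refine le_trans (Finset.sum_le_sum fun j hj => ?_) (sum_two_inv_pow_le (Finset.Ico J K))
        have hj := (Finset.mem_Ico.1 hj).1
        have hjr : (J : ℝ) ≤ j := by exact_mod_cast hj
        have hu : p.1 ∈ Icc (-(j : ℝ)) j :=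
          ⟨by have := neg_abs_le a; linarith [h3.1.1], by have := le_abs_self b; linarith [h3.1.2]⟩
        refine le_trans ?_ ((jet_mono hp (hJm.trans hj) _ _).trans (hR j p hp hu h3.2))
        have e2 : pw n N = (pw n N - (pw n j - 1 / 2)) + (pw n j - 1 / 2) := by ring
        rw [e2, jet_weight hp]
        refine mul_le_of_le_one_left (jet_nonneg hp _ _ _) ?_
        refine Real.rpow_le_one_of_one_le_of_nonpos h2.le ?_
        have : pw n (N + 1) ≤ pw n j := pw_mono (by omega)
        simp only [pw] at this ⊢
        push_cast at this
        linarith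
    have h2 : IsOScri (fun p => ∑ j ∈ Finset.range N, (T j p - mono (pw n j) (c j) p)) (pw n N) :=
      IsOScri.sum _ fun j _ => (IsOScri.zero _).congr fun a b => by
        filter_upwards [eventually_scriOn_gt a b (2 * R j)] with p hp
        filter_upwards [cut_eventuallyEq_one (hR0 j) hp] with q hq
        simp [hTdef, hq]
    convert key.add h2 using 1
    funext p
    simp [Finset.sum_sub_distrib]

/-! ### Comparison of weighted norms in the two charts -/

theorem jet_shift (a : NullChart n) (ha : a.2.1 = 0) (m : ℕ) (β : ℝ) (F : NullChart n → ℝ)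
    (p : NullChart n) : jet m β (fun q => F (q + a)) p = jet m β F (p + a) := by
  have h0 : (p + a).2.1 = p.2.1 := by simp [ha]
  induction m generalizing β F with
  | zero => simp only [jet, h0]
  | succ m ih =>
    have hd : ∀ v : Slot n, dd v (fun q => F (q + a)) = fun q => dd v F (q + a) := fun v => by
      funext q
      rw [dd, fderiv_comp_add_right]
      rfl
    simp only [jet, hd, ih, h0]

/-- Translation in u reduces to u = 0, so compactness of the sphere alone gives a bound valid for
all u. Such uniformity is needed for Schwartz estimates on all of spacetime. -/
theorem exists_jet_lift_le_of_invariant (m : ℕ) {c : ℝ × Space n → ℝ}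
    (hc : ∀ q, q.2 ≠ 0 → ContDiffAt ℝ ∞ c q) (hu : ∀ t q, c (q.1 + t, q.2) = c q) :
    ∃ C : ℝ, 0 ≤ C ∧ ∀ p : NullChart n, 0 < p.2.1 → ‖p.2.2‖ = 1 → jet m 0 (lift c) p ≤ C := by
  obtain ⟨C, hC⟩ := exists_jet_lift_bound m hc 0 0
  refine ⟨max C 0, le_max_right _ _, fun p hp hy => le_max_of_le_left ?_⟩
  have h1 := jet_shift (p.1, 0, 0) rfl m 0 (lift c) (0, p.2.1, p.2.2)
  have h2 : (fun q : NullChart n => lift c (q + (p.1, 0, 0))) = lift c := by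
    funext q
    simpa [lift] using hu p.1 (q.1, q.2.2)
  rw [h2] at h1
  have h3 : ((0, p.2.1, p.2.2) + (p.1, 0, 0) : NullChart n) = p := by
    refine Prod.ext (by simp) (Prod.ext (by simp) (by simp))
  rw [h3] at h1
  rw [← h1]
  exact hC _ hp (by simp) hy

theorem jet_le_of_one_le {p : NullChart n} (hp : 1 ≤ p.2.1) (m : ℕ) {β γ : ℝ} (h : γ ≤ β)
    (F : NullChart n → ℝ) : jet m γ F p ≤ jet m β F p := by
  have hp0 : 0 < p.2.1 := zero_lt_one.trans_le hp
  have e : γ = (γ - β) + β := by ring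
  rw [e, jet_weight hp0]
  exact mul_le_of_le_one_left (jet_nonneg hp0 _ _ _)
    (Real.rpow_le_one_of_one_le_of_nonpos hp (by linarith))

/-- The coefficients of the inertial derivatives are independent of u, hence have jets bounded
uniformly for r ≥ 1, also where u is unbounded. -/
theorem exists_jet_npd_le (m : ℕ) : ∃ C : ℝ, 0 ≤ C ∧ ∀ (F : NullChart n → ℝ) (p : NullChart n)
    (μ : Fin (n + 1)), 1 ≤ p.2.1 → ‖p.2.2‖ = 1 → ContDiffAt ℝ ∞ F p →
    jet m 0 (npd μ F) p ≤ C * jet (m + 1) 0 F p := by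
  have h1 : ∀ i : Fin n, ∃ C : ℝ, 0 ≤ C ∧ ∀ p : NullChart n, 0 < p.2.1 → ‖p.2.2‖ = 1 →
      jet m 0 (lift (hatY i)) p ≤ C := fun i =>
    exists_jet_lift_le_of_invariant m (IsCoef.hatY i).smooth fun t q => rfl
  choose A hA0 hA using h1
  have hns : ∀ q : ℝ × Space n, q.2 ≠ 0 → ContDiffAt ℝ ∞ (fun q : ℝ × Space n => ‖q.2‖) q :=
    fun q hq => ContDiffAt.comp q (g := fun y : Space n => ‖y‖) (contDiffAt_norm_space hq)
      contDiffAt_snd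
  obtain ⟨B, hB0, hB⟩ := exists_jet_lift_le_of_invariant m hns fun t q => rfl
  obtain ⟨D, hD⟩ := exists_jet_rpowR_le (n := n) m (-1)
  refine ⟨1 + ∑ i, 3 ^ m * (A i * 2) + 3 ^ m * (3 ^ m * (|D| * B)), by
    have := Finset.sum_nonneg fun i (_ : i ∈ Finset.univ) =>
      (by have := hA0 i; positivity : (0:ℝ) ≤ 3 ^ m * (A i * 2))
    positivity, fun F p μ hr hy hF => ?_⟩
  have hp : 0 < p.2.1 := zero_lt_one.trans_le hr
  have hy0 := ne_zero_of_norm_eq_one hy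
  set J := jet (m + 1) 0 F p with hJ
  have hJ0 : 0 ≤ J := jet_nonneg hp _ _ _
  have hd : ∀ v, jet m 0 (dd v F) p ≤ J := fun v =>
    (jet_le_of_one_le hr m (by rcases v with _ | _ | i <;> simp [Slot.wt]) _).trans
      (jet_dd_le hp m 0 F v)
  have hsum : ∀ i, 0 ≤ 3 ^ m * (A i * 2) := fun i => by have := hA0 i; positivity
  refine Fin.cases ?_ (fun i => ?_) μ
  · rw [npd_zero]
    refine (hd none).trans (le_mul_of_one_le_left hJ0 ?_)
    have := Finset.sum_nonneg fun i (_ : i ∈ Finset.univ) => hsum i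
    have : 0 ≤ 3 ^ m * (3 ^ m * (|D| * B)) := by positivity
    linarith
  · have e : npd i.succ F = lift (hatY i) * (dd (some none) F + fun p => (-1) * dd none F p)
        + (rpowR n (-1) * lift fun q => ‖q.2‖) * dd (some (some i)) F := by
      funext q
      simp only [npd_succ, lift, hatY, rpowR, Real.rpow_neg_one, Pi.add_apply, Pi.mul_apply]
      ring
    have s1 : ContDiffAt ℝ ∞ (lift (hatY i)) p := contDiffAt_lift ((IsCoef.hatY i).smooth _ hy0)
    have s2 : ContDiffAt ℝ ∞ (fun p => (-1) * dd none F p) p := contDiffAt_const.mul (hF.dd none)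
    have s3 : ContDiffAt ℝ ∞ (dd (some none) F + fun p => (-1) * dd none F p) p :=
      (hF.dd _).add s2
    have s4 : ContDiffAt ℝ ∞ (rpowR n (-1)) p := contDiffAt_rpowR _ hp
    have s5 : ContDiffAt ℝ ∞ (lift fun q : ℝ × Space n => ‖q.2‖) p := contDiffAt_lift (hns _ hy0)
    rw [e]
    refine (jet_add_le hp (s1.mul s3) ((s4.mul s5).mul (hF.dd _)) m 0).trans ?_
    have b1 : jet m 0 (dd (some none) F + fun p => (-1) * dd none F p) p ≤ 2 * J := by
      refine (jet_add_le hp (hF.dd _) s2 m 0).trans ?_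
      rw [jet_const_mul]
      have := hd none
      have := hd (some none)
      simp only [abs_neg, abs_one, one_mul]
      linarith
    have b2 := jet_mul_le hp s1 s3 m 0 0
    have b3 := jet_mul_le hp (s4.mul s5) (hF.dd (some (some i))) m 0 0
    have b4 := jet_mul_le hp s4 s5 m 0 0
    have b5 : jet m 0 (rpowR n (-1)) p ≤ |D| := by
      refine (jet_le_of_one_le hr m (β := -(-1)) (by norm_num) _).trans ?_
      exact (hD p hp).trans (le_abs_self D)
    rw [add_zero] at b2 b3 b4
    have b6 : jet m 0 (lift (hatY i) * (dd (some none) F + fun p => (-1) * dd none F p)) p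
        ≤ 3 ^ m * (A i * 2) * J := by
      refine b2.trans ?_
      rw [mul_assoc, mul_assoc]
      gcongr
      · exact jet_nonneg hp _ _ _
      · exact hA0 i
      · exact hA i p hp hy
    have b7 : jet m 0 ((rpowR n (-1) * lift fun q : ℝ × Space n => ‖q.2‖) * dd (some (some i)) F) p
        ≤ 3 ^ m * (3 ^ m * (|D| * B)) * J := by
      refine b3.trans ?_
      rw [mul_assoc]
      gcongr
      · exact jet_nonneg hp _ _ _
      · refine b4.trans ?_
        gcongr
        · exact jet_nonneg hp _ _ _
        · exact hB p hp hy
      · exact hd _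
    have b8 : 3 ^ m * (A i * 2) ≤ ∑ i, 3 ^ m * (A i * 2) :=
      Finset.single_le_sum (fun i _ => hsum i) (Finset.mem_univ i)
    have b9 := mul_le_mul_of_nonneg_right b8 hJ0
    refine (add_le_add b6 b7).trans ?_
    linarith

theorem pdjet_nonneg (m : ℕ) (f : Spacetime n → ℝ) (x : Spacetime n) : 0 ≤ pdjet m f x := by
  induction m generalizing f with
  | zero => exact abs_nonneg _
  | succ m ih => exact add_nonneg (abs_nonneg _) (Finset.sum_nonneg fun μ _ => ih _)

theorem pdjet_pd_le (m : ℕ) (f : Spacetime n → ℝ) (x : Spacetime n) (μ : Fin (n + 1)) :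
    pdjet m (pd μ f) x ≤ pdjet (m + 1) f x :=
  (Finset.single_le_sum (f := fun μ => pdjet m (pd μ f) x) (fun _ _ => pdjet_nonneg _ _ _)
    (Finset.mem_univ μ)).trans (le_add_of_nonneg_left (abs_nonneg _))

theorem exists_pdjet_le (m : ℕ) : ∃ C : ℝ, 0 ≤ C ∧ ∀ (f : Spacetime n → ℝ) (p : NullChart n),
    1 ≤ p.2.1 → ‖p.2.2‖ = 1 → ContDiffAt ℝ ∞ f (chartPoint p) →
    pdjet m f (chartPoint p) ≤ C * jet m 0 (toNull f) p := by
  induction m with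
  | zero =>
    refine ⟨1, zero_le_one, fun f p _ _ _ => ?_⟩
    simp [pdjet, jet, toNull]
  | succ m ih =>
    obtain ⟨C, hC0, hC⟩ := ih
    obtain ⟨D, hD0, hD⟩ := exists_jet_npd_le (n := n) m
    refine ⟨1 + ∑ _μ : Fin (n + 1), C * D, by positivity, fun f p hr hy hf => ?_⟩
    have hp : 0 < p.2.1 := zero_lt_one.trans_le hr
    have hy0 := ne_zero_of_norm_eq_one hy
    rw [pdjet, add_mul, Finset.sum_mul]
    refine add_le_add ?_ (Finset.sum_le_sum fun μ _ => ?_)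
    · have := abs_mul_le_jet hp (m + 1) 0 (toNull f)
      simpa [toNull] using this
    · refine (hC (pd μ f) p hr hy (hf.pd μ)).trans ?_
      rw [jet_congr (toNull_pd_eventuallyEq hp hy0 hf μ), mul_assoc]
      exact mul_le_mul_of_nonneg_left (hD _ p μ hr hy (hf.toNull hy0)) hC0

theorem exists_norm_iteratedFDeriv_le_pdjet (m : ℕ) : ∃ C : ℝ, 0 ≤ C ∧
    ∀ (f : Spacetime n → ℝ) (x : Spacetime n), ContDiffAt ℝ ∞ f x →
      ‖iteratedFDeriv ℝ m f x‖ ≤ C * pdjet m f x := by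
  induction m with
  | zero =>
    refine ⟨1, zero_le_one, fun f x _ => ?_⟩
    simp [pdjet]
  | succ m ih =>
    obtain ⟨C, hC0, hC⟩ := ih
    set ε : Fin (n + 1) → Spacetime n →L[ℝ] ℝ := fun μ =>
      ContinuousLinearMap.proj (R := ℝ) (φ := fun _ : Fin (n + 1) => ℝ) μ with hε
    refine ⟨∑ μ, ‖ε μ‖ * C, Finset.sum_nonneg fun μ _ => by positivity, fun f x hf => ?_⟩
    have h1 := norm_iteratedFDeriv_succ_le_sum (fun μ : Fin (n + 1) => (Pi.single μ 1 : Spacetime n))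
      ε (fun x => by
        funext ν
        simp [hε, Finset.sum_apply, Pi.single_apply]) hf m
    refine h1.trans ?_
    rw [Finset.sum_mul]
    refine Finset.sum_le_sum fun μ _ => ?_
    rw [mul_assoc]
    refine mul_le_mul_of_nonneg_left ?_ (norm_nonneg _)
    exact (hC (pd μ f) x (hf.pd μ)).trans (mul_le_mul_of_nonneg_left (pdjet_pd_le m f x μ) hC0)

theorem ContDiffAt.continuousAt_jet {F : NullChart n → ℝ} {p : NullChart n}
    (hF : ContDiffAt ℝ ∞ F p) (hp : 0 < p.2.1) (m : ℕ) (β : ℝ) : ContinuousAt (jet m β F) p := by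
  have h0 : ∀ (F : NullChart n → ℝ) (β : ℝ), ContDiffAt ℝ ∞ F p →
      ContinuousAt (fun p => |F p| * p.2.1 ^ β) p := fun F β hF =>
    hF.continuousAt.abs.mul (contDiffAt_rpowR (m := 0) β hp).continuousAt
  induction m generalizing F β with
  | zero => exact h0 F β hF
  | succ m ih => exact (h0 F β hF).add (tendsto_finsetSum _ fun v _ => ih (hF.dd v) _)

/-! ### Rapidly decreasing functions near null infinity -/

/-- A partition of unity in the retarded time. -/
def band (k : ℕ) (u : ℝ) : ℝ :=
  Real.smoothTransition (1 + u ^ 2 - k) - Real.smoothTransition (1 + u ^ 2 - (k + 1 : ℕ))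

theorem contDiff_band (k : ℕ) : ContDiff ℝ ∞ (band k) := by
  have h : ∀ a : ℝ, ContDiff ℝ ∞ fun u : ℝ => Real.smoothTransition (1 + u ^ 2 - a) := fun a =>
    (Real.smoothTransition.contDiff (n := ⊤)).comp (f := fun u : ℝ => 1 + u ^ 2 - a) (by fun_prop)
  exact (h _).sub (h _)

theorem band_eq_zero {k : ℕ} {u : ℝ} (h : 1 + u ^ 2 ≤ k) : band k u = 0 := by
  rw [band, Real.smoothTransition.zero_of_nonpos (by linarith),
    Real.smoothTransition.zero_of_nonpos (by push_cast; linarith), sub_zero]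

theorem band_eq_zero' {k : ℕ} {u : ℝ} (h : (k + 1 : ℝ) < |u|) : band k u = 0 := by
  have h1 : (k + 1 : ℝ) ≤ u ^ 2 := by
    rw [← sq_abs]
    have : (0:ℝ) ≤ k := Nat.cast_nonneg k
    nlinarith
  rw [band, Real.smoothTransition.one_of_one_le (by linarith),
    Real.smoothTransition.one_of_one_le (by push_cast; linarith), sub_self]

theorem sum_band {K : ℕ} {u : ℝ} (h : 1 + u ^ 2 ≤ K) : ∑ k ∈ Finset.range K, band k u = 1 := by
  simp only [band]
  rw [Finset.sum_range_sub' (fun k : ℕ => Real.smoothTransition (1 + u ^ 2 - k)),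
    Real.smoothTransition.one_of_one_le (by simp; positivity),
    Real.smoothTransition.zero_of_nonpos (by linarith), sub_zero]

/-- The support is bounded in u. For large r the decay hypothesis applies, and the rest is compact
and stays away from r = 0. -/
theorem exists_jet_bound_of_support {T : NullChart n → ℝ} {a b : ℝ} {β : ℝ} (hT : IsOScri T β)
    (hs : ∀ p, 0 < p.2.1 → ‖p.2.2‖ = 1 → ContDiffAt ℝ ∞ T p) (h1 : ∀ p, p.2.1 < 2 → T =ᶠ[𝓝 p] 0)
    (hu : ∀ p, p.1 ∉ Icc a b → T =ᶠ[𝓝 p] 0) (m : ℕ) : ∃ C : ℝ, 0 ≤ C ∧ ∀ p : NullChart n,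
      ‖p.2.2‖ = 1 → jet m β T p ≤ C := by
  obtain ⟨C, hC⟩ := hT.bound m a b
  obtain ⟨R, hR⟩ := eventually_scriOn.1 hC
  have hK : IsCompact (Icc a b ×ˢ (Icc (1:ℝ) R ×ˢ Metric.sphere (0 : Space n) 1)) :=
    isCompact_Icc.prod (isCompact_Icc.prod (isCompact_sphere _ _))
  obtain ⟨D, hD⟩ := hK.bddAbove_image (f := jet m β T) fun p hp =>
    ((hs p (zero_lt_one.trans_le hp.2.1.1) (by simpa using hp.2.2)).continuousAt_jet
      (zero_lt_one.trans_le hp.2.1.1) m β).continuousWithinAt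
  refine ⟨max 0 (max C D), le_max_left _ _, fun p hy => ?_⟩
  by_cases h2 : p.2.1 < 2
  · rw [jet_congr (h1 p h2), jet_zero]; exact le_max_left _ _
  by_cases h3 : p.1 ∈ Icc a b
  · refine le_max_of_le_right ?_
    rcases le_or_gt p.2.1 R with h4 | h4
    · exact le_max_of_le_right (hD ⟨p, ⟨h3, ⟨by linarith, h4⟩, by simpa using hy⟩, rfl⟩)
    · exact le_max_of_le_left (hR _ h4 _ h3 _ hy)
  · rw [jet_congr (hu p h3), jet_zero]; exact le_max_left _ _

theorem norm_chartPoint_le {p : NullChart n} (hr : 0 ≤ p.2.1) (hy : ‖p.2.2‖ = 1)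
    (hu : |p.1| ≤ p.2.1) : ‖chartPoint p‖ ≤ 2 * p.2.1 := by
  refine (pi_norm_le_iff_of_nonneg (by linarith)).2 fun μ => ?_
  refine Fin.cases ?_ (fun i => ?_) μ
  · rw [chartPoint, nullPoint_zero, Real.norm_eq_abs]
    have := abs_add_le p.1 p.2.1
    rw [abs_of_nonneg hr] at this
    linarith
  · rw [chartPoint, nullPoint_succ, norm_mul, Real.norm_eq_abs, abs_of_nonneg hr]
    have h1 := PiLp.norm_apply_le (dir p.2.2) i
    rw [norm_dir (ne_zero_of_norm_eq_one hy)] at h1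
    nlinarith

set_option maxHeartbeats 1000000 in
-- Rapid decay is given only where r is large depending on u. The error is cut into bands in u, the
-- k-th band being kept only beyond a radius R k. Each bounded u-interval meets finitely many bands,
-- so the sum still agrees with the error near null infinity; choosing the radii large makes it
-- Schwartz on all of spacetime.
theorem exists_rapid_extension {E : Spacetime n → ℝ} (hE : ∀ β, IsOScri (toNull E) β) :
    ∃ G : Spacetime n → ℝ, ContDiff ℝ ∞ G ∧
      (∀ k m : ℕ, ∃ C : ℝ, ∀ x, ‖x‖ ^ k * ‖iteratedFDeriv ℝ m G x‖ ≤ C) ∧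
      ∀ a b, ∀ᶠ p in scriOn n a b, G (chartPoint p) = E (chartPoint p) := by
  have hbs : ∀ k : ℕ, ∀ q : ℝ × Space n, q.2 ≠ 0 →
      ContDiffAt ℝ ∞ (fun q : ℝ × Space n => band k q.1) q := fun k q _ =>
    ((contDiff_band k).comp contDiff_fst).contDiffAt
  set e : ℕ → NullChart n → ℝ := fun k p => band k p.1 * toNull E p with he
  have heO : ∀ k β, IsOScri (e k) β := fun k β => by
    have := (isOScri_lift (hbs k)).mul (hE β)
    rwa [zero_add] at this
  -- R ≥ k + 2 exceeds |u| on the band, which keeps the k-th piece in the region |u| ≤ r; the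
  -- u-interval is a little larger than the band. Weight and order k together with 2⁻ᵏ make the tail
  -- summable in every fixed norm.
  have hex : ∀ k : ℕ, ∃ R : ℝ, (k + 2 : ℝ) ≤ R ∧ 1 ≤ R ∧
      (∀ p : NullChart n, R ≤ p.2.1 → p.1 ∈ Icc (-(k + 2 : ℝ)) (k + 2) → ‖p.2.2‖ = 1 →
        ContDiffAt ℝ ∞ (e k) p) ∧
      ∀ p : NullChart n, 0 < p.2.1 → p.1 ∈ Icc (-(k + 2 : ℝ)) (k + 2) → ‖p.2.2‖ = 1 →
        jet k k (fun p => cut n R p * e k p) p ≤ 2⁻¹ ^ k := fun k => by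
    obtain ⟨C, hC⟩ := (heO k (k + 1)).bound k (-(k + 2 : ℝ)) (k + 2)
    obtain ⟨R₀, hR₀⟩ := eventually_scriOn.1 (hC.and ((heO k (k + 1)).smooth _ _))
    obtain ⟨R, h1, h2, h3⟩ := exists_cut_jet_le (e := e k) (m := k) (β := (k + 1 : ℝ)) (γ := k)
      (R₀ := R₀) (C := C) (I := Icc (-(k + 2 : ℝ)) (k + 2)) (by linarith)
      (fun p hp hu hy => ⟨(hR₀ _ hp _ hu _ hy).2, (hR₀ _ hp _ hu _ hy).1⟩)
      (max (k + 2 : ℝ) (R₀ + 1)) (ε := 2⁻¹ ^ k) (by positivity)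
    refine ⟨R, (le_max_left _ _).trans h1, h2, fun p hp hu hy => ?_, h3⟩
    have := (le_max_right _ _).trans h1
    exact (hR₀ _ (by linarith) _ hu _ hy).2
  choose R hRk hR1 hRs hR using hex
  have hR0 : ∀ j, 0 < R j := fun j => zero_lt_one.trans_le (hR1 j)
  set T : ℕ → NullChart n → ℝ := fun k p => cut n (R k) p * e k p with hTdef
  have hT : ∀ (k : ℕ) (p : NullChart n), p.2.1 ≤ k → T k p = 0 := fun k p hp => by
    simp only [hTdef, cut_eq_zero (hR0 k) (hp.trans (by linarith [hRk k])), zero_mul]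
  have hTr : ∀ (k : ℕ) (p : NullChart n), p.2.1 < R k → T k =ᶠ[𝓝 p] 0 := fun k p hp => by
    filter_upwards [cut_eventuallyEq_zero (hR0 k) hp] with q hq
    simp [hTdef, hq]
  have hTu : ∀ (k : ℕ) (p : NullChart n), p.1 ∉ Icc (-(k + 1 : ℝ)) (k + 1) → T k =ᶠ[𝓝 p] 0 := fun k p hp => by
    have h1 : (k + 1 : ℝ) < |p.1| := by
      by_contra h
      exact hp (abs_le.1 (not_lt.1 h))
    have h2 : ContinuousAt (fun q : NullChart n => |q.1|) p := by fun_prop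
    filter_upwards [h2.eventually (lt_mem_nhds h1)] with q hq
    simp [hTdef, he, band_eq_zero' hq]
  have hTs : ∀ k p, ‖p.2.2‖ = 1 → ContDiffAt ℝ ∞ (T k) p := fun k p hy => by
    rcases lt_or_ge p.2.1 (R k) with h | h
    · exact contDiffAt_const.congr_of_eventuallyEq (hTr k p h)
    by_cases hu : p.1 ∈ Icc (-(k + 1 : ℝ)) (k + 1)
    · exact (contDiff_cut (R k)).contDiffAt.mul
        (hRs k p h ⟨by linarith [hu.1], by linarith [hu.2]⟩ hy)
    · exact contDiffAt_const.congr_of_eventuallyEq (hTu k p hu)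
  have hTO : ∀ k β, IsOScri (T k) β := fun k β => by
    refine (heO k β).congr fun a b => ?_
    filter_upwards [eventually_scriOn_gt a b (2 * R k)] with p hp
    filter_upwards [cut_eventuallyEq_one (hR0 k) hp] with q hq
    simp [hTdef, hq]
  have hTh : ∀ k p, p.2.2 ≠ 0 → T k (p.1, p.2.1, dir p.2.2) = T k p := fun k p hy => by
    have : chartPoint (p.1, p.2.1, dir p.2.2) = chartPoint p := by
      simp only [chartPoint, dir_of_norm_eq_one (norm_dir hy)]
    simp only [hTdef, he, cut, toNull, this]
  have hBs : ∀ p, ‖p.2.2‖ = 1 → ContDiffAt ℝ ∞ (locSum T) p := fun p hy => by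
    obtain ⟨K, hK⟩ := exists_nat_gt p.2.1
    exact (ContDiffAt.sum fun j _ => hTs j p hy).congr_of_eventuallyEq (locSum_eventuallyEq hT hK)
  set G : Spacetime n → ℝ := ofNull (locSum T) with hG
  -- All cutoffs vanish there, so the singularity of the null chart on the axis r = 0 does no harm.
  have hG0 : ∀ x, ‖spatial x‖ < 2 → G =ᶠ[𝓝 x] 0 := fun x hx => by
    have h1 : ContinuousAt (fun x : Spacetime n => ‖spatial x‖) x :=
      (contDiff_spatial (m := 0)).continuous.norm.continuousAt
    filter_upwards [h1.eventually (gt_mem_nhds hx)] with z hz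
    simp only [hG, ofNull, locSum]
    refine Finset.sum_eq_zero fun k _ => ?_
    have : cut n (R k) (z 0 - ‖spatial z‖, ‖spatial z‖, dir (spatial z)) = 0 :=
      cut_eq_zero (hR0 k) (by
        have : (0:ℝ) ≤ k := Nat.cast_nonneg k
        have := hRk k
        simp only
        linarith)
    simp only [hTdef, this, zero_mul]
  have hGs : ContDiff ℝ ∞ G := contDiff_iff_contDiffAt.2 fun x => by
    rcases lt_or_ge ‖spatial x‖ 2 with h | h
    · exact contDiffAt_const.congr_of_eventuallyEq (hG0 x h)
    · have hx : spatial x ≠ 0 := by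
        intro h0; rw [h0] at h; norm_num at h
      exact (hBs (x 0 - ‖spatial x‖, ‖spatial x‖, dir (spatial x)) (norm_dir hx)).ofNull hx
  have hGn : ∀ p : NullChart n, 0 < p.2.1 → ‖p.2.2‖ = 1 → toNull G =ᶠ[𝓝 p] locSum T :=
    fun p hp hy => by
      filter_upwards [eventually_ne_of_pos hp (ne_zero_of_norm_eq_one hy)] with q hq
      rw [hG, toNull_ofNull _ hq.1 hq.2]
      exact Finset.sum_congr rfl fun k _ => hTh k q hq.2
  refine ⟨G, hGs, fun k m => ?_, fun a b => ?_⟩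
  · obtain ⟨A, hA0, hA⟩ := exists_norm_iteratedFDeriv_le_pdjet (n := n) m
    obtain ⟨B, hB0, hB⟩ := exists_pdjet_le (n := n) m
    have hD : ∀ j, ∃ C : ℝ, 0 ≤ C ∧ ∀ p : NullChart n, ‖p.2.2‖ = 1 → jet m k (T j) p ≤ C :=
      fun j => exists_jet_bound_of_support (hTO j k) (fun p _ hy => hTs j p hy)
        (fun p hp => hTr j p (by
          have : (0:ℝ) ≤ j := Nat.cast_nonneg j
          linarith [hRk j])) (hTu j) m
    choose D hD0 hD using hD
    -- Terms from J on are small in m derivatives with weight k; the finitely many others are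
    -- bounded individually.
    set J := max m k with hJ
    set S := ∑ j ∈ Finset.range J, D j + 2 with hS
    have hS0 : 0 ≤ S := add_nonneg (Finset.sum_nonneg fun j _ => hD0 j) (by norm_num)
    refine ⟨A * (B * (2 ^ k * S)), fun x => ?_⟩
    rcases lt_or_ge ‖spatial x‖ 2 with h | h
    · have : iteratedFDeriv ℝ m G x = 0 := by
        rw [((hG0 x h).iteratedFDeriv ℝ m).self_of_nhds]
        exact congrFun iteratedFDeriv_fun_zero x
      rw [this]
      simp
      positivity
    have hx : spatial x ≠ 0 := by
      intro h0; rw [h0] at h; norm_num at h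
    obtain ⟨p, hp2, hpy, hpx⟩ : ∃ p : NullChart n, 2 ≤ p.2.1 ∧ ‖p.2.2‖ = 1 ∧ chartPoint p = x :=
      ⟨(x 0 - ‖spatial x‖, ‖spatial x‖, dir (spatial x)), h, norm_dir hx, by
        simp only [chartPoint, dir_of_norm_eq_one (norm_dir hx)]
        exact nullPoint_spatial x⟩
    have hp : 0 < p.2.1 := by linarith
    have key : ‖x‖ ^ k * jet m 0 (toNull G) p ≤ 2 ^ k * S := by
      obtain ⟨K, hK⟩ := exists_nat_gt (max p.2.1 J)
      have hKp : p.2.1 < K := (le_max_left _ _).trans_lt hK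
      have hKJ : J ≤ K := by exact_mod_cast ((le_max_right _ _).trans_lt hK).le
      rw [jet_congr ((hGn p hp hpy).trans (locSum_eventuallyEq hT hKp))]
      have h1 := jet_sum_le (Finset.range K) hp (fun j _ => hTs j p hpy) m 0
      refine (mul_le_mul_of_nonneg_left h1 (by positivity)).trans ?_
      -- On the support of the j-th term |u| ≤ r and therefore ‖x‖ ≤ 2r, so powers of r control
      -- powers of ‖x‖.
      have h2 : ∀ j, ‖x‖ ^ k * jet m 0 (T j) p ≤ 2 ^ k * jet m k (T j) p := fun j => by
        rcases lt_or_ge p.2.1 (R j) with h3 | h3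
        · rw [jet_congr (hTr j p h3), jet_congr (hTr j p h3), jet_zero, jet_zero]; simp
        by_cases hu : p.1 ∈ Icc (-(j + 1 : ℝ)) (j + 1)
        · have h4 : ‖x‖ ≤ 2 * p.2.1 := by
            rw [← hpx]
            refine norm_chartPoint_le hp.le hpy ((abs_le.2 hu).trans ?_)
            linarith [hRk j]
          have h5 : jet m k (T j) p = p.2.1 ^ k * jet m 0 (T j) p := by
            rw [← Real.rpow_natCast, ← jet_weight hp, add_zero]
          rw [h5, ← mul_assoc, ← mul_pow]
          gcongr
          exact jet_nonneg hp _ _ _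
        · rw [jet_congr (hTu j p hu), jet_congr (hTu j p hu), jet_zero, jet_zero]; simp
      rw [Finset.mul_sum]
      refine (Finset.sum_le_sum fun j _ => h2 j).trans ?_
      rw [← Finset.mul_sum]
      refine mul_le_mul_of_nonneg_left ?_ (by positivity)
      rw [← Finset.sum_range_add_sum_Ico _ hKJ]
      refine add_le_add (Finset.sum_le_sum fun j _ => hD j p hpy)
        (le_trans (Finset.sum_le_sum fun j hj => ?_) (sum_two_inv_pow_le (Finset.Ico J K)))
      have hjJ := (Finset.mem_Ico.1 hj).1
      have hmj : m ≤ j := (le_max_left _ _).trans hjJ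
      have hkj : (k : ℝ) ≤ j := by exact_mod_cast (le_max_right _ _).trans hjJ
      by_cases hu : p.1 ∈ Icc (-(j + 1 : ℝ)) (j + 1)
      · refine (jet_le_of_one_le (by linarith) m hkj _).trans ?_
        refine (jet_mono hp hmj _ _).trans ?_
        exact hR j p hp ⟨by linarith [hu.1], by linarith [hu.2]⟩ hpy
      · rw [jet_congr (hTu j p hu), jet_zero]; positivity
    have h1 := hA G x hGs.contDiffAt
    have h2 := hB G p (by linarith) hpy hGs.contDiffAt
    rw [hpx] at h2
    calc ‖x‖ ^ k * ‖iteratedFDeriv ℝ m G x‖ ≤ ‖x‖ ^ k * (A * (B * jet m 0 (toNull G) p)) := by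
          gcongr
          exact h1.trans (mul_le_mul_of_nonneg_left h2 hA0)
      _ = A * (B * (‖x‖ ^ k * jet m 0 (toNull G) p)) := by ring
      _ ≤ _ := by gcongr
  -- For u in [a, b] only bands below K are nonzero; beyond their radii all of these cutoffs are 1
  -- and the bands add up to 1.
  · obtain ⟨K, hK⟩ := exists_nat_ge (1 + max (a ^ 2) (b ^ 2))
    have h1 : ∀ᶠ p in scriOn n a b, ∀ k ∈ Finset.range K, 2 * R k < p.2.1 :=
      (Finset.eventually_all _).2 fun k _ => eventually_scriOn_gt a b _
    filter_upwards [h1, eventually_scriOn_gt a b K, eventually_scriOn_gt a b 0,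
      eventually_scriOn_mem a b] with p h1 h2 h3 h4
    have h5 : G (chartPoint p) = locSum T p := (hGn p h3 h4.2).self_of_nhds
    have hu : 1 + p.1 ^ 2 ≤ K := by
      refine le_trans ?_ hK
      have : p.1 ^ 2 ≤ max (a ^ 2) (b ^ 2) := by
        rcases le_or_gt 0 p.1 with h | h
        · exact le_max_of_le_right (pow_le_pow_left₀ h h4.1.2 2)
        · refine le_max_of_le_left ?_
          nlinarith [h4.1.1]
      linarith
    have h6 : ∀ k ∈ Finset.range ⌈p.2.1⌉₊, T k p = band k p.1 * toNull E p := fun k _ => by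
      by_cases hk : k < K
      · simp [hTdef, he, cut_eq_one (hR0 k) (h1 k (Finset.mem_range.2 hk)).le]
      · have : band k p.1 = 0 := band_eq_zero (hu.trans (by exact_mod_cast not_lt.1 hk))
        simp [hTdef, he, this]
    rw [h5, locSum, Finset.sum_congr rfl h6, ← Finset.sum_mul, sum_band, one_mul]
    · rfl
    · exact hu.trans (h2.le.trans (Nat.le_ceil _))

theorem dd_toNull {f : Spacetime n → ℝ} {p : NullChart n} (hy : p.2.2 ≠ 0)
    (hf : DifferentiableAt ℝ f (chartPoint p)) (v : Slot n) :
    dd v (toNull f) p = ∑ μ, fderiv ℝ chartPoint p v.vec μ * toNull (pd μ f) p := by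
  have hd : DifferentiableAt ℝ (chartPoint : NullChart n → Spacetime n) p :=
    (contDiffAt_chartPoint (m := 1) hy).differentiableAt (by simp)
  have h1 : toNull f = f ∘ chartPoint := rfl
  rw [dd, h1, fderiv_comp p hf hd, ContinuousLinearMap.comp_apply]
  have h2 : ∀ w : Spacetime n, w = ∑ μ, w μ • (Pi.single μ 1 : Spacetime n) := fun w => by
    funext ν
    simp [Finset.sum_apply, Pi.single_apply]
  conv_lhs => rw [h2 (fderiv ℝ chartPoint p v.vec)]
  rw [map_sum]
  simp [toNull, pd]

/-- Angular coordinate vectors have inertial components of order r. The precise exponent is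
immaterial, since the factors are only multiplied with rapidly decreasing functions. -/
theorem exists_isOScri_fderiv_chartPoint (v : Slot n) (μ : Fin (n + 1)) :
    ∃ β, IsOScri (fun p => fderiv ℝ chartPoint p v.vec μ) β := by
  refine Fin.cases ⟨0, ?_⟩ (fun i => ?_) μ
  · have h : IsOScri (lift fun _ : ℝ × Space n => v.vec.1 + v.vec.2.1) 0 :=
      isOScri_lift fun _ _ => contDiffAt_const
    refine h.congr (eqScri_of_forall fun p hp hy => ?_)
    rw [fderiv_chartPoint hy]
    rfl
  · have hs : ∀ q : ℝ × Space n, q.2 ≠ 0 → ContDiffAt ℝ ∞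
        (fun q : ℝ × Space n => fderiv ℝ (dir : Space n → Space n) q.2 v.vec.2.2 i) q := fun q hq => by
      have h1 : ContDiffAt ℝ ∞ (fun y : Space n => fderiv ℝ (dir : Space n → Space n) y v.vec.2.2)
        q.2 := ((contDiffAt_dir (m := ∞) hq).fderiv_right (m := ∞) (by simp)).clm_apply
          contDiffAt_const
      have h2 : ContDiffAt ℝ ∞ (fun y : Space n => fderiv ℝ (dir : Space n → Space n) y v.vec.2.2 i)
        q.2 := (EuclideanSpace.proj (𝕜 := ℝ) i).contDiff.contDiffAt.comp q.2 h1
      exact ContDiffAt.comp q h2 contDiffAt_snd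
    have h1 := (isOScri_lift (IsCoef.hatY i).smooth).const_mul v.vec.2.1
    have h2 := (isOScri_rpowR (n := n) 1).mul (isOScri_lift hs)
    refine ⟨-1, ((h1.mono (γ := -1) (by norm_num)).add
      (h2.mono (γ := -1) (by norm_num))).congr (eqScri_of_forall fun p hp hy => ?_)⟩
    rw [fderiv_chartPoint hy]
    simp [lift, hatY, rpowR]

/-- For u in a bounded interval t = u + r is comparable with r, so rapid decay in time is rapid
decay in r. -/
theorem isOScri_toNull_of_rapid {ψ : Spacetime n → ℝ} (hψ : ContDiff ℝ ∞ ψ)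
    (hdec : ∀ m N : ℕ, ∃ C : ℝ, ∀ x : Spacetime n, 1 ≤ x 0 → pdjet m ψ x * (x 0) ^ N ≤ C)
    (β : ℝ) : IsOScri (toNull ψ) β := by
  refine ⟨fun a b => ?_, fun m => ?_⟩
  · filter_upwards [eventually_scriOn_pos_ne a b] with p hp
    exact hψ.contDiffAt.toNull hp.2
  have hbase : ∀ ψ : Spacetime n → ℝ, (∀ m N : ℕ, ∃ C : ℝ, ∀ x : Spacetime n, 1 ≤ x 0 →
      pdjet m ψ x * (x 0) ^ N ≤ C) → ∀ (β a b : ℝ), ∃ C, ∀ᶠ p in scriOn n a b,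
      |toNull ψ p| * p.2.1 ^ β ≤ C := fun ψ hdec β a b => by
    obtain ⟨N, hN⟩ := exists_nat_ge β
    obtain ⟨C, hC⟩ := hdec 0 N
    refine ⟨2 ^ N * |C|, ?_⟩
    filter_upwards [eventually_scriOn_gt a b 1, eventually_scriOn_gt a b (2 * (1 + |a|)),
      eventually_scriOn_mem a b] with p h1 h2 h3
    have h4 := neg_abs_le a
    have h5 : chartPoint p 0 = p.1 + p.2.1 := rfl
    have h6 : p.2.1 / 2 ≤ chartPoint p 0 := by rw [h5]; linarith [h3.1.1]
    have h7 := hC (chartPoint p) (by rw [h5]; linarith [h3.1.1, abs_nonneg a])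
    have h8 : p.2.1 ^ β ≤ 2 ^ N * (chartPoint p 0) ^ N := by
      rw [← mul_pow]
      refine (Real.rpow_le_rpow_of_exponent_le h1.le hN).trans ?_
      rw [Real.rpow_natCast]
      exact pow_le_pow_left₀ (by linarith) (by linarith) N
    calc |toNull ψ p| * p.2.1 ^ β ≤ |toNull ψ p| * (2 ^ N * (chartPoint p 0) ^ N) :=
          mul_le_mul_of_nonneg_left h8 (abs_nonneg _)
      _ = 2 ^ N * (pdjet 0 ψ (chartPoint p) * (chartPoint p 0) ^ N) := by
          simp only [pdjet, toNull]; ring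
      _ ≤ 2 ^ N * |C| := by
          gcongr
          exact h7.trans (le_abs_self C)
  induction m generalizing ψ β with
  | zero => exact hbase ψ hdec β
  | succ m ih =>
    intro a b
    obtain ⟨C, hC⟩ := hbase ψ hdec β a b
    have hpd : ∀ μ : Fin (n + 1), ∀ β a b, ∃ C, ∀ᶠ p in scriOn n a b,
        jet m β (toNull (pd μ ψ)) p ≤ C := fun μ β =>
      ih (ψ := pd μ ψ) (contDiff_iff_contDiffAt.2 fun x => hψ.contDiffAt.pd μ) (fun k N => by
        obtain ⟨C, hC⟩ := hdec (k + 1) N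
        refine ⟨C, fun x hx => (mul_le_mul_of_nonneg_right (pdjet_pd_le k ψ x μ) ?_).trans (hC x hx)⟩
        positivity) β
    have hv : ∀ v : Slot n, ∃ D, ∀ᶠ p in scriOn n a b,
        jet m (β + v.wt) (dd v (toNull ψ)) p ≤ D := fun v => by
      -- The powers of r lost in passing to inertial derivatives are regained because the induction
      -- hypothesis holds for every exponent.
      choose γ hγ using exists_isOScri_fderiv_chartPoint v
      choose A hA using fun μ => (hγ μ).bound m a b
      choose B hB using fun μ => hpd μ (β + v.wt - γ μ) a b
      refine ⟨∑ μ, 3 ^ m * (|A μ| * |B μ|), ?_⟩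
      filter_upwards [eventually_all.2 hA, eventually_all.2 hB, eventually_scriOn_pos_ne a b,
        eventually_all.2 fun μ => (hγ μ).smooth a b] with p h1 h2 h3 h4
      have h5 : ∀ μ, ContDiffAt ℝ ∞ (toNull (pd μ ψ)) p := fun μ =>
        (hψ.contDiffAt.pd μ).toNull h3.2
      have h6 : dd v (toNull ψ) =ᶠ[𝓝 p] fun p => ∑ μ,
          ((fun p => fderiv ℝ chartPoint p v.vec μ) * toNull (pd μ ψ)) p := by
        filter_upwards [eventually_ne_of_pos h3.1 h3.2] with q hq
        exact dd_toNull hq.2 (hψ.differentiable (by simp) _) v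
      rw [jet_congr h6]
      refine (jet_sum_le _ h3.1 (fun μ _ => (h4 μ).mul (h5 μ)) m _).trans ?_
      refine Finset.sum_le_sum fun μ _ => ?_
      have h7 := jet_mul_le h3.1 (h4 μ) (h5 μ) m (γ μ) (β + v.wt - γ μ)
      rw [add_sub_cancel] at h7
      refine h7.trans ?_
      gcongr
      · exact jet_nonneg h3.1 _ _ _
      · exact (h1 μ).trans (le_abs_self _)
      · exact (h2 μ).trans (le_abs_self _)
    choose D hD using hv
    refine ⟨C + ∑ v, D v, ?_⟩
    filter_upwards [hC, eventually_all.2 hD] with p h1 h2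
    exact add_le_add h1 (Finset.sum_le_sum fun v _ => h2 v)

/-- Rapidly decreasing errors near null infinity are removed by means of the wave equation. -/
theorem exists_box_eq_of_rapid (hn : 0 < n) {E : Spacetime n → ℝ}
    (hE : ∀ β, IsOScri (toNull E) β) :
    ∃ ψ : Spacetime n → ℝ, ContDiff ℝ ∞ ψ ∧ (∀ β, IsOScri (toNull ψ) β) ∧
      ∀ a b, ∀ᶠ p in scriOn n a b, box ψ (chartPoint p) = E (chartPoint p) := by
  obtain ⟨G, hG, hdec, hGE⟩ := exists_rapid_extension hE
  obtain ⟨ψ, hψ, hbox, hψd⟩ := exists_wave_solution hn hG hdec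
  refine ⟨ψ, hψ, isOScri_toNull_of_rapid hψ hψd, fun a b => ?_⟩
  filter_upwards [hGE a b] with p hp
  rw [hbox, hp]

/-! ### The Newtonian potential -/

section Potential

open MeasureTheory

/-- Partial derivatives on Euclidean space. -/
def spd (i : Fin n) (P : Space n → ℝ) (x : Space n) : ℝ := fderiv ℝ P x (EuclideanSpace.single i 1)

theorem ContDiff.spd {P : Space n → ℝ} (hP : ContDiff ℝ ∞ P) (i : Fin n) :
    ContDiff ℝ ∞ (spd i P) := contDiff_iff_contDiffAt.2 fun _ =>
  hP.contDiffAt.contDiffAt_fderiv_apply _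

theorem tsupport_spd_subset (P : Space n → ℝ) (i : Fin n) : tsupport (spd i P) ⊆ tsupport P :=
  tsupport_fderiv_apply_subset ℝ (EuclideanSpace.single i 1)

/-- Smooth functions away from the origin that are homogeneous of degree `-t`. -/
structure IsHomog (t : ℝ) (k : Space n → ℝ) : Prop where
  smooth : ∀ x, x ≠ 0 → ContDiffAt ℝ ∞ k x
  homog : ∀ x, x ≠ 0 → ∀ s : ℝ, 0 < s → k (s • x) = s ^ (-t) * k x

theorem IsHomog.spd {t : ℝ} {k : Space n → ℝ} (hk : IsHomog t k) (i : Fin n) :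
    IsHomog (t + 1) (spd i k) := by
  refine ⟨fun x hx => (hk.smooth x hx).contDiffAt_fderiv_apply _, fun x hx s hs => ?_⟩
  have h1 : (fun y => k (s • y)) =ᶠ[𝓝 x] fun y => s ^ (-t) * k y :=
    (isOpen_ne.mem_nhds hx : {y : Space n | y ≠ 0} ∈ 𝓝 x) |> fun h =>
      Filter.mem_of_superset h fun y hy => hk.homog y hy s hs
  have h2 : DifferentiableAt ℝ k (s • x) :=
    (hk.smooth _ (smul_ne_zero hs.ne' hx)).differentiableAt (by simp)
  have h3 : DifferentiableAt ℝ k x := (hk.smooth x hx).differentiableAt (by simp)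
  have h4 := h1.fderiv_eq (𝕜 := ℝ)
  have h5 : HasFDerivAt (fun y => k (s • y)) _ x :=
    h2.hasFDerivAt.comp x ((hasFDerivAt_id x).const_smul s)
  rw [h5.fderiv, fderiv_const_mul h3] at h4
  have h6 := congrArg (fun L => L (EuclideanSpace.single i 1)) h4
  simp only [ContinuousLinearMap.comp_apply, smul_apply, ContinuousLinearMap.id_apply, map_smul,
    smul_eq_mul] at h6
  have e : s ^ (-(t + 1)) = s⁻¹ * s ^ (-t) := by
    rw [show -(t + 1) = -1 + -t by ring, Real.rpow_add hs, Real.rpow_neg_one]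
  rw [_root_.spd, _root_.spd, e]
  field_simp
  rw [mul_comm]
  exact h6

theorem IsHomog.exists_bound {t : ℝ} {k : Space n → ℝ} (hk : IsHomog t k) :
    ∃ C : ℝ, 0 ≤ C ∧ ∀ x, x ≠ 0 → |k x| ≤ C * ‖x‖ ^ (-t) := by
  obtain ⟨C, hC⟩ := (isCompact_sphere (0 : Space n) 1).bddAbove_image (f := fun x => |k x|)
    fun x hx => (hk.smooth x (ne_zero_of_norm_eq_one (by simpa using hx))).continuousAt.abs
      |>.continuousWithinAt
  refine ⟨max C 0, le_max_right _ _, fun x hx => ?_⟩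
  have h1 := hk.homog (dir x) (ne_zero_of_norm_eq_one (norm_dir hx)) ‖x‖ (norm_pos_iff.2 hx)
  rw [norm_smul_dir] at h1
  rw [h1, abs_mul, abs_of_nonneg (by positivity), mul_comm]
  refine mul_le_mul_of_nonneg_right (le_max_of_le_left (hC ⟨dir x, ?_, rfl⟩)) (by positivity)
  simpa using norm_dir hx

/-- The convolution of a kernel with a compactly supported function. -/
def pot (k F : Space n → ℝ) (x : Space n) : ℝ := ∫ z, k z * F (x - z)

theorem pot_eq (k F : Space n → ℝ) (x : Space n) : pot k F x = ∫ z, k (x - z) * F z := by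
  rw [pot, ← integral_sub_left_eq_self (fun z => k z * F (x - z)) volume x]
  simp

theorem pot_eq_convolution (k F : Space n → ℝ) :
    pot k F = convolution k F (ContinuousLinearMap.mul ℝ ℝ) volume := rfl

theorem contDiff_pot {k F : Space n → ℝ} (hk : LocallyIntegrable k) (hF : ContDiff ℝ ∞ F)
    (hc : HasCompactSupport F) : ContDiff ℝ ∞ (pot k F) :=
  hc.contDiff_convolution_right (n := ⊤) (ContinuousLinearMap.mul ℝ ℝ) hk hF

theorem spd_pot {k F : Space n → ℝ} (hk : LocallyIntegrable k) (hF : ContDiff ℝ ∞ F)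
    (hc : HasCompactSupport F) (i : Fin n) : spd i (pot k F) = pot k (spd i F) := by
  funext x
  have h1 := hc.hasFDerivAt_convolution_right (ContinuousLinearMap.mul ℝ ℝ) hk
    (hF.of_le (by simp)) x
  rw [spd, pot_eq_convolution, h1.fderiv, convolution_precompR_apply _ hk (hc.fderiv ℝ)
    (hF.continuous_fderiv (by simp))]
  rfl

theorem continuous_mul_of_tsupport {f g : Space n → ℝ} (hg : Continuous g)
    (hf : ∀ z ∈ tsupport g, ContinuousAt f z) : Continuous fun z => f z * g z := by
  refine continuous_iff_continuousAt.2 fun z => ?_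
  by_cases hz : z ∈ tsupport g
  · exact (hf z hz).mul hg.continuousAt
  · have h1 : g =ᶠ[𝓝 z] 0 := notMem_tsupport_iff_eventuallyEq.1 hz
    exact (continuousAt_const (y := (0:ℝ))).congr (h1.mono fun w hw => by simp [hw])

theorem integrable_mul_of_tsupport {f g : Space n → ℝ} (hg : Continuous g)
    (hc : HasCompactSupport g) (hf : ∀ z ∈ tsupport g, ContinuousAt f z) :
    Integrable fun z => f z * g z :=
  (continuous_mul_of_tsupport hg hf).integrable_of_hasCompactSupport hc.mul_left

/-- Outside the support of the density the kernel is smooth where it is evaluated, so integration by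
parts moves the derivative onto it without a contribution from its singularity. -/
theorem pot_spd_eq {k F : Space n → ℝ} {t R : ℝ} (hk : IsHomog t k) (hF : ContDiff ℝ ∞ F)
    (hs : tsupport F ⊆ Metric.closedBall 0 R) (i : Fin n) {x : Space n} (hx : R < ‖x‖) :
    pot k (spd i F) x = pot (spd i k) F x := by
  have hc : HasCompactSupport F := (isCompact_closedBall _ _).of_isClosed_subset
    (isClosed_tsupport F) hs
  have hc' : HasCompactSupport (spd i F) := (isCompact_closedBall _ _).of_isClosed_subset
    (isClosed_tsupport _) ((tsupport_spd_subset F i).trans hs)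
  have hne : ∀ z ∈ tsupport F, x - z ≠ 0 := fun z hz h => by
    have h1 := hs hz
    rw [sub_eq_zero] at h
    rw [mem_closedBall_zero_iff, ← h] at h1
    linarith
  have hd : ∀ z ∈ tsupport F, HasFDerivAt (fun z => k (x - z))
      ((fderiv ℝ k (x - z)).comp (-ContinuousLinearMap.id ℝ (Space n))) z := fun z hz =>
    ((hk.smooth _ (hne z hz)).differentiableAt (by simp)).hasFDerivAt.comp z
      ((hasFDerivAt_id z).const_sub x)
  have hcont : ∀ (k : Space n → ℝ) t, IsHomog t k → ∀ z ∈ tsupport F,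
      ContinuousAt (fun z => k (x - z)) z := fun k t hk z hz =>
    ContinuousAt.comp (f := fun z => x - z) (hk.smooth _ (hne z hz)).continuousAt (by fun_prop)
  have hfd : ∀ z, fderiv ℝ (fun z => k (x - z)) z (EuclideanSpace.single i 1) * F z
      = -(spd i k (x - z) * F z) := fun z => by
    by_cases hz : z ∈ tsupport F
    · rw [(hd z hz).fderiv, spd]; simp
    · simp [image_eq_zero_of_notMem_tsupport hz]
  rw [pot_eq, pot_eq]
  have key := integral_mul_fderiv_eq_neg_fderiv_mul_of_integrable (μ := volume)
    (f := fun z => k (x - z)) (g := F) (v := EuclideanSpace.single i 1) ?_ ?_ ?_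
    (fun z hz => (hd z hz).differentiableAt) (fun z _ => hF.differentiable (by simp) z)
  · simp only [hfd, integral_neg, neg_neg] at key
    exact key
  · simp only [hfd]
    exact (integrable_mul_of_tsupport hF.continuous hc (hcont _ _ (hk.spd i))).neg
  · exact integrable_mul_of_tsupport (hF.spd i).continuous hc' fun z hz =>
      hcont k t hk z (tsupport_spd_subset F i hz)
  · exact integrable_mul_of_tsupport hF.continuous hc (hcont k t hk)

/-- Iterated partial derivatives. -/
def wd (w : List (Fin n)) (F : Space n → ℝ) : Space n → ℝ := w.foldr spd F

theorem contDiff_wd {F : Space n → ℝ} (hF : ContDiff ℝ ∞ F) (w : List (Fin n)) :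
    ContDiff ℝ ∞ (wd w F) := by
  induction w with
  | nil => exact hF
  | cons i w ih => exact ih.spd i

theorem tsupport_wd_subset (F : Space n → ℝ) (w : List (Fin n)) :
    tsupport (wd w F) ⊆ tsupport F := by
  induction w with
  | nil => exact Subset.rfl
  | cons i w ih => exact (tsupport_spd_subset _ i).trans ih

/-- At distance at least 2R the kernel is evaluated at distance at least ‖x‖/2. Each derivative
moved onto it raises its rate of decay by one. -/
theorem exists_pot_wd_bound {F : Space n → ℝ} {R : ℝ} (hR : 0 ≤ R) (hF : ContDiff ℝ ∞ F)
    (hs : tsupport F ⊆ Metric.closedBall 0 R) (w : List (Fin n)) {k : Space n → ℝ} {t : ℝ}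
    (ht : 0 ≤ t) (hk : IsHomog t k) :
    ∃ C : ℝ, ∀ x, 2 * R < ‖x‖ → |pot k (wd w F) x| * ‖x‖ ^ (t + w.length) ≤ C := by
  induction w generalizing k t with
  | nil =>
    have hc : HasCompactSupport F := (isCompact_closedBall _ _).of_isClosed_subset
      (isClosed_tsupport F) hs
    obtain ⟨C, hC0, hC⟩ := hk.exists_bound
    have hi : Integrable fun z => |F z| := (hF.continuous.integrable_of_hasCompactSupport hc).norm
    refine ⟨∫ z, C * 2 ^ t * |F z|, fun x hx => ?_⟩
    have hx0 : 0 < ‖x‖ := by linarith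
    simp only [List.length_nil, Nat.cast_zero, add_zero]
    rw [pot_eq, ← le_div_iff₀ (by positivity), ← integral_div, ← Real.norm_eq_abs]
    refine norm_integral_le_of_norm_le ((hi.const_mul _).div_const _)
      (Eventually.of_forall fun z => ?_)
    by_cases hz : z ∈ tsupport F
    · have hzR : ‖z‖ ≤ R := by simpa using hs hz
      have h1 : ‖x‖ / 2 ≤ ‖x - z‖ := by
        have := norm_sub_norm_le x z
        linarith
      have h2 : x - z ≠ 0 := norm_pos_iff.1 (by linarith)
      rw [norm_mul, Real.norm_eq_abs, Real.norm_eq_abs]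
      have h3 : ‖x - z‖ ^ (-t) ≤ (‖x‖ / 2) ^ (-t) :=
        Real.rpow_le_rpow_of_nonpos (by linarith) h1 (by linarith)
      have h4 : (‖x‖ / 2) ^ (-t) = 2 ^ t / ‖x‖ ^ t := by
        rw [Real.div_rpow hx0.le (by norm_num), Real.rpow_neg hx0.le, Real.rpow_neg (by norm_num)]
        field_simp
      have h5 := (hC _ h2).trans (mul_le_mul_of_nonneg_left h3 hC0)
      rw [h4] at h5
      refine (mul_le_mul_of_nonneg_right h5 (abs_nonneg _)).trans (le_of_eq ?_)
      simp only [wd, List.foldr_nil]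
      ring
    · have : F z = 0 := image_eq_zero_of_notMem_tsupport hz
      simp [wd, this]
  | cons i w ih =>
    -- The induction changes the kernel: a derivative of the density becomes one of the kernel, of
    -- homogeneity one lower.
    obtain ⟨C, hC⟩ := ih (k := spd i k) (t := t + 1) (by linarith) (hk.spd i)
    refine ⟨C, fun x hx => ?_⟩
    have h1 := hC x hx
    have h2 : pot k (wd (i :: w) F) x = pot (spd i k) (wd w F) x :=
      pot_spd_eq hk (contDiff_wd hF w) ((tsupport_wd_subset F w).trans hs) i (by linarith)
    rw [h2, List.length_cons]
    push_cast
    rwa [show t + ((w.length : ℝ) + 1) = t + 1 + w.length by ring]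

/-- Derivatives up to order `m` decay like `|x|^(-t)`, with one more power for each derivative. -/
def Decays : ℕ → ℝ → (Space n → ℝ) → Prop
  | 0, t, P => ∃ C : ℝ, ∀ x, 1 ≤ ‖x‖ → |P x| * ‖x‖ ^ t ≤ C
  | m + 1, t, P => (∃ C : ℝ, ∀ x, 1 ≤ ‖x‖ → |P x| * ‖x‖ ^ t ≤ C) ∧
      ∀ i, Decays m (t + 1) (spd i P)

/-- The far estimate holds beyond 2R; inside this ball the potential is continuous and compactness
suffices. Derivatives of the potential are potentials of derivatives. -/
theorem decays_pot {F : Space n → ℝ} {R : ℝ} (hR : 0 ≤ R) (hF : ContDiff ℝ ∞ F)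
    (hs : tsupport F ⊆ Metric.closedBall 0 R) {k : Space n → ℝ} {t : ℝ} (ht : 0 ≤ t)
    (hk : IsHomog t k) (hki : LocallyIntegrable k) (m : ℕ) (w : List (Fin n)) :
    Decays m (t + w.length) (pot k (wd w F)) := by
  have hc : ∀ w : List (Fin n), HasCompactSupport (wd w F) := fun w =>
    (isCompact_closedBall _ _).of_isClosed_subset
      (isClosed_tsupport _) ((tsupport_wd_subset F w).trans hs)
  have base : ∀ w : List (Fin n),
      ∃ C : ℝ, ∀ x, 1 ≤ ‖x‖ → |pot k (wd w F) x| * ‖x‖ ^ (t + w.length) ≤ C := fun w => by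
    obtain ⟨C, hC⟩ := exists_pot_wd_bound hR hF hs w ht hk
    have hcont : Continuous fun x : Space n => |pot k (wd w F) x| * ‖x‖ ^ (t + w.length) :=
      (contDiff_pot hki (contDiff_wd hF w) (hc w)).continuous.abs.mul
        (continuous_norm.rpow_const fun x => Or.inr (by positivity))
    obtain ⟨D, hD⟩ := (isCompact_closedBall (0 : Space n) (2 * R)).bddAbove_image
      hcont.continuousOn
    refine ⟨max C D, fun x _ => ?_⟩
    rcases lt_or_ge (2 * R) ‖x‖ with h | h
    · exact le_max_of_le_left (hC x h)
    · exact le_max_of_le_right (hD ⟨x, by simpa using h, rfl⟩)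
  induction m generalizing w with
  | zero => exact base w
  | succ m ih =>
    refine ⟨base w, fun i => ?_⟩
    rw [spd_pot hki (contDiff_wd hF w) (hc w)]
    have := ih (i :: w)
    rw [List.length_cons] at this
    push_cast at this
    rwa [show t + ((w.length : ℝ) + 1) = t + w.length + 1 by ring] at this

/-! #### The fundamental solution -/

/-- The regularised Newtonian kernel. -/
def regKer (n : ℕ) (ε : ℝ) (z : Space n) : ℝ := (‖z‖ ^ 2 + ε ^ 2) ^ (-(((n : ℝ) - 2) / 2))

def newton (n : ℕ) (z : Space n) : ℝ := ‖z‖ ^ (-((n : ℝ) - 2))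

theorem isHomog_newton : IsHomog ((n : ℝ) - 2) (newton n) := by
  refine ⟨fun x hx => (contDiffAt_norm_space hx).rpow_const_of_ne (norm_ne_zero_iff.2 hx),
    fun x hx s hs => ?_⟩
  rw [newton, newton, norm_smul, Real.norm_eq_abs, abs_of_pos hs, Real.mul_rpow hs.le (norm_nonneg _)]

theorem locallyIntegrable_newton (hn : 0 < n) : LocallyIntegrable (newton n) := by
  refine locallyIntegrable_of_norm_le_rpow (C := 1) (α := (n : ℝ) - 2) (by simp; omega)
    (by simp) (Eventually.of_forall fun x => ?_) ?_
  · rw [one_mul, newton, Real.norm_eq_abs, abs_of_nonneg (by positivity)]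
  · exact (measurable_norm.pow_const _).aestronglyMeasurable

theorem hasFDerivAt_sq_add_rpow {ε : ℝ} (hε : 0 < ε) (a : ℝ) (z : Space n) :
    HasFDerivAt (fun z : Space n => (‖z‖ ^ 2 + ε ^ 2) ^ a)
      ((a * (‖z‖ ^ 2 + ε ^ 2) ^ (a - 1)) • (2 • innerSL ℝ z)) z :=
  ((hasStrictFDerivAt_norm_sq z).hasFDerivAt.add_const _).rpow_const (Or.inl (by positivity))

theorem spd_sq_add_rpow {ε : ℝ} (hε : 0 < ε) (a : ℝ) (i : Fin n) :
    spd i (fun z : Space n => (‖z‖ ^ 2 + ε ^ 2) ^ a)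
      = fun z => 2 * a * z i * (‖z‖ ^ 2 + ε ^ 2) ^ (a - 1) := by
  funext z
  rw [spd, (hasFDerivAt_sq_add_rpow hε a z).fderiv]
  simp [EuclideanSpace.inner_single_right]
  ring

/-- A scaled bump, whose mass does not depend on ε and which concentrates at the origin: up to a
constant, an approximation of the delta function. -/
theorem sum_spd_spd_regKer {ε : ℝ} (hε : 0 < ε) (z : Space n) :
    ∑ i, spd i (spd i (regKer n ε)) z
      = -((n : ℝ) * (n - 2)) * (ε ^ 2 * (‖z‖ ^ 2 + ε ^ 2) ^ (-(((n : ℝ) + 2) / 2))) := by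
  set a := -(((n : ℝ) - 2) / 2) with ha
  have h1 : ∀ i : Fin n, spd i (spd i (regKer n ε)) z = 2 * a * (‖z‖ ^ 2 + ε ^ 2) ^ (a - 1)
      + 2 * a * (2 * (a - 1)) * (z i ^ 2 * (‖z‖ ^ 2 + ε ^ 2) ^ (a - 1 - 1)) := fun i => by
    have e : regKer n ε = fun z : Space n => (‖z‖ ^ 2 + ε ^ 2) ^ a := rfl
    rw [e, spd_sq_add_rpow hε, spd]
    have h2 : HasFDerivAt (fun z : Space n => 2 * a * z i) _ z :=
      ((EuclideanSpace.proj (𝕜 := ℝ) i).hasFDerivAt (x := z)).const_mul (2 * a)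
    rw [(h2.fun_mul (hasFDerivAt_sq_add_rpow hε (a - 1) z)).fderiv]
    simp [EuclideanSpace.inner_single_right]
    ring
  simp only [h1]
  rw [Finset.sum_add_distrib, ← Finset.mul_sum (a := 2 * a * (2 * (a - 1))),
    ← Finset.sum_mul Finset.univ (fun i => z i ^ 2),
    ← EuclideanSpace.real_norm_sq_eq]
  have hq : 0 < ‖z‖ ^ 2 + ε ^ 2 := by positivity
  have e1 : (‖z‖ ^ 2 + ε ^ 2) ^ (a - 1)
      = (‖z‖ ^ 2 + ε ^ 2) * (‖z‖ ^ 2 + ε ^ 2) ^ (-(((n : ℝ) + 2) / 2)) := by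
    nth_rewrite 2 [← Real.rpow_one (‖z‖ ^ 2 + ε ^ 2)]
    rw [← Real.rpow_add hq]
    congr 1
    rw [ha]; ring
  have e2 : a - 1 - 1 = -(((n : ℝ) + 2) / 2) := by rw [ha]; ring
  rw [e1, e2, ha]
  simp
  ring

theorem contDiff_regKer {ε : ℝ} (hε : 0 < ε) : ContDiff ℝ ∞ (regKer n ε) :=
  (ContDiff.add (contDiff_norm_sq ℝ) contDiff_const).rpow_const_of_ne fun x => by positivity

theorem integral_mul_spd {f g : Space n → ℝ} (hf : ContDiff ℝ ∞ f) (hg : ContDiff ℝ ∞ g)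
    (hc : HasCompactSupport g) (i : Fin n) : ∫ z, f z * spd i g z = -∫ z, spd i f z * g z := by
  have hc' : HasCompactSupport (spd i g) := hc.isCompact.of_isClosed_subset (isClosed_tsupport _)
    (tsupport_spd_subset g i)
  exact integral_mul_fderiv_eq_neg_fderiv_mul_of_integrable (μ := volume)
    (integrable_mul_of_tsupport hg.continuous hc fun z _ => (hf.spd i).continuous.continuousAt)
    (integrable_mul_of_tsupport (hg.spd i).continuous hc' fun z _ => hf.continuous.continuousAt)
    (integrable_mul_of_tsupport hg.continuous hc fun z _ => hf.continuous.continuousAt)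
    (fun z _ => hf.differentiable (by simp) z) (fun z _ => hg.differentiable (by simp) z)

/-- The regularized kernel is smooth, so Green's identity needs no excision; the substitution z = εw
then exhibits the approximate identity. -/
theorem pot_regKer_laplacian {F : Space n → ℝ} (hF : ContDiff ℝ ∞ F) (hc : HasCompactSupport F)
    {ε : ℝ} (hε : 0 < ε) (x : Space n) :
    pot (regKer n ε) (fun z => ∑ i, spd i (spd i F) z) x
      = -((n : ℝ) * (n - 2)) * ∫ w : Space n, (‖w‖ ^ 2 + 1) ^ (-(((n : ℝ) + 2) / 2)) * F (x - ε • w) := by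
  set G : Space n → ℝ := fun z => F (x - z) with hG
  have hGs : ContDiff ℝ ∞ G := hF.comp (contDiff_const.sub contDiff_id)
  have hGc : HasCompactSupport G := hc.comp_homeomorph (Homeomorph.subLeft x)
  have h1 : ∀ (F : Space n → ℝ), ContDiff ℝ ∞ F → ∀ (i : Fin n) (z : Space n),
      spd i (fun z => F (x - z)) z = -spd i F (x - z) := by
    intro F hF i z
    have h : HasFDerivAt (fun z => F (x - z)) _ z :=
      (hF.differentiable (by simp) (x - z)).hasFDerivAt.comp z ((hasFDerivAt_id z).const_sub x)
    rw [spd, h.fderiv, spd]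
    simp
  have h2 : ∀ i z, spd i (spd i G) z = spd i (spd i F) (x - z) := fun i z => by
    have e : spd i G = fun z => -spd i F (x - z) := funext fun z => h1 F hF i z
    have e2 : spd i (fun z => -spd i F (x - z)) z = -spd i (fun z => spd i F (x - z)) z := by
      rw [spd, fderiv_fun_neg]; rfl
    rw [e, e2, h1 _ (hF.spd i), neg_neg]
  have hreg := contDiff_regKer (n := n) hε
  have hsc : ∀ i, HasCompactSupport (spd i G) := fun i => hGc.isCompact.of_isClosed_subset
    (isClosed_tsupport _) (tsupport_spd_subset G i)
  have hssc : ∀ i, HasCompactSupport (spd i (spd i G)) := fun i =>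
    (hsc i).isCompact.of_isClosed_subset (isClosed_tsupport _) (tsupport_spd_subset _ i)
  have h3 : pot (regKer n ε) (fun z => ∑ i, spd i (spd i F) z) x
      = ∫ z, (∑ i, spd i (spd i (regKer n ε)) z) * G z := by
    rw [pot]
    simp only [← h2, Finset.mul_sum, Finset.sum_mul]
    rw [integral_finsetSum, integral_finsetSum]
    · refine Finset.sum_congr rfl fun i _ => ?_
      rw [integral_mul_spd hreg (hGs.spd i) (hsc i), integral_mul_spd (hreg.spd i) hGs hGc, neg_neg]
    · exact fun i _ => integrable_mul_of_tsupport hGs.continuous hGc fun z _ =>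
        ((hreg.spd i).spd i).continuous.continuousAt
    · exact fun i _ => integrable_mul_of_tsupport ((hGs.spd i).spd i).continuous (hssc i) fun z _ =>
        hreg.continuous.continuousAt
  rw [h3]
  simp only [sum_spd_spd_regKer hε, mul_assoc]
  rw [integral_const_mul, integral_const_mul]
  congr 1
  -- The Jacobian ε^n and the factor ε² exactly cancel the homogeneity ε^(-(n+2)) of the kernel.
  have h4 := Measure.integral_comp_smul (volume : Measure (Space n))
    (fun z => (‖z‖ ^ 2 + ε ^ 2) ^ (-(((n : ℝ) + 2) / 2)) * G z) ε
  have h5 : ∀ w : Space n, (‖ε • w‖ ^ 2 + ε ^ 2) ^ (-(((n : ℝ) + 2) / 2)) * G (ε • w)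
      = (ε ^ n * ε ^ 2)⁻¹ * ((‖w‖ ^ 2 + 1) ^ (-(((n : ℝ) + 2) / 2)) * F (x - ε • w)) := fun w => by
    have e1 : ‖ε • w‖ ^ 2 + ε ^ 2 = ε ^ 2 * (‖w‖ ^ 2 + 1) := by
      rw [norm_smul, mul_pow, Real.norm_eq_abs, sq_abs]; ring
    have e2 : (ε ^ 2) ^ (-(((n : ℝ) + 2) / 2)) = (ε ^ n * ε ^ 2)⁻¹ := by
      rw [← pow_add, ← Real.rpow_natCast ε 2, ← Real.rpow_mul hε.le, ← Real.rpow_natCast ε (n + 2),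
        ← Real.rpow_neg hε.le]
      congr 1
      push_cast; ring
    rw [e1, Real.mul_rpow (by positivity) (by positivity), e2]
    ring
  simp only [h5] at h4
  rw [integral_const_mul, finrank_euclideanSpace_fin, smul_eq_mul, abs_of_pos (by positivity)] at h4
  have h6 : ε ^ n ≠ 0 := by positivity
  field_simp at h4
  linarith

/-- The normalisation of the Newtonian kernel. -/
def newtonConst (n : ℕ) : ℝ :=
  (n : ℝ) * (n - 2) * ∫ w : Space n, (‖w‖ ^ 2 + 1) ^ (-(((n : ℝ) + 2) / 2))

theorem integrable_japanese :
    Integrable fun w : Space n => (‖w‖ ^ 2 + 1) ^ (-(((n : ℝ) + 2) / 2)) := by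
  have := integrable_rpow_neg_one_add_norm_sq (E := Space n) (μ := volume)
      (r := (n : ℝ) + 2) (by simp)
  convert this using 3
  · ring
  · ring

theorem newtonConst_pos (hn : 3 ≤ n) : 0 < newtonConst n := by
  have hn' : (3:ℝ) ≤ n := by exact_mod_cast hn
  refine mul_pos (mul_pos (by linarith) (by linarith)) ?_
  rw [integral_pos_iff_support_of_nonneg (fun w => by positivity) integrable_japanese]
  have : Function.support (fun w : Space n => (‖w‖ ^ 2 + 1) ^ (-(((n : ℝ) + 2) / 2))) = univ := by
    ext w
    simp only [Function.mem_support, mem_univ, iff_true]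
    positivity
  rw [this]
  exact (isOpen_univ.measure_pos volume univ_nonempty)

/-- Let ε → 0 in `pot_regKer_laplacian`, with dominated convergence on both sides. -/
theorem pot_newton_laplacian (hn : 3 ≤ n) {F : Space n → ℝ} (hF : ContDiff ℝ ∞ F)
    (hc : HasCompactSupport F) (x : Space n) :
    pot (newton n) (fun z => ∑ i, spd i (spd i F) z) x = -newtonConst n * F x := by
  have hn' : (3:ℝ) ≤ n := by exact_mod_cast hn
  have hLs : ContDiff ℝ ∞ fun z => ∑ i, spd i (spd i F) z :=
    ContDiff.sum fun i _ => (hF.spd i).spd i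
  have hLc : HasCompactSupport fun z => ∑ i, spd i (spd i F) z := by
    refine hc.isCompact.of_isClosed_subset (isClosed_tsupport _) (closure_minimal (fun z hz => ?_)
      (isClosed_tsupport F))
    by_contra hz2
    refine hz (Finset.sum_eq_zero fun i _ => ?_)
    exact image_eq_zero_of_notMem_tsupport fun h =>
      hz2 (tsupport_spd_subset F i (tsupport_spd_subset _ i h))
  have : Nonempty (Fin n) := ⟨⟨0, by omega⟩⟩
  -- Since n ≥ 3, the exponent is negative and the Newtonian kernel dominates its regularizations;
  -- it is locally integrable.
  have h1 : Tendsto (fun ε => pot (regKer n ε) (fun z => ∑ i, spd i (spd i F) z) x) (𝓝[>] 0)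
      (𝓝 (pot (newton n) (fun z => ∑ i, spd i (spd i F) z) x)) := by
    refine tendsto_integral_filter_of_dominated_convergence
      (fun z => |newton n z * ∑ i, spd i (spd i F) (x - z)|) ?_ ?_ ?_ ?_
    · filter_upwards [self_mem_nhdsWithin] with ε hε
      exact ((contDiff_regKer hε).continuous.mul
        (hLs.continuous.comp (continuous_const.sub continuous_id))).aestronglyMeasurable
    · filter_upwards [self_mem_nhdsWithin] with ε hε
      filter_upwards [Measure.ae_ne volume (0 : Space n)] with z hz
      rw [Real.norm_eq_abs, abs_mul, abs_mul]
      refine mul_le_mul_of_nonneg_right ?_ (abs_nonneg _)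
      have hz' := norm_pos_iff.2 hz
      rw [regKer, newton, abs_of_nonneg (by positivity), abs_of_nonneg (by positivity)]
      have e : ‖z‖ ^ (-((n : ℝ) - 2)) = (‖z‖ ^ 2) ^ (-(((n : ℝ) - 2) / 2)) := by
        rw [← Real.rpow_natCast, ← Real.rpow_mul (norm_nonneg _)]
        congr 1
        push_cast; ring
      rw [e]
      exact Real.rpow_le_rpow_of_nonpos (by positivity) (by nlinarith [sq_nonneg ε]) (by linarith)
    · exact (hLc.convolutionExists_right (ContinuousLinearMap.mul ℝ ℝ)
        (locallyIntegrable_newton (by omega)) hLs.continuous x).norm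
    · filter_upwards [Measure.ae_ne volume (0 : Space n)] with z hz
      refine Tendsto.mul_const _ ?_
      have hz' := norm_pos_iff.2 hz
      have e : newton n z = (‖z‖ ^ 2 + (0:ℝ) ^ 2) ^ (-(((n : ℝ) - 2) / 2)) := by
        rw [newton, zero_pow (by norm_num), add_zero, ← Real.rpow_natCast,
          ← Real.rpow_mul (norm_nonneg _)]
        congr 1
        push_cast; ring
      rw [e]
      have hc : ContinuousAt (fun ε : ℝ => (‖z‖ ^ 2 + ε ^ 2) ^ (-(((n : ℝ) - 2) / 2))) 0 :=
        ContinuousAt.rpow_const (by fun_prop) (Or.inl (by positivity))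
      exact hc.tendsto.mono_left nhdsWithin_le_nhds
  have h2 : Tendsto (fun ε : ℝ => -((n : ℝ) * (n - 2)) *
      ∫ w : Space n, (‖w‖ ^ 2 + 1) ^ (-(((n : ℝ) + 2) / 2)) * F (x - ε • w)) (𝓝[>] 0)
      (𝓝 (-((n : ℝ) * (n - 2)) *
        ∫ w : Space n, (‖w‖ ^ 2 + 1) ^ (-(((n : ℝ) + 2) / 2)) * F x)) := by
    refine Tendsto.const_mul _ ?_
    obtain ⟨M, hM⟩ := hc.exists_bound_of_continuous hF.continuous
    refine tendsto_integral_filter_of_dominated_convergence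
      (fun w => (‖w‖ ^ 2 + 1) ^ (-(((n : ℝ) + 2) / 2)) * M) ?_ ?_ ?_ ?_
    · refine Eventually.of_forall fun ε => Continuous.aestronglyMeasurable ?_
      refine Continuous.mul (Continuous.rpow_const (by fun_prop) fun w => Or.inl (by positivity)) ?_
      exact hF.continuous.comp (by fun_prop)
    · refine Eventually.of_forall fun ε => Eventually.of_forall fun w => ?_
      rw [norm_mul, Real.norm_eq_abs, abs_of_nonneg (by positivity)]
      exact mul_le_mul_of_nonneg_left (hM _) (by positivity)
    · exact integrable_japanese.mul_const _
    · refine Eventually.of_forall fun w => Tendsto.const_mul _ ?_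
      have hcc : ContinuousAt (fun ε : ℝ => F (x - ε • w)) 0 :=
        (hF.continuous.comp (by fun_prop : Continuous fun ε : ℝ => x - ε • w)).continuousAt
      have := hcc.tendsto.mono_left (nhdsWithin_le_nhds (s := Ioi 0))
      simpa using this
  have h3 : (fun ε => pot (regKer n ε) (fun z => ∑ i, spd i (spd i F) z) x) =ᶠ[𝓝[>] 0]
      (fun ε : ℝ => -((n : ℝ) * (n - 2)) *
      ∫ w : Space n, (‖w‖ ^ 2 + 1) ^ (-(((n : ℝ) + 2) / 2)) * F (x - ε • w)) := by
    filter_upwards [self_mem_nhdsWithin] with ε hε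
    exact pot_regKer_laplacian hF hc hε x
  rw [tendsto_nhds_unique h1 (h2.congr' h3.symm), integral_mul_const, newtonConst]
  ring

end Potential

/-! ### The Poisson equation for homogeneous functions -/

section Poisson

open MeasureTheory

/-- Symbols of order `-t`. -/
structure IsSymbol (t : ℝ) (P : Space n → ℝ) : Prop where
  smooth : ContDiff ℝ ∞ P
  decays : ∀ m, Decays m t P

theorem IsSymbol.spd {t : ℝ} {P : Space n → ℝ} (h : IsSymbol t P) (i : Fin n) :
    IsSymbol (t + 1) (spd i P) :=
  ⟨h.smooth.spd i, fun m => (h.decays (m + 1)).2 i⟩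

/-- Vanishing of order `a` at the origin and decay of order `t` at infinity. -/
def TwoSided (a : ℕ) (t : ℝ) (P : Space n → ℝ) : Prop :=
  ∃ C : ℝ, 0 ≤ C ∧ ∀ z, |P z| ≤ C * (‖z‖ ^ a * (1 + ‖z‖) ^ (-(a + t)))

/-- One closed expression replaces the two regimes; the factor 2^(a+t) pays for comparing 1 + ‖z‖
with 1, respectively with ‖z‖. -/
theorem twoSided_of_bounds {a : ℕ} {t M C : ℝ} {P : Space n → ℝ} (ht : 0 ≤ t)
    (h1 : ∀ z, ‖z‖ ≤ 1 → |P z| ≤ M * ‖z‖ ^ a) (h2 : ∀ z, 1 ≤ ‖z‖ → |P z| * ‖z‖ ^ t ≤ C) :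
    TwoSided a t P := by
  refine ⟨(|M| + |C|) * 2 ^ (a + t), by positivity, fun z => ?_⟩
  have hA : 0 ≤ (a : ℝ) + t := by positivity
  have h2p : (2:ℝ) ^ ((a : ℝ) + t) * 2 ^ (-((a : ℝ) + t)) = 1 := by
    rw [← Real.rpow_add (by norm_num)]; simp
  rcases le_total ‖z‖ 1 with h | h
  · have h3 : (2:ℝ) ^ (-((a : ℝ) + t)) ≤ (1 + ‖z‖) ^ (-(a + t)) :=
      Real.rpow_le_rpow_of_nonpos (by positivity) (by linarith) (by linarith)
    calc |P z| ≤ M * ‖z‖ ^ a := h1 z h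
      _ ≤ (|M| + |C|) * ‖z‖ ^ a := by
        gcongr
        have := le_abs_self M
        have := abs_nonneg C
        linarith
      _ = (|M| + |C|) * 2 ^ (a + t) * (‖z‖ ^ a * 2 ^ (-((a : ℝ) + t))) := by
        linear_combination (-(|M| + |C|) * ‖z‖ ^ a) * h2p
      _ ≤ _ := by gcongr
  · have hz : 0 < ‖z‖ := by linarith
    have h3 : (2 * ‖z‖) ^ (-((a : ℝ) + t)) ≤ (1 + ‖z‖) ^ (-(a + t)) :=
      Real.rpow_le_rpow_of_nonpos (by positivity) (by linarith) (by linarith)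
    have h4 : ‖z‖ ^ (-((a : ℝ) + t)) = ‖z‖ ^ (-(a : ℝ)) * ‖z‖ ^ (-t) := by
      rw [← Real.rpow_add hz]; congr 1; ring
    have h5 : ‖z‖ ^ a * ‖z‖ ^ (-(a : ℝ)) = 1 := by
      rw [← Real.rpow_natCast, ← Real.rpow_add hz]; simp
    have h6 : |P z| ≤ C * ‖z‖ ^ (-t) := by
      rw [Real.rpow_neg hz.le, ← div_eq_mul_inv, le_div_iff₀ (by positivity)]
      exact h2 z h
    rw [Real.mul_rpow (by norm_num) hz.le, h4] at h3
    calc |P z| ≤ C * ‖z‖ ^ (-t) := h6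
      _ ≤ (|M| + |C|) * ‖z‖ ^ (-t) := by
        gcongr
        have := le_abs_self C
        have := abs_nonneg M
        linarith
      _ = (|M| + |C|) * 2 ^ (a + t) *
          (‖z‖ ^ a * (2 ^ (-((a : ℝ) + t)) * (‖z‖ ^ (-(a : ℝ)) * ‖z‖ ^ (-t)))) := by
        have : 2 ^ ((a : ℝ) + t) * 2 ^ (-((a : ℝ) + t)) * (‖z‖ ^ a * ‖z‖ ^ (-(a : ℝ))) = 1 := by
          rw [h2p, h5, one_mul]
        linear_combination (-(|M| + |C|) * ‖z‖ ^ (-t)) * this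
      _ ≤ _ := by gcongr

theorem IsSymbol.exists_bound {t : ℝ} {P : Space n → ℝ} (h : IsSymbol t P) :
    ∃ C, ∀ z, 1 ≤ ‖z‖ → |P z| * ‖z‖ ^ t ≤ C := h.decays 0

theorem IsSymbol.twoSided_zero {t : ℝ} {P : Space n → ℝ} (h : IsSymbol t P) (ht : 0 ≤ t) :
    TwoSided 0 t P := by
  obtain ⟨C, hC⟩ := h.exists_bound
  obtain ⟨M, hM⟩ := (isCompact_closedBall (0 : Space n) 1).bddAbove_image
    (f := fun z => |P z|) h.smooth.continuous.abs.continuousOn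
  refine twoSided_of_bounds ht (M := M) (fun z hz => ?_) hC
  simpa using hM ⟨z, by simpa using hz, rfl⟩

theorem IsSymbol.twoSided_one {t : ℝ} {P : Space n → ℝ} (h : IsSymbol t P) (ht : 0 ≤ t)
    (h0 : P 0 = 0) : TwoSided 1 t P := by
  obtain ⟨C, hC⟩ := h.exists_bound
  obtain ⟨M, hM⟩ := (isCompact_closedBall (0 : Space n) 1).bddAbove_image
    (f := fun z => ‖fderiv ℝ P z‖) (h.smooth.continuous_fderiv (by simp)).norm.continuousOn
  refine twoSided_of_bounds ht (M := M) (fun z hz => ?_) hC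
  have := (convex_closedBall (0 : Space n) 1).norm_image_sub_le_of_norm_fderiv_le (𝕜 := ℝ)
    (f := P) (C := M) (fun x _ => h.smooth.differentiable (by simp) x)
    (fun x hx => hM ⟨x, hx, rfl⟩) (x := 0) (y := z) (by simp) (by simpa using hz)
  simpa [h0] using this

/-- The Mellin transform along rays. -/
def radInt (t : ℝ) (P : Space n → ℝ) (x : Space n) : ℝ :=
  ∫ r in Ioi (0:ℝ), r ^ (t - 1) * P (r • x)

/-- The integrand is of order r^(t-1+a) near 0 and r^(t-1-t') at infinity, which are the two strict
inequalities assumed. -/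
theorem integrableOn_radial_weight {a : ℕ} {t t' δ : ℝ} (h1 : 0 < t + a) (h2 : t < t')
    (hδ : 0 < δ) : IntegrableOn
      (fun r : ℝ => r ^ (t - 1) * (r ^ a * (1 + r * δ) ^ (-(a + t')))) (Ioi 0) := by
  have hc : ContinuousOn (fun r : ℝ => r ^ (t - 1) * (r ^ a * (1 + r * δ) ^ (-(a + t')))) (Ioi 0) := by
    refine ContinuousOn.mul (continuousOn_id.rpow_const fun r hr => Or.inl (ne_of_gt hr))
      ((continuous_pow a).continuousOn.mul (ContinuousOn.rpow_const (by fun_prop) fun r hr => ?_))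
    have : (0:ℝ) < r := hr
    left; positivity
  have hpow : ∀ r : ℝ, 0 < r → r ^ (t - 1) * r ^ a = r ^ (t - 1 + a) := fun r hr => by
    rw [Real.rpow_add hr, Real.rpow_natCast]
  rw [← Ioc_union_Ioi_eq_Ioi (zero_le_one' ℝ)]
  refine IntegrableOn.union ?_ ?_
  · have h3 : IntegrableOn (fun r : ℝ => r ^ (t - 1 + a)) (Ioc 0 1) :=
      (intervalIntegrable_iff_integrableOn_Ioc_of_le zero_le_one).1
        (intervalIntegral.intervalIntegrable_rpow' (by linarith))
    refine h3.mono' ((hc.mono Ioc_subset_Ioi_self).aestronglyMeasurable measurableSet_Ioc)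
      ((ae_restrict_mem measurableSet_Ioc).mono fun r hr => ?_)
    have hr0 : 0 < r := hr.1
    rw [Real.norm_eq_abs, abs_of_nonneg (by positivity), ← mul_assoc, hpow r hr0]
    refine mul_le_of_le_one_right (by positivity) (Real.rpow_le_one_of_one_le_of_nonpos ?_ ?_)
    · have : 0 < r * δ := by positivity
      linarith
    · have : (0:ℝ) ≤ a := Nat.cast_nonneg a
      linarith
  · have h3 : IntegrableOn (fun r : ℝ => δ ^ (-(a + t')) * r ^ (t - 1 - t')) (Ioi 1) :=
      (integrableOn_Ioi_rpow_of_lt (by linarith) one_pos).const_mul _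
    refine h3.mono' ((hc.mono (Ioi_subset_Ioi zero_le_one)).aestronglyMeasurable measurableSet_Ioi)
      ((ae_restrict_mem measurableSet_Ioi).mono fun r hr => ?_)
    have hr0 : 0 < r := zero_lt_one.trans hr
    rw [Real.norm_eq_abs, abs_of_nonneg (by positivity), ← mul_assoc, hpow r hr0]
    have h4 : (1 + r * δ) ^ (-((a : ℝ) + t')) ≤ (r * δ) ^ (-((a : ℝ) + t')) :=
      Real.rpow_le_rpow_of_nonpos (by positivity) (by linarith) (by linarith)
    refine (mul_le_mul_of_nonneg_left h4 (by positivity)).trans (le_of_eq ?_)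
    rw [Real.mul_rpow hr0.le hδ.le, ← mul_assoc, ← Real.rpow_add hr0, mul_comm]
    congr 2
    ring

theorem TwoSided.exists_radial_bound {a : ℕ} {t' : ℝ} {P : Space n → ℝ} (h : TwoSided a t' P)
    (ht' : 0 ≤ t') {δ M : ℝ} (hδ : 0 < δ) : ∃ C : ℝ, ∀ (t : ℝ) (x : Space n), δ ≤ ‖x‖ → ‖x‖ ≤ M →
      ∀ r : ℝ, 0 < r →
      |r ^ (t - 1) * P (r • x)| ≤ C * (r ^ (t - 1) * (r ^ a * (1 + r * δ) ^ (-(a + t')))) := by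
  obtain ⟨C, hC0, hC⟩ := h
  refine ⟨C * M ^ a, fun t x h1 h2 r hr => ?_⟩
  rw [abs_mul, abs_of_nonneg (by positivity)]
  have h3 := hC (r • x)
  rw [norm_smul, Real.norm_eq_abs, abs_of_pos hr] at h3
  have h4 : (1 + r * ‖x‖) ^ (-((a : ℝ) + t')) ≤ (1 + r * δ) ^ (-((a : ℝ) + t')) :=
    Real.rpow_le_rpow_of_nonpos (by positivity) (by gcongr) (by
      have : (0:ℝ) ≤ a := Nat.cast_nonneg a
      linarith)
  have h5 : (r * ‖x‖) ^ a ≤ (r * M) ^ a := by gcongr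
  calc r ^ (t - 1) * |P (r • x)|
      ≤ r ^ (t - 1) * (C * ((r * ‖x‖) ^ a * (1 + r * ‖x‖) ^ (-((a : ℝ) + t')))) := by gcongr
    _ ≤ r ^ (t - 1) * (C * ((r * M) ^ a * (1 + r * δ) ^ (-((a : ℝ) + t')))) := by
        have : 0 ≤ M := hδ.le.trans (h1.trans h2)
        gcongr
    _ = _ := by rw [mul_pow]; ring

theorem continuousOn_radial {P : Space n → ℝ} (hP : Continuous P) (t : ℝ) (x : Space n) :
    ContinuousOn (fun r : ℝ => r ^ (t - 1) * P (r • x)) (Ioi 0) :=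
  ContinuousOn.mul (continuousOn_id.rpow_const fun r hr => Or.inl (ne_of_gt hr))
    (hP.comp (by fun_prop)).continuousOn

theorem TwoSided.integrableOn {a : ℕ} {t t' : ℝ} {P : Space n → ℝ} (h : TwoSided a t' P)
    (hP : Continuous P) (ht' : 0 ≤ t') (h1 : 0 < t + a) (h2 : t < t') {x : Space n} (hx : x ≠ 0) :
    IntegrableOn (fun r : ℝ => r ^ (t - 1) * P (r • x)) (Ioi 0) := by
  have hx0 := norm_pos_iff.2 hx
  obtain ⟨C, hC⟩ := h.exists_radial_bound ht' (M := ‖x‖) hx0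
  exact ((integrableOn_radial_weight h1 h2 hx0).const_mul C).mono'
    ((continuousOn_radial hP t x).aestronglyMeasurable measurableSet_Ioi)
    ((ae_restrict_mem measurableSet_Ioi).mono fun r hr => hC t x le_rfl le_rfl r hr)

def coordCLM (i : Fin n) : Space n →L[ℝ] ℝ := EuclideanSpace.proj i

/-- A derivative in x brings out a factor r and raises the order of the symbol by one, so the
condition at infinity persists. At the origin the exponent is now t + 1 > 0, and vanishing there is
no longer needed. -/
theorem hasFDerivAt_radInt {a : ℕ} {t t' : ℝ} {P : Space n → ℝ} (hP : IsSymbol t' P)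
    (h : TwoSided a t' P) (ht : 0 ≤ t) (h1 : 0 < t + a) (h2 : t < t') {x : Space n} (hx : x ≠ 0) :
    HasFDerivAt (radInt t P) (∑ i, radInt (t + 1) (spd i P) x • coordCLM i) x := by
  have hx0 := norm_pos_iff.2 hx
  have hball : ∀ y ∈ Metric.ball x (‖x‖ / 2), ‖x‖ / 2 ≤ ‖y‖ ∧ ‖y‖ ≤ 2 * ‖x‖ := fun y hy => by
    rw [mem_ball_iff_norm] at hy
    have h3 := norm_sub_norm_le x y
    have h4 := norm_sub_norm_le y x
    rw [norm_sub_rev] at h3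
    constructor <;> linarith
  have hpt : ∀ r : ℝ, 0 < r → ∀ y, HasFDerivAt (fun y => r ^ (t - 1) * P (r • y))
      (∑ i, (r ^ (t + 1 - 1) * spd i P (r • y)) • coordCLM i) y := fun r hr y => by
    have h3 : HasFDerivAt (fun y => r ^ (t - 1) * P (r • y)) _ y :=
      ((hP.smooth.differentiable (by simp) (r • y)).hasFDerivAt.comp y
        ((hasFDerivAt_id y).const_smul r)).const_mul (r ^ (t - 1))
    refine h3.congr_fderiv ?_
    ext v
    have h4 : v = ∑ i, v i • (EuclideanSpace.single i 1 : Space n) := by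
      ext j; simp [Pi.single_apply]
    have h5 : fderiv ℝ P (r • y) v = ∑ i, v i * spd i P (r • y) := by
      conv_lhs => rw [h4]
      rw [map_sum]
      simp [spd]
    have h6 : r ^ (t + 1 - 1) = r ^ (t - 1) * r := by
      rw [show t + 1 - 1 = (t - 1) + 1 by ring, Real.rpow_add hr, Real.rpow_one]
    simp only [smul_apply, ContinuousLinearMap.comp_apply, ContinuousLinearMap.id_apply, map_smul,
      h5, h6, sum_apply, smul_eq_mul, Finset.mul_sum, coordCLM,
      EuclideanSpace.coe_proj]
    refine Finset.sum_congr rfl fun i _ => ?_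
    ring
  have hi : ∀ i, TwoSided 0 (t' + 1) (spd i P) := fun i => (hP.spd i).twoSided_zero (by linarith)
  choose C hC using fun i => (hi i).exists_radial_bound (by linarith) (M := 2 * ‖x‖)
    (half_pos hx0)
  have hInt : ∀ i, IntegrableOn (fun r : ℝ => r ^ (t + 1 - 1) * spd i P (r • x)) (Ioi 0) :=
    fun i => (hi i).integrableOn (hP.spd i).smooth.continuous (by linarith) (by simp; linarith)
      (by linarith) hx
  have key := hasFDerivAt_integral_of_dominated_of_fderiv_le (μ := volume.restrict (Ioi (0:ℝ)))
    (F := fun y r => r ^ (t - 1) * P (r • y))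
    (F' := fun y r => ∑ i, (r ^ (t + 1 - 1) * spd i P (r • y)) • coordCLM i) (x₀ := x)
    (s := Metric.ball x (‖x‖ / 2))
    (bound := fun r => ∑ i, C i * (r ^ (t + 1 - 1) * (r ^ 0 *
      (1 + r * (‖x‖ / 2)) ^ (-((0 : ℕ) + (t' + 1))))) * ‖coordCLM i‖)
    (Metric.ball_mem_nhds x (half_pos hx0))
    (Eventually.of_forall fun y => (continuousOn_radial hP.smooth.continuous t y).aestronglyMeasurable
      measurableSet_Ioi)
    (h.integrableOn hP.smooth.continuous (by linarith) h1 h2 hx)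
    (ContinuousOn.aestronglyMeasurable (continuousOn_finsetSum _ fun i _ =>
      (continuousOn_radial (hP.spd i).smooth.continuous (t + 1) x).smul continuousOn_const)
      measurableSet_Ioi)
    ((ae_restrict_mem measurableSet_Ioi).mono fun r hr y hy => ?_)
    (integrable_finsetSum _ fun i _ => ((integrableOn_radial_weight (by simp; linarith)
      (by linarith) (half_pos hx0)).const_mul _).mul_const _)
    ((ae_restrict_mem measurableSet_Ioi).mono fun r hr y _ => hpt r hr y)
  · refine key.congr_fderiv ?_
    rw [integral_finsetSum _ fun i _ => (hInt i).smul_const _]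
    exact Finset.sum_congr rfl fun i _ => integral_smul_const _ _
  · refine (norm_sum_le _ _).trans (Finset.sum_le_sum fun i _ => ?_)
    rw [norm_smul]
    exact mul_le_mul_of_nonneg_right
      (hC i (t + 1) y (hball y hy).1 (hball y hy).2 r hr) (norm_nonneg _)

theorem spd_radInt {a : ℕ} {t t' : ℝ} {P : Space n → ℝ} (hP : IsSymbol t' P)
    (h : TwoSided a t' P) (ht : 0 ≤ t) (h1 : 0 < t + a) (h2 : t < t') {x : Space n} (hx : x ≠ 0)
    (i : Fin n) : spd i (radInt t P) x = radInt (t + 1) (spd i P) x := by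
  rw [spd, (hasFDerivAt_radInt hP h ht h1 h2 hx).fderiv]
  simp [coordCLM]

/-- Derivatives of such integrals are integrals of the same kind, with a = 0; hence induction on the
order. -/
theorem contDiffAt_radInt {a : ℕ} {t t' : ℝ} {P : Space n → ℝ} (hP : IsSymbol t' P)
    (h : TwoSided a t' P) (ht : 0 ≤ t) (h1 : 0 < t + a) (h2 : t < t') {x : Space n} (hx : x ≠ 0) :
    ContDiffAt ℝ ∞ (radInt t P) x := by
  have hopen : IsOpen {x : Space n | x ≠ 0} := isOpen_ne
  have key : ∀ (m : ℕ) (a : ℕ) (t t' : ℝ) (P : Space n → ℝ), IsSymbol t' P → TwoSided a t' P →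
      0 ≤ t → 0 < t + a → t < t' → ContDiffOn ℝ m (radInt t P) {x | x ≠ 0} := by
    intro m
    induction m with
    | zero =>
      intro a t t' P hP h ht h1 h2
      exact contDiffOn_zero.2 fun y hy =>
        (hasFDerivAt_radInt hP h ht h1 h2 hy).continuousAt.continuousWithinAt
    | succ m ih =>
      intro a t t' P hP h ht h1 h2
      push_cast
      rw [contDiffOn_succ_iff_fderiv_of_isOpen hopen]
      refine ⟨fun y hy => (hasFDerivAt_radInt hP h ht h1 h2 hy).differentiableAt.differentiableWithinAt,
        by simp, ?_⟩
      refine ContDiffOn.congr (f := fun x => ∑ i, radInt (t + 1) (spd i P) x • coordCLM i) ?_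
        fun y hy => (hasFDerivAt_radInt hP h ht h1 h2 hy).fderiv
      refine ContDiffOn.sum fun i _ => ContDiffOn.fun_smul ?_ contDiffOn_const
      exact ih 0 (t + 1) (t' + 1) (spd i P) (hP.spd i)
        ((hP.spd i).twoSided_zero (by linarith)) (by linarith) (by simp; linarith) (by linarith)
  exact contDiffAt_infty.2 fun m => (key m a t t' P hP h ht h1 h2).contDiffAt (hopen.mem_nhds hx)

/-- Scaling of the integration variable: averaging over dilations makes the function homogeneous. -/
theorem radInt_smul {t : ℝ} (P : Space n → ℝ) (x : Space n) {s : ℝ} (hs : 0 < s) :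
    radInt t P (s • x) = s ^ (-t) * radInt t P x := by
  have h1 := integral_comp_mul_left_Ioi (fun r : ℝ => r ^ (t - 1) * P (r • x)) 0 hs
  rw [mul_zero, smul_eq_mul] at h1
  have h2 : radInt t P (s • x) = ∫ r in Ioi (0:ℝ), s ^ (-(t - 1)) *
      ((s * r) ^ (t - 1) * P ((s * r) • x)) := by
    refine setIntegral_congr_fun measurableSet_Ioi fun r hr => ?_
    have hr0 : 0 < r := hr
    rw [Real.mul_rpow hs.le hr0.le, smul_smul, mul_comm r s, ← mul_assoc, ← mul_assoc,
      ← Real.rpow_add hs]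
    simp
  rw [h2, integral_const_mul, h1, ← mul_assoc, ← Real.rpow_neg_one, ← Real.rpow_add hs, radInt]
  congr 2
  ring

/-- A bump function of the radius. -/
def radBump (r : ℝ) : ℝ := Real.smoothTransition (r - 1) * Real.smoothTransition (3 - r)

theorem contDiff_radBump : ContDiff ℝ ∞ radBump :=
  ((Real.smoothTransition.contDiff (n := ⊤)).comp (contDiff_id.sub contDiff_const)).mul
    ((Real.smoothTransition.contDiff (n := ⊤)).comp (contDiff_const.sub contDiff_id))

theorem radBump_nonneg (r : ℝ) : 0 ≤ radBump r :=
  mul_nonneg (Real.smoothTransition.nonneg _) (Real.smoothTransition.nonneg _)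

theorem radBump_eq_zero_of_le {r : ℝ} (h : r ≤ 1) : radBump r = 0 := by
  rw [radBump, Real.smoothTransition.zero_of_nonpos (by linarith), zero_mul]

theorem radBump_eq_zero_of_ge {r : ℝ} (h : 3 ≤ r) : radBump r = 0 := by
  rw [radBump, Real.smoothTransition.zero_of_nonpos (x := 3 - r) (by linarith), mul_zero]

theorem radBump_two : radBump 2 = 1 := by
  rw [radBump, Real.smoothTransition.one_of_one_le (by norm_num),
    Real.smoothTransition.one_of_one_le (by norm_num), one_mul]

theorem contDiff_radBump_mul {f : Space n → ℝ} (hf : ∀ x, x ≠ 0 → ContDiffAt ℝ ∞ f x) :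
    ContDiff ℝ ∞ fun x => radBump ‖x‖ * f x := contDiff_iff_contDiffAt.2 fun x => by
  rcases lt_or_ge ‖x‖ 1 with h | h
  · refine (contDiffAt_const (c := (0:ℝ))).congr_of_eventuallyEq ?_
    filter_upwards [continuous_norm.continuousAt.eventually (gt_mem_nhds h)] with y hy
    rw [radBump_eq_zero_of_le (le_of_lt hy), zero_mul]
  · have hx : x ≠ 0 := norm_pos_iff.1 (by linarith)
    exact (contDiff_radBump.contDiffAt.comp x (contDiffAt_norm_space hx)).mul (hf x hx)

theorem tsupport_radBump_mul (f : Space n → ℝ) :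
    tsupport (fun x => radBump ‖x‖ * f x) ⊆ Metric.closedBall 0 3 := by
  refine closure_minimal (fun x hx => ?_) Metric.isClosed_closedBall
  rw [mem_closedBall_zero_iff]
  by_contra h
  exact hx (by simp [radBump_eq_zero_of_ge (not_le.1 h).le])

theorem integral_radBump_pos (s : ℝ) : 0 < ∫ r in Ioi (0:ℝ), r ^ s * radBump r := by
  have hc : Continuous fun r : ℝ => r ^ s * radBump r := by
    refine continuous_iff_continuousAt.2 fun r => ?_
    rcases lt_or_ge r 1 with h | h
    · exact (continuousAt_const (y := (0:ℝ))).congr ((gt_mem_nhds h).mono fun z hz => by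
        beta_reduce
        rw [radBump_eq_zero_of_le (le_of_lt hz), mul_zero])
    · exact (Real.continuousAt_rpow_const _ _ (Or.inl (by linarith))).mul
        contDiff_radBump.continuous.continuousAt
  have hs : HasCompactSupport fun r : ℝ => r ^ s * radBump r :=
    HasCompactSupport.intro (isCompact_Icc (a := (1:ℝ)) (b := 3)) fun r hr => by
      rcases le_or_gt r 1 with h | h
      · rw [radBump_eq_zero_of_le h, mul_zero]
      · rw [radBump_eq_zero_of_ge, mul_zero]
        by_contra h3
        exact hr ⟨h.le, (not_le.1 h3).le⟩
  have hnn : 0 ≤ fun r : ℝ => r ^ s * radBump r := fun r => by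
    rcases le_or_gt r 1 with h | h
    · simp [radBump_eq_zero_of_le h]
    · have h0 : 0 < r := by linarith
      exact mul_nonneg (by positivity) (radBump_nonneg r)
  have h1 : (∫ r in Ioi (0:ℝ), r ^ s * radBump r) = ∫ r, r ^ s * radBump r := by
    refine setIntegral_eq_integral_of_forall_compl_eq_zero fun r hr => ?_
    rw [radBump_eq_zero_of_le, mul_zero]
    have := not_lt.1 (fun h : 0 < r => hr h)
    linarith
  rw [h1]
  refine hc.integral_pos_of_hasCompactSupport_nonneg_nonzero hs hnn (x := 2) ?_
  rw [radBump_two]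
  positivity

/-- Kernel and bump are nonnegative and their product is positive at radius 2. The value is divided
by in the normalization in three dimensions. -/
theorem pot_newton_radBump_pos : 0 < pot (newton n) (fun x => radBump ‖x‖) 0 ∨ n = 0 := by
  rcases Nat.eq_zero_or_pos n with h | h
  · exact Or.inr h
  left
  have hb : ContDiff ℝ ∞ fun x : Space n => radBump ‖x‖ := by
    simpa using contDiff_radBump_mul (n := n) (f := fun _ => 1) fun _ _ => contDiffAt_const
  have hbs : tsupport (fun x : Space n => radBump ‖x‖) ⊆ Metric.closedBall 0 3 := by
    simpa using tsupport_radBump_mul (n := n) (fun _ => 1)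
  have hbc : HasCompactSupport fun x : Space n => radBump ‖x‖ :=
    (isCompact_closedBall _ _).of_isClosed_subset (isClosed_tsupport _) hbs
  have e : pot (newton n) (fun x => radBump ‖x‖) 0 = ∫ z : Space n, newton n z * radBump ‖z‖ := by
    simp [pot]
  rw [e]
  have hne : ∀ z ∈ tsupport (fun x : Space n => radBump ‖x‖), z ≠ 0 := fun z hz h0 => by
    subst h0
    have : (fun x : Space n => radBump ‖x‖) =ᶠ[𝓝 0] 0 := by
      filter_upwards [continuous_norm.continuousAt.eventually
        (gt_mem_nhds (by simp : ‖(0 : Space n)‖ < 1))] with y hy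
      exact radBump_eq_zero_of_le (le_of_lt hy)
    exact (notMem_tsupport_iff_eventuallyEq.2 this) hz
  have hc : Continuous fun z : Space n => newton n z * radBump ‖z‖ :=
    continuous_mul_of_tsupport hb.continuous fun z hz =>
      (isHomog_newton.smooth z (hne z hz)).continuousAt
  refine hc.integral_pos_of_hasCompactSupport_nonneg_nonzero hbc.mul_left (fun z =>
    mul_nonneg (Real.rpow_nonneg (norm_nonneg _) _) (radBump_nonneg _))
    (x := EuclideanSpace.single ⟨0, h⟩ 2) ?_
  have : ‖(EuclideanSpace.single ⟨0, h⟩ 2 : Space n)‖ = 2 := by simp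
  rw [newton, this, radBump_two]
  positivity

/-- A homogeneous function of degree `-(n+1)/2` is, up to a constant multiple of `|x|^(-2)` if
`n = 3`, the Laplacian of a homogeneous function. -/
theorem exists_poisson (hn : 3 ≤ n) {f : Space n → ℝ} (hf : IsHomog 0 f) :
    ∃ (g : Space n → ℝ) (c : ℝ), IsHomog (((n : ℝ) - 3) / 2) g ∧ (n ≠ 3 → c = 0) ∧
      ∀ x, x ≠ 0 → ∑ i, spd i (spd i g) x = ‖x‖ ^ (-(((n : ℝ) + 1) / 2)) * (f x - c) := by
  have hn' : (3:ℝ) ≤ n := by exact_mod_cast hn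
  have hK := locallyIntegrable_newton (n := n) (by omega)
  set s : ℝ := ((n : ℝ) - 3) / 2 with hs
  have hInt : ∀ f : Space n → ℝ, (∀ x, x ≠ 0 → ContDiffAt ℝ ∞ f x) →
      Integrable fun z => newton n z * (radBump ‖0 - z‖ * f (0 - z)) := fun f hf => by
    have h : HasCompactSupport fun x : Space n => radBump ‖x‖ * f x :=
      (isCompact_closedBall _ _).of_isClosed_subset (isClosed_tsupport _) (tsupport_radBump_mul f)
    exact h.convolutionExists_right (ContinuousLinearMap.mul ℝ ℝ) hK
      (contDiff_radBump_mul hf).continuous 0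
  -- For n = 3 the Mellin exponent s is 0 and the radial integral converges at the origin only if
  -- the potential vanishes there. Subtracting a constant from f achieves this; it is the
  -- obstruction to inverting the Laplacian of the 2-sphere.
  obtain ⟨c, hc, hc0⟩ : ∃ c : ℝ, (n ≠ 3 → c = 0) ∧
      (n = 3 → pot (newton n) (fun x => radBump ‖x‖ * (f x - c)) 0 = 0) := by
    by_cases h3 : n = 3
    · have hp := (pot_newton_radBump_pos (n := n)).resolve_right (by omega)
      refine ⟨pot (newton n) (fun x => radBump ‖x‖ * f x) 0 / pot (newton n) (fun x => radBump ‖x‖) 0,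
        fun h => absurd h3 h, fun _ => ?_⟩
      set c := pot (newton n) (fun x => radBump ‖x‖ * f x) 0 / pot (newton n) (fun x => radBump ‖x‖) 0
        with hcdef
      have e : pot (newton n) (fun x => radBump ‖x‖ * (f x - c)) 0
          = pot (newton n) (fun x => radBump ‖x‖ * f x) 0
            - c * pot (newton n) (fun x => radBump ‖x‖) 0 := by
        have h1 := hInt f hf.smooth
        have h2 := hInt (fun _ => 1) fun _ _ => contDiffAt_const
        simp only [pot]
        rw [← integral_const_mul, ← integral_sub h1 (by simpa using h2.const_mul c)]
        congr 1
        funext z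
        ring
      rw [e, hcdef, div_mul_cancel₀ _ hp.ne', sub_self]
    · exact ⟨0, fun _ => rfl, fun h => absurd h h3⟩
  set F : Space n → ℝ := fun x => radBump ‖x‖ * (f x - c) with hF
  have hfc : ∀ x, x ≠ 0 → ContDiffAt ℝ ∞ (fun x => f x - c) x := fun x hx =>
    (hf.smooth x hx).sub contDiffAt_const
  have hFs : ContDiff ℝ ∞ F := contDiff_radBump_mul hfc
  have hFt : tsupport F ⊆ Metric.closedBall 0 3 := tsupport_radBump_mul _
  have hFc : HasCompactSupport F := (isCompact_closedBall _ _).of_isClosed_subset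
    (isClosed_tsupport _) hFt
  have hΨ : IsSymbol ((n : ℝ) - 2) (pot (newton n) F) :=
    ⟨contDiff_pot hK hFs hFc, fun m => by
      have := decays_pot (by norm_num) hFs hFt (by linarith) isHomog_newton hK m []
      simpa [wd] using this⟩
  -- First-order vanishing at the origin when s = 0; none is needed when s > 0.
  obtain ⟨a, ha, hsa⟩ : ∃ a : ℕ, TwoSided a ((n : ℝ) - 2) (pot (newton n) F) ∧ 0 < s + a := by
    by_cases h3 : n = 3
    · refine ⟨1, hΨ.twoSided_one (by linarith) (hc0 h3), ?_⟩
      rw [hs, h3]; norm_num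
    · refine ⟨0, hΨ.twoSided_zero (by linarith), ?_⟩
      have : (4:ℝ) ≤ n := by exact_mod_cast (by omega : 4 ≤ n)
      rw [hs]; push_cast; linarith
  have hs0 : 0 ≤ s := by rw [hs]; linarith
  have hst : s < (n : ℝ) - 2 := by rw [hs]; linarith
  set A : ℝ := ∫ r in Ioi (0:ℝ), r ^ (s + 1) * radBump r with hA
  have hA0 : 0 < A := integral_radBump_pos _
  have hκ := newtonConst_pos hn
  have hlap : ∀ x, x ≠ 0 → ∑ i, spd i (spd i (radInt s (pot (newton n) F))) x
      = -(newtonConst n * A) * (‖x‖ ^ (-(((n : ℝ) + 1) / 2)) * (f x - c)) := fun x hx => by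
    -- Two derivatives pass through the Mellin transform, raising its exponent by two, and then
    -- through the potential.
    have h1 : ∀ i, spd i (spd i (radInt s (pot (newton n) F))) x
        = radInt (s + 1 + 1) (pot (newton n) (spd i (spd i F))) x := fun i => by
      have e1 : spd i (radInt s (pot (newton n) F)) =ᶠ[𝓝 x]
          radInt (s + 1) (spd i (pot (newton n) F)) :=
        (isOpen_ne.mem_nhds hx : {y : Space n | y ≠ 0} ∈ 𝓝 x) |> fun h =>
          Filter.mem_of_superset h fun y hy => spd_radInt hΨ ha hs0 hsa hst hy i
      rw [spd, e1.fderiv_eq, ← spd, spd_radInt (hΨ.spd i) ((hΨ.spd i).twoSided_zero (by linarith))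
        (by linarith) (by simp; linarith) (by linarith) hx, spd_pot hK hFs hFc,
        spd_pot hK (hFs.spd i) ((hFc.isCompact.of_isClosed_subset (isClosed_tsupport _)
          (tsupport_spd_subset F i)))]
    have hssc : ∀ i, HasCompactSupport (spd i (spd i F)) := fun i =>
      hFc.isCompact.of_isClosed_subset (isClosed_tsupport _)
        ((tsupport_spd_subset _ i).trans (tsupport_spd_subset F i))
    have h2 : ∀ i, IntegrableOn (fun r : ℝ => r ^ (s + 1 + 1 - 1) *
        pot (newton n) (spd i (spd i F)) (r • x)) (Ioi 0) := fun i => by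
      have h3 := (hΨ.spd i).spd i
      have h4 := (h3.twoSided_zero (by linarith)).integrableOn (t := s + 1 + 1)
        h3.smooth.continuous (by linarith) (by simp; linarith) (by linarith) hx
      rwa [spd_pot hK hFs hFc, spd_pot hK (hFs.spd i)
        ((hFc.isCompact.of_isClosed_subset (isClosed_tsupport _) (tsupport_spd_subset F i)))] at h4
    simp only [h1, radInt]
    rw [← integral_finsetSum _ fun i _ => h2 i]
    have h3 : ∀ y, ∑ i, pot (newton n) (spd i (spd i F)) y = -newtonConst n * F y := fun y => by
      rw [← pot_newton_laplacian hn hFs hFc]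
      have hi : ∀ i, Integrable fun z => newton n z * spd i (spd i F) (y - z) := fun i =>
        (hssc i).convolutionExists_right
          (ContinuousLinearMap.mul ℝ ℝ) hK ((hFs.spd i).spd i).continuous y
      simp only [pot, Finset.mul_sum]
      rw [integral_finsetSum _ fun i _ => hi i]
    simp only [← Finset.mul_sum, h3]
    have hx0 := norm_pos_iff.2 hx
    -- As f has degree zero, f(rx) = f(x) comes out of the integral, and what is left is a radial
    -- integral of the bump with value A after scaling by ‖x‖.
    have h4 : ∀ r ∈ Ioi (0:ℝ), r ^ (s + 1 + 1 - 1) * (-newtonConst n * F (r • x))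
        = -newtonConst n * (f x - c) * ‖x‖ ^ (-(s + 1)) *
          ((‖x‖ * r) ^ (s + 1) * radBump (‖x‖ * r)) := fun r hr => by
      have hr0 : 0 < r := hr
      have h5 := hf.homog x hx r hr0
      rw [neg_zero, Real.rpow_zero, one_mul] at h5
      have h6 : ‖x‖ ^ (-(s + 1)) * ‖x‖ ^ (s + 1) = 1 := by rw [← Real.rpow_add hx0]; simp
      simp only [hF, h5, norm_smul, Real.norm_eq_abs, abs_of_pos hr0]
      rw [Real.mul_rpow hx0.le hr0.le, mul_comm r ‖x‖, show s + 1 + 1 - 1 = s + 1 by ring]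
      linear_combination (newtonConst n * r ^ (s + 1) * radBump (‖x‖ * r) * (f x - c)) * h6
    rw [setIntegral_congr_fun measurableSet_Ioi h4, integral_const_mul,
      integral_comp_mul_left_Ioi (fun r => r ^ (s + 1) * radBump r) 0 hx0, mul_zero, ← hA,
      smul_eq_mul]
    have h7 : ‖x‖ ^ (-(((n : ℝ) + 1) / 2)) = ‖x‖ ^ (-(s + 1)) * ‖x‖⁻¹ := by
      rw [← Real.rpow_neg_one, ← Real.rpow_add hx0]
      congr 1
      rw [hs]; ring
    rw [h7]
    ring
  have hsm : ∀ x, x ≠ 0 → ContDiffAt ℝ ∞ (radInt s (pot (newton n) F)) x := fun x hx =>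
    contDiffAt_radInt hΨ ha hs0 hsa hst hx
  set B : ℝ := -(newtonConst n * A)⁻¹ with hB
  have hcm : ∀ (P : Space n → ℝ) (i : Fin n), spd i (fun x => B * P x) = fun x => B * spd i P x := by
    intro P i
    funext x
    have : (fun x => B * P x) = B • P := rfl
    rw [spd, this, fderiv_const_smul_field]
    rfl
  refine ⟨fun x => B * radInt s (pot (newton n) F) x, c, ⟨fun x hx =>
    contDiffAt_const.mul (hsm x hx), fun x hx r hr => ?_⟩, hc, fun x hx => ?_⟩
  · rw [radInt_smul _ _ hr]; ring
  · simp only [hcm]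
    rw [← Finset.mul_sum, hlap x hx, hB]
    have : newtonConst n * A ≠ 0 := by positivity
    field_simp

end Poisson

/-! ### Integration of coefficients in `u` -/

section Antiderivative

open MeasureTheory

/-- The primitive with respect to `u` that vanishes at `u = 0`. -/
def primU (k : ℝ × Space n → ℝ) (q : ℝ × Space n) : ℝ := ∫ s in (0:ℝ)..q.1, k (s, q.2)

/-- Substituting s ↦ su turns the variable limit of integration into a parameter of an integral over
[0, 1], to which smoothness of convolutions with parameters applies. -/
theorem IsCoef.primU {k : ℝ × Space n → ℝ} (hk : IsCoef k) : IsCoef (primU k) := by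
  refine ⟨fun q hq => ?_, fun q hq t ht => ?_⟩
  · let bp : ContDiffBump (0:ℝ) := ⟨1, 2, by norm_num, by norm_num⟩
    let f : ℝ → ℝ := indicator (Icc (-1) 0) fun _ => 1
    let g : ℝ × Space n → ℝ → ℝ := fun q x => bp x * k (x * q.1, q.2)
    have hg : ContDiffOn ℝ ∞ ↿g ({q : ℝ × Space n | q.2 ≠ 0} ×ˢ univ) := by
      rintro ⟨q, x⟩ ⟨hq, -⟩
      refine ContDiffAt.contDiffWithinAt ?_
      refine (bp.contDiff.contDiffAt.comp (q, x) contDiffAt_snd).mul ?_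
      exact (hk.smooth (x * q.1, q.2) hq).comp (q, x)
        ((contDiffAt_snd.mul contDiffAt_fst.fst).prodMk contDiffAt_fst.snd)
    have hf : LocallyIntegrable f volume :=
      ((integrable_indicator_iff measurableSet_Icc).2
        (integrableOn_const (by simp))).locallyIntegrable
    have key := contDiffOn_convolution_right_with_param_comp (n := ⊤)
      (ContinuousLinearMap.mul ℝ ℝ) (v := fun _ => (0:ℝ)) contDiffOn_const isOpen_snd_ne
      (isCompact_closedBall (0:ℝ) 2)
      (fun p x _ hx => by
        have : bp x = 0 := bp.zero_of_le_dist (by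
          rw [Metric.mem_closedBall] at hx; exact (not_le.1 hx).le)
        simp [g, this]) hf hg (μ := volume)
    have h1 : ContDiffAt ℝ ∞ (fun q : ℝ × Space n =>
        q.1 * (convolution f (g q) (ContinuousLinearMap.mul ℝ ℝ) volume) 0) q :=
      contDiffAt_fst.mul (key.contDiffAt (isOpen_snd_ne.mem_nhds hq))
    refine h1.congr_of_eventuallyEq (Eventually.of_forall fun q => ?_)
    have h2 : (convolution f (g q) (ContinuousLinearMap.mul ℝ ℝ) volume) 0
        = ∫ s in (0:ℝ)..1, k (s * q.1, q.2) := by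
      have h3 : ∀ t, (ContinuousLinearMap.mul ℝ ℝ) (f t) (g q (0 - t))
          = indicator (Icc (-1:ℝ) 0) (fun t => k (-t * q.1, q.2)) t := fun t => by
        by_cases ht : t ∈ Icc (-1:ℝ) 0
        · have : bp (-t) = 1 := bp.one_of_mem_closedBall (by
            rw [Metric.mem_closedBall, Real.dist_eq, abs_le]
            exact ⟨by have := ht.2; simp [bp]; linarith, by have := ht.1; simp [bp]; linarith⟩)
          simp [f, g, ht, this]
        · simp [f, ht]
      simp only [convolution, h3]
      rw [integral_indicator measurableSet_Icc, integral_Icc_eq_integral_Ioc,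
        ← intervalIntegral.integral_of_le (by norm_num)]
      have := intervalIntegral.integral_comp_neg (a := (0:ℝ)) (b := 1)
        (f := fun t => k (-t * q.1, q.2))
      simp only [neg_neg, neg_zero] at this
      exact this.symm
    beta_reduce
    rw [h2]
    have := intervalIntegral.mul_integral_comp_mul_right (a := (0:ℝ)) (b := 1)
      (f := fun s => k (s, q.2)) q.1
    simp only [zero_mul, one_mul] at this
    exact this.symm
  · simp only [_root_.primU]
    exact intervalIntegral.integral_congr fun s _ => hk.homog (s, q.2) hq t ht

theorem IsCoef.continuous_u {k : ℝ × Space n → ℝ} (hk : IsCoef k) {y : Space n} (hy : y ≠ 0) :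
    Continuous fun s : ℝ => k (s, y) := continuous_iff_continuousAt.2 fun s =>
  (hk.smooth (s, y) hy).continuousAt.comp (f := fun s : ℝ => (s, y))
    (continuousAt_id.prodMk continuousAt_const)

theorem IsCoef.hasDerivAt_u {k : ℝ × Space n → ℝ} (hk : IsCoef k) {q : ℝ × Space n}
    (hq : q.2 ≠ 0) : HasDerivAt (fun s : ℝ => k (s, q.2)) (_root_.dU k q) q.1 :=
  (hk.differentiableAt hq).hasFDerivAt.comp_hasDerivAt (f := fun s : ℝ => (s, q.2)) q.1
    ((hasDerivAt_id _).prodMk (hasDerivAt_const _ _))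

theorem dU_primU {k : ℝ × Space n → ℝ} (hk : IsCoef k) {q : ℝ × Space n} (hq : q.2 ≠ 0) :
    dU (primU k) q = k q := by
  refine (hk.primU.hasDerivAt_u hq).unique ?_
  exact (hk.continuous_u hq).integral_hasStrictDerivAt 0 q.1 |>.hasDerivAt

theorem IsCoef.eq_of_dU_eq_zero {k : ℝ × Space n → ℝ} (hk : IsCoef k)
    (h : ∀ q : ℝ × Space n, q.2 ≠ 0 → _root_.dU k q = 0) {y : Space n} (hy : y ≠ 0) (u v : ℝ) : k (u, y) = k (v, y) :=
  is_const_of_deriv_eq_zero (f := fun s : ℝ => k (s, y))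
    (fun s => (hk.hasDerivAt_u (q := (s, y)) hy).differentiableAt)
    (fun s => by rw [(hk.hasDerivAt_u (q := (s, y)) hy).deriv, h _ hy]) u v

end Antiderivative

/-! ### The wave operator on asymptotic series -/

/-- Near the point the function is recovered from its null chart version by `ofNull`, which
evaluates at unit directions; hence the assumption ‖y‖ = 1. -/
theorem ContDiffAt.of_toNull {f : Spacetime n → ℝ} {p : NullChart n} (hr : 0 < p.2.1)
    (hy : ‖p.2.2‖ = 1) (h : ContDiffAt ℝ ∞ (_root_.toNull f) p) : ContDiffAt ℝ ∞ f (chartPoint p) := by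
  have e1 : spatial (chartPoint p) = p.2.1 • p.2.2 := by
    rw [chartPoint, spatial_nullPoint, dir_of_norm_eq_one hy]
  have e2 : ‖spatial (chartPoint p)‖ = p.2.1 := by
    rw [e1, norm_smul, hy, Real.norm_eq_abs, abs_of_pos hr, mul_one]
  have h0 : spatial (chartPoint p) ≠ 0 := norm_pos_iff.1 (by rw [e2]; exact hr)
  have e3 : (chartPoint p 0 - ‖spatial (chartPoint p)‖, ‖spatial (chartPoint p)‖,
      dir (spatial (chartPoint p))) = p := by
    rw [e2, e1, dir_smul hr, dir_of_norm_eq_one hy, chartPoint, nullPoint_zero, add_sub_cancel_right]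
  have h1 : ContDiffAt ℝ ∞ (_root_.ofNull (_root_.toNull f)) (chartPoint p) :=
    ContDiffAt.ofNull (by rw [e3]; exact h) h0
  refine h1.congr_of_eventuallyEq ?_
  filter_upwards [(contDiff_spatial (m := ∞)).continuous.continuousAt.eventually_ne h0] with x hx
  have : dir (dir (spatial x)) = dir (spatial x) := dir_of_norm_eq_one (norm_dir hx)
  simp only [_root_.ofNull, _root_.toNull, chartPoint, this, nullPoint_spatial]

theorem eqScri_toNull_pd {f : Spacetime n → ℝ}
    (hf : ∀ a b, ∀ᶠ p in scriOn n a b, ContDiffAt ℝ ∞ (toNull f) p) (μ : Fin (n + 1)) :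
    EqScri (npd μ (toNull f)) (toNull (pd μ f)) := fun a b => by
  filter_upwards [hf a b, eventually_scriOn_gt a b 0, eventually_scriOn_mem a b] with p h1 h2 h3
  exact (toNull_pd_eventuallyEq h2 (ne_zero_of_norm_eq_one h3.2) (ContDiffAt.of_toNull h2 h3.2 h1) μ).symm

theorem HasAsymp.toNull_pd {f : Spacetime n → ℝ} {c : ℕ → ℝ × Space n → ℝ}
    (h : HasAsymp (toNull f) c) (μ : Fin (n + 1)) : HasAsymp (toNull (pd μ f)) (pdCoef μ c) :=
  (h.npd μ).congr (eqScri_toNull_pd h.smooth μ)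

/-- `r^(p+2)` times the Laplacian of `r^(-p) c` on the slices of constant `u`. -/
def lapC (p : ℝ) (c : ℝ × Space n → ℝ) (q : ℝ × Space n) : ℝ :=
  ∑ i : Fin n, dC (p + 1) i.succ (dC p i.succ c) q

/-- The coefficients of the wave operator applied to a series. -/
def boxCoef (c : ℕ → ℝ × Space n → ℝ) : ℕ → ℝ × Space n → ℝ
  | 0 => fun _ => 0
  | 1 => fun _ => 0
  | 2 => fun q => -2 * dU (c 0) q
  | 3 => fun q => -dU (c 1) q
  | j + 4 => fun q => j * dU (c (j + 2)) q + lapC (pw n j) (c j) q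

theorem ell_succ_fun (i : Fin n) : (ell i.succ : ℝ × Space n → ℝ) = fun q => -hatY i q := rfl
theorem dC_zero_fun (β : ℝ) (c : ℝ × Space n → ℝ) : dC β 0 c = fun _ => 0 := rfl
theorem dC_succ_fun (β : ℝ) (i : Fin n) (c : ℝ × Space n → ℝ) :
    dC β i.succ c = fun q => -β * (hatY i q * c q) + dY i c q := rfl

theorem dC_congr {c c' : ℝ × Space n → ℝ} (h : ∀ q, q.2 ≠ 0 → c q = c' q) (β : ℝ)
    (μ : Fin (n + 1)) {q : ℝ × Space n} (hq : q.2 ≠ 0) : dC β μ c q = dC β μ c' q := by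
  refine Fin.cases ?_ (fun i => ?_) μ
  · simp only [dC_zero_fun]
  · simp only [dC_succ_fun, h q hq, dY_congr h i hq]

theorem dC_add {c c' : ℝ × Space n → ℝ} (hc : IsCoef c) (hc' : IsCoef c') (β : ℝ)
    (μ : Fin (n + 1)) {q : ℝ × Space n} (hq : q.2 ≠ 0) :
    dC β μ (fun q => c q + c' q) q = dC β μ c q + dC β μ c' q := by
  refine Fin.cases ?_ (fun i => ?_) μ
  · simp only [dC_zero_fun, add_zero]
  · simp only [dC_succ_fun, dY_add i hc hc' hq]; ring

theorem dC_of_vanish {c : ℝ × Space n → ℝ} (h : ∀ q, q.2 ≠ 0 → c q = 0) (β : ℝ)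
    (μ : Fin (n + 1)) {q : ℝ × Space n} (hq : q.2 ≠ 0) : dC β μ c q = 0 := by
  rw [dC_congr h β μ hq]
  refine Fin.cases ?_ (fun i => ?_) μ
  · simp only [dC_zero_fun]
  · simp only [dC_succ_fun, dY_const]; ring

theorem dU_of_vanish {c : ℝ × Space n → ℝ} (h : ∀ q, q.2 ≠ 0 → c q = 0) {q : ℝ × Space n}
    (hq : q.2 ≠ 0) : dU c q = 0 := by
  rw [dU_congr h hq, dU_const]

theorem lapC_of_vanish {c : ℝ × Space n → ℝ} (h : ∀ q, q.2 ≠ 0 → c q = 0) (p : ℝ)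
    {q : ℝ × Space n} (hq : q.2 ≠ 0) : lapC p c q = 0 :=
  Finset.sum_eq_zero fun _ _ => dC_of_vanish (fun _ h' => dC_of_vanish h p _ h') _ _ hq

theorem isCoef_lapC {c : ℝ × Space n → ℝ} (hc : IsCoef c) (p : ℝ) : IsCoef (lapC p c) :=
  IsCoef.sum _ fun i _ => (hc.dC p i.succ).dC (p + 1) i.succ

theorem sum_hatY_mul_hatY {q : ℝ × Space n} (hq : q.2 ≠ 0) : ∑ i, hatY i q * hatY i q = 1 :=
  sum_dir_mul_dir hq

theorem sum_hatY_mul_dC {c : ℝ × Space n → ℝ} (hc : IsCoef c) (p : ℝ) {q : ℝ × Space n}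
    (hq : q.2 ≠ 0) : ∑ i : Fin n, hatY i q * dC p i.succ c q = -p * c q := by
  have h1 := sum_hatY_mul_hatY hq
  have h2 := hc.sum_dir_mul_dY hq
  calc ∑ i : Fin n, hatY i q * dC p i.succ c q
      = -p * c q * ∑ i, hatY i q * hatY i q + ∑ i, hatY i q * dY i c q := by
        rw [Finset.mul_sum, ← Finset.sum_add_distrib]
        exact Finset.sum_congr rfl fun i _ => by rw [dC_succ_fun]; ring
    _ = _ := by rw [h1, h2]; ring

theorem sum_dC_hatY_mul {c : ℝ × Space n → ℝ} (hc : IsCoef c) (p : ℝ) {q : ℝ × Space n}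
    (hq : q.2 ≠ 0) : ∑ i : Fin n, dC p i.succ (fun q => hatY i q * c q) q
      = ((n : ℝ) - 1 - p) * c q := by
  have h1 := sum_hatY_mul_hatY hq
  have h2 := hc.sum_dir_mul_dY hq
  calc ∑ i : Fin n, dC p i.succ (fun q => hatY i q * c q) q
      = (-p - 1) * c q * ∑ i, hatY i q * hatY i q + ∑ i, hatY i q * dY i c q
        + ∑ _i : Fin n, c q := by
        rw [Finset.mul_sum, ← Finset.sum_add_distrib, ← Finset.sum_add_distrib]
        refine Finset.sum_congr rfl fun i _ => ?_
        rw [dC_succ_fun]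
        simp only [dY_mul i (IsCoef.hatY i) hc hq, dY_hatY i i hq, if_true]
        ring
    _ = _ := by rw [h1, h2]; simp; ring

theorem dU_dC {c : ℝ × Space n → ℝ} (hc : IsCoef c) (p : ℝ) (μ : Fin (n + 1)) {q : ℝ × Space n}
    (hq : q.2 ≠ 0) : dU (dC p μ c) q = dC p μ (dU c) q := by
  refine Fin.cases ?_ (fun i => ?_) μ
  · rw [dC_zero_fun, dC_zero_fun, dU_const]
  · rw [dC_succ_fun, dC_succ_fun]
    beta_reduce
    rw [dU_add (((IsCoef.hatY i).mul hc).const_mul (-p)) (hc.dY i) hq,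
      dU_const_mul _ ((IsCoef.hatY i).mul hc) hq, dU_mul (IsCoef.hatY i) hc hq, dU_hatY i hq,
      hc.dU_dY i hq]
    ring

/-- The second u-derivatives cancel because du is null. The cross terms combine to (2p − (n − 1))
∂_u c, which is j ∂_u c for p = `pw n (j + 2)`; at j = 0 the transport operator degenerates. -/
theorem boxCoef_eq {c : ℕ → ℝ × Space n → ℝ} (hc : ∀ j, IsCoef (c j)) (j : ℕ) {q : ℝ × Space n}
    (hq : q.2 ≠ 0) : -pdCoef 0 (pdCoef 0 c) j q + ∑ i : Fin n, pdCoef i.succ (pdCoef i.succ c) j q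
      = boxCoef c j q := by
  have h1 := sum_hatY_mul_hatY hq
  have hell : ∀ (c : ℝ × Space n → ℝ), IsCoef c → ∀ (i : Fin n) (q : ℝ × Space n), q.2 ≠ 0 →
      ell i.succ q * dU (fun q => ell i.succ q * dU c q) q
        = hatY i q * hatY i q * dU (dU c) q := fun c hc i q hq => by
    rw [dU_mul (isCoef_ell i.succ) hc.dU hq]
    have : dU (ell i.succ) q = 0 := by
      rw [show (ell i.succ : ℝ × Space n → ℝ) = fun q => -1 * hatY i q by
        funext q; simp, dU_const_mul _ (IsCoef.hatY i) hq, dU_hatY i hq, mul_zero]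
    rw [this]; simp only [ell_succ_fun]; ring
  have h00 : ∀ c : ℝ × Space n → ℝ, -dU (dU c) q + ∑ i, hatY i q * hatY i q * dU (dU c) q = 0 :=
    fun c => by rw [← Finset.sum_mul, h1]; ring
  have hdiv : ∀ (j : ℕ) (i : Fin n), pdCoef i.succ (pdCoef i.succ c) (j + 2) q
      = hatY i q * hatY i q * dU (dU (c (j + 2))) q
        - hatY i q * dC (pw n j) i.succ (dU (c j)) q
        + dC (pw n j) i.succ (pdCoef i.succ c j) q := fun j i => by
    simp only [pdCoef]
    have e : dU (pdCoef i.succ c (j + 2)) q = dU (fun q => ell i.succ q * dU (c (j + 2)) q) q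
        + dC (pw n j) i.succ (dU (c j)) q := by
      rw [← dU_dC (hc j) _ _ hq]
      exact dU_add ((isCoef_ell i.succ).mul (hc (j + 2)).dU) ((hc j).dC _ _) hq
    simp only [pdCoef] at e
    rw [e, mul_add, hell _ (hc (j + 2)) i q hq]
    simp only [ell_succ_fun]
    ring
  have hdivl : ∀ (p : ℝ) (c : ℝ × Space n → ℝ) (i : Fin n), IsCoef c →
      dC p i.succ (fun q => ell i.succ q * c q) q = -dC p i.succ (fun q => hatY i q * c q) q :=
    fun p c i hc => by
      have h := (IsCoef.hatY i).mul hc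
      have e : (fun q => ell i.succ q * c q) = fun q => -1 * (hatY i q * c q) := by
        funext q; rw [ell_succ_fun]; ring
      rw [e, dC_succ_fun]
      simp only [dC_succ_fun, dY_const_mul i _ h hq]
      ring
  have h0 : ∀ j, pdCoef 0 c j = dU (c j) := fun j => by
    match j with
    | 0 => simp [pdCoef]
    | 1 => simp [pdCoef]
    | j + 2 => simp [pdCoef]
  have h0' : ∀ j, pdCoef 0 (pdCoef 0 c) j = dU (dU (c j)) := fun j => by
    rw [← h0 j]
    match j with
    | 0 => simp [pdCoef]
    | 1 => simp [pdCoef]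
    | j + 2 => simp [pdCoef]
  rw [h0']
  match j with
  | 0 =>
    simp only [pdCoef, boxCoef]
    rw [Finset.sum_congr rfl fun i _ => hell _ (hc 0) i q hq]
    exact h00 _
  | 1 =>
    simp only [pdCoef, boxCoef]
    rw [Finset.sum_congr rfl fun i _ => hell _ (hc 1) i q hq]
    exact h00 _
  | 2 =>
    have e := sum_hatY_mul_dC (hc 0).dU (pw n 0) hq
    have e' := sum_dC_hatY_mul (hc 0).dU (pw n 0) hq
    simp only [hdiv 0, Finset.sum_add_distrib, Finset.sum_sub_distrib]
    simp only [pdCoef, hdivl _ _ _ (hc 0).dU, Finset.sum_neg_distrib]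
    simp only [boxCoef]
    rw [e, e']
    have := h00 (c 2)
    simp only [pw] at *
    push_cast at *
    linear_combination this
  | 3 =>
    have e := sum_hatY_mul_dC (hc 1).dU (pw n 1) hq
    have e' := sum_dC_hatY_mul (hc 1).dU (pw n 1) hq
    simp only [hdiv 1, Finset.sum_add_distrib, Finset.sum_sub_distrib]
    simp only [pdCoef, hdivl _ _ _ (hc 1).dU, Finset.sum_neg_distrib]
    simp only [boxCoef]
    rw [e, e']
    have := h00 (c 3)
    simp only [pw] at *
    push_cast at *
    linear_combination this
  | j + 4 =>
    have e := sum_hatY_mul_dC (hc (j + 2)).dU (pw n (j + 2)) hq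
    have e' := sum_dC_hatY_mul (hc (j + 2)).dU (pw n (j + 2)) hq
    have e2 : ∀ i : Fin n, dC (pw n (j + 2)) i.succ (pdCoef i.succ c (j + 2)) q
        = -dC (pw n (j + 2)) i.succ (fun q => hatY i q * dU (c (j + 2)) q) q
          + dC (pw n j + 1) i.succ (dC (pw n j) i.succ (c j)) q := fun i => by
      rw [← hdivl _ _ _ (hc (j + 2)).dU, ← pw_add_two]
      exact dC_add ((isCoef_ell i.succ).mul (hc (j + 2)).dU) ((hc j).dC _ _) _ _ hq
    simp only [hdiv (j + 2), e2, Finset.sum_add_distrib, Finset.sum_sub_distrib,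
      Finset.sum_neg_distrib]
    simp only [boxCoef, lapC]
    rw [e, e']
    have := h00 (c (j + 4))
    simp only [pw] at *
    push_cast at *
    linear_combination this

theorem HasAsymp.toNull_box {f : Spacetime n → ℝ} {c : ℕ → ℝ × Space n → ℝ}
    (h : HasAsymp (toNull f) c) : HasAsymp (toNull (box f)) (boxCoef c) := by
  have h1 := (((h.toNull_pd 0).toNull_pd 0).const_mul (-1)).add
    (HasAsymp.sum Finset.univ fun i _ => (h.toNull_pd (Fin.succ i)).toNull_pd (Fin.succ i))
  refine (h1.congr_coef fun j q hq => ?_).congr (eqScri_of_forall fun p _ _ => ?_)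
  · rw [← boxCoef_eq h.coef j hq]; ring
  · simp only [toNull, box_eq]; ring

/-- Conversion of derivatives of a homogeneous function to those of a coefficient. -/
theorem dC_norm_rpow_mul {g : Space n → ℝ} (β : ℝ) (i : Fin n) {q : ℝ × Space n} (hq : q.2 ≠ 0)
    (hg : ContDiffAt ℝ ∞ g q.2) : dC β i.succ (fun q => ‖q.2‖ ^ β * g q.2) q
      = ‖q.2‖ ^ (β + 1) * spd i g q.2 := by
  have hn := norm_pos_iff.2 hq
  have h1 : HasFDerivAt (fun y : Space n => ‖y‖ ^ β * g y)
      (‖q.2‖ ^ β • fderiv ℝ g q.2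
        + g q.2 • ((β * ‖q.2‖ ^ (β - 1)) • fderiv ℝ (fun y : Space n => ‖y‖) q.2)) q.2 :=
    (((contDiffAt_norm_space (m := ∞) hq).differentiableAt (by simp)).hasFDerivAt.rpow_const
      (Or.inl hn.ne')).mul (hg.differentiableAt (by simp)).hasFDerivAt
  have h2 := h1.comp (f := Prod.snd) q hasFDerivAt_snd
  have h3 : dY i (fun q : ℝ × Space n => ‖q.2‖ ^ β * g q.2) q
      = ‖q.2‖ * (‖q.2‖ ^ β * spd i g q.2 + g q.2 * (β * ‖q.2‖ ^ (β - 1) * dir q.2 i)) := by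
    have : fderiv ℝ (fun q : ℝ × Space n => ‖q.2‖ ^ β * g q.2) q = _ := h2.fderiv
    rw [dY, this]
    simp [spd, fderiv_norm_single hq]
  rw [dC_succ_fun]
  simp only [h3, hatY]
  have e1 : ‖q.2‖ ^ (β + 1) = ‖q.2‖ * ‖q.2‖ ^ β := by rw [Real.rpow_add_one hn.ne', mul_comm]
  have e2 : ‖q.2‖ ^ β = ‖q.2‖ * ‖q.2‖ ^ (β - 1) := by
    rw [mul_comm, ← Real.rpow_add_one hn.ne', sub_add_cancel]
  rw [e1, e2]
  ring

theorem IsHomog.isCoef {t : ℝ} {g : Space n → ℝ} (hg : IsHomog t g) :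
    IsCoef fun q : ℝ × Space n => ‖q.2‖ ^ t * g q.2 := by
  refine ⟨fun q hq => ?_, fun q hq s hs => ?_⟩
  · exact (((contDiffAt_norm_space hq).rpow_const_of_ne (norm_ne_zero_iff.2 hq)).mul
      (hg.smooth q.2 hq)).comp q contDiffAt_snd
  · have h0 : s ^ t * s ^ (-t) = 1 := by rw [← Real.rpow_add hs]; simp
    simp only [hg.homog q.2 hq s hs, norm_smul, Real.norm_eq_abs, abs_of_pos hs,
      Real.mul_rpow hs.le (norm_nonneg q.2)]
    linear_combination (‖q.2‖ ^ t * g q.2) * h0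

/-- Coefficients independent of u, multiplied by a power of ‖y‖, are homogeneous functions on space,
so the elliptic equation on the sphere becomes the Poisson equation of `exists_poisson`. -/
theorem exists_lapC_eq (hn : 3 ≤ n) {f : ℝ × Space n → ℝ} (hf : IsCoef f)
    (h0 : ∀ q, q.2 ≠ 0 → dU f q = 0) : ∃ (k : ℝ × Space n → ℝ) (c : ℝ), IsCoef k ∧
      (n ≠ 3 → c = 0) ∧ (∀ q, q.2 ≠ 0 → dU k q = 0) ∧
      ∀ q, q.2 ≠ 0 → lapC (pw n 0) k q = f q - c := by
  have hf' : IsHomog 0 fun y : Space n => f (0, y) :=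
    ⟨fun y hy => (hf.smooth (0, y) hy).comp y (contDiffAt_const.prodMk contDiffAt_id),
      fun y hy s hs => by simpa using hf.homog (0, y) hy s hs⟩
  obtain ⟨g, c, hg, hc, heq⟩ := exists_poisson hn hf'
  have hs : pw n 0 = ((n : ℝ) - 3) / 2 := by simp [pw]
  rw [← hs] at hg
  refine ⟨_, c, hg.isCoef, hc, fun q hq => ?_, fun q hq => ?_⟩
  · have h1 := (hg.isCoef.hasDerivAt_u hq).deriv
    simpa using h1.symm
  · have h1 : ∀ i : Fin n, dC (pw n 0 + 1) i.succ (dC (pw n 0) i.succ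
        (fun q : ℝ × Space n => ‖q.2‖ ^ pw n 0 * g q.2)) q
        = ‖q.2‖ ^ (pw n 0 + 1 + 1) * spd i (spd i g) q.2 := fun i => by
      rw [dC_congr (fun q hq => dC_norm_rpow_mul (pw n 0) i hq (hg.smooth q.2 hq)) _ _ hq,
        dC_norm_rpow_mul _ i hq ((hg.spd i).smooth q.2 hq)]
    rw [lapC, Finset.sum_congr rfl fun i _ => h1 i, ← Finset.mul_sum, heq q.2 hq, ← mul_assoc,
      ← Real.rpow_add (norm_pos_iff.2 hq), hs,
      show ((n : ℝ) - 3) / 2 + 1 + 1 + -(((n : ℝ) + 1) / 2) = 0 by ring, Real.rpow_zero, one_mul,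
      hf.eq_of_dU_eq_zero h0 hq 0 q.1]

/-! ### The scalar wave equation within the ansatz -/

/-- The indices `j` for which `r^(-pw n j)` occurs in the ansatz for the metric. -/
def Adm (n j : ℕ) : Prop := (Even j ∧ 2 ≤ j) ∨ (Even n ∧ Odd j ∧ n ≤ j + 1)

theorem Adm.add_two {j : ℕ} (h : Adm n j) : Adm n (j + 2) := by
  rcases h with ⟨h1, h2⟩ | ⟨h1, h2, h3⟩
  · exact Or.inl ⟨by simpa [Nat.even_add] using h1, by omega⟩
  · exact Or.inr ⟨h1, by simpa [Nat.odd_add, Nat.not_odd_iff_even] using h2, by omega⟩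

theorem adm_two : Adm n 2 := Or.inl ⟨even_two, le_rfl⟩

theorem pdCoef_of_vanish {c : ℕ → ℝ × Space n → ℝ} (μ : Fin (n + 1)) {j : ℕ}
    (h : ∀ q, q.2 ≠ 0 → c j q = 0) (h2 : ∀ i, j = i + 2 → ∀ q, q.2 ≠ 0 → c i q = 0)
    {q : ℝ × Space n} (hq : q.2 ≠ 0) : pdCoef μ c j q = 0 := by
  match j with
  | 0 => simp only [pdCoef, dU_of_vanish h hq, mul_zero]
  | 1 => simp only [pdCoef, dU_of_vanish h hq, mul_zero]
  | j + 2 => simp only [pdCoef, dU_of_vanish h hq, dC_of_vanish (h2 j rfl) _ _ hq, mul_zero, add_zero]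

theorem HasAsymp.toNull_box_of_pd {f : Spacetime n → ℝ}
    {Y : Fin (n + 1) → ℕ → ℝ × Space n → ℝ} (h : ∀ μ, HasAsymp (toNull (pd μ f)) (Y μ)) :
    HasAsymp (toNull (box f)) fun j q =>
      -pdCoef 0 (Y 0) j q + ∑ i : Fin n, pdCoef i.succ (Y i.succ) j q := by
  have h1 := (((h 0).toNull_pd 0).const_mul (-1)).add
    (HasAsymp.sum Finset.univ fun i _ => (h (Fin.succ i)).toNull_pd (Fin.succ i))
  refine (h1.congr_coef fun j q hq => ?_).congr (eqScri_of_forall fun p _ _ => ?_)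
  · ring
  · simp only [toNull, box_eq]; ring

theorem pd_add {f g : Spacetime n → ℝ} {x : Spacetime n} (hf : ContDiffAt ℝ ∞ f x)
    (hg : ContDiffAt ℝ ∞ g x) (μ : Fin (n + 1)) :
    pd μ (fun x => f x + g x) =ᶠ[𝓝 x] fun x => pd μ f x + pd μ g x := by
  filter_upwards [hf.eventually_differentiableAt, hg.eventually_differentiableAt] with y h1 h2
  rw [pd, fderiv_fun_add h1 h2]
  rfl

theorem pd_congr {f g : Spacetime n → ℝ} {x : Spacetime n} (h : f =ᶠ[𝓝 x] g) (μ : Fin (n + 1)) :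
    pd μ f =ᶠ[𝓝 x] pd μ g := h.fderiv.mono fun y hy => by rw [pd, hy, pd]

theorem box_add {f g : Spacetime n → ℝ} {x : Spacetime n} (hf : ContDiffAt ℝ ∞ f x)
    (hg : ContDiffAt ℝ ∞ g x) : box (fun x => f x + g x) x = box f x + box g x := by
  have h : ∀ μ, pd μ (pd μ fun x => f x + g x) x = pd μ (pd μ f) x + pd μ (pd μ g) x := fun μ =>
    ((pd_congr (pd_add hf hg μ) μ).trans (pd_add (hf.pd μ) (hg.pd μ) μ)).self_of_nhds
  simp only [box_eq, h, Finset.sum_add_distrib]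
  ring

theorem spatial_chartPoint_ne {p : NullChart n} (hr : 0 < p.2.1) (hy : p.2.2 ≠ 0) :
    spatial (chartPoint p) ≠ 0 := by
  rw [chartPoint, spatial_nullPoint]
  exact smul_ne_zero hr.ne' (norm_ne_zero_iff.1 (by rw [norm_dir hy]; exact one_ne_zero))

/-- The coefficients of the solution of the wave equation with a given source series. -/
def waveCoef (X : ℕ → ℝ × Space n → ℝ) (k : ℝ × Space n → ℝ) : ℕ → ℝ × Space n → ℝ
  | 0 => k
  | 1 => fun _ => 0
  | 2 => fun _ => 0
  | j + 3 => primU fun q => ((j : ℝ) + 1)⁻¹ *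
      (X (j + 5) q - lapC (pw n (j + 1)) (waveCoef X k (j + 1)) q)

section WaveCoef

variable {X : ℕ → ℝ × Space n → ℝ} {k : ℝ × Space n → ℝ}

theorem isCoef_waveCoef (hX : ∀ j, IsCoef (X j)) (hk : IsCoef k) :
    ∀ j, IsCoef (waveCoef X k j) := by
  intro j
  induction j using Nat.strong_induction_on with
  | _ j ih =>
    match j with
    | 0 => exact hk
    | 1 => exact IsCoef.const 0
    | 2 => exact IsCoef.const 0
    | j + 3 =>
      rw [waveCoef]
      exact (((hX _).sub (isCoef_lapC (ih (j + 1) (by omega)) _)).const_mul _).primU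

/-- The recursion advances by two indices and the admissible indices are closed under such steps, so
an inadmissible index only receives contributions from inadmissible ones. Index 0, where k sits, is
the exception. -/
theorem waveCoef_eq_zero (hX : ∀ j, ¬ Adm n j → ∀ q, q.2 ≠ 0 → X (j + 2) q = 0) :
    ∀ j, j ≠ 0 → ¬ Adm n j → ∀ q, q.2 ≠ 0 → waveCoef X k j q = 0 := by
  intro j
  induction j using Nat.strong_induction_on with
  | _ j ih =>
    intro hj ha q hq
    match j with
    | 1 => rfl
    | 2 => rfl
    | j + 3 =>
      rw [waveCoef, primU]
      refine intervalIntegral.integral_zero_ae (Eventually.of_forall fun s _ => ?_)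
      have h1 := hX (j + 3) ha (s, q.2) hq
      have h2 := lapC_of_vanish (ih (j + 1) (by omega) (by omega) fun h => ha h.add_two)
        (pw n (j + 1)) (q := (s, q.2)) hq
      rw [show j + 5 = j + 3 + 2 by omega, h1, h2, sub_zero, mul_zero]

/-- The recursion is designed for this at indices above 4. At index 4 the coefficient with index 2
is multiplied by zero, and k accounts for the source up to the constant c. -/
theorem boxCoef_waveCoef (hX : ∀ j, IsCoef (X j)) (hk : IsCoef k)
    (hX0 : ∀ j < 4, ∀ q, q.2 ≠ 0 → X j q = 0) (hk0 : ∀ q, q.2 ≠ 0 → dU k q = 0) {c : ℝ}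
    (hlap : ∀ q, q.2 ≠ 0 → lapC (pw n 0) k q = X 4 q - c) (j : ℕ) {q : ℝ × Space n}
    (hq : q.2 ≠ 0) : boxCoef (waveCoef X k) j q = X j q - if j = 4 then c else 0 := by
  match j with
  | 0 => simp [boxCoef, hX0 0 (by norm_num) q hq]
  | 1 => simp [boxCoef, hX0 1 (by norm_num) q hq]
  | 2 => simp [boxCoef, hX0 2 (by norm_num) q hq, waveCoef, hk0 q hq]
  | 3 => simp [boxCoef, hX0 3 (by norm_num) q hq, waveCoef, dU_const]
  | 4 => simp [boxCoef, waveCoef, hlap q hq]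
  | j + 5 =>
    have h1 : dU (waveCoef X k (j + 1 + 2)) q = ((j : ℝ) + 1)⁻¹ *
      (X (j + 5) q - lapC (pw n (j + 1)) (waveCoef X k (j + 1)) q) := by
      rw [show j + 1 + 2 = j + 3 by omega, waveCoef]
      exact dU_primU (((hX _).sub (isCoef_lapC (isCoef_waveCoef hX hk _) _)).const_mul _) hq
    have h2 : ((j : ℝ) + 1) ≠ 0 := by positivity
    rw [show j + 5 = j + 1 + 4 by omega, boxCoef]
    simp only [h1]
    push_cast
    rw [mul_inv_cancel_left₀ h2]
    simp

end WaveCoef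

theorem npd_log (p : NullChart n) (hp : 0 < p.2.1) (μ : Fin (n + 1)) :
    npd μ (fun p : NullChart n => Real.log p.2.1) p
      = Fin.cases 0 (fun i => dir p.2.2 i * p.2.1⁻¹) μ := by
  have h : HasFDerivAt (fun p : NullChart n => Real.log p.2.1)
      (p.2.1⁻¹ • ((ContinuousLinearMap.fst ℝ ℝ (Space n)).comp
        (ContinuousLinearMap.snd ℝ ℝ (ℝ × Space n)))) p :=
    ((hasFDerivAt_fst (p := p.2)).comp p hasFDerivAt_snd).log hp.ne'
  refine Fin.cases ?_ (fun i => ?_) μ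
  · simp [npd, dd, h.fderiv, Slot.vec]
  · simp [npd, dd, h.fderiv, Slot.vec]

/-- In three space dimensions the logarithm of the radius solves the wave equation with source
`r^(-2)`. -/
theorem exists_box_log (c : ℝ) (hc : n ≠ 3 → c = 0) : ∃ L : Spacetime n → ℝ,
    (∀ x, spatial x ≠ 0 → ContDiffAt ℝ ∞ L x) ∧
    (∀ μ, ∃ Y, HasAsymp (toNull (pd μ L)) Y ∧ ∀ j, ¬ Adm n j → ∀ q, q.2 ≠ 0 → Y j q = 0) ∧
    HasAsymp (toNull (box L)) fun j _ => if j = 4 then c else 0 := by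
  have hs : ∀ x : Spacetime n, spatial x ≠ 0 →
      ContDiffAt ℝ ∞ (fun x => c * Real.log ‖spatial x‖) x := fun x hx =>
    contDiffAt_const.mul (((contDiffAt_norm_space hx).comp x contDiff_spatial.contDiffAt).log
      (norm_ne_zero_iff.2 hx))
  have hY : ∀ μ : Fin (n + 1), HasAsymp (toNull (pd μ fun x => c * Real.log ‖spatial x‖))
      fun j q => if j = 2 then Fin.cases 0 (fun i => c * hatY i q) μ else 0 := fun μ => by
    have hcoef : IsCoef fun q : ℝ × Space n =>
        (Fin.cases 0 (fun i => c * hatY i q) μ : ℝ) := by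
      refine Fin.cases ?_ (fun i => ?_) μ
      · exact IsCoef.const 0
      · exact (IsCoef.hatY i).const_mul c
    refine (HasAsymp.of_mono hcoef).congr (eqScri_of_forall fun p hp hy => ?_)
    have hd := (hs _ (spatial_chartPoint_ne hp hy)).differentiableAt (by simp)
    rw [toNull_pd hp hy hd]
    have e : toNull (fun x => c * Real.log ‖spatial x‖) =ᶠ[𝓝 p]
        fun p : NullChart n => c * Real.log p.2.1 := by
      filter_upwards [eventually_ne_of_pos hp hy] with q hq
      rw [toNull, chartPoint, spatial_nullPoint, norm_smul, norm_dir hq.2, Real.norm_eq_abs,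
        abs_of_pos hq.1, mul_one]
    have e2 : npd μ (toNull fun x => c * Real.log ‖spatial x‖) p
        = npd μ (fun p : NullChart n => c * Real.log p.2.1) p := by
      simp only [npd, dd, e.fderiv_eq]
    rw [e2, npd_const_mul]
    beta_reduce
    rw [npd_log p hp]
    -- For n ≠ 3 the constant is zero and the logarithm is absent; for n = 3 the gradient is of
    -- order 1/r, which is index 2.
    by_cases h3 : n = 3
    · have hpw : pw n 2 = 1 := by rw [pw, h3]; norm_num
      rw [mono, hpw, Real.rpow_neg_one]
      refine Fin.cases ?_ (fun i => ?_) μ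
      · simp
      · simp only [Fin.cases_succ, hatY]; ring
    · rw [mono, hc h3]
      refine Fin.cases ?_ (fun i => ?_) μ <;> simp
  refine ⟨fun x => c * Real.log ‖spatial x‖, hs, fun μ => ⟨_, hY μ, fun j hj q _ => if_neg fun h : j = 2 =>
    hj (by rw [h]; exact adm_two)⟩, (HasAsymp.toNull_box_of_pd hY).congr_coef fun j q hq => ?_⟩
  have h0 : pdCoef 0 (fun j (q : ℝ × Space n) => if j = 2 then
      (Fin.cases 0 (fun i => c * hatY i q) (0 : Fin (n + 1)) : ℝ) else 0) j q = 0 :=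
    pdCoef_of_vanish _ (fun q _ => by simp) (fun _ _ q _ => by simp) hq
  rw [h0, neg_zero, zero_add]
  by_cases h2 : j = 2
  · subst h2
    rw [if_neg (by norm_num)]
    refine Finset.sum_eq_zero fun i _ => ?_
    simp only [pdCoef, if_true, Fin.cases_succ]
    rw [dU_const_mul _ (IsCoef.hatY i) hq, dU_hatY i hq, mul_zero, mul_zero, zero_add]
    exact dC_of_vanish (fun _ _ => by simp) _ _ hq
  by_cases h4 : j = 4
  · subst h4
    rw [if_pos rfl]
    have e : ∀ i : Fin n, pdCoef i.succ (fun j (q : ℝ × Space n) => if j = 2 then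
        (Fin.cases 0 (fun i => c * hatY i q) i.succ : ℝ) else 0) 4 q
        = dC (pw n 2) i.succ (fun q => hatY i q * c) q := fun i => by
      simp only [pdCoef, if_true, Fin.cases_succ, mul_comm c]
      rw [dU_of_vanish (fun _ _ => by simp) hq, mul_zero, zero_add]
    rw [Finset.sum_congr rfl fun i _ => e i, sum_dC_hatY_mul (IsCoef.const c) _ hq]
    by_cases h3 : n = 3
    · rw [pw, h3]; norm_num
    · rw [hc h3, mul_zero]
  · rw [if_neg h4]
    exact Finset.sum_eq_zero fun i _ => pdCoef_of_vanish _ (fun q _ => if_neg h2)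
      (fun i hi q _ => if_neg (by omega)) hq

/-- The wave equation with a source that decays one order faster than the ansatz can be solved
near null infinity by a function whose gradient satisfies the ansatz, provided that the leading
coefficient of the source is stationary. -/
theorem exists_box_eq (hn : 3 ≤ n) {F : Spacetime n → ℝ} {X : ℕ → ℝ × Space n → ℝ}
    (hF : HasAsymp (toNull F) X) (hX : ∀ j < 4, ∀ q, q.2 ≠ 0 → X j q = 0)
    (hX' : ∀ j, ¬ Adm n j → ∀ q, q.2 ≠ 0 → X (j + 2) q = 0)
    (hX4 : ∀ q, q.2 ≠ 0 → dU (X 4) q = 0) : ∃ ξ : Spacetime n → ℝ,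
      (∀ x, spatial x ≠ 0 → ContDiffAt ℝ ∞ ξ x) ∧
      (∀ a b, ∀ᶠ p in scriOn n a b, box ξ (chartPoint p) = F (chartPoint p)) ∧
      ∀ μ, ∃ Y, HasAsymp (toNull (pd μ ξ)) Y ∧ ∀ j, ¬ Adm n j → ∀ q, q.2 ≠ 0 → Y j q = 0 := by
  -- The source at index 4 cannot be integrated in u; the stationary k and, for n = 3, the logarithm
  -- absorb it.
  obtain ⟨k, c, hk, hc, hk0, hlap⟩ := exists_lapC_eq hn (hF.coef 4) hX4
  have hw := isCoef_waveCoef hF.coef hk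
  have hw0 : ∀ j, j ≠ 0 → ¬ Adm n j → ∀ q, q.2 ≠ 0 → waveCoef X k j q = 0 := waveCoef_eq_zero hX'
  obtain ⟨B, hB, hBdir, hBasymp⟩ := exists_borel hw
  obtain ⟨L, hL, hLpd, hLbox⟩ := exists_box_log c hc
  have hB' : HasAsymp (toNull (ofNull B)) (waveCoef X k) :=
    hBasymp.congr (eqScri_of_forall fun p hp hy => by rw [toNull_ofNull B hp hy, hBdir p hy])
  have hBs : ∀ x, spatial x ≠ 0 → ContDiffAt ℝ ∞ (ofNull B) x := fun x hx =>
    ContDiffAt.ofNull (hB _ (norm_pos_iff.2 hx)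
      (norm_ne_zero_iff.1 (by rw [norm_dir hx]; exact one_ne_zero))) hx
  -- All coefficients of the remaining error vanish, so it decreases faster than any power.
  obtain ⟨ψ, hψ, hψO, hψbox⟩ := exists_box_eq_of_rapid (by omega)
    (E := fun x => F x - box (ofNull B) x - box L x)
    (((hF.sub hB'.toNull_box).sub hLbox).isOScri_of_vanish fun j q hq => by
      rw [boxCoef_waveCoef hF.coef hk hX hk0 hlap j hq]; ring)
  have hsm : ∀ x, spatial x ≠ 0 → ContDiffAt ℝ ∞ (fun x => ofNull B x + L x) x := fun x hx =>
    (hBs x hx).add (hL x hx)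
  refine ⟨fun x => ofNull B x + L x + ψ x, fun x hx => (hsm x hx).add hψ.contDiffAt,
    fun a b => ?_, fun μ => ?_⟩
  · filter_upwards [hψbox a b, eventually_scriOn_pos_ne a b] with p h1 h2
    have hx := spatial_chartPoint_ne h2.1 h2.2
    rw [box_add (hsm _ hx) hψ.contDiffAt, box_add (hBs _ hx) (hL _ hx), h1]
    ring
  · obtain ⟨Y, hY, hY0⟩ := hLpd μ
    have h1 := ((hB'.toNull_pd μ).add hY).add
      ((HasAsymp.of_isOScri hψO).toNull_pd μ)
    refine ⟨_, h1.congr (eqScri_of_forall fun p hp hy => ?_), fun j hj q hq => ?_⟩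
    · have hx := spatial_chartPoint_ne hp hy
      have h2 := (pd_add (hsm _ hx) (hψ.contDiffAt) μ).self_of_nhds
      have h3 := (pd_add (hBs _ hx) (hL _ hx) μ).self_of_nhds
      simp only [toNull, h2, h3]
    · rw [hY0 j hj q hq, pdCoef_of_vanish μ (fun _ _ => rfl) (fun _ _ _ _ => rfl) hq]
      -- Index 0 is not admissible, but only the gradient matters: ∂_u k = 0, and the angular part
      -- of the derivative of k falls on the admissible index 2.
      have h0 : pdCoef μ (waveCoef X k) j q = 0 := by
        match j with
        | 0 => simp only [pdCoef, waveCoef, hk0 q hq, mul_zero]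
        | 1 => simp only [pdCoef, waveCoef, dU_const, mul_zero]
        | j + 2 =>
          refine pdCoef_of_vanish μ (hw0 _ (by omega) hj) (fun i hi => ?_) hq
          obtain rfl : j = i := by omega
          exact hw0 j (fun h => hj (h ▸ adm_two)) fun h => hj h.add_two
      rw [h0]; ring

/-! ### Translation of expansions -/

theorem LinGrav.IsNhdNullInfinity.eventually_chartPoint_mem {U : Set (Spacetime n)}
    (hU : IsNhdNullInfinity U) (a b : ℝ) : ∀ᶠ p in scriOn n a b, chartPoint p ∈ U := by
  obtain ⟨R, hR⟩ := hU.2 a b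
  refine eventually_scriOn.2 ⟨R, fun r hr u hu θ hθ => ?_⟩
  rw [chartPoint]
  simp only [dir_of_norm_eq_one hθ]
  exact hR u hu r hr θ hθ

theorem LinGrav.IsNhdNullInfinity.eventually_contDiffAt_toNull {U : Set (Spacetime n)}
    (hU : IsNhdNullInfinity U) {f : Spacetime n → ℝ} (hf : ContDiffOn ℝ ∞ f U) (a b : ℝ) :
    ∀ᶠ p in scriOn n a b, ContDiffAt ℝ ∞ (toNull f) p := by
  filter_upwards [hU.eventually_chartPoint_mem a b, eventually_scriOn_mem a b] with p h1 h2
  exact (hf.contDiffAt (hU.1.mem_nhds h1)).toNull (ne_zero_of_norm_eq_one h2.2)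

theorem LinGrav.IsNhdNullInfinity.eqScri_toNull {U : Set (Spacetime n)} (hU : IsNhdNullInfinity U)
    {f g : Spacetime n → ℝ} (hfg : ∀ x ∈ U, f x = g x) : EqScri (toNull f) (toNull g) :=
  fun a b => by
  filter_upwards [hU.eventually_chartPoint_mem a b, eventually_scriOn_mem a b] with p h1 h2
  have hc : ContinuousAt chartPoint p :=
    (contDiffAt_chartPoint (m := ∞) (ne_zero_of_norm_eq_one h2.2)).continuousAt
  filter_upwards [hc.eventually (hU.1.mem_nhds h1)] with p' hp'
  exact hfg _ hp'

theorem isNhdNullInfinity_of_eventually {V : Set (Spacetime n)} (hV : IsOpen V)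
    (h : ∀ a b, ∀ᶠ p in scriOn n a b, chartPoint p ∈ V) : IsNhdNullInfinity V := by
  refine ⟨hV, fun a b => ?_⟩
  obtain ⟨R, hR⟩ := eventually_scriOn.1 (h a b)
  refine ⟨R, fun u hu r hr θ hθ => ?_⟩
  have := hR r hr u hu θ hθ
  rw [chartPoint] at this
  simpa only [dir_of_norm_eq_one hθ] using this

theorem isCoef_of_isSmoothCoeff {c : ℝ → Space n → ℝ} (hc : IsSmoothCoeff c) :
    IsCoef fun q : ℝ × Space n => c q.1 (dir q.2) :=
  ⟨fun _ hq => hc.contDiffAt (isOpen_snd_ne.mem_nhds hq), fun q _ t ht => by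
    simp only [dir_smul ht]⟩

theorem IsCoef.apply_dir {c : ℝ × Space n → ℝ} (hc : IsCoef c) {q : ℝ × Space n} (hq : q.2 ≠ 0) :
    c (q.1, dir q.2) = c q :=
  hc.homog q hq _ (inv_pos.2 (norm_pos_iff.2 hq))

theorem IsCoef.isSmoothCoeff {c : ℝ × Space n → ℝ} (hc : IsCoef c) :
    IsSmoothCoeff fun u θ => c (u, θ) := fun q hq =>
  ((hc.smooth q hq).congr_of_eventuallyEq ((eventually_snd_ne hq).mono fun _ hx =>
    hc.apply_dir hx)).contDiffWithinAt

/-- The coefficients, in half-integer steps, of a series in integer steps that starts at the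
index `k`. -/
def stepCoef (k : ℕ) (c : ℕ → ℝ → Space n → ℝ) (j : ℕ) (q : ℝ × Space n) : ℝ :=
  if k ≤ j ∧ Even (j - k) then c ((j - k) / 2) q.1 (dir q.2) else 0

theorem stepCoef_add (k : ℕ) (c : ℕ → ℝ → Space n → ℝ) (i : ℕ) (q : ℝ × Space n) :
    stepCoef k c (k + 2 * i) q = c i q.1 (dir q.2) := by
  simp [stepCoef]

theorem stepCoef_eq_zero {k j : ℕ} (c : ℕ → ℝ → Space n → ℝ) (h : ∀ i, j ≠ k + 2 * i)
    (q : ℝ × Space n) : stepCoef k c j q = 0 := by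
  refine if_neg fun ⟨h1, i, hi⟩ => h i (by omega)

theorem isCoef_stepCoef {k : ℕ} {c : ℕ → ℝ → Space n → ℝ} (hc : ∀ j, IsSmoothCoeff (c j)) (j : ℕ) :
    IsCoef (stepCoef k c j) := by
  by_cases h : ∃ i, j = k + 2 * i
  · obtain ⟨i, rfl⟩ := h
    exact (isCoef_of_isSmoothCoeff (hc i)).congr fun q _ => (stepCoef_add k c i q).symm
  · exact (IsCoef.const 0).congr fun q _ => (stepCoef_eq_zero c (not_exists.1 h) q).symm

theorem pw_add_two_mul (n k i : ℕ) : pw n (k + 2 * i) = pw n k + i := by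
  simp only [pw]; push_cast; ring

theorem isOScri_sum_stepCoef {k : ℕ} {c : ℕ → ℝ → Space n → ℝ} (hc : ∀ j, IsSmoothCoeff (c j))
    (N : ℕ) : IsOScri (fun p : NullChart n =>
      ∑ i ∈ Finset.range N, p.2.1 ^ (-(pw n k + i)) * c i p.1 (dir p.2.2)
        - ∑ j ∈ Finset.range N, mono (pw n j) (stepCoef k c j) p) (pw n N) := by
  have h := isOScri_sum_sub_sum (K := N) (isCoef_stepCoef (k := k) hc)
    (s := (Finset.range N).image fun i => k + 2 * i) fun i hi his q _ =>
      stepCoef_eq_zero c (fun m hm => his (Finset.mem_image.2 ⟨m, Finset.mem_range.2 (by omega),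
        hm.symm⟩)) q
  refine h.congr (eqScri_of_forall fun p _ _ => ?_)
  rw [Finset.sum_image fun i _ j _ hij => by omega]
  simp only [mono, pw_add_two_mul, stepCoef_add]

/-- Both integer-step series are interleaved in the half-integer scale; where they share an index,
their coefficients add. -/
theorem LinGrav.HasDoubleExpansion.hasAsymp {f : Spacetime n → ℝ} {k k' : ℕ} {c c' : ℕ → ℝ → Space n → ℝ}
    (h : HasDoubleExpansion f (pw n k) c (pw n k') c')
    (hf : ∀ a b, ∀ᶠ p in scriOn n a b, ContDiffAt ℝ ∞ (toNull f) p) :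
    HasAsymp (toNull f) fun j q => stepCoef k c j q + stepCoef k' c' j q := by
  obtain ⟨hc, hc', hO⟩ := h
  refine ⟨fun j => (isCoef_stepCoef hc j).add (isCoef_stepCoef hc' j), fun N => ?_⟩
  have hsm : ∀ (k : ℕ) (c : ℕ → ℝ → Space n → ℝ), (∀ j, IsSmoothCoeff (c j)) →
      ∀ p : NullChart n, 0 < p.2.1 → p.2.2 ≠ 0 → ContDiffAt ℝ ∞ (fun p : NullChart n =>
        ∑ i ∈ Finset.range N, p.2.1 ^ (-(pw n k + i)) * c i p.1 (dir p.2.2)) p :=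
    fun k c hc p hp hy => ContDiffAt.sum fun i _ =>
      (isCoef_of_isSmoothCoeff (hc i)).contDiffAt_mono _ hp hy
  have h1 : IsOScri (fun p : NullChart n => toNull f p
      - ∑ i ∈ Finset.range N, p.2.1 ^ (-(pw n k + i)) * c i p.1 (dir p.2.2)
      - ∑ i ∈ Finset.range N, p.2.1 ^ (-(pw n k' + i)) * c' i p.1 (dir p.2.2))
      (min (pw n k) (pw n k') + N) := by
    refine isOScri_of_isBigOInfinity (fun a b => ?_) (hO N)
    filter_upwards [hf a b, eventually_scriOn_pos_ne a b] with p h1 h2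
    exact (h1.sub (hsm k c hc p h2.1 h2.2)).sub (hsm k' c' hc' p h2.1 h2.2)
  -- N integer steps amount to 2N half-integer steps, so the given remainder is at least as small as
  -- required.
  have h2 : pw n N ≤ min (pw n k) (pw n k') + N := by
    have e : pw n (2 * N) = pw n 0 + N := by simpa using pw_add_two_mul n 0 N
    have h3 : pw n N ≤ pw n (2 * N) := pw_mono (by omega)
    have h4 : pw n 0 ≤ min (pw n k) (pw n k') := le_min (pw_mono (by omega)) (pw_mono (by omega))
    linarith
  refine (((h1.mono h2).add (isOScri_sum_stepCoef (k := k) hc N)).add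
    (isOScri_sum_stepCoef (k := k') hc' N)).congr (eqScri_of_forall fun p _ _ => ?_)
  have e : ∀ j, mono (pw n j) (fun q => stepCoef k c j q + stepCoef k' c' j q) p
      = mono (pw n j) (stepCoef k c j) p + mono (pw n j) (stepCoef k' c' j) p := fun j => by
    simp only [mono]; ring
  simp only [e, Finset.sum_add_distrib, Pi.add_apply]
  ring

theorem LinGrav.HasExpansion.hasAsymp {f : Spacetime n → ℝ} {k : ℕ} {c : ℕ → ℝ → Space n → ℝ}
    (h : HasExpansion f (pw n k) c)
    (hf : ∀ a b, ∀ᶠ p in scriOn n a b, ContDiffAt ℝ ∞ (toNull f) p) :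
    HasAsymp (toNull f) (stepCoef k c) := by
  have h1 : HasDoubleExpansion f (pw n k) c (pw n k) fun _ _ _ => 0 :=
    ⟨h.1, fun _ => contDiffOn_const, fun N => by simpa using h.2 N⟩
  refine (h1.hasAsymp hf).congr_coef fun j q _ => ?_
  simp [stepCoef]

theorem pw_two : pw n 2 = ((n + 1 : ℕ) : ℝ) / 2 - 1 := by
  simp only [pw]; push_cast; ring

theorem pw_sub_one (hn : 1 ≤ n) : pw n (n - 1) = ((n + 1 : ℕ) : ℝ) - 3 := by
  simp only [pw]; push_cast [Nat.cast_sub hn]; ring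

theorem pw_add_one : pw n (n + 1) = ((n + 1 : ℕ) : ℝ) - 2 := by
  simp only [pw]; push_cast; ring

/-- The metric ansatz as a single series in half-integer steps. -/
def AsympAnsatz (h : TensorField n) : Prop :=
  ∃ H : Fin (n + 1) → Fin (n + 1) → ℕ → ℝ × Space n → ℝ,
    (∀ μ ν, HasAsymp (toNull fun x => h x μ ν) (H μ ν)) ∧
    ∀ μ ν j, ¬ Adm n j → ∀ q, q.2 ≠ 0 → H μ ν j q = 0

theorem LinGrav.MetricAnsatz.asympAnsatz (hn : 3 ≤ n) {h : TensorField n} (hh : MetricAnsatz h)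
    (hf : ∀ μ ν a b, ∀ᶠ p in scriOn n a b, ContDiffAt ℝ ∞ (toNull fun x => h x μ ν) p) :
    AsympAnsatz h := by
  rcases Nat.even_or_odd (n + 1) with he | ho
  · obtain ⟨c, hc⟩ := hh.1 he
    rw [← pw_two] at hc
    refine ⟨_, fun μ ν => (hc μ ν).hasAsymp (hf μ ν), fun μ ν j hj q _ =>
      stepCoef_eq_zero _ (fun i hi => hj (Or.inl ⟨?_, by omega⟩)) q⟩
    rw [hi, ← mul_one_add]; exact even_two_mul _
  · obtain ⟨c, c', hc⟩ := hh.2 ho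
    rw [← pw_two, ← pw_sub_one (by omega)] at hc
    refine ⟨_, fun μ ν => (hc μ ν).hasAsymp (hf μ ν), fun μ ν j hj q _ => ?_⟩
    rw [stepCoef_eq_zero, stepCoef_eq_zero, add_zero]
    · intro i hi
      refine hj (Or.inr ⟨by grind, by grind, by omega⟩)
    · intro i hi
      exact hj (Or.inl ⟨by grind, by omega⟩)

theorem AsympAnsatz.metricAnsatz (hn : 3 ≤ n) {h : TensorField n} (hh : AsympAnsatz h) :
    MetricAnsatz h := by
  obtain ⟨H, hH, hH0⟩ := hh
  have hadm : ∀ j, Even j → 2 ≤ j → ∃ i, 2 + 2 * i = j := fun j h1 h2 => by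
    obtain ⟨m, hm⟩ := h1
    exact ⟨m - 1, by omega⟩
  refine ⟨fun he => ⟨fun j u θ μ ν => H μ ν (2 + 2 * j) (u, θ), fun μ ν => ?_⟩, fun ho =>
    ⟨fun j u θ μ ν => H μ ν (2 + 2 * j) (u, θ), fun j u θ μ ν => H μ ν (n - 1 + 2 * j) (u, θ),
      fun μ ν => ?_⟩⟩
  · rw [← pw_two]
    refine ⟨fun j => ((hH μ ν).coef _).isSmoothCoeff, fun N => ?_⟩
    have h1 := (hH μ ν).rem_finset (K := 2 + 2 * N)
      (s := (Finset.range N).image fun i => 2 + 2 * i) fun i hi his q hq =>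
        hH0 μ ν i (fun ha => by
          rcases ha with ⟨h1, h2⟩ | ⟨h1, -, -⟩
          · obtain ⟨m, rfl⟩ := hadm i h1 h2
            exact his (Finset.mem_image.2 ⟨m, Finset.mem_range.2 (by omega), rfl⟩)
          · grind) q hq
    rw [pw_add_two_mul] at h1
    refine (h1.congr (eqScri_of_forall (G := fun p => toNull (fun x => h x μ ν) p -
      ∑ j ∈ Finset.range N, p.2.1 ^ (-(pw n 2 + j)) * H μ ν (2 + 2 * j) (p.1, dir p.2.2))
        fun p _ hy => ?_)).isBigOInfinity
    rw [Finset.sum_image fun i _ j _ hij => by omega]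
    simp only [mono, pw_add_two_mul, ((hH μ ν).coef _).apply_dir (q := (p.1, p.2.2)) hy]
  · have hne : Even n := by grind
    rw [← pw_two, ← pw_sub_one (by omega)]
    refine ⟨fun j => ((hH μ ν).coef _).isSmoothCoeff, fun j => ((hH μ ν).coef _).isSmoothCoeff,
      fun N => ?_⟩
    have h1 := (hH μ ν).rem_finset (K := 2 + 2 * N)
      (s := ((Finset.range N).image fun i => 2 + 2 * i) ∪
        (Finset.range N).image fun i => n - 1 + 2 * i) fun i hi his q hq =>
        hH0 μ ν i (fun ha => by
          rcases ha with ⟨h1, h2⟩ | ⟨h1, h2, h3⟩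
          · obtain ⟨m, rfl⟩ := hadm i h1 h2
            exact his (Finset.mem_union_left _
              (Finset.mem_image.2 ⟨m, Finset.mem_range.2 (by omega), rfl⟩))
          · obtain ⟨m, rfl⟩ : ∃ m, n - 1 + 2 * m = i := by
              obtain ⟨a, ha⟩ := h1
              obtain ⟨b, hb⟩ := h2
              exact ⟨b + 1 - a, by omega⟩
            exact his (Finset.mem_union_right _
              (Finset.mem_image.2 ⟨m, Finset.mem_range.2 (by omega), rfl⟩))) q hq
    rw [pw_add_two_mul] at h1
    rw [min_eq_left (pw_mono (by omega))]
    refine (h1.congr (eqScri_of_forall (G := fun p => toNull (fun x => h x μ ν) p -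
      ∑ j ∈ Finset.range N, p.2.1 ^ (-(pw n 2 + j)) * H μ ν (2 + 2 * j) (p.1, dir p.2.2) -
      ∑ j ∈ Finset.range N, p.2.1 ^ (-(pw n (n - 1) + j)) *
        H μ ν (n - 1 + 2 * j) (p.1, dir p.2.2)) fun p _ hy => ?_)).isBigOInfinity
    rw [Finset.sum_union, Finset.sum_image fun i _ j _ hij => by omega,
      Finset.sum_image fun i _ j _ hij => by omega, sub_add_eq_sub_sub]
    · simp only [mono, pw_add_two_mul, ((hH μ ν).coef _).apply_dir (q := (p.1, p.2.2)) hy]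
    -- As n is even, the two families of indices have opposite parity.
    · rw [Finset.disjoint_left]
      intro j hj hj'
      obtain ⟨i, -, hi⟩ := Finset.mem_image.1 hj
      obtain ⟨i', -, hi'⟩ := Finset.mem_image.1 hj'
      obtain ⟨a, ha⟩ := hne
      omega

/-- The remainder after the leading term is smaller by half a power. This is how pointwise
conditions such as dominant energy pass to the leading coefficient. -/
theorem HasAsymp.tendsto {F : NullChart n → ℝ} {c : ℕ → ℝ × Space n → ℝ} (h : HasAsymp F c)
    {k : ℕ} (h0 : ∀ j < k, ∀ q, q.2 ≠ 0 → c j q = 0) (u : ℝ) {θ : Space n} (hθ : ‖θ‖ = 1) :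
    Tendsto (fun r : ℝ => r ^ pw n k * F (u, r, θ)) atTop (𝓝 (c k (u, θ))) := by
  have h1 := (h.rem_finset (K := k + 1) (s := {k}) fun i hi his q hq =>
    h0 i (by simp at his; omega) q hq)
  obtain ⟨C, hC⟩ := h1.bound 0 u u
  obtain ⟨R, hR⟩ := eventually_scriOn.1 hC
  rw [tendsto_iff_norm_sub_tendsto_zero]
  have hlim : Tendsto (fun r : ℝ => C * r ^ (-(1/2 : ℝ))) atTop (𝓝 0) := by
    simpa using (tendsto_rpow_neg_atTop (by norm_num : (0:ℝ) < 1 / 2)).const_mul C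
  refine squeeze_zero' (Eventually.of_forall fun _ => norm_nonneg _) ?_ hlim
  filter_upwards [eventually_gt_atTop R, eventually_gt_atTop 0] with r hr hr0
  have h2 := hR r hr u ⟨le_rfl, le_rfl⟩ θ hθ
  simp only [jet, Finset.sum_singleton, mono] at h2
  have e1 : r ^ pw n k * r ^ (-pw n k) = 1 := by rw [← Real.rpow_add hr0]; simp
  have e2 : r ^ pw n k = r ^ pw n (k + 1) * r ^ (-(1/2 : ℝ)) := by
    rw [← Real.rpow_add hr0]; congr 1; simp only [pw]; push_cast; ring
  have hp : 0 < r ^ pw n k := Real.rpow_pos_of_pos hr0 _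
  have hq : 0 < r ^ (-(1/2 : ℝ)) := Real.rpow_pos_of_pos hr0 _
  have e3 : r ^ pw n k * F (u, r, θ) - c k (u, θ)
      = r ^ pw n k * (F (u, r, θ) - r ^ (-pw n k) * c k (u, θ)) := by
    linear_combination c k (u, θ) * e1
  rw [e3, norm_mul, Real.norm_eq_abs, Real.norm_eq_abs, abs_of_pos hp, e2]
  calc _ = |F (u, r, θ) - r ^ (-pw n k) * c k (u, θ)| * r ^ pw n (k + 1) * r ^ (-(1/2 : ℝ)) := by
        ring
    _ ≤ _ := mul_le_mul_of_nonneg_right h2 hq.le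

/-! ### Identities of the linearized Einstein operator -/

def sgn (μ : Fin (n + 1)) : ℝ := if μ = 0 then -1 else 1

theorem sgn_zero : sgn (0 : Fin (n + 1)) = -1 := if_pos rfl
theorem sgn_succ (i : Fin n) : sgn i.succ = 1 := if_neg (Fin.succ_ne_zero i)

theorem sgn_mul_sgn (μ : Fin (n + 1)) : sgn μ * sgn μ = 1 := by
  unfold sgn; split_ifs <;> norm_num

theorem eta_eq (μ ν : Fin (n + 1)) : eta n μ ν = if μ = ν then sgn μ else 0 := by
  simp [eta, Matrix.diagonal_apply, sgn]

theorem eta_comm (μ ν : Fin (n + 1)) : eta n μ ν = eta n ν μ := by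
  rw [eta_eq, eta_eq]
  by_cases h : μ = ν
  · rw [h]
  · rw [if_neg h, if_neg fun h' => h h'.symm]

theorem sum_eta_mul (μ : Fin (n + 1)) (f : Fin (n + 1) → ℝ) :
    ∑ ν, eta n μ ν * f ν = sgn μ * f μ := by
  simp [eta_eq]

theorem sum_sgn (f : Fin (n + 1) → ℝ) : ∑ μ, sgn μ * f μ = -f 0 + ∑ i : Fin n, f i.succ := by
  rw [Fin.sum_univ_succ]
  simp [sgn_zero, sgn_succ]

/-- The space of smooth functions. -/
def SmoothFn (n : ℕ) : Submodule ℝ (Spacetime n → ℝ) where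
  carrier := {f | ContDiff ℝ ∞ f}
  add_mem' {f g} (hf : ContDiff ℝ ∞ f) (hg : ContDiff ℝ ∞ g) := ContDiff.add hf hg
  zero_mem' := (contDiff_const : ContDiff ℝ ∞ fun _ : Spacetime n => (0 : ℝ))
  smul_mem' _ f (hf : ContDiff ℝ ∞ f) := contDiff_const.smul hf

/-- Partial derivatives as linear operators on smooth functions. -/
def smPd (μ : Fin (n + 1)) : SmoothFn n →ₗ[ℝ] SmoothFn n where
  toFun f := ⟨pd μ f, contDiff_iff_contDiffAt.2 fun _ => (ContDiff.contDiffAt (show ContDiff ℝ ∞ f.1 from f.2)).pd μ⟩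
  map_add' f g := Subtype.ext <| funext fun x =>
    (pd_add (ContDiff.contDiffAt (show ContDiff ℝ ∞ f.1 from f.2)) (ContDiff.contDiffAt (show ContDiff ℝ ∞ g.1 from g.2)) μ).self_of_nhds
  map_smul' c f := Subtype.ext <| funext fun x => by
    change fderiv ℝ (c • (f : Spacetime n → ℝ)) x _ = c * _
    rw [fderiv_const_smul_field]
    rfl

theorem smPd_comm (μ ν : Fin (n + 1)) (f : SmoothFn n) : smPd μ (smPd ν f) = smPd ν (smPd μ f) :=
  Subtype.ext <| funext fun _ =>
    (ContDiffAt.fderiv_fderiv_comm (ContDiff.contDiffAt (show ContDiff ℝ ∞ f.1 from f.2)) _ _).self_of_nhds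

def boxS : SmoothFn n →ₗ[ℝ] SmoothFn n where
  toFun f := ∑ μ, sgn μ • smPd μ (smPd μ f)
  map_add' f g := by simp only [map_add, smul_add, Finset.sum_add_distrib]
  map_smul' c f := by simp only [map_smul, Finset.smul_sum, smul_comm c, RingHom.id_apply]

theorem boxS_apply (f : SmoothFn n) : boxS f = ∑ μ, sgn μ • smPd μ (smPd μ f) := rfl

theorem boxS_smPd (μ : Fin (n + 1)) (f : SmoothFn n) : boxS (smPd μ f) = smPd μ (boxS f) := by
  simp only [boxS_apply, map_sum, map_smul]
  exact Finset.sum_congr rfl fun ν _ => by rw [smPd_comm ν μ f, smPd_comm ν μ]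

def divS (w : Fin (n + 1) → SmoothFn n) : SmoothFn n := ∑ μ, sgn μ • smPd μ (w μ)

def traceRevS (h : Fin (n + 1) → Fin (n + 1) → SmoothFn n) (μ ν : Fin (n + 1)) : SmoothFn n :=
  h μ ν - (1 / 2 * eta n μ ν) • ∑ α, sgn α • h α α

def chiS (h : Fin (n + 1) → Fin (n + 1) → SmoothFn n) (μ : Fin (n + 1)) : SmoothFn n :=
  divS (traceRevS h μ)

def linEinsteinS (h : Fin (n + 1) → Fin (n + 1) → SmoothFn n) (μ ν : Fin (n + 1)) : SmoothFn n :=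
  -(1 / 2 : ℝ) • (boxS (traceRevS h μ ν) - (smPd μ (chiS h ν) + smPd ν (chiS h μ))
    + eta n μ ν • divS (chiS h))

theorem divS_sub (w w' : Fin (n + 1) → SmoothFn n) :
    divS (fun μ => w μ - w' μ) = divS w - divS w' := by
  simp only [divS, map_sub, smul_sub, Finset.sum_sub_distrib]

theorem divS_add (w w' : Fin (n + 1) → SmoothFn n) :
    divS (fun μ => w μ + w' μ) = divS w + divS w' := by
  simp only [divS, map_add, smul_add, Finset.sum_add_distrib]

theorem divS_smul (c : ℝ) (w : Fin (n + 1) → SmoothFn n) :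
    divS (fun μ => c • w μ) = c • divS w := by
  simp only [divS, map_smul, Finset.smul_sum, smul_comm c]

theorem divS_smPd (μ : Fin (n + 1)) (w : Fin (n + 1) → SmoothFn n) :
    divS (fun ν => smPd μ (w ν)) = smPd μ (divS w) := by
  simp only [divS, map_sum, map_smul, smPd_comm _ μ]

theorem divS_boxS (w : Fin (n + 1) → SmoothFn n) :
    divS (fun ν => boxS (w ν)) = boxS (divS w) := by
  simp only [divS, map_sum, map_smul, boxS_smPd]

theorem divS_smPd_self (f : SmoothFn n) : divS (fun ν => smPd ν f) = boxS f := by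
  rw [boxS_apply, divS]

theorem divS_eta (μ : Fin (n + 1)) (f : SmoothFn n) :
    divS (fun ν => eta n μ ν • f) = smPd μ f := by
  simp only [divS, map_smul, smul_smul]
  rw [Finset.sum_eq_single μ]
  · rw [eta_eq, if_pos rfl, sgn_mul_sgn, one_smul]
  · intro ν _ h
    rw [eta_eq, if_neg h.symm, mul_zero, zero_smul]
  · exact fun h => absurd (Finset.mem_univ μ) h

/-- The linearized Bianchi identity. -/
theorem divS_linEinsteinS (h : Fin (n + 1) → Fin (n + 1) → SmoothFn n) (μ : Fin (n + 1)) :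
    divS (linEinsteinS h μ) = 0 := by
  have e : linEinsteinS h μ = fun ν => -(1 / 2 : ℝ) • (boxS (traceRevS h μ ν)
    - (smPd μ (chiS h ν) + smPd ν (chiS h μ)) + eta n μ ν • divS (chiS h)) := rfl
  rw [e, divS_smul, divS_add, divS_sub, divS_add, divS_boxS, divS_smPd, divS_smPd_self, divS_eta]
  have : divS (fun ν => traceRevS h μ ν) = chiS h μ := rfl
  rw [this]
  have : divS (fun ν => chiS h ν) = divS (chiS h) := rfl
  rw [this]
  simp

def gaugeS (ξ : Fin (n + 1) → SmoothFn n) (μ ν : Fin (n + 1)) : SmoothFn n :=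
  (1 / 2 : ℝ) • (smPd μ (ξ ν) + smPd ν (ξ μ))

theorem traceRevS_gaugeS (ξ : Fin (n + 1) → SmoothFn n) (μ ν : Fin (n + 1)) :
    traceRevS (gaugeS ξ) μ ν = (1 / 2 : ℝ) • (smPd μ (ξ ν) + smPd ν (ξ μ) - eta n μ ν • divS ξ) := by
  have : ∑ α, sgn α • gaugeS ξ α α = divS ξ := Finset.sum_congr rfl fun α _ => by
    rw [gaugeS, ← two_smul ℝ (smPd α (ξ α)), smul_smul, smul_smul]
    congr 1
    ring
  rw [traceRevS, this, gaugeS, smul_sub, smul_smul]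

/-- In the trace-reversed divergence the two terms containing the divergence of ξ cancel, and only
the wave operator survives. -/
theorem chiS_gaugeS (ξ : Fin (n + 1) → SmoothFn n) (μ : Fin (n + 1)) :
    chiS (gaugeS ξ) μ = (1 / 2 : ℝ) • boxS (ξ μ) := by
  have e : traceRevS (gaugeS ξ) μ = fun ν =>
      (1 / 2 : ℝ) • (smPd μ (ξ ν) + smPd ν (ξ μ) - eta n μ ν • divS ξ) :=
    funext fun ν => traceRevS_gaugeS ξ μ ν
  rw [chiS, e, divS_smul, divS_sub, divS_add, divS_smPd, divS_smPd_self, divS_eta]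
  simp

theorem linEinsteinS_gaugeS (ξ : Fin (n + 1) → SmoothFn n) (μ ν : Fin (n + 1)) :
    linEinsteinS (gaugeS ξ) μ ν = 0 := by
  have e : chiS (gaugeS ξ) = fun μ => (1 / 2 : ℝ) • boxS (ξ μ) :=
    funext fun μ => chiS_gaugeS ξ μ
  rw [linEinsteinS, traceRevS_gaugeS, e, divS_smul, divS_boxS]
  simp only [map_smul, map_add, map_sub, boxS_smPd]
  generalize eta n μ ν = t
  module

theorem traceRevS_sub (h h' : Fin (n + 1) → Fin (n + 1) → SmoothFn n) (μ ν : Fin (n + 1)) :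
    traceRevS (fun μ ν => h μ ν - h' μ ν) μ ν = traceRevS h μ ν - traceRevS h' μ ν := by
  simp only [traceRevS, smul_sub, Finset.sum_sub_distrib]
  abel

theorem chiS_sub (h h' : Fin (n + 1) → Fin (n + 1) → SmoothFn n) (μ : Fin (n + 1)) :
    chiS (fun μ ν => h μ ν - h' μ ν) μ = chiS h μ - chiS h' μ := by
  have e : traceRevS (fun μ ν => h μ ν - h' μ ν) μ
      = fun ν => traceRevS h μ ν - traceRevS h' μ ν := funext fun ν => traceRevS_sub h h' μ ν
  rw [chiS, e, divS_sub]
  rfl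

theorem linEinsteinS_sub (h h' : Fin (n + 1) → Fin (n + 1) → SmoothFn n) (μ ν : Fin (n + 1)) :
    linEinsteinS (fun μ ν => h μ ν - h' μ ν) μ ν = linEinsteinS h μ ν - linEinsteinS h' μ ν := by
  have e : chiS (fun μ ν => h μ ν - h' μ ν) = fun μ => chiS h μ - chiS h' μ :=
    funext fun μ => chiS_sub h h' μ
  simp only [linEinsteinS, traceRevS_sub, e, divS_sub, map_sub, smul_sub, smul_add]
  abel

/-! ### Agreement of the operators on smooth functions with those on fields -/

section Transfer

variable (h : Fin (n + 1) → Fin (n + 1) → SmoothFn n) (w : Fin (n + 1) → SmoothFn n)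

theorem coe_sum_sgn (f : Fin (n + 1) → SmoothFn n) (x : Spacetime n) :
    ((∑ μ, sgn μ • f μ : SmoothFn n) : Spacetime n → ℝ) x
      = ∑ μ, sgn μ * (f μ : Spacetime n → ℝ) x := by
  simp

theorem coe_divS (x : Spacetime n) : (divS w : Spacetime n → ℝ) x
    = div (fun x μ => (w μ : Spacetime n → ℝ) x) x := by
  rw [divS, coe_sum_sgn, div]
  exact Finset.sum_congr rfl fun μ _ => (sum_eta_mul μ fun ν => pd μ (w ν) x).symm

theorem coe_boxS (f : SmoothFn n) (x : Spacetime n) : (boxS f : Spacetime n → ℝ) x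
    = box (f : Spacetime n → ℝ) x := by
  rw [boxS_apply, coe_sum_sgn, box]
  exact Finset.sum_congr rfl fun μ _ => (sum_eta_mul μ fun ν => pd μ (pd ν f) x).symm

theorem coe_traceRevS (μ ν : Fin (n + 1)) (x : Spacetime n) :
    (traceRevS h μ ν : Spacetime n → ℝ) x
      = traceRev (fun x μ ν => (h μ ν : Spacetime n → ℝ) x) x μ ν := by
  have e : ∑ α, ∑ β, eta n α β * (h α β : Spacetime n → ℝ) x
      = ((∑ α, sgn α • h α α : SmoothFn n) : Spacetime n → ℝ) x := by
    rw [coe_sum_sgn]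
    exact Finset.sum_congr rfl fun α _ => sum_eta_mul α fun β => (h α β : Spacetime n → ℝ) x
  rw [traceRev, e]
  change _ - 1 / 2 * eta n μ ν * _ = _
  ring

theorem coe_chiS (μ : Fin (n + 1)) (x : Spacetime n) : (chiS h μ : Spacetime n → ℝ) x
      = chi (fun x μ ν => (h μ ν : Spacetime n → ℝ) x) x μ := by
  rw [chiS, coe_divS, chi]
  simp only [coe_traceRevS]

theorem coe_linEinsteinS (μ ν : Fin (n + 1)) (x : Spacetime n) :
    (linEinsteinS h μ ν : Spacetime n → ℝ) x
      = linEinstein (fun x μ ν => (h μ ν : Spacetime n → ℝ) x) x μ ν := by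
  have e1 : (traceRevS h μ ν : Spacetime n → ℝ)
      = fun y => traceRev (fun x μ ν => (h μ ν : Spacetime n → ℝ) x) y μ ν :=
    funext fun y => coe_traceRevS h μ ν y
  have e2 : ∀ μ, (chiS h μ : Spacetime n → ℝ)
      = fun y => chi (fun x μ ν => (h μ ν : Spacetime n → ℝ) x) y μ :=
    fun μ => funext fun y => coe_chiS h μ y
  have e3 : (divS (chiS h) : Spacetime n → ℝ) x
      = div (chi fun x μ ν => (h μ ν : Spacetime n → ℝ) x) x := by
    rw [coe_divS]; simp only [coe_chiS]
  rw [linEinstein, ← e1, ← e2, ← e2, ← coe_boxS, ← e3]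
  rfl

end Transfer

/-! ### Local versions -/

/-- All operators involved depend on germs only, so identities proved for globally smooth functions
hold on any open set after this extension. -/
theorem exists_contDiff_eventuallyEq {E : Type*} [NormedAddCommGroup E] [NormedSpace ℝ E]
    {U : Set (Spacetime n)} (hU : IsOpen U) {f : Spacetime n → E} (hf : ContDiffOn ℝ ∞ f U)
    {x : Spacetime n} (hx : x ∈ U) : ∃ g : Spacetime n → E, ContDiff ℝ ∞ g ∧ g =ᶠ[𝓝 x] f := by
  obtain ⟨R, hR, hRU⟩ := Metric.nhds_basis_closedBall.mem_iff.1 (hU.mem_nhds hx)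
  let φ : ContDiffBump x := ⟨R / 2, R, by positivity, by linarith⟩
  refine ⟨fun y => φ y • f y, contDiff_iff_contDiffAt.2 fun y => ?_, ?_⟩
  · by_cases hy : y ∈ Metric.closedBall x R
    · exact φ.contDiffAt.smul (hf.contDiffAt (hU.mem_nhds (hRU hy)))
    · refine (contDiffAt_const (c := (0 : E))).congr_of_eventuallyEq ?_
      filter_upwards [Metric.isClosed_closedBall.isOpen_compl.mem_nhds hy] with z hz
      have : φ z = 0 := φ.zero_of_le_dist (not_le.1 fun h => hz (Metric.mem_closedBall.2 h)).le
      rw [this, zero_smul]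
  · filter_upwards [φ.eventuallyEq_one] with y hy
    rw [hy]
    simp

theorem box_congr {f g : Spacetime n → ℝ} {x : Spacetime n} (h : f =ᶠ[𝓝 x] g) :
    box f =ᶠ[𝓝 x] box g := by
  have h1 : ∀ μ ν, pd μ (pd ν f) =ᶠ[𝓝 x] pd μ (pd ν g) := fun μ ν => pd_congr (pd_congr h ν) μ
  filter_upwards [eventually_all.2 fun μ => eventually_all.2 (h1 μ)] with y hy
  simp only [box, fun μ ν => hy μ ν]

theorem div_congr {w w' : CovectorField n} {x : Spacetime n} (h : w =ᶠ[𝓝 x] w') :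
    div w =ᶠ[𝓝 x] div w' := by
  have h1 : ∀ μ ν, pd μ (fun y => w y ν) =ᶠ[𝓝 x] pd μ (fun y => w' y ν) := fun μ ν =>
    pd_congr (h.mono fun y hy => by simp only [hy]) μ
  filter_upwards [eventually_all.2 fun μ => eventually_all.2 (h1 μ)] with y hy
  simp only [div, fun μ ν => hy μ ν]

section Congr

variable {h h' : TensorField n} {x : Spacetime n}

theorem traceRev_congr (hh : h =ᶠ[𝓝 x] h') : traceRev h =ᶠ[𝓝 x] traceRev h' :=
  hh.mono fun y hy => by funext μ ν; simp only [traceRev, hy]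

theorem chi_congr (hh : h =ᶠ[𝓝 x] h') : chi h =ᶠ[𝓝 x] chi h' := by
  have h1 : ∀ μ, (fun y => chi h y μ) =ᶠ[𝓝 x] fun y => chi h' y μ := fun μ =>
    div_congr ((traceRev_congr hh).mono fun y hy => by simp only [hy])
  filter_upwards [eventually_all.2 h1] with y hy
  exact funext hy

theorem linEinstein_congr (hh : h =ᶠ[𝓝 x] h') : linEinstein h =ᶠ[𝓝 x] linEinstein h' := by
  have h1 : ∀ μ ν, box (fun y => traceRev h y μ ν) =ᶠ[𝓝 x] box fun y => traceRev h' y μ ν :=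
    fun μ ν => box_congr ((traceRev_congr hh).mono fun y hy => by simp only [hy])
  have h2 : ∀ μ ν, pd μ (fun y => chi h y ν) =ᶠ[𝓝 x] pd μ fun y => chi h' y ν := fun μ ν =>
    pd_congr ((chi_congr hh).mono fun y hy => by simp only [hy]) μ
  filter_upwards [eventually_all.2 fun μ => eventually_all.2 (h1 μ),
    eventually_all.2 fun μ => eventually_all.2 (h2 μ), div_congr (chi_congr hh)] with y h1 h2 h3
  funext μ ν
  simp only [linEinstein, h1 μ ν, h2 μ ν, h2 ν μ, h3]

theorem gaugeTransform_congr (hh : h =ᶠ[𝓝 x] h') {ξ ξ' : CovectorField n} (hξ : ξ =ᶠ[𝓝 x] ξ') :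
    gaugeTransform h ξ =ᶠ[𝓝 x] gaugeTransform h' ξ' := by
  have h2 : ∀ μ ν, pd μ (fun y => ξ y ν) =ᶠ[𝓝 x] pd μ fun y => ξ' y ν := fun μ ν =>
    pd_congr (hξ.mono fun y hy => by simp only [hy]) μ
  filter_upwards [hh, eventually_all.2 fun μ => eventually_all.2 (h2 μ)] with y h1 h2
  funext μ ν
  simp only [gaugeTransform, h1, h2 μ ν, h2 ν μ]

end Congr

section Local

variable {U : Set (Spacetime n)} {h : TensorField n} {ξ : CovectorField n} {x : Spacetime n}

theorem exists_smoothFn_tensor (hU : IsOpen U) (hh : ContDiffOn ℝ ∞ h U) (hx : x ∈ U) :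
    ∃ H : Fin (n + 1) → Fin (n + 1) → SmoothFn n,
      (fun x μ ν => (H μ ν : Spacetime n → ℝ) x) =ᶠ[𝓝 x] h := by
  obtain ⟨g, hg, hgh⟩ := exists_contDiff_eventuallyEq hU hh hx
  exact ⟨fun μ ν => ⟨fun x => g x μ ν, contDiff_pi.1 (contDiff_pi.1 hg μ) ν⟩, hgh⟩

theorem exists_smoothFn_covector (hU : IsOpen U) (hξ : ContDiffOn ℝ ∞ ξ U) (hx : x ∈ U) :
    ∃ w : Fin (n + 1) → SmoothFn n, (fun x μ => (w μ : Spacetime n → ℝ) x) =ᶠ[𝓝 x] ξ := by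
  obtain ⟨g, hg, hgh⟩ := exists_contDiff_eventuallyEq hU hξ hx
  exact ⟨fun μ => ⟨fun x => g x μ, contDiff_pi.1 hg μ⟩, hgh⟩

theorem div_linEinstein (hU : IsOpen U) (hh : ContDiffOn ℝ ∞ h U) (hx : x ∈ U)
    (μ : Fin (n + 1)) : div (fun y ν => linEinstein h y μ ν) x = 0 := by
  obtain ⟨H, hH⟩ := exists_smoothFn_tensor hU hh hx
  have h1 : (fun y ν => linEinstein h y μ ν) =ᶠ[𝓝 x] fun y ν =>
      (linEinsteinS H μ ν : Spacetime n → ℝ) y := by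
    filter_upwards [linEinstein_congr hH] with y hy
    funext ν
    rw [coe_linEinsteinS, hy]
  rw [(div_congr h1).self_of_nhds, ← coe_divS]
  rw [divS_linEinsteinS]
  rfl

theorem chi_gaugeTransform (hU : IsOpen U) (hh : ContDiffOn ℝ ∞ h U) (hξ : ContDiffOn ℝ ∞ ξ U)
    (hx : x ∈ U) (μ : Fin (n + 1)) : chi (gaugeTransform h ξ) x μ
      = chi h x μ - 1 / 2 * box (fun y => ξ y μ) x := by
  obtain ⟨H, hH⟩ := exists_smoothFn_tensor hU hh hx
  obtain ⟨w, hw⟩ := exists_smoothFn_covector hU hξ hx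
  have hb : box (w μ : Spacetime n → ℝ) x = box (fun y => ξ y μ) x :=
    (box_congr (hw.mono fun y hy => congrFun hy μ)).self_of_nhds
  rw [← (chi_congr (gaugeTransform_congr hH hw)).self_of_nhds, ← (chi_congr hH).self_of_nhds,
    ← hb, ← coe_boxS, ← coe_chiS]
  have := coe_chiS (fun μ ν => H μ ν - gaugeS w μ ν) μ x
  rw [chiS_sub, chiS_gaugeS] at this
  exact this.symm

theorem linEinstein_gaugeTransform (hU : IsOpen U) (hh : ContDiffOn ℝ ∞ h U)
    (hξ : ContDiffOn ℝ ∞ ξ U) (hx : x ∈ U) (μ ν : Fin (n + 1)) :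
    linEinstein (gaugeTransform h ξ) x μ ν = linEinstein h x μ ν := by
  obtain ⟨H, hH⟩ := exists_smoothFn_tensor hU hh hx
  obtain ⟨w, hw⟩ := exists_smoothFn_covector hU hξ hx
  rw [← (linEinstein_congr (gaugeTransform_congr hH hw)).self_of_nhds,
    ← (linEinstein_congr hH).self_of_nhds, ← coe_linEinsteinS]
  have := coe_linEinsteinS (fun μ ν => H μ ν - gaugeS w μ ν) μ ν x
  rw [linEinsteinS_sub, linEinsteinS_gaugeS, sub_zero] at this
  exact this.symm

theorem linEinstein_symm (hU : IsOpen U) (hh : ∀ x ∈ U, ∀ μ ν, h x μ ν = h x ν μ) (hx : x ∈ U)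
    (μ ν : Fin (n + 1)) : linEinstein h x μ ν = linEinstein h x ν μ := by
  have h1 : (fun y => traceRev h y μ ν) =ᶠ[𝓝 x] fun y => traceRev h y ν μ := by
    filter_upwards [hU.mem_nhds hx] with y hy
    simp only [traceRev, hh y hy μ ν, eta_comm μ ν]
  rw [linEinstein, linEinstein, (box_congr h1).self_of_nhds, eta_comm μ ν,
    add_comm (pd μ (fun y => chi h y ν) x)]

theorem linEinstein_of_chi_eq_zero (hU : IsOpen U) (hχ : ∀ x ∈ U, ∀ μ, chi h x μ = 0) (hx : x ∈ U)
    (μ ν : Fin (n + 1)) :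
    linEinstein h x μ ν = -(1 / 2) * box (fun y => traceRev h y μ ν) x := by
  have h0 : chi h =ᶠ[𝓝 x] fun _ _ => 0 := by
    filter_upwards [hU.mem_nhds hx] with y hy
    exact funext (hχ y hy)
  have h1 : ∀ μ (c : ℝ), pd μ (fun _ : Spacetime n => c) x = 0 := fun μ c => by simp [pd]
  have h2 : ∀ μ ν, pd μ (fun y => chi h y ν) x = 0 := fun μ ν => by
    rw [(pd_congr (h0.mono fun y hy => congrFun hy ν) μ).self_of_nhds, h1]
  rw [linEinstein, h2, h2, (div_congr h0).self_of_nhds]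
  simp [div, h1]

end Local

/-! ### Coefficients of the linearized Einstein equation -/

def divCoef (W : Fin (n + 1) → ℕ → ℝ × Space n → ℝ) (j : ℕ) (q : ℝ × Space n) : ℝ :=
  ∑ μ, sgn μ * pdCoef μ (W μ) j q

theorem isCoef_divCoef {W : Fin (n + 1) → ℕ → ℝ × Space n → ℝ} (hW : ∀ μ j, IsCoef (W μ j))
    (j : ℕ) : IsCoef (divCoef W j) :=
  IsCoef.sum _ fun μ _ => (isCoef_pdCoef (hW μ) μ j).const_mul (sgn μ)

theorem HasAsymp.toNull_div {w : CovectorField n} {W : Fin (n + 1) → ℕ → ℝ × Space n → ℝ}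
    (h : ∀ μ, HasAsymp (toNull fun x => w x μ) (W μ)) : HasAsymp (toNull (div w)) (divCoef W) := by
  refine (HasAsymp.sum Finset.univ fun μ _ => ((h μ).toNull_pd μ).const_mul (sgn μ)).congr
    (eqScri_of_forall fun p _ _ => ?_)
  simp only [toNull, div]
  exact Finset.sum_congr rfl fun μ _ =>
    (sum_eta_mul μ fun ν => pd μ (fun x => w x ν) (chartPoint p)).symm

def traceRevCoef (H : Fin (n + 1) → Fin (n + 1) → ℕ → ℝ × Space n → ℝ) (μ ν : Fin (n + 1)) (j : ℕ)
    (q : ℝ × Space n) : ℝ :=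
  H μ ν j q - 1 / 2 * eta n μ ν * ∑ α, sgn α * H α α j q

section Tensor

variable {h : TensorField n} {H : Fin (n + 1) → Fin (n + 1) → ℕ → ℝ × Space n → ℝ}

theorem HasAsymp.toNull_traceRev (hH : ∀ μ ν, HasAsymp (toNull fun x => h x μ ν) (H μ ν))
    (μ ν : Fin (n + 1)) :
    HasAsymp (toNull fun x => traceRev h x μ ν) (traceRevCoef H μ ν) := by
  refine ((hH μ ν).sub ((HasAsymp.sum Finset.univ fun α _ => (hH α α).const_mul (sgn α)).const_mul
    (1 / 2 * eta n μ ν))).congr (eqScri_of_forall fun p _ _ => ?_)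
  have e : ∀ x, ∑ α, ∑ β, eta n α β * h x α β = ∑ α, sgn α * h x α α := fun x =>
    Finset.sum_congr rfl fun α _ => sum_eta_mul α fun β => h x α β
  simp only [toNull, traceRev, e]
  ring

theorem HasAsymp.toNull_chi (hH : ∀ μ ν, HasAsymp (toNull fun x => h x μ ν) (H μ ν))
    (μ : Fin (n + 1)) :
    HasAsymp (toNull fun x => chi h x μ) (divCoef (traceRevCoef H μ)) :=
  HasAsymp.toNull_div (w := fun y ν => traceRev h y μ ν) (HasAsymp.toNull_traceRev hH μ)

/-- The coefficients of `-2 δG` in terms of those of the trace reversed perturbation. -/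
def einsteinCoef (K : Fin (n + 1) → Fin (n + 1) → ℕ → ℝ × Space n → ℝ) (μ ν : Fin (n + 1)) (j : ℕ)
    (q : ℝ × Space n) : ℝ :=
  boxCoef (K μ ν) j q - (pdCoef μ (divCoef (K ν)) j q + pdCoef ν (divCoef (K μ)) j q)
    + eta n μ ν * divCoef (fun α => divCoef (K α)) j q

theorem HasAsymp.toNull_linEinstein (hH : ∀ μ ν, HasAsymp (toNull fun x => h x μ ν) (H μ ν))
    (μ ν : Fin (n + 1)) : HasAsymp (toNull fun x => linEinstein h x μ ν)
      fun j q => -(1 / 2) * einsteinCoef (traceRevCoef H) μ ν j q := by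
  have h1 := (HasAsymp.toNull_traceRev hH μ ν).toNull_box
  have h2 := (HasAsymp.toNull_chi hH ν).toNull_pd μ
  have h3 := (HasAsymp.toNull_chi hH μ).toNull_pd ν
  have h4 := HasAsymp.toNull_div (HasAsymp.toNull_chi hH)
  exact (((h1.sub (h2.add h3)).add (h4.const_mul (eta n μ ν))).const_mul (-(1 / 2))).congr
    (eqScri_of_forall fun p _ _ => rfl)

end Tensor

/-- Contraction with the null covector `∂u`. -/
def lc (q : ℝ × Space n) (f : Fin (n + 1) → ℝ) : ℝ := ∑ μ, sgn μ * ell μ q * f μ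

section Contraction

variable {q : ℝ × Space n}

theorem lc_eq (f : Fin (n + 1) → ℝ) : lc q f = -f 0 - ∑ i : Fin n, hatY i q * f i.succ := by
  rw [lc, Fin.sum_univ_succ]
  simp [sgn_zero, sgn_succ, Finset.sum_neg_distrib, sub_eq_add_neg]

theorem lc_add (f g : Fin (n + 1) → ℝ) : lc q (fun μ => f μ + g μ) = lc q f + lc q g := by
  simp only [lc, mul_add, Finset.sum_add_distrib]

theorem lc_sub (f g : Fin (n + 1) → ℝ) : lc q (fun μ => f μ - g μ) = lc q f - lc q g := by
  simp only [lc, mul_sub, Finset.sum_sub_distrib]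

theorem lc_mul_left (a : ℝ) (f : Fin (n + 1) → ℝ) : lc q (fun μ => a * f μ) = a * lc q f := by
  simp only [lc, Finset.mul_sum]
  exact Finset.sum_congr rfl fun μ _ => by ring

theorem lc_mul_right (a : ℝ) (f : Fin (n + 1) → ℝ) : lc q (fun μ => f μ * a) = lc q f * a := by
  simp only [lc, Finset.sum_mul]
  exact Finset.sum_congr rfl fun μ _ => by ring

theorem lc_comm (f : Fin (n + 1) → Fin (n + 1) → ℝ) :
    lc q (fun μ => lc q fun ν => f μ ν) = lc q fun ν => lc q fun μ => f μ ν := by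
  simp only [lc, Finset.mul_sum]
  rw [Finset.sum_comm]
  exact Finset.sum_congr rfl fun μ _ => Finset.sum_congr rfl fun ν _ => by ring

theorem lc_zero : lc q (fun _ => 0) = 0 := by simp [lc]

theorem lc_ell (hq : q.2 ≠ 0) : lc q (fun μ => ell μ q) = 0 := by
  have h := sum_hatY_mul_hatY hq
  rw [lc_eq]
  simp [h]

theorem lc_eta (μ : Fin (n + 1)) : lc q (fun ν => eta n μ ν) = ell μ q := by
  rw [lc, Finset.sum_eq_single μ]
  · rw [eta_eq, if_pos rfl, mul_right_comm, sgn_mul_sgn, one_mul]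
  · intro ν _ h
    rw [eta_eq, if_neg h.symm, mul_zero]
  · exact fun h => absurd (Finset.mem_univ μ) h

theorem lc_dC {c : ℝ × Space n → ℝ} (hc : IsCoef c) (p : ℝ) (hq : q.2 ≠ 0) :
    lc q (fun μ => dC p μ c q) = p * c q := by
  rw [lc_eq, sum_hatY_mul_dC hc p hq]
  simp

theorem divCoef_add_two (W : Fin (n + 1) → ℕ → ℝ × Space n → ℝ) (j : ℕ) :
    divCoef W (j + 2) q = lc q (fun μ => dU (W μ (j + 2)) q)
      + ∑ i : Fin n, dC (pw n j) i.succ (W i.succ j) q := by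
  simp only [divCoef, pdCoef, mul_add, Finset.sum_add_distrib]
  congr 1
  · simp only [lc, mul_assoc]
  · rw [Fin.sum_univ_succ]
    simp [sgn_succ]

end Contraction

/-! ### The first coefficients of the divergence -/

section Leading

variable {K : Fin (n + 1) → Fin (n + 1) → ℕ → ℝ × Space n → ℝ}

/-- The leading coefficient of the divergence of the trace reversed perturbation vanishes if the
null contraction of the source vanishes at the order at which it first enters. -/
theorem divCoef_eq_zero_of_leading (hK : ∀ μ ν j, IsCoef (K μ ν j)) {m : ℕ} (hm : m + 3 ≤ n)
    (hKm : ∀ μ ν q, q.2 ≠ 0 → K μ ν m q = 0)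
    (hE : ∀ μ q, q.2 ≠ 0 → lc q (fun ν => einsteinCoef K μ ν (m + 4) q) = 0)
    (μ : Fin (n + 1)) {q : ℝ × Space n} (hq : q.2 ≠ 0) : divCoef (K μ) (m + 2) q = 0 := by
  have hm' : (m : ℝ) + 3 ≤ n := by exact_mod_cast hm
  set c : Fin (n + 1) → ℝ × Space n → ℝ := fun μ => divCoef (K μ) (m + 2) with hcdef
  have hc : ∀ μ, IsCoef (c μ) := fun μ => isCoef_divCoef (hK μ) _
  obtain ⟨p, hp⟩ : ∃ p, pw n (m + 2) = p := ⟨_, rfl⟩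
  -- Of the exponent only this relation is used; it turns the factors below into 1 − n, m − 1 − n
  -- and m + 1 − n, none of which vanishes.
  have hp2 : 2 * p = n + m - 1 := by rw [← hp, pw]; push_cast; ring
  obtain ⟨D, hD⟩ : ∃ D : ℝ × Space n → ℝ, ∀ q, ∑ i : Fin n, dC p i.succ (c i.succ) q = D q :=
    ⟨_, fun _ => rfl⟩
  have hlead : ∀ μ q, q.2 ≠ 0 → lc q (fun ν => dU (K μ ν (m + 2)) q) = c μ q := fun μ q hq => by
    rw [hcdef]
    simp only [divCoef_add_two]
    rw [Finset.sum_eq_zero fun i _ => dC_of_vanish (hKm μ i.succ) _ _ hq, add_zero]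
  -- The Einstein equation contracted with ∂u in one index. The next, unknown coefficient of the
  -- divergence drops out because ∂u is null and the trace term cancels the remaining contribution.
  have hA : ∀ μ q, q.2 ≠ 0 →
      m * c μ q - lc q (fun ν => dC p μ (c ν) q) - p * c μ q + ell μ q * D q = 0 :=
    fun μ q hq => by
    have h1 := hE μ q hq
    have h2 : ∀ ν, einsteinCoef K μ ν (m + 4) q = m * dU (K μ ν (m + 2)) q
        - ((ell μ q * dU (divCoef (K ν) (m + 4)) q + dC p μ (c ν) q)
          + (ell ν q * dU (divCoef (K μ) (m + 4)) q + dC p ν (c μ) q))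
        + eta n μ ν * (lc q (fun α => dU (divCoef (K α) (m + 4)) q) + D q) := fun ν => by
      have e := lapC_of_vanish (hKm μ ν) (pw n m) hq
      rw [einsteinCoef, divCoef_add_two _ (m + 2), ← hD q]
      simp only [boxCoef, pdCoef, e, hp, hcdef, add_zero]
    simp only [h2, lc_add, lc_sub, lc_mul_left, lc_mul_right, hlead μ q hq, lc_ell hq, lc_eta,
      lc_dC (hc μ) p hq] at h1
    linear_combination h1
  have hcl : ∀ q, q.2 ≠ 0 → lc q (fun μ => c μ q) = 0 := fun q hq => by
    have h1 : lc q (fun μ => m * c μ q - lc q (fun ν => dC p μ (c ν) q) - p * c μ q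
        + ell μ q * D q) = 0 := by simp only [hA _ q hq, lc_zero]
    simp only [lc_add, lc_sub, lc_mul_left, lc_mul_right, lc_ell hq] at h1
    rw [lc_comm] at h1
    simp only [lc_dC (hc _) p hq, lc_mul_left] at h1
    have h2 : (1 - (n : ℝ)) * lc q (fun μ => c μ q) = 0 := by
      linear_combination h1 + lc q (fun μ => c μ q) * hp2
    exact (mul_eq_zero.1 h2).resolve_left (by linarith [(Nat.cast_nonneg m : (0:ℝ) ≤ m)])
  have hy : ∀ q, q.2 ≠ 0 → ∑ i : Fin n, hatY i q * c i.succ q = -c 0 q := fun q hq => by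
    have := hcl q hq
    rw [lc_eq] at this
    linarith
  have h0 : ∀ q, q.2 ≠ 0 → (m - p) * c 0 q + D q = 0 := fun q hq => by
    have := hA 0 q hq
    simp only [dC_zero, lc_zero, ell_zero] at this
    linarith
  -- Contraction and angular derivative do not commute. Differentiating the identity just obtained
  -- leaves the derivative of the null covector, which is the tangential part of c.
  have hdc : ∀ (i : Fin n) q, q.2 ≠ 0 →
      lc q (fun ν => dC p i.succ (c ν) q) = c i.succ q + hatY i q * c 0 q := fun i q hq => by
    have hs : IsCoef fun q => ∑ j : Fin n, hatY j q * c j.succ q :=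
      IsCoef.sum _ fun j _ => (IsCoef.hatY j).mul (hc j.succ)
    have h1 : dY i (fun q => c 0 q + ∑ j : Fin n, hatY j q * c j.succ q) q = 0 := by
      rw [dY_congr (c' := fun _ => 0) (fun q hq => by rw [hy q hq]; ring) i hq, dY_const]
    rw [dY_add i (hc 0) hs hq, dY_sum i _ (fun j _ => (IsCoef.hatY j).mul (hc j.succ)) hq] at h1
    have h2 : ∀ j : Fin n, dY i (fun q => hatY j q * c j.succ q) q
        = hatY j q * dY i (c j.succ) q + ((if i = j then c j.succ q else 0)
          - hatY i q * (hatY j q * c j.succ q)) := fun j => by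
      rw [dY_mul i (IsCoef.hatY j) (hc j.succ) hq, dY_hatY i j hq]
      split_ifs <;> ring
    simp only [h2, Finset.sum_add_distrib, Finset.sum_sub_distrib, Finset.sum_ite_eq,
      Finset.mem_univ, if_true, ← Finset.mul_sum, hy q hq] at h1
    have h3 : ∑ j : Fin n, hatY j q * (-p * (hatY i q * c j.succ q) + dY i (c j.succ) q)
        = -p * hatY i q * ∑ j : Fin n, hatY j q * c j.succ q
          + ∑ j : Fin n, hatY j q * dY i (c j.succ) q := by
      rw [Finset.mul_sum, ← Finset.sum_add_distrib]
      exact Finset.sum_congr rfl fun j _ => by ring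
    rw [lc_eq]
    simp only [dC_succ]
    rw [h3, hy q hq]
    linear_combination -h1
  -- The spatial components, combined with the time component, annihilate the tangential part: c is
  -- proportional to ∂u.
  have hci : ∀ (i : Fin n) q, q.2 ≠ 0 → c i.succ q = hatY i q * -c 0 q := fun i q hq => by
    have h1 := hA i.succ q hq
    rw [hdc i q hq, ell_succ] at h1
    have h2 : ((m : ℝ) - 1 - n) * (c i.succ q + hatY i q * c 0 q) = 0 := by
      linear_combination 2 * h1 + 2 * hatY i q * h0 q hq
        + (c i.succ q + hatY i q * c 0 q) * hp2
    have := (mul_eq_zero.1 h2).resolve_left (by linarith)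
    linarith
  -- With c proportional to ∂u its angular divergence D is explicit, and the time component leaves a
  -- nonzero multiple of c₀.
  have hc0 : ∀ q, q.2 ≠ 0 → c 0 q = 0 := fun q hq => by
    have h1 : D q = ((n : ℝ) - 1 - p) * -c 0 q := by
      rw [← hD q, ← sum_dC_hatY_mul (hc 0).neg p hq]
      exact Finset.sum_congr rfl fun i _ => dC_congr (hci i) p _ hq
    have h2 : ((m : ℝ) - n + 1) * c 0 q = 0 := by
      linear_combination h0 q hq - h1
    exact (mul_eq_zero.1 h2).resolve_left (by linarith)
  change c μ q = 0
  refine Fin.cases (hc0 q hq) (fun i => ?_) μ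
  rw [hci i q hq, hc0 q hq]
  ring

/-- At the order r^(-d/2) the wave operator contributes nothing to the Einstein equation. What
remains is purely algebraic in X = ∂_u of the divergence coefficient: a symmetric product of X with
∂u plus a trace term. -/
theorem dU_divCoef_four_eq_zero (hn : 3 ≤ n) (hK0 : ∀ μ ν q, q.2 ≠ 0 → K μ ν 0 q = 0)
    (hC : ∀ μ q, q.2 ≠ 0 → divCoef (K μ) 2 q = 0) {q : ℝ × Space n} (hq : q.2 ≠ 0)
    (hE : ∀ μ ν, einsteinCoef K μ ν 4 q = 0) (μ : Fin (n + 1)) :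
    dU (divCoef (K μ) 4) q = 0 := by
  have hn' : (3:ℝ) ≤ n := by exact_mod_cast hn
  set X : Fin (n + 1) → ℝ := fun μ => dU (divCoef (K μ) 4) q with hX
  have h1 : ∀ μ ν, -(ell μ q * X ν + ell ν q * X μ) + eta n μ ν * lc q X = 0 := fun μ ν => by
    rw [← hE μ ν, einsteinCoef, divCoef_add_two _ 2,
      Finset.sum_eq_zero fun i _ => dC_of_vanish (hC i.succ) _ _ hq]
    have e := lapC_of_vanish (hK0 μ ν) (pw n 0) hq
    simp only [boxCoef, pdCoef, e, dC_of_vanish (hC _) _ _ hq, hX]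
    push_cast
    ring
  -- The trace of the equation gives n − 1 times the contraction of X with ∂u.
  have h2 : lc q X = 0 := by
    have h3 : ∑ μ, sgn μ * (-(ell μ q * X μ + ell μ q * X μ) + eta n μ μ * lc q X) = 0 :=
      Finset.sum_eq_zero fun μ _ => by rw [h1, mul_zero]
    have h4 : ∀ μ, sgn μ * (-(ell μ q * X μ + ell μ q * X μ) + eta n μ μ * lc q X)
        = -2 * (sgn μ * ell μ q * X μ) + lc q X := fun μ => by
      rw [eta_eq, if_pos rfl]
      linear_combination (lc q X) * sgn_mul_sgn μ
    simp only [h4, Finset.sum_add_distrib, ← Finset.mul_sum] at h3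
    have h5 : ∑ μ, sgn μ * ell μ q * X μ = lc q X := rfl
    rw [h5] at h3
    simp at h3
    have h6 : ((n : ℝ) - 1) * lc q X = 0 := by linear_combination h3
    exact (mul_eq_zero.1 h6).resolve_left (by linarith)
  have h3 : X 0 = 0 := by
    have := h1 0 0
    rw [h2, ell_zero] at this
    linarith
  have := h1 0 μ
  rw [h2, h3, ell_zero] at this
  linarith

end Leading

/-! ### The dominant energy condition at null infinity -/

/-- The energy current `-t^μ_ν v^ν`. -/
def energyCurrent (t : Fin (n + 1) → Fin (n + 1) → ℝ) (v : Fin (n + 1) → ℝ) :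
    Fin (n + 1) → ℝ := fun μ => -∑ ρ, ∑ ν, eta n μ ρ * t ρ ν * v ν

theorem energyCurrent_apply (t : Fin (n + 1) → Fin (n + 1) → ℝ) (v : Fin (n + 1) → ℝ)
    (μ : Fin (n + 1)) : energyCurrent t v μ = -(sgn μ * ∑ ν, t μ ν * v ν) := by
  rw [energyCurrent, ← sum_eta_mul μ fun ρ => ∑ ν, t ρ ν * v ν]
  simp only [Finset.mul_sum, mul_assoc]

theorem sum_eta_mul_mul (v : Fin (n + 1) → ℝ) :
    ∑ μ, ∑ ν, eta n μ ν * v μ * v ν = -(v 0 * v 0) + ∑ i : Fin n, v i.succ * v i.succ := by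
  have h : ∀ μ, ∑ ν, eta n μ ν * v μ * v ν = sgn μ * (v μ * v μ) := fun μ => by
    rw [← sum_eta_mul μ fun ν => v μ * v ν]
    exact Finset.sum_congr rfl fun ν _ => by ring
  simp only [h]
  exact sum_sgn fun μ => v μ * v μ

theorem LinGrav.IsFutureCausal.mul_pos {w : Fin (n + 1) → ℝ} (hw : IsFutureCausal w) {a : ℝ}
    (ha : 0 < a) : IsFutureCausal fun μ => a * w μ := by
  refine ⟨mul_nonneg ha.le hw.1, ?_⟩
  have h : ∑ μ, ∑ ν, eta n μ ν * (a * w μ) * (a * w ν)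
      = a * a * ∑ μ, ∑ ν, eta n μ ν * w μ * w ν := by
    simp only [Finset.mul_sum]
    exact Finset.sum_congr rfl fun μ _ => Finset.sum_congr rfl fun ν _ => by ring
  rw [h]
  exact mul_nonpos_of_nonneg_of_nonpos (by positivity) hw.2

theorem isClosed_isFutureCausal_energyCurrent (v : Fin (n + 1) → ℝ) :
    IsClosed {t : Fin (n + 1) → Fin (n + 1) → ℝ | IsFutureCausal (energyCurrent t v)} := by
  have hc : ∀ μ, Continuous fun t : Fin (n + 1) → Fin (n + 1) → ℝ => energyCurrent t v μ :=
    fun μ => by unfold energyCurrent; fun_prop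
  have hc2 : Continuous fun t : Fin (n + 1) → Fin (n + 1) → ℝ =>
      ∑ μ, ∑ ν, eta n μ ν * energyCurrent t v μ * energyCurrent t v ν :=
    continuous_finsetSum _ fun μ _ => continuous_finsetSum _ fun ν _ =>
      (continuous_const.mul (hc μ)).mul (hc ν)
  exact (isClosed_le continuous_const (hc 0)).inter (isClosed_le hc2 continuous_const)

theorem eq_zero_of_isFutureCausal {w : Fin (n + 1) → ℝ} (hw : IsFutureCausal w) (h0 : w 0 = 0)
    (μ : Fin (n + 1)) : w μ = 0 := by
  have h := hw.2
  rw [sum_eta_mul_mul, h0] at h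
  refine Fin.cases h0 (fun i => ?_) μ
  have h1 : w i.succ * w i.succ ≤ ∑ i : Fin n, w i.succ * w i.succ :=
    Finset.single_le_sum (f := fun i : Fin n => w i.succ * w i.succ)
      (fun i _ => mul_self_nonneg _) (Finset.mem_univ i)
  exact mul_self_eq_zero.1 (le_antisymm (by linarith) (mul_self_nonneg _))

/-- A symmetric tensor that satisfies the dominant energy condition and has no energy density
vanishes. -/
theorem eq_zero_of_dominantEnergy {t : Fin (n + 1) → Fin (n + 1) → ℝ}
    (hs : ∀ μ ν, t μ ν = t ν μ) (h00 : t 0 0 = 0)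
    (hd : ∀ v, IsFutureTimelike v → IsFutureCausal (energyCurrent t v)) (μ ν : Fin (n + 1)) :
    t μ ν = 0 := by
  have key : ∀ v, IsFutureTimelike v → ∑ ν, t 0 ν * v ν = 0 → ∀ μ, ∑ ν, t μ ν * v ν = 0 :=
    fun v hv h0 μ => by
    have h1 := eq_zero_of_isFutureCausal (hd v hv) (by rw [energyCurrent_apply, h0]; simp) μ
    rw [energyCurrent_apply, neg_eq_zero] at h1
    refine (mul_eq_zero.1 h1).resolve_left fun h => ?_
    have := sgn_mul_sgn μ
    rw [h] at this
    simp at this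
  -- The observer at rest sees no energy density, hence no energy current at all, because a causal
  -- vector without time component is zero.
  have ht0 : ∀ μ, t μ 0 = 0 := fun μ => by
    have h1 : IsFutureTimelike (Pi.single 0 1 : Fin (n + 1) → ℝ) := by
      refine ⟨by simp, ?_⟩
      rw [sum_eta_mul_mul]
      simp
    simpa [Pi.single_apply] using key _ h1 (by simpa [Pi.single_apply] using h00) μ
  refine Fin.cases (ht0 μ) (fun i => ?_) ν
  -- An observer moving at speed 1/2 in direction i sees a current without time component, since the
  -- mixed components are already zero; its current is half the i-th column.
  have h1 : IsFutureTimelike (Pi.single 0 1 + Pi.single i.succ (1 / 2) : Fin (n + 1) → ℝ) := by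
    refine ⟨by simp [(Fin.succ_ne_zero i).symm], ?_⟩
    rw [sum_eta_mul_mul]
    simp [Pi.single_apply, (Fin.succ_ne_zero i).symm]
    norm_num
  have h2 : ∀ μ, ∑ ν, t μ ν * (Pi.single 0 1 + Pi.single i.succ (1 / 2) : Fin (n + 1) → ℝ) ν
      = t μ 0 + t μ i.succ * (1 / 2) := fun μ => by
    simp [Pi.single_apply, mul_add, Finset.sum_add_distrib]
  have h3 := key _ h1 (by rw [h2, ht0, hs 0, ht0]; ring) μ
  rw [h2, ht0] at h3
  linarith

/-- For a fixed observer the condition is closed in T and invariant under positive scaling, so it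
passes to the limit of r^p T. -/
theorem isFutureCausal_energyCurrent_limit {U : Set (Spacetime n)} (hU : IsNhdNullInfinity U)
    {T : TensorField n} (hT : DominantEnergy U T)
    {S : Fin (n + 1) → Fin (n + 1) → ℕ → ℝ × Space n → ℝ}
    (hS : ∀ μ ν, HasAsymp (toNull fun x => T x μ ν) (S μ ν)) {k : ℕ}
    (h0 : ∀ μ ν, ∀ j < k, ∀ q, q.2 ≠ 0 → S μ ν j q = 0) (u : ℝ) {θ : Space n} (hθ : ‖θ‖ = 1)
    {v : Fin (n + 1) → ℝ} (hv : IsFutureTimelike v) :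
    IsFutureCausal (energyCurrent (fun μ ν => S μ ν k (u, θ)) v) := by
  have h1 : Tendsto (fun (r : ℝ) μ ν => r ^ pw n k * T (nullPoint u r θ) μ ν) atTop
      (𝓝 fun μ ν => S μ ν k (u, θ)) := by
    refine tendsto_pi_nhds.2 fun μ => tendsto_pi_nhds.2 fun ν => ?_
    have := (hS μ ν).tendsto (h0 μ ν) u hθ
    simpa only [toNull, chartPoint, dir_of_norm_eq_one hθ] using this
  refine (isClosed_isFutureCausal_energyCurrent v).mem_of_tendsto h1 ?_
  obtain ⟨R, hR⟩ := hU.2 u u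
  filter_upwards [eventually_gt_atTop R, eventually_gt_atTop 0] with r hr hr0
  have h2 := (hT _ (hR u ⟨le_rfl, le_rfl⟩ r hr θ hθ) v hv).mul_pos (Real.rpow_pos_of_pos hr0 (pw n k))
  have e : (fun μ => r ^ pw n k * -∑ ρ, ∑ ν, eta n μ ρ * T (nullPoint u r θ) ρ ν * v ν)
      = energyCurrent (fun μ ν => r ^ pw n k * T (nullPoint u r θ) μ ν) v := by
    funext μ
    simp only [energyCurrent, mul_neg, Finset.mul_sum]
    congr 1
    exact Finset.sum_congr rfl fun ρ _ => Finset.sum_congr rfl fun ν _ => by ring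
  rw [e] at h2
  exact h2

/-! ### Neighborhoods of null infinity -/

/-- A neighborhood of a point changes u slightly; the property is therefore taken on the larger
interval [a − 1, b + 1]. -/
theorem eventually_nhds_chartPoint {P : Spacetime n → Prop}
    (h : ∀ a b, ∀ᶠ p in scriOn n a b, P (chartPoint p)) (a b : ℝ) :
    ∀ᶠ p in scriOn n a b, ∀ᶠ x in 𝓝 (chartPoint p), P x := by
  obtain ⟨R, hR⟩ := eventually_scriOn.1 (h (a - 1) (b + 1))
  filter_upwards [eventually_scriOn_gt a b (max R 0), eventually_scriOn_mem a b] with p hp hp'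
  have hr : 0 < p.2.1 := (le_max_right _ _).trans_lt hp
  have hs : spatial (chartPoint p) = p.2.1 • p.2.2 := by
    rw [chartPoint, spatial_nullPoint, dir_of_norm_eq_one hp'.2]
  have hn : ‖spatial (chartPoint p)‖ = p.2.1 := by
    rw [hs, norm_smul, hp'.2, Real.norm_eq_abs, abs_of_pos hr, mul_one]
  have hc : Continuous fun x : Spacetime n => ‖spatial x‖ :=
    (contDiff_spatial (m := ∞)).continuous.norm
  have hc0 : Continuous fun x : Spacetime n => x 0 - ‖spatial x‖ := (continuous_apply 0).sub hc
  have hu : chartPoint p 0 - ‖spatial (chartPoint p)‖ = p.1 := by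
    rw [hn, chartPoint, nullPoint_zero, add_sub_cancel_right]
  filter_upwards [hc.continuousAt.eventually (lt_mem_nhds (a := max R 0) (by beta_reduce; rw [hn]; exact hp)),
    hc0.continuousAt.eventually (lt_mem_nhds (a := a - 1) (by beta_reduce; rw [hu]; linarith [hp'.1.1])),
    hc0.continuousAt.eventually (gt_mem_nhds (a := b + 1) (by beta_reduce; rw [hu]; linarith [hp'.1.2]))]
    with x h1 h2 h3
  have hx : spatial x ≠ 0 := norm_pos_iff.1 ((le_max_right _ _).trans_lt h1)
  have h4 := hR ‖spatial x‖ ((le_max_left _ _).trans_lt h1) (x 0 - ‖spatial x‖) ⟨h2.le, h3.le⟩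
    (dir (spatial x)) (norm_dir hx)
  rw [chartPoint] at h4
  simpa only [dir_of_norm_eq_one (norm_dir hx), nullPoint_spatial] using h4

theorem contDiffAt_gaugeTransform {U : Set (Spacetime n)} (hU : IsOpen U) {h : TensorField n}
    {ξ : CovectorField n} (hh : ContDiffOn ℝ ∞ h U) (hξ : ContDiffOn ℝ ∞ ξ U)
    (μ ν : Fin (n + 1)) : ContDiffOn ℝ ∞ (fun x => gaugeTransform h ξ x μ ν) U := fun x hx => by
  have h1 : ∀ μ, ContDiffAt ℝ ∞ (fun x => ξ x μ) x := fun μ =>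
    contDiffAt_pi.1 (hξ.contDiffAt (hU.mem_nhds hx)) μ
  have h2 : ContDiffAt ℝ ∞ (fun x => h x μ ν) x :=
    contDiffAt_pi.1 (contDiffAt_pi.1 (hh.contDiffAt (hU.mem_nhds hx)) μ) ν
  exact (h2.sub (contDiffAt_const.mul (((h1 ν).pd μ).add ((h1 μ).pd ν)))).contDiffWithinAt

theorem traceRevCoef_eq_zero {H : Fin (n + 1) → Fin (n + 1) → ℕ → ℝ × Space n → ℝ} {j : ℕ}
    {q : ℝ × Space n} (h : ∀ μ ν, H μ ν j q = 0) (μ ν : Fin (n + 1)) :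
    traceRevCoef H μ ν j q = 0 := by
  simp [traceRevCoef, h]

theorem divCoef_eq_zero {W : Fin (n + 1) → ℕ → ℝ × Space n → ℝ} {j : ℕ}
    (h : ∀ μ q, q.2 ≠ 0 → W μ j q = 0) (h' : ∀ i, j = i + 2 → ∀ μ q, q.2 ≠ 0 → W μ i q = 0)
    {q : ℝ × Space n} (hq : q.2 ≠ 0) : divCoef W j q = 0 :=
  Finset.sum_eq_zero fun μ _ => by
    rw [pdCoef_of_vanish μ (h μ) (fun i hi => h' i hi μ) hq, mul_zero]

theorem dU_ell (μ : Fin (n + 1)) {q : ℝ × Space n} (hq : q.2 ≠ 0) : dU (ell μ) q = 0 := by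
  refine Fin.cases (dU_const 1) (fun i => ?_) μ
  rw [show (ell i.succ : ℝ × Space n → ℝ) = fun q => -1 * hatY i q by funext q; simp,
    dU_const_mul _ (IsCoef.hatY i) hq, dU_hatY i hq, mul_zero]

theorem isCoef_lc {G : Fin (n + 1) → ℝ × Space n → ℝ} (hG : ∀ μ, IsCoef (G μ)) :
    IsCoef fun q => lc q fun μ => G μ q :=
  IsCoef.sum _ fun μ _ => ((isCoef_ell μ).const_mul (sgn μ)).mul (hG μ)

theorem dU_lc {G : Fin (n + 1) → ℝ × Space n → ℝ} (hG : ∀ μ, IsCoef (G μ)) {q : ℝ × Space n}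
    (hq : q.2 ≠ 0) : dU (fun q => lc q fun μ => G μ q) q = lc q fun μ => dU (G μ) q := by
  have h1 : ∀ μ : Fin (n + 1), IsCoef fun q : ℝ × Space n => sgn μ * ell μ q := fun μ => (isCoef_ell μ).const_mul (sgn μ)
  have h2 := dU_sum (q := q) Finset.univ (c := fun μ q => sgn μ * ell μ q * G μ q)
    (fun μ _ => (h1 μ).mul (hG μ)) hq
  refine h2.trans (Finset.sum_congr rfl fun μ _ => ?_)
  rw [dU_mul (h1 μ) (hG μ) hq, dU_const_mul _ (isCoef_ell μ) hq, dU_ell μ hq]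
  ring

/-! ### The Lorenz gauge -/

section Einstein

variable {U : Set (Spacetime n)} {h T : TensorField n}
  {Tc : ℕ → ℝ → Space n → Fin (n + 1) → Fin (n + 1) → ℝ}
  {H : Fin (n + 1) → Fin (n + 1) → ℕ → ℝ × Space n → ℝ}

theorem eventually_contDiffAt_toNull_component (hU : IsNhdNullInfinity U)
    (hh : ContDiffOn ℝ ∞ h U) (μ ν : Fin (n + 1)) (a b : ℝ) :
    ∀ᶠ p in scriOn n a b, ContDiffAt ℝ ∞ (toNull fun x => h x μ ν) p :=
  hU.eventually_contDiffAt_toNull (contDiffOn_pi.1 (contDiffOn_pi.1 hh μ) ν) a b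

/-- The expansion of the stress-energy tensor in half-integer steps. -/
def stressCoef (Tc : ℕ → ℝ → Space n → Fin (n + 1) → Fin (n + 1) → ℝ) (μ ν : Fin (n + 1)) :
    ℕ → ℝ × Space n → ℝ :=
  stepCoef (n + 1) fun j u θ => Tc j u θ μ ν

theorem stressCoef_eq_zero {j : ℕ} (hj : ∀ i, j ≠ n + 1 + 2 * i) (μ ν : Fin (n + 1))
    (q : ℝ × Space n) : stressCoef Tc μ ν j q = 0 := stepCoef_eq_zero _ hj q

theorem stressCoef_leading (μ ν : Fin (n + 1)) (u : ℝ) {θ : Space n} (hθ : ‖θ‖ = 1) :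
    stressCoef Tc μ ν (n + 1) (u, θ) = Tc 0 u θ μ ν := by
  have := stepCoef_add (n + 1) (fun j u θ => Tc j u θ μ ν) 0 (u, θ)
  rwa [mul_zero, add_zero, dir_of_norm_eq_one hθ] at this

theorem hasAsymp_stress (hU : IsNhdNullInfinity U)
    (hH : ∀ μ ν, HasAsymp (toNull fun x => h x μ ν) (H μ ν))
    (hT : StressEnergyAnsatz U T Tc)
    (hE : ∀ x ∈ U, ∀ μ ν, linEinstein h x μ ν = 8 * Real.pi * T x μ ν) (μ ν : Fin (n + 1)) :
    HasAsymp (toNull fun x => T x μ ν) (stressCoef Tc μ ν) := by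
  have h1 := ((HasAsymp.toNull_linEinstein hH μ ν).const_mul (8 * Real.pi)⁻¹).congr
    (G := toNull fun x => T x μ ν) (hU.eqScri_toNull
      (f := fun x => (8 * Real.pi)⁻¹ * linEinstein h x μ ν) fun x hx => by
        rw [hE x hx, inv_mul_cancel_left₀ (by positivity)])
  have h2 := hT.expansion μ ν
  rw [← pw_add_one] at h2
  exact h2.hasAsymp h1.smooth

theorem einsteinCoef_eq (hU : IsNhdNullInfinity U)
    (hH : ∀ μ ν, HasAsymp (toNull fun x => h x μ ν) (H μ ν))
    (hT : StressEnergyAnsatz U T Tc)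
    (hE : ∀ x ∈ U, ∀ μ ν, linEinstein h x μ ν = 8 * Real.pi * T x μ ν) (μ ν : Fin (n + 1)) (j : ℕ)
    {q : ℝ × Space n} (hq : q.2 ≠ 0) :
    einsteinCoef (traceRevCoef H) μ ν j q = -(16 * Real.pi) * stressCoef Tc μ ν j q := by
  have h1 := (HasAsymp.toNull_linEinstein hH μ ν).congr
    (G := toNull fun x => 8 * Real.pi * T x μ ν) (hU.eqScri_toNull fun x hx => hE x hx μ ν)
  have h2 := h1.coef_unique ((hasAsymp_stress hU hH hT hE μ ν).const_mul (8 * Real.pi)) j q hq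
  linear_combination (-2) * h2

/-- Stress-energy conservation and the absence of early flux imply that the leading coefficient of
the stress-energy tensor is annihilated by the null normal. -/
theorem lc_stressCoef_eq_zero (hn : 3 ≤ n) (hU : IsNhdNullInfinity U) (hh : ContDiffOn ℝ ∞ h U)
    (hH : ∀ μ ν, HasAsymp (toNull fun x => h x μ ν) (H μ ν))
    (hT : StressEnergyAnsatz U T Tc)
    (hE : ∀ x ∈ U, ∀ μ ν, linEinstein h x μ ν = 8 * Real.pi * T x μ ν) (μ : Fin (n + 1))
    {q : ℝ × Space n} (hq : q.2 ≠ 0) : lc q (fun ν => stressCoef Tc μ ν (n + 1) q) = 0 := by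
  have hS := hasAsymp_stress hU hH hT hE
  -- Conservation of T follows from the linearized Bianchi identity through the field equation.
  have hdiv : ∀ x ∈ U, div (fun y ν => T y μ ν) x = 0 := fun x hx => by
    have h1 : (fun y ν => linEinstein h y μ ν) =ᶠ[𝓝 x] fun y ν => 8 * Real.pi * T y μ ν := by
      filter_upwards [hU.1.mem_nhds hx] with y hy
      exact funext fun ν => hE y hy μ ν
    have h2 := div_linEinstein hU.1 hh hx μ
    rw [(div_congr h1).self_of_nhds] at h2
    have h3 : ∀ α ν, pd α (fun y => 8 * Real.pi * T y μ ν) x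
        = 8 * Real.pi * pd α (fun y => T y μ ν) x := fun α ν => by
      have : (fun y => 8 * Real.pi * T y μ ν) = (8 * Real.pi) • fun y => T y μ ν := rfl
      rw [pd, this, fderiv_const_smul_field]
      rfl
    have h4 : div (fun y ν => 8 * Real.pi * T y μ ν) x
        = 8 * Real.pi * div (fun y ν => T y μ ν) x := by
      simp only [div, h3, Finset.mul_sum]
      exact Finset.sum_congr rfl fun α _ => Finset.sum_congr rfl fun ν _ => by ring
    rw [h4] at h2
    exact (mul_eq_zero.1 h2).resolve_left (by positivity)
  -- The index is n + 1, written so as to expose the shift by two in the divergence.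
  have hcons : ∀ q, q.2 ≠ 0 → divCoef (stressCoef Tc μ) (n - 1 + 2) q = 0 :=
    fun q hq => ((HasAsymp.toNull_div (w := fun y ν => T y μ ν) (hS μ)).congr
      (hU.eqScri_toNull (g := fun _ => 0) hdiv)).coef_eq_zero _ q hq
  -- At leading order only ∂_u terms occur, because T has no coefficient two indices earlier.
  have hst : ∀ q, q.2 ≠ 0 → dU (fun q => lc q fun ν => stressCoef Tc μ ν (n + 1) q) q = 0 :=
    fun q hq => by
    have h1 := hcons q hq
    rw [divCoef_add_two, Finset.sum_eq_zero fun i _ => dC_of_vanish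
      (fun q _ => stressCoef_eq_zero (by omega) μ i.succ q) _ _ hq, add_zero,
      show n - 1 + 2 = n + 1 by omega] at h1
    rw [dU_lc (fun ν => (hS μ ν).coef _) hq, h1]
  have hcoef := isCoef_lc fun ν => (hS μ ν).coef (n + 1)
  have hd : ‖dir q.2‖ = 1 := norm_dir hq
  have hd0 : dir q.2 ≠ 0 := ne_zero_of_norm_eq_one hd
  rw [← hcoef.apply_dir hq]
  -- Being constant in u and tending to 0 as u → −∞, the contraction vanishes; the null covector
  -- itself does not depend on u.
  have hlim : Tendsto (fun u : ℝ => lc (u, dir q.2) fun ν => stressCoef Tc μ ν (n + 1) (u, dir q.2))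
      atBot (𝓝 0) := by
    have h1 : ∀ u : ℝ, (lc (u, dir q.2) fun ν => stressCoef Tc μ ν (n + 1) (u, dir q.2))
        = ∑ ν, sgn ν * ell ν (0, dir q.2) * Tc 0 u (dir q.2) μ ν := fun u => by
      rw [lc]
      refine Finset.sum_congr rfl fun ν _ => ?_
      rw [stressCoef_leading _ _ _ hd]
      rfl
    simp only [h1]
    rw [show (0:ℝ) = ∑ ν : Fin (n + 1), sgn ν * ell ν ((0:ℝ), dir q.2) * 0 by simp]
    exact tendsto_finsetSum _ fun ν _ => (hT.noEarlyFlux _ hd μ ν).const_mul _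
  have hconst : ∀ u : ℝ, (lc (u, dir q.2) fun ν => stressCoef Tc μ ν (n + 1) (u, dir q.2))
      = lc (q.1, dir q.2) fun ν => stressCoef Tc μ ν (n + 1) (q.1, dir q.2) := fun u =>
    hcoef.eq_of_dU_eq_zero hst hd0 u q.1
  simp only [hconst] at hlim
  exact tendsto_nhds_unique tendsto_const_nhds hlim

/-- If the coefficient of `r^(-2)` in the source vanishes, the Lorenz gauge can be imposed. -/
theorem canImposeLorenzGauge_of_stressCoef (hn : 3 ≤ n) (hU : IsNhdNullInfinity U)
    (hh : ContDiffOn ℝ ∞ h U) (hansatz : MetricAnsatz h) (hT : StressEnergyAnsatz U T Tc)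
    (hE : ∀ x ∈ U, ∀ μ ν, linEinstein h x μ ν = 8 * Real.pi * T x μ ν)
    (hT4 : ∀ μ ν q, q.2 ≠ 0 → stressCoef Tc μ ν 4 q = 0) : CanImposeLorenzGauge U h := by
  obtain ⟨H, hH, hH0⟩ := hansatz.asympAnsatz hn (eventually_contDiffAt_toNull_component hU hh)
  set K := traceRevCoef H with hKdef
  have hK0 : ∀ j, ¬ Adm n j → ∀ μ ν q, q.2 ≠ 0 → K μ ν j q = 0 := fun j hj μ ν q hq =>
    traceRevCoef_eq_zero (fun μ ν => hH0 μ ν j hj q hq) μ ν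
  have hK : ∀ μ ν j, IsCoef (K μ ν j) := fun μ ν =>
    (HasAsymp.toNull_traceRev hH μ ν).coef
  have hC := HasAsymp.toNull_chi hH
  have hEc : ∀ μ ν j q, q.2 ≠ 0 → einsteinCoef K μ ν j q = -(16 * Real.pi) * stressCoef Tc μ ν j q :=
    fun μ ν j q hq => einsteinCoef_eq hU hH hT hE μ ν j hq
  have hl : ∀ μ q, q.2 ≠ 0 → lc q (fun ν => einsteinCoef K μ ν (n + 1) q) = 0 := fun μ q hq => by
    simp only [hEc _ _ _ q hq, lc_mul_left, lc_stressCoef_eq_zero hn hU hh hH hT hE μ hq, mul_zero]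
  have h4 : ∀ μ ν q, q.2 ≠ 0 → einsteinCoef K μ ν 4 q = 0 := fun μ ν q hq => by
    rw [hEc μ ν 4 q hq, hT4 μ ν q hq, mul_zero]
  -- Leading order of the main series, m = 0: T has no term at index 4.
  have hC2 : ∀ μ q, q.2 ≠ 0 → divCoef (K μ) 2 q = 0 := fun μ q hq =>
    divCoef_eq_zero_of_leading hK (m := 0) (by omega) (hK0 0 (by simp [Adm]))
      (fun μ q hq => by simp only [h4 μ _ q hq, lc_zero]) μ hq
  -- Leading order of the second series in odd spacetime dimension, m = n − 3. Here the source is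
  -- the leading stress coefficient, but its null contraction vanishes.
  have hCn : Even n → ∀ μ q, q.2 ≠ 0 → divCoef (K μ) (n - 1) q = 0 := fun he μ q hq => by
    obtain ⟨m, rfl⟩ : ∃ m, n = m + 3 := ⟨n - 3, by omega⟩
    refine divCoef_eq_zero_of_leading hK (m := m) le_rfl (hK0 m ?_) hl μ hq
    rintro (⟨h1, -⟩ | ⟨-, -, h1⟩)
    · grind
    · omega
  -- An admissible index of the divergence with inadmissible predecessor is the start of one of the
  -- two series, and these two coefficients have just been shown to vanish.
  have hCadm : ∀ j, ¬ Adm n j → ∀ μ q, q.2 ≠ 0 → divCoef (K μ) (j + 2) q = 0 :=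
    fun j hj μ q hq => by
    by_cases hj2 : Adm n (j + 2)
    · rcases hj2 with ⟨h1, h2⟩ | ⟨h1, h2, h3⟩
      · obtain rfl : j = 0 := by
          by_contra h0
          exact hj (Or.inl ⟨by grind, by grind⟩)
        exact hC2 μ q hq
      · obtain rfl : j = n - 3 := by
          have : ¬ n ≤ j + 1 := fun h => hj (Or.inr ⟨h1, by grind, h⟩)
          obtain ⟨a, ha⟩ := h1
          obtain ⟨b, hb⟩ := h2
          omega
        rw [show n - 3 + 2 = n - 1 by omega]
        exact hCn h1 μ q hq
    · refine divCoef_eq_zero (hK0 _ hj2 μ) (fun i hi => ?_) hq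
      obtain rfl : j = i := by omega
      exact hK0 j hj μ
  have hadm0 : ¬ Adm n 0 := by simp [Adm]
  have hadm1 : ¬ Adm n 1 := by
    rintro (⟨-, h1⟩ | ⟨-, -, h1⟩) <;> omega
  have hClow : ∀ j < 4, ∀ μ q, q.2 ≠ 0 → divCoef (K μ) j q = 0 := fun j hj μ q hq => by
    match j with
    | 0 => exact divCoef_eq_zero (hK0 0 hadm0 μ) (fun i hi => by omega) hq
    | 1 => exact divCoef_eq_zero (hK0 1 hadm1 μ) (fun i hi => by omega) hq
    | 2 => exact hC2 μ q hq
    | 3 => exact hCadm 1 hadm1 μ q hq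
  -- Stationarity of the coefficient that the transport equation cannot absorb; this is where the
  -- absence of a stress term at index 4 is essential.
  have hC4 : ∀ μ q, q.2 ≠ 0 → dU (divCoef (K μ) 4) q = 0 := fun μ q hq =>
    dU_divCoef_four_eq_zero hn (hK0 0 hadm0) hC2 hq (fun μ ν => h4 μ ν q hq) μ
  -- The factor 2 compensates for the ½ in the gauge transformation. Each inertial component is a
  -- separate scalar equation.
  have hsolve := fun μ => exists_box_eq hn (F := fun x => 2 * chi h x μ) ((hC μ).const_mul 2)
    (fun j hj q hq => by rw [hClow j hj μ q hq, mul_zero])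
    (fun j hj q hq => by rw [hCadm j hj μ q hq, mul_zero])
    (fun q hq => by rw [dU_const_mul _ ((hC μ).coef 4) hq, hC4 μ q hq, mul_zero])
  choose ξ hξs hξbox Y hY hY0 using hsolve
  have hopen : IsOpen {x : Spacetime n | spatial x ≠ 0} :=
    isOpen_ne_fun (contDiff_spatial (m := ∞)).continuous continuous_const
  set ζ : CovectorField n := fun x μ => ξ μ x with hζ
  have hζs : ContDiffOn ℝ ∞ ζ {x | spatial x ≠ 0} :=
    contDiffOn_pi.2 fun μ x hx => (hξs μ x hx).contDiffWithinAt
  have hg : AsympAnsatz (gaugeTransform h ζ) := by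
    refine ⟨fun μ ν j q => H μ ν j q - 1 / 2 * (Y ν μ j q + Y μ ν j q), fun μ ν =>
      ((hH μ ν).sub (((hY ν μ).add (hY μ ν)).const_mul (1 / 2))).congr
        (eqScri_of_forall fun p _ _ => rfl), fun μ ν j hj q hq => ?_⟩
    beta_reduce
    rw [hH0 μ ν j hj q hq, hY0 ν μ j hj q hq, hY0 μ ν j hj q hq]
    ring
  -- The wave equation is known pointwise near null infinity; the interior of this set is an open
  -- neighborhood on which it holds.
  set W : Set (Spacetime n) :=
    {x | x ∈ U ∧ spatial x ≠ 0 ∧ ∀ μ, box (ξ μ) x = 2 * chi h x μ} with hW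
  refine ⟨interior W, interior_subset.trans fun x hx => hx.1, ?_, ζ,
    hζs.mono (interior_subset.trans fun x hx => hx.2.1), hg.metricAnsatz hn, fun x hx μ => ?_⟩
  · refine isNhdNullInfinity_of_eventually isOpen_interior fun a b => ?_
    have h1 := eventually_nhds_chartPoint (P := fun x => x ∈ W) (fun a b => by
      filter_upwards [hU.eventually_chartPoint_mem a b, eventually_scriOn_pos_ne a b,
        eventually_all.2 fun μ => hξbox μ a b] with p h1 h2 h3
      exact ⟨h1, spatial_chartPoint_ne h2.1 h2.2, h3⟩) a b
    filter_upwards [h1] with p hp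
    exact mem_interior_iff_mem_nhds.2 hp
  · have hx' := interior_subset hx
    rw [chi_gaugeTransform (hU.1.inter hopen) (hh.mono inter_subset_left)
      (hζs.mono inter_subset_right) ⟨hx'.1, hx'.2.1⟩, hζ, hx'.2.2 μ]
    ring

/-- In Lorenz gauge the coefficient of `r^(-2)` in the source vanishes. -/
theorem stressCoef_four_eq_zero (hn : 3 ≤ n) (hU : IsNhdNullInfinity U)
    (hh : ContDiffOn ℝ ∞ h U) (hansatz : MetricAnsatz h) (hT : StressEnergyAnsatz U T Tc)
    (hE : ∀ x ∈ U, ∀ μ ν, linEinstein h x μ ν = 8 * Real.pi * T x μ ν)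
    (hgauge : CanImposeLorenzGauge U h) (μ ν : Fin (n + 1)) {q : ℝ × Space n} (hq : q.2 ≠ 0) :
    stressCoef Tc μ ν 4 q = 0 := by
  obtain ⟨V, hVU, hV, ξ, hξ, hg, hχ⟩ := hgauge
  obtain ⟨H, hH, -⟩ := hansatz.asympAnsatz hn (eventually_contDiffAt_toNull_component hU hh)
  have hhV := hh.mono hVU
  obtain ⟨H', hH', hH0'⟩ := hg.asympAnsatz hn fun μ ν =>
    hV.eventually_contDiffAt_toNull (contDiffAt_gaugeTransform hV.1 hhV hξ μ ν)
  have hS := hasAsymp_stress hU hH hT hE μ ν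
  have h1 := (HasAsymp.toNull_traceRev hH' μ ν).toNull_box
  have h2 : ∀ x ∈ V, box (fun y => traceRev (gaugeTransform h ξ) y μ ν) x
      = -(16 * Real.pi) * T x μ ν := fun x hx => by
    have e1 := linEinstein_of_chi_eq_zero hV.1 hχ hx μ ν
    rw [linEinstein_gaugeTransform hV.1 hhV hξ hx, hE x (hVU hx)] at e1
    linear_combination 2 * e1
  have h3 := (h1.congr (hV.eqScri_toNull h2)).coef_unique (hS.const_mul (-(16 * Real.pi))) 4 q hq
  -- The transport factor is zero at this index, and the angular term involves index 0, absent from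
  -- the ansatz.
  have h4 : boxCoef (traceRevCoef H' μ ν) 4 q = 0 := by
    have := lapC_of_vanish (c := traceRevCoef H' μ ν 0) (fun q hq =>
      traceRevCoef_eq_zero (fun μ ν => hH0' μ ν 0 (by simp [Adm]) q hq) μ ν) (pw n 0) hq
    simp [boxCoef, this]
  rw [h4] at h3
  exact (mul_eq_zero.1 h3.symm).resolve_left (by simp [Real.pi_ne_zero])

/-- Without energy flux the leading coefficient of the stress-energy tensor vanishes. -/
theorem stressCoef_leading_eq_zero (hn : 3 ≤ n) (hU : IsNhdNullInfinity U)
    (hh : ContDiffOn ℝ ∞ h U) (hsymm : ∀ x ∈ U, ∀ μ ν, h x μ ν = h x ν μ)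
    (hansatz : MetricAnsatz h) (hT : StressEnergyAnsatz U T Tc)
    (hE : ∀ x ∈ U, ∀ μ ν, linEinstein h x μ ν = 8 * Real.pi * T x μ ν)
    (hflux : ∀ (u : ℝ) (θ : Space n), ‖θ‖ = 1 → uuComp (Tc 0 u θ) = 0) (μ ν : Fin (n + 1))
    {q : ℝ × Space n} (hq : q.2 ≠ 0) : stressCoef Tc μ ν (n + 1) q = 0 := by
  obtain ⟨H, hH, -⟩ := hansatz.asympAnsatz hn (eventually_contDiffAt_toNull_component hU hh)
  have hS := hasAsymp_stress hU hH hT hE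
  have hd : ‖dir q.2‖ = 1 := norm_dir hq
  have hTs : ∀ x ∈ U, ∀ μ ν, T x μ ν = T x ν μ := fun x hx μ ν => by
    have h1 := linEinstein_symm hU.1 hsymm hx μ ν
    rw [hE x hx, hE x hx] at h1
    exact mul_left_cancel₀ (by positivity) h1
  rw [← ((hS μ ν).coef _).apply_dir hq]
  -- Since ∂/∂u is ∂/∂t, the flux component is the energy density of the rest observer in the
  -- limiting tensor.
  refine eq_zero_of_dominantEnergy (t := fun μ ν => stressCoef Tc μ ν (n + 1) (q.1, dir q.2))
    (fun μ ν => ?_) ?_ (fun v hv => ?_) μ ν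
  · exact ((hS μ ν).congr (hU.eqScri_toNull fun x hx => hTs x hx μ ν)).coef_unique (hS ν μ) _ _
      (ne_zero_of_norm_eq_one hd)
  · rw [stressCoef_leading _ _ _ hd]
    exact hflux q.1 _ hd
  · exact isFutureCausal_energyCurrent_limit hU hT.dominantEnergy hS
      (fun μ ν j hj q _ => stressCoef_eq_zero (by omega) μ ν q) q.1 hd hv

end Einstein

end

/-! ### The theorem -/

theorem mainTheorem3 (n : ℕ) (hn : 4 ≤ n + 1)
    (U : Set (Spacetime n)) (hU : IsNhdNullInfinity U)
    (h T : TensorField n)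
    (Tc : ℕ → ℝ → Space n → Fin (n + 1) → Fin (n + 1) → ℝ)
    (h_smooth : ContDiffOn ℝ ∞ h U)
    (h_symm : ∀ x ∈ U, ∀ μ ν, h x μ ν = h x ν μ)
    (h_ansatz : MetricAnsatz h)
    (T_ansatz : StressEnergyAnsatz U T Tc)
    (einstein : ∀ x ∈ U, ∀ μ ν, linEinstein h x μ ν = 8 * Real.pi * T x μ ν) :
    (4 < n + 1 → CanImposeLorenzGauge U h) ∧
    (n + 1 = 4 → (CanImposeLorenzGauge U h ↔
      ∀ (u : ℝ) (θ : Space n), ‖θ‖ = 1 → uuComp (Tc 0 u θ) = 0)) := by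
  have hn3 : 3 ≤ n := by omega
  -- The stress expansion starts at index n + 1, which exceeds the critical index 4 exactly when d >
  -- 4.
  refine ⟨fun hd => canImposeLorenzGauge_of_stressCoef hn3 hU h_smooth h_ansatz T_ansatz einstein
    fun μ ν q _ => stressCoef_eq_zero (fun i => by omega) μ ν q, fun hd => ?_⟩
  obtain rfl : n = 3 := by omega
  refine ⟨fun hg u θ hθ => ?_, fun hf => ?_⟩
  -- For n = 3 the leading stress index n + 1 is the critical index 4, so vanishing there is
  -- vanishing of T^(2).
  · rw [uuComp, ← stressCoef_leading (Tc := Tc) 0 0 u hθ]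
    exact stressCoef_four_eq_zero hn3 hU h_smooth h_ansatz T_ansatz einstein hg 0 0
      (ne_zero_of_norm_eq_one hθ)
  · exact canImposeLorenzGauge_of_stressCoef hn3 hU h_smooth h_ansatz T_ansatz einstein
      fun μ ν q hq => stressCoef_leading_eq_zero hn3 hU h_smooth h_symm h_ansatz T_ansatz einstein hf
        μ ν hq
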